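/- **Setting.** Let $\mathbb T=\mathbb R/2\pi\mathbb Z$ with normalized measure $dx/2\pi$, let $\widehat u(n)$ be the Fourier coefficients of $u$, $P_{\le N}u=\sum_{|n|\le N}\widehat u(n)e^{inx}$, $\langle n\rangle=(1+n^2)^{1/2}$, and $H^{1/2-}(\mathbb T)=\bigcap_{s<1/2}H^s(\mathbb T)$ with the $\sigma$-algebra generated by the sets depending on finitely many Fourier coefficients. Let $\mu$ be the law on $H^{1/2-}(\mathbb T)$ of $\sum_{n\in\mathbb Z}\frac{g_n}{\langle n\rangle}e^{inx}$, where the $g_n$ are i.i.d. complex Gaussians with independent $N(0,\tfrac12)$ real and imaginary parts. For $m,\varepsilon>0$ let $\mu_m^\varepsilon$ be $\mu$ conditioned on $\|u\|_{L^2}^2\in(m-\varepsilon,m+\varepsilon)$, and let $\mu_m$ be the measure with $\mu_m(E)=\lim_{\varepsilon\to0+}\mu_m^\varepsilon(E)$ for every measurable $E$ that depends only on finitely many Fourier coefficients. For an integer $N\ge 0$ put $$f_N(u)=-\frac{3i}{4}\int_{\mathbb T}\overline{P_{\le N}u}^{\,2}\,\partial_x\big((P_{\le N}u)^2\big)\,dx\in\mathbb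 R .$$ For real $q\ge1$ call $M>0$ an admissible value of $m_q$ if $$\sup_{N\ge0}\int \mathbf 1_{\{\|P_{\le N}u\|_{L^2}^2<M\}}\,e^{q f_N(u)}\,d\mu<\infty .$$ **Theorem.** 1. For every real $q\ge 1$ there is an admissible value $m_q>0$; for every $m>0$ the measure $\mu_m$ exists; and there is a function $f$ on $H^{1/2-}(\mathbb T)$ such that $f_N\to f$ in $L^2(\mu)$ and in $L^2(\mu_m)$ for every $m>0$. 2. Let $p\ge1$ be real, and let $0<m<\tfrac12 m_{480p}$ for some admissible value of $m_{480p}$. Then there is a finite constant $C=C(m,p)$ such that * $\displaystyle\int e^{p f_N(u)}\,d\mu_m\le C$ for all $N\ge0$; * there is $\delta>0$ such that $\displaystyle\int e^{p f_N(u)}\,d\mu_m^\varepsilon\le C$ for all $\varepsilon\in(0,\delta)$ and all $N\ge0$; * $e^{pf(u)}\in L^1(\mu_m)$ and $\displaystyle\int e^{p f(u)}\,d\mu_m\le C$, where $f$ is the limit of $f_N$ in $L^2(\mu_m)$. -/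

import Mathlib

open MeasureTheory ProbabilityTheory Filter Topology
open scoped ENNReal NNReal ComplexConjugate

namespace DNLS

noncomputable section

instance factTwoPiPos : Fact ((0 : ℝ) < 2 * Real.pi) := ⟨Real.two_pi_pos⟩

/-- The torus `ℝ / 2πℤ`. -/
abbrev Torus : Type := AddCircle (2 * Real.pi)

/-- `L²(𝕋)` for the normalized measure `dx / 2π`. -/
abbrev L2T : Type := Lp ℂ 2 (AddCircle.haarAddCircle : Measure Torus)

/-- The Japanese bracket `⟨n⟩ = (1 + n²)^{1/2}`. -/
def bracket (n : ℤ) : ℝ := Real.sqrt (1 + (n : ℝ) ^ 2)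

/-- Membership of `u ∈ L²(𝕋)` in `⋂_{s < 1/2} H^s(𝕋)`. -/
def MemHHalfMinus (u : L2T) : Prop :=
  ∀ s : ℝ, s < 1 / 2 →
    Summable fun n : ℤ => bracket n ^ (2 * s) * ‖fourierCoeff (u : Torus → ℂ) n‖ ^ 2

/-- The space `H^{1/2-}(𝕋) = ⋂_{s < 1/2} H^s(𝕋)`. -/
def HHalfMinus : Type := {u : L2T // MemHHalfMinus u}

/-- The Fourier coefficient `û(n) = (2π)⁻¹ ∫ u(x) e^{-inx} dx`. -/
def coeff (u : HHalfMinus) (n : ℤ) : ℂ := fourierCoeff (u.1 : Torus → ℂ) n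

/-- The σ-algebra on `H^{1/2-}(𝕋)` generated by the sets that depend on finitely many
frequencies. -/
instance : MeasurableSpace HHalfMinus := MeasurableSpace.comap coeff MeasurableSpace.pi

theorem memHHalfMinus_zero : MemHHalfMinus 0 := by
  intro s _
  have h : ∀ n : ℤ, fourierCoeff ((0 : L2T) : Torus → ℂ) n = 0 := by
    intro n
    rw [← fourierBasis_repr]
    simp
  simp only [h]
  simp

instance : Zero HHalfMinus := ⟨⟨0, memHHalfMinus_zero⟩⟩

/-- The law of a complex Gaussian `a + ib`, with `a`, `b` independent and `N(0, 1/2)`. -/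
def complexGaussian : Measure ℂ :=
  ((gaussianReal 0 (1 / 2)).prod (gaussianReal 0 (1 / 2))).map
    fun z : ℝ × ℝ => (z.1 : ℂ) + (z.2 : ℂ) * Complex.I

instance : IsProbabilityMeasure complexGaussian :=
  Measure.isProbabilityMeasure_map (by fun_prop)

/-- The law of a family `(g_n)_{n ∈ ℤ}` of i.i.d. complex Gaussians of variance one. -/
def gaussianSequence : Measure (ℤ → ℂ) := Measure.infinitePi fun _ : ℤ => complexGaussian

/-- The random Fourier series `∑ₙ (g_n / ⟨n⟩) e^{inx}`, as an unconditional sum in `L²(𝕋)`. -/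
def randomSeries (g : ℤ → ℂ) : L2T :=
  ∑' n : ℤ, (g n / (bracket n : ℂ)) • (fourierLp 2 n : L2T)

open Classical in
/-- The random Fourier series as an element of `H^{1/2-}(𝕋)`; it lies there almost surely, and on
the exceptional null set the value is `0`. -/
def randomData (g : ℤ → ℂ) : HHalfMinus :=
  if h : MemHHalfMinus (randomSeries g) then ⟨randomSeries g, h⟩ else 0

/-- The Gaussian measure `μ` on `H^{1/2-}(𝕋)`: the law of the random Fourier series. -/
def wienerMeasure : Measure HHalfMinus := gaussianSequence.map randomData

/-- The mass `‖u‖²_{L²(𝕋)}`. -/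
def mass (u : HHalfMinus) : ℝ := ‖u.1‖ ^ 2

/-- The set of functions with mass in `(m - ε, m + ε)`. -/
def massShell (m ε : ℝ) : Set HHalfMinus := {u | mass u ∈ Set.Ioo (m - ε) (m + ε)}

/-- `μ_m^ε`: the measure `μ` conditioned on mass in `(m - ε, m + ε)`. -/
def shellMeasure (m ε : ℝ) : Measure HHalfMinus := cond wienerMeasure (massShell m ε)

/-- The defining property of `μ_m`: on every measurable set that depends only on the frequencies
`|n| ≤ N`, its value is the limit of `μ_m^ε` as `ε → 0+`. These sets form a π-system that generates
the σ-algebra and contains the whole space, so at most one measure has this property. -/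
def IsFixedMassMeasure (m : ℝ) (ν : Measure HHalfMinus) : Prop :=
  ∀ (N : ℕ) (B : Set (Finset.Icc (-(N : ℤ)) (N : ℤ) → ℂ)), MeasurableSet B →
    Tendsto (fun ε : ℝ => shellMeasure m ε {u | (fun n => coeff u n.1) ∈ B}) (𝓝[>] 0)
      (𝓝 (ν {u | (fun n => coeff u n.1) ∈ B}))

open Classical in
/-- `μ_m`: the measure `μ` conditioned on mass exactly `m`, i.e. the measure singled out by
`IsFixedMassMeasure m`. -/
def fixedMassMeasure (m : ℝ) : Measure HHalfMinus :=
  if h : ∃ ν, IsFixedMassMeasure m ν then h.choose else 0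

/-- The truncation `P_{≤N} u (x) = ∑_{|n| ≤ N} û(n) e^{inx}`, as a `2π`-periodic function. -/
def trunc (N : ℕ) (u : HHalfMinus) (x : ℝ) : ℂ :=
  ∑ n ∈ Finset.Icc (-(N : ℤ)) (N : ℤ), coeff u n * Complex.exp (Complex.I * n * x)

/-- The mass `‖P_{≤N} u‖²_{L²(𝕋)}` of the truncation. -/
def truncMass (N : ℕ) (u : HHalfMinus) : ℝ :=
  (2 * Real.pi)⁻¹ * ∫ x in (0 : ℝ)..2 * Real.pi, ‖trunc N u x‖ ^ 2

/-- `f_N(u) = -(3i/4) ∫_𝕋 (conj P_{≤N}u)² ∂ₓ((P_{≤N}u)²) dx`, with the normalized measure on `𝕋`.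
The expression is real, since `∫_𝕋 conj w · ∂ₓw dx` is purely imaginary for periodic `w`. -/
def fN (N : ℕ) (u : HHalfMinus) : ℝ :=
  (-(3 * Complex.I / 4) * ((2 * Real.pi : ℝ) : ℂ)⁻¹ *
    ∫ x in (0 : ℝ)..2 * Real.pi,
      conj (trunc N u x) ^ 2 * deriv (fun y : ℝ => trunc N u y ^ 2) x).re

/-- `M` is an admissible value of the constant `m_q`: it is positive, and the functions
`1_{‖P_{≤N}u‖² < M} e^{f_N(u)}` are bounded in `L^q(μ)` uniformly in `N`. -/
def IsMassThreshold (q M : ℝ) : Prop :=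
  0 < M ∧ ∃ C : ℝ, ∀ N : ℕ,
    IntegrableOn (fun u => Real.exp (q * fN N u)) {u | truncMass N u < M} wienerMeasure ∧
    ∫ u in {u | truncMass N u < M}, Real.exp (q * fN N u) ∂wienerMeasure ≤ C

/-- `f` is the limit of the functions `f_N` in `L²(ν)`. -/
def IsL2Limit (ν : Measure HHalfMinus) (f : HHalfMinus → ℝ) : Prop :=
  AEStronglyMeasurable f ν ∧
    Tendsto (fun N : ℕ => eLpNorm (fun u => fN N u - f u) 2 ν) atTop (𝓝 0)

end

end DNLS

namespace DNLS

noncomputable section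

/-! Everything is transported to sequences of Fourier coefficients. Under `seqLaw` these are
independent complex Gaussians of variance `1/⟨n⟩²`, and `fN N` becomes `quartic (box N)`, the form
-(3i/2) ∫ u ū² u_x.

Admissible thresholds. Frequencies are added one dyadic block at a time, the lower modes being held
fixed. Averaging over phases and translations of the block shows that the mean increment is 3 ·
(momentum of the lower modes) · (expected block mass) (`setIntegral_quartic_splice`). The
fluctuation is handled by the Maurey–Pisier rotation trick (`lintegral_convex_sub_le`): the
difference of the values at two independent copies is the integral of a derivative along a quarter
rotation; a rotated pair has the law of the original pair; and the derivative is linear in the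
second copy, so it is Gaussian with variance of order 4^{-j} ∫ |u|⁴ |u_x|² for the block at
frequency 2^j. If the mass below 2^k is small and the blocks above 2^k obey the geometric bounds of
`tailEvent`, the costs of all blocks add up to O(t² 4^k / K²) plus a term bounded in k
(`lintegral_exp_goodSet_le`). Those bounds fail with probability at most a multiple of
exp(-4^k/(48K)) (`seqLaw_compl_tailGood_le`). When K is a large multiple of q² and the mass
threshold is small, the probability beats the cost, and summation over k gives
`exists_lintegral_exp_quartic_le`.

Convergence. The same block analysis with squares in place of exponentials bounds the squared L²(μ)
distance of f_{N₁} and f_{N₂} by O(1/N₁) for N₁ ≤ N₂ ≤ 2N₁ (`lintegral_quartic_box_sub_sq_le`),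
which is summable along dyadic scales after taking roots.

Fixed mass. |c₀|² is exponentially distributed and independent of the argument of c₀ and of the
other modes. Restricting to total mass t therefore means weighting the other modes by e^{-(t-r)} on
r < t, with r their mass, and placing the remaining t - r on the zero mode with a uniform phase;
this is `sliceLaw t`, and `lintegral_mass_slice` is the disintegration. On sets that ignore some
mode k ≠ 0 the slices depend continuously on t, because the radius of the mode k smooths the
constraint (`tendsto_lintegral_sliceLaw`). Averages over thin shells then converge, and μ_m is the
normalized slice.

From μ to μ_m. As a function of the zero mode z the form is A + 3 Im(zT) + 3|z|²Y, with Y the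
momentum (`quartic_update_zero`). A function with so few parameters is controlled on any circle by
its behaviour on a set of positive Gaussian measure. For squares this gives
`lintegral_sq_sliceLaw_le`, hence convergence in L²(μ_m). For exponentials, `exp_zeroMode_le`
compares with the values at z, iz, -z, -iz in an annulus, at the price of the exponent 6p and of an
exponential moment of the momentum. That moment is finite below a mass cutoff, because the
contributions of n and -n cancel to first order (`exists_lintegral_exp_momentum_le`). The annulus
lies in |z|² < M/2 and the other truncated modes have mass below M/2, so the comparison stays below
the threshold M: hence the condition m < M/2. The factor 480 leaves ample room above 6. The bound
for f follows by Fatou. -/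

/-- `⟨n⟩² = 1 + n²`. -/
def bracketSq (n : ℤ) : ℝ := 1 + (n : ℝ) ^ 2

theorem bracketSq_pos (n : ℤ) : 0 < bracketSq n := by unfold bracketSq; positivity

theorem one_le_bracketSq (n : ℤ) : 1 ≤ bracketSq n := by
  unfold bracketSq; nlinarith [sq_nonneg (n : ℝ)]

theorem bracketSq_neg (n : ℤ) : bracketSq (-n) = bracketSq n := by simp [bracketSq]

theorem bracket_sq (n : ℤ) : bracket n ^ 2 = bracketSq n :=
  Real.sq_sqrt (bracketSq_pos n).le

theorem bracket_pos (n : ℤ) : 0 < bracket n := Real.sqrt_pos.2 (bracketSq_pos n)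

/-! ### The Gaussian modes: densities, polar form, exponential moments. -/

/-- The law of the `n`-th Fourier coefficient of the random series. -/
def modeLaw (n : ℤ) : Measure ℂ := complexGaussian.map fun z => z / (bracket n : ℂ)

instance (n : ℤ) : IsProbabilityMeasure (modeLaw n) :=
  Measure.isProbabilityMeasure_map (by fun_prop)

/-- The law of the sequence of Fourier coefficients of the random series. -/
def seqLaw : Measure (ℤ → ℂ) := Measure.infinitePi modeLaw

instance : IsProbabilityMeasure seqLaw := by unfold seqLaw; infer_instance

theorem gaussianSequence_map_scale :
    gaussianSequence.map (fun g n => g n / (bracket n : ℂ)) = seqLaw := by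
  unfold gaussianSequence seqLaw modeLaw
  exact Measure.infinitePi_map_pi (μ := fun _ : ℤ => complexGaussian)
    (f := fun n z => z / (bracket n : ℂ)) (fun n => by fun_prop)

theorem lintegral_modeLaw_eq_gaussianReal (n : ℤ) {G : ℂ → ℝ≥0∞} (hG : Measurable G) :
    ∫⁻ z, G z ∂modeLaw n = ∫⁻ p : ℝ × ℝ, G (((p.1 / bracket n : ℝ) : ℂ) +
      ((p.2 / bracket n : ℝ) : ℂ) * Complex.I)
      ∂((gaussianReal 0 (1 / 2)).prod (gaussianReal 0 (1 / 2))) := by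
  unfold modeLaw complexGaussian
  rw [lintegral_map hG (by fun_prop), lintegral_map (by fun_prop) (by fun_prop)]
  congr 1
  ext p
  congr 1
  push_cast
  ring

theorem lintegral_gaussianReal_half (G : ℝ → ℝ≥0∞) (hG : Measurable G) :
    ∫⁻ x, G x ∂gaussianReal 0 (1 / 2) =
      ∫⁻ x, ENNReal.ofReal ((Real.sqrt Real.pi)⁻¹ * Real.exp (-x ^ 2)) * G x := by
  rw [gaussianReal_of_var_ne_zero _ (by norm_num),
    lintegral_withDensity_eq_lintegral_mul _ (by fun_prop) hG]
  congr 1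
  ext x
  have h : 2 * Real.pi * ((1 / 2 : ℝ≥0) : ℝ) = Real.pi := by push_cast; ring
  have h' : -(x - 0) ^ 2 / (2 * ((1 / 2 : ℝ≥0) : ℝ)) = -x ^ 2 := by push_cast; ring
  simp only [Pi.mul_apply, gaussianPDF, gaussianPDFReal, h, h']

theorem lintegral_complexGaussian {G : ℂ → ℝ≥0∞} (hG : Measurable G) :
    ∫⁻ z, G z ∂complexGaussian =
      ∫⁻ z, ENNReal.ofReal (Real.pi⁻¹ * Real.exp (-‖z‖ ^ 2)) * G z := by
  unfold complexGaussian
  rw [lintegral_map hG (by fun_prop), lintegral_prod _ (by fun_prop),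
    lintegral_gaussianReal_half _ (by fun_prop)]
  rw [← (Complex.volume_preserving_equiv_real_prod.symm).lintegral_comp (by fun_prop),
    Measure.volume_eq_prod, lintegral_prod _ (by fun_prop)]
  congr 1
  ext x
  rw [lintegral_gaussianReal_half _ (by fun_prop), ← lintegral_const_mul _ (by fun_prop)]
  congr 1
  ext y
  have hz : Complex.measurableEquivRealProd.symm (x, y) = (x : ℂ) + (y : ℂ) * Complex.I := by
    apply Complex.ext <;> simp [Complex.measurableEquivRealProd]
  rw [hz, ← mul_assoc, ← ENNReal.ofReal_mul (by positivity)]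
  congr 2
  rw [Complex.sq_norm, Complex.normSq_add_mul_I]
  have h1 : (Real.sqrt Real.pi)⁻¹ * (Real.sqrt Real.pi)⁻¹ = Real.pi⁻¹ := by
    rw [← mul_inv, Real.mul_self_sqrt Real.pi_pos.le]
  rw [neg_add, Real.exp_add, ← h1]
  ring

/-- The density depends on |z| alone and rotations of the plane preserve Lebesgue measure. -/
theorem complexGaussian_map_phase {e : ℂ} (he : ‖e‖ = 1) :
    complexGaussian.map (fun z => e * z) = complexGaussian := by
  let a : Circle := ⟨e, by simpa [Submonoid.unitSphere] using he⟩
  refine Measure.ext_of_lintegral _ fun G hG => ?_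
  rw [lintegral_map hG (by fun_prop), lintegral_complexGaussian (by fun_prop),
    lintegral_complexGaussian hG, ← ((rotation a).measurePreserving).lintegral_comp
      (f := fun z => ENNReal.ofReal (Real.pi⁻¹ * Real.exp (-‖z‖ ^ 2)) * G z) (by fun_prop)]
  congr 1
  ext z
  have h1 : rotation a z = e * z := rfl
  rw [h1, norm_mul, he, one_mul]

theorem modeLaw_map_phase (n : ℤ) {e : ℂ} (he : ‖e‖ = 1) :
    (modeLaw n).map (fun z => e * z) = modeLaw n := by
  unfold modeLaw
  conv_rhs => rw [← complexGaussian_map_phase he]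
  rw [Measure.map_map (by fun_prop) (by fun_prop), Measure.map_map (by fun_prop) (by fun_prop)]
  congr 1
  ext z
  simp [mul_div_assoc]

/-- The uniform probability measure on `(-π, π)`. -/
def angleLaw : Measure ℝ :=
  ENNReal.ofReal (2 * Real.pi)⁻¹ • volume.restrict (Set.Ioo (-Real.pi) Real.pi)

instance : IsProbabilityMeasure angleLaw := by
  constructor
  simp only [angleLaw, Measure.smul_apply, Measure.restrict_apply MeasurableSet.univ,
    Set.univ_inter, Real.volume_Ioo, smul_eq_mul]
  rw [← ENNReal.ofReal_mul (by positivity)]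
  have := Real.pi_pos
  rw [show (2 * Real.pi)⁻¹ * (Real.pi - -Real.pi) = 1 by field_simp; ring]
  simp

/-- The point of squared modulus `s` and argument `θ`. -/
def polarPoint (s θ : ℝ) : ℂ := (Real.sqrt s : ℂ) * Complex.exp (θ * Complex.I)

theorem measurable_polarPoint : Measurable fun p : ℝ × ℝ => polarPoint p.1 p.2 := by
  unfold polarPoint; fun_prop

theorem norm_sq_polarPoint {s : ℝ} (hs : 0 ≤ s) (θ : ℝ) : ‖polarPoint s θ‖ ^ 2 = s := by
  unfold polarPoint
  rw [norm_mul, Complex.norm_exp_ofReal_mul_I, mul_one, Complex.norm_real, Real.norm_eq_abs, sq_abs,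
    Real.sq_sqrt hs]

/-- Polar coordinates with s = r², so that 2r dr = ds: the squared modulus is exponential of rate
one and independent of the uniform argument. This lets the radius of a single mode be traded for the
total mass later on. -/
theorem lintegral_complexGaussian_polar {G : ℂ → ℝ≥0∞} (hG : Measurable G) :
    ∫⁻ z, G z ∂complexGaussian =
      ∫⁻ s in Set.Ioi (0 : ℝ), ENNReal.ofReal (Real.exp (-s)) *
        ∫⁻ θ, G (polarPoint s θ) ∂angleLaw := by
  have hsq : (fun r : ℝ => r ^ 2) '' Set.Ioi 0 = Set.Ioi 0 := by
    ext s
    constructor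
    · rintro ⟨r, hr, rfl⟩
      exact pow_pos (Set.mem_Ioi.1 hr) 2
    · intro hs
      exact ⟨Real.sqrt s, Real.sqrt_pos.2 hs, Real.sq_sqrt (le_of_lt hs)⟩
  have hm := measurable_polarPoint
  rw [lintegral_complexGaussian hG, ← Complex.lintegral_comp_polarCoord_symm]
  rw [← hsq, lintegral_image_eq_lintegral_abs_deriv_mul (f' := fun r => 2 * r) measurableSet_Ioi]
  · simp only [polarCoord_target]
    rw [Measure.volume_eq_prod, ← Measure.prod_restrict, lintegral_prod]
    · refine setLIntegral_congr_fun measurableSet_Ioi fun r hr => ?_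
      have hr0 : (0 : ℝ) < r := hr
      simp only [angleLaw, lintegral_smul_measure]
      rw [smul_eq_mul, ← mul_assoc, ← mul_assoc, ← ENNReal.ofReal_mul (by positivity),
        ← ENNReal.ofReal_mul (by positivity), ← lintegral_const_mul]
      · refine lintegral_congr fun θ => ?_
        have h1 : Complex.polarCoord.symm (r, θ) = polarPoint (r ^ 2) θ := by
          rw [Complex.polarCoord_symm_apply, polarPoint, Real.sqrt_sq hr0.le, Complex.exp_mul_I]
          push_cast
          ring
        simp only [h1]
        rw [norm_sq_polarPoint (by positivity), smul_eq_mul, ← mul_assoc,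
          ← ENNReal.ofReal_mul hr0.le, abs_of_pos (by positivity)]
        congr 2
        have := Real.pi_pos
        field_simp
      · exact hG.comp (hm.comp (measurable_const.prodMk measurable_id))
    · apply Measurable.aemeasurable
      have : Measurable fun p : ℝ × ℝ => Complex.polarCoord.symm p := by
        have : (fun p : ℝ × ℝ => Complex.polarCoord.symm p) = fun p : ℝ × ℝ =>
            (p.1 : ℂ) * (Real.cos p.2 + Real.sin p.2 * Complex.I) := by
          ext p; rw [Complex.polarCoord_symm_apply]
        rw [this]; fun_prop
      fun_prop
  · intro r _
    have := (hasDerivAt_pow 2 r).hasDerivWithinAt (s := Set.Ioi 0)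
    simpa using this
  · intro a ha b hb hab
    have ha' : (0 : ℝ) < a := ha
    have hb' : (0 : ℝ) < b := hb
    exact (sq_eq_sq₀ ha'.le hb'.le).1 hab

theorem lintegral_modeLaw_polar (n : ℤ) {G : ℂ → ℝ≥0∞} (hG : Measurable G) :
    ∫⁻ z, G z ∂modeLaw n =
      ∫⁻ s in Set.Ioi (0 : ℝ), ENNReal.ofReal (bracketSq n * Real.exp (-(bracketSq n * s))) *
        ∫⁻ θ, G (polarPoint s θ) ∂angleLaw := by
  have hb := bracket_pos n
  have hk := bracketSq_pos n
  unfold modeLaw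
  rw [lintegral_map hG (by fun_prop), lintegral_complexGaussian_polar (by fun_prop)]
  have him : (fun s : ℝ => bracketSq n * s) '' Set.Ioi 0 = Set.Ioi 0 := by
    ext s
    constructor
    · rintro ⟨r, hr, rfl⟩
      exact mul_pos hk hr
    · intro hs
      exact ⟨s / bracketSq n, div_pos hs hk, by field_simp⟩
  conv_lhs => rw [← him]
  rw [lintegral_image_eq_lintegral_abs_deriv_mul (f' := fun r => bracketSq n) measurableSet_Ioi]
  · refine setLIntegral_congr_fun measurableSet_Ioi fun s hs => ?_
    have hs0 : (0 : ℝ) < s := hs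
    rw [← mul_assoc, ← ENNReal.ofReal_mul (by positivity), abs_of_pos hk]
    congr 1
    refine lintegral_congr fun θ => ?_
    congr 1
    unfold polarPoint
    rw [Real.sqrt_mul hk.le, ← bracket_sq, Real.sqrt_sq hb.le]
    have : (bracket n : ℂ) ≠ 0 := by exact_mod_cast hb.ne'
    push_cast
    field_simp
  · intro r _
    simpa using ((hasDerivAt_id r).const_mul (bracketSq n)).hasDerivWithinAt (s := Set.Ioi 0)
  · intro a _ b _ hab
    exact mul_left_cancel₀ hk.ne' hab

theorem lintegral_exp_neg_mul_Ioi {a : ℝ} (ha : 0 < a) :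
    ∫⁻ s in Set.Ioi (0 : ℝ), ENNReal.ofReal (Real.exp (-(a * s))) = ENNReal.ofReal a⁻¹ := by
  have h := integral_exp_mul_Ioi (a := -a) (by linarith) 0
  have hi := integrableOn_exp_mul_Ioi (a := -a) (by linarith) 0
  simp only [neg_mul] at h hi
  rw [← ofReal_integral_eq_lintegral_ofReal hi (ae_of_all _ fun _ => (Real.exp_pos _).le), h]
  congr 1
  simp [div_eq_mul_inv]

theorem lintegral_exp_norm_sq_modeLaw (n : ℤ) {t : ℝ} (ht : t < bracketSq n) :
    ∫⁻ z, ENNReal.ofReal (Real.exp (t * ‖z‖ ^ 2)) ∂modeLaw n =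
      ENNReal.ofReal ((1 - t / bracketSq n)⁻¹) := by
  have hk := bracketSq_pos n
  rw [lintegral_modeLaw_polar n (by fun_prop)]
  have : ∀ s ∈ Set.Ioi (0 : ℝ), ENNReal.ofReal (bracketSq n * Real.exp (-(bracketSq n * s))) *
      ∫⁻ θ, ENNReal.ofReal (Real.exp (t * ‖polarPoint s θ‖ ^ 2)) ∂angleLaw =
      ENNReal.ofReal (bracketSq n) * ENNReal.ofReal (Real.exp (-((bracketSq n - t) * s))) := by
    intro s hs
    have hs0 : (0 : ℝ) < s := hs
    simp only [norm_sq_polarPoint hs0.le, lintegral_const, measure_univ, mul_one]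
    rw [← ENNReal.ofReal_mul (by positivity), ← ENNReal.ofReal_mul (by positivity), mul_assoc,
      ← Real.exp_add]
    congr 3
    ring
  rw [setLIntegral_congr_fun measurableSet_Ioi this, lintegral_const_mul _ (by fun_prop),
    lintegral_exp_neg_mul_Ioi (by linarith), ← ENNReal.ofReal_mul hk.le]
  congr 1
  have : bracketSq n - t ≠ 0 := by linarith
  field_simp

theorem lintegral_exp_re_modeLaw (n : ℤ) (a : ℂ) :
    ∫⁻ z, ENNReal.ofReal (Real.exp (a * z).re) ∂modeLaw n =
      ENNReal.ofReal (Real.exp (‖a‖ ^ 2 / (4 * bracketSq n))) := by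
  have hb := bracket_pos n
  rw [lintegral_modeLaw_eq_gaussianReal n (by fun_prop)]
  have h1 : ∀ t : ℝ, ∫⁻ x, ENNReal.ofReal (Real.exp (t * x)) ∂gaussianReal 0 (1 / 2) =
      ENNReal.ofReal (Real.exp (t ^ 2 / 4)) := by
    intro t
    have h2 := mgf_gaussianReal (p := gaussianReal 0 (1 / 2)) (X := id) (μ := 0) (v := 1 / 2)
      (by simp) t
    rw [← ofReal_integral_eq_lintegral_ofReal (integrable_exp_mul_gaussianReal t)
      (ae_of_all _ fun _ => (Real.exp_pos _).le)]
    unfold mgf at h2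
    simp only [id] at h2
    rw [h2]
    congr 2
    push_cast
    ring
  have h2 : ∀ p : ℝ × ℝ, ENNReal.ofReal (Real.exp (a * (((p.1 / bracket n : ℝ) : ℂ) +
      ((p.2 / bracket n : ℝ) : ℂ) * Complex.I)).re) =
      ENNReal.ofReal (Real.exp (a.re / bracket n * p.1)) *
        ENNReal.ofReal (Real.exp (-a.im / bracket n * p.2)) := by
    intro p
    rw [← ENNReal.ofReal_mul (Real.exp_pos _).le, ← Real.exp_add]
    congr 2
    simp
    ring
  simp only [h2]
  rw [lintegral_prod_mul (f := fun x => ENNReal.ofReal (Real.exp (a.re / bracket n * x)))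
    (g := fun x => ENNReal.ofReal (Real.exp (-a.im / bracket n * x))) (by fun_prop) (by fun_prop),
    h1, h1,
    ← ENNReal.ofReal_mul (Real.exp_pos _).le, ← Real.exp_add]
  congr 2
  rw [← bracket_sq, Complex.sq_norm, Complex.normSq_apply]
  field_simp

instance : IsGaussian complexGaussian := by
  have : complexGaussian = ((gaussianReal 0 (1 / 2)).prod (gaussianReal 0 (1 / 2))).map
      (Complex.equivRealProdCLM.symm : ℝ × ℝ →L[ℝ] ℂ) := by
    unfold complexGaussian
    congr 1
    ext p
    exact (Complex.equivRealProd_symm_apply p).symm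
  rw [this]
  exact isGaussian_map _

instance (n : ℤ) : IsGaussian (modeLaw n) := by
  have : modeLaw n = complexGaussian.map
      (((bracket n : ℝ)⁻¹ • ContinuousLinearMap.id ℝ ℂ : ℂ →L[ℝ] ℂ)) := by
    unfold modeLaw
    congr 1
    ext z
    simp [div_eq_inv_mul]
  rw [this]
  exact isGaussian_map _

/-- Symmetry under z ↦ -z. Centering is what makes the product of two copies invariant under
rotations. -/
theorem integral_id_modeLaw (n : ℤ) : ∫ z, id z ∂modeLaw n = 0 := by
  have h : ∫ z, id z ∂modeLaw n = ∫ z, id z ∂((modeLaw n).map fun z => (-1 : ℂ) * z) := by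
    rw [modeLaw_map_phase n (by simp)]
  rw [integral_map (by fun_prop) (by fun_prop)] at h
  simp only [id, neg_mul, one_mul] at h ⊢
  rw [integral_neg] at h
  exact self_eq_neg.1 h

theorem modeLaw_prod_map_rotation (n : ℤ) (θ : ℝ) :
    ((modeLaw n).prod (modeLaw n)).map (fun p : ℂ × ℂ => ((Real.cos θ : ℂ) * p.1 + Real.sin θ * p.2,
      -(Real.sin θ : ℂ) * p.1 + Real.cos θ * p.2)) = (modeLaw n).prod (modeLaw n) := by
  conv_rhs => rw [← IsGaussian.map_rotation_eq_self (integral_id_modeLaw n) θ]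
  congr 1
  ext p <;> simp [ContinuousLinearMap.rotation_apply]

theorem lintegral_prod_coord_seqLaw (S : Finset ℤ) {f : ℤ → ℂ → ℝ≥0∞} (hf : ∀ n, Measurable (f n)) :
    ∫⁻ c, ∏ n ∈ S, f n (c n) ∂seqLaw = ∏ n ∈ S, ∫⁻ z, f n z ∂modeLaw n := by
  have h := lintegral_prod_eq_prod_lintegral_of_indepFun (μ := seqLaw) S (fun n c => f n (c n))
    (iIndepFun_infinitePi (P := modeLaw) hf) (fun n => (hf n).comp (measurable_pi_apply n))
  rw [h]
  refine Finset.prod_congr rfl fun n _ => ?_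
  rw [← Measure.infinitePi_map_eval modeLaw n, lintegral_map (hf n) (measurable_pi_apply n)]
  rfl

theorem lintegral_coord_seqLaw (n : ℤ) {f : ℂ → ℝ≥0∞} (hf : Measurable f) :
    ∫⁻ c, f (c n) ∂seqLaw = ∫⁻ z, f z ∂modeLaw n := by
  rw [← Measure.infinitePi_map_eval modeLaw n, lintegral_map hf (measurable_pi_apply n)]
  rfl

theorem lintegral_exp_sum_re_seqLaw (S : Finset ℤ) (a : ℤ → ℂ) :
    ∫⁻ c, ENNReal.ofReal (Real.exp (∑ n ∈ S, a n * c n).re) ∂seqLaw =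
      ENNReal.ofReal (Real.exp (∑ n ∈ S, ‖a n‖ ^ 2 / (4 * bracketSq n))) := by
  have h : ∀ c : ℤ → ℂ, ENNReal.ofReal (Real.exp (∑ n ∈ S, a n * c n).re) =
      ∏ n ∈ S, ENNReal.ofReal (Real.exp (a n * c n).re) := by
    intro c
    rw [Complex.re_sum, Real.exp_sum, ENNReal.ofReal_prod_of_nonneg fun _ _ => (Real.exp_pos _).le]
  simp only [h]
  rw [lintegral_prod_coord_seqLaw S (f := fun n z => ENNReal.ofReal (Real.exp (a n * z).re))
    (fun n => by fun_prop)]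
  simp only [lintegral_exp_re_modeLaw]
  rw [Real.exp_sum, ENNReal.ofReal_prod_of_nonneg fun _ _ => (Real.exp_pos _).le]

theorem lintegral_exp_sum_norm_sq_seqLaw (S : Finset ℤ) {t : ℤ → ℝ}
    (ht : ∀ n ∈ S, t n < bracketSq n) :
    ∫⁻ c, ENNReal.ofReal (Real.exp (∑ n ∈ S, t n * ‖c n‖ ^ 2)) ∂seqLaw =
      ENNReal.ofReal (∏ n ∈ S, (1 - t n / bracketSq n)⁻¹) := by
  have h : ∀ c : ℤ → ℂ, ENNReal.ofReal (Real.exp (∑ n ∈ S, t n * ‖c n‖ ^ 2)) =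
      ∏ n ∈ S, ENNReal.ofReal (Real.exp (t n * ‖c n‖ ^ 2)) := by
    intro c
    rw [Real.exp_sum, ENNReal.ofReal_prod_of_nonneg fun _ _ => (Real.exp_pos _).le]
  simp only [h]
  rw [lintegral_prod_coord_seqLaw S (f := fun n z => ENNReal.ofReal (Real.exp (t n * ‖z‖ ^ 2)))
    (fun n => by fun_prop), ENNReal.ofReal_prod_of_nonneg]
  · exact Finset.prod_congr rfl fun n hn => lintegral_exp_norm_sq_modeLaw n (ht n hn)
  · intro n hn
    have := (div_lt_one (bracketSq_pos n)).2 (ht n hn)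
    exact inv_nonneg.2 (by linarith)

/-- Gaussian integral of the exponential of the squared modulus of a linear functional. -/
theorem lintegral_exp_norm_sq_sum_seqLaw (S : Finset ℤ) (a : ℤ → ℂ) {l : ℝ} (hl : 0 ≤ l)
    (h : l * ∑ n ∈ S, ‖a n‖ ^ 2 / bracketSq n < 1) :
    ∫⁻ c, ENNReal.ofReal (Real.exp (l * ‖∑ n ∈ S, a n * c n‖ ^ 2)) ∂seqLaw =
      ENNReal.ofReal ((1 - l * ∑ n ∈ S, ‖a n‖ ^ 2 / bracketSq n)⁻¹) := by
  have hb : bracketSq 0 = 1 := by simp [bracketSq]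
  -- Linearization by an auxiliary Gaussian z, drawn from `modeLaw 0` because ⟨0⟩ = 1: e^{l|w|²} is
  -- the mean of exp Re(2√l w z). After exchanging the integrals, the one over c is the exponential
  -- of a linear form and the one over z is a quadratic exponential again.
  have h1 : ∀ c : ℤ → ℂ, ENNReal.ofReal (Real.exp (l * ‖∑ n ∈ S, a n * c n‖ ^ 2)) =
      ∫⁻ z, ENNReal.ofReal (Real.exp (∑ n ∈ S, (2 * Real.sqrt l * z * a n) * c n).re)
        ∂modeLaw 0 := by
    intro c
    have h2 := lintegral_exp_re_modeLaw 0 (2 * Real.sqrt l * ∑ n ∈ S, a n * c n)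
    rw [hb] at h2
    have h3 : ‖2 * (Real.sqrt l : ℂ) * ∑ n ∈ S, a n * c n‖ ^ 2 / (4 * 1) =
        l * ‖∑ n ∈ S, a n * c n‖ ^ 2 := by
      rw [norm_mul, norm_mul, Complex.norm_real, mul_pow, mul_pow, Real.norm_eq_abs, sq_abs,
        Real.sq_sqrt hl]
      norm_num
      ring
    rw [h3] at h2
    rw [← h2]
    refine lintegral_congr fun z => ?_
    congr 3
    rw [Finset.mul_sum, Finset.sum_mul]
    exact Finset.sum_congr rfl fun n _ => by ring
  simp only [h1]
  rw [lintegral_lintegral_swap (by fun_prop)]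
  simp only [lintegral_exp_sum_re_seqLaw]
  have h2 : ∀ z : ℂ, ∑ n ∈ S, ‖2 * (Real.sqrt l : ℂ) * z * a n‖ ^ 2 / (4 * bracketSq n) =
      (l * ∑ n ∈ S, ‖a n‖ ^ 2 / bracketSq n) * ‖z‖ ^ 2 := by
    intro z
    rw [Finset.mul_sum, Finset.sum_mul]
    refine Finset.sum_congr rfl fun n _ => ?_
    rw [norm_mul, norm_mul, norm_mul, Complex.norm_real, mul_pow, mul_pow, mul_pow,
      Real.norm_eq_abs, sq_abs, Real.sq_sqrt hl]
    have := bracketSq_pos n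
    norm_num
    field_simp
  simp only [h2]
  rw [lintegral_exp_norm_sq_modeLaw 0 (by rw [hb]; exact h), hb, div_one]

/-- Used both with constant phases, for multiplication of u by a unit, and with e_n = e^{iny}, for
translation of u. -/
theorem seqLaw_map_phase {e : ℤ → ℂ} (he : ∀ n, ‖e n‖ = 1) :
    seqLaw.map (fun c n => e n * c n) = seqLaw := by
  unfold seqLaw
  rw [Measure.infinitePi_map_pi modeLaw (f := fun n z => e n * z) (fun n => by fun_prop)]
  congr 1
  ext1 n
  exact modeLaw_map_phase n (he n)

theorem modeLaw_neg (n : ℤ) : modeLaw (-n) = modeLaw n := by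
  simp [modeLaw, bracket]

theorem seqLaw_map_reflect : seqLaw.map (fun c n => c (-n)) = seqLaw := by
  unfold seqLaw
  rw [Measure.map_infinitePi_infinitePi_of_inj (P := modeLaw) neg_injective]
  congr 1
  ext1 n
  exact modeLaw_neg n

/-! ### Resampling blocks of modes and rotating pairs of sequences. -/

open Classical in
/-- The sequence that agrees with `c'` on `A` and with `c` elsewhere. -/
def splice (A : Set ℤ) (c c' : ℤ → ℂ) : ℤ → ℂ := fun n => if n ∈ A then c' n else c n

theorem splice_of_mem {A : Set ℤ} {n : ℤ} (h : n ∈ A) (c c' : ℤ → ℂ) : splice A c c' n = c' n := by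
  simp [splice, h]

theorem splice_of_notMem {A : Set ℤ} {n : ℤ} (h : n ∉ A) (c c' : ℤ → ℂ) :
    splice A c c' n = c n := by
  simp [splice, h]

theorem splice_singleton (k : ℤ) (c c' : ℤ → ℂ) :
    splice {k} c c' = Function.update c k (c' k) := by
  ext n
  by_cases h : n = k
  · subst h; simp [splice]
  · simp [splice, h]

theorem measurable_splice (A : Set ℤ) :
    Measurable fun p : (ℤ → ℂ) × (ℤ → ℂ) => splice A p.1 p.2 := by
  refine measurable_pi_lambda _ fun n => ?_
  by_cases h : n ∈ A
  · simp only [splice_of_mem h]; fun_prop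
  · simp only [splice_of_notMem h]; fun_prop

-- Independence of the coordinates: replacing the modes in A by those of an independent copy does
-- not change the law. It suffices to check this on finite boxes, where both sides factor.
open Classical in
theorem seqLaw_prod_map_splice (A : Set ℤ) :
    (seqLaw.prod seqLaw).map (fun p => splice A p.1 p.2) = seqLaw := by
  refine Measure.eq_infinitePi modeLaw fun s t ht => ?_
  rw [Measure.map_apply (measurable_splice A) (.pi s.countable_toSet fun _ _ => ht _)]
  have : (fun p : (ℤ → ℂ) × (ℤ → ℂ) => splice A p.1 p.2) ⁻¹' ((s : Set ℤ).pi t) =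
      ((s.filter (· ∉ A) : Finset ℤ) : Set ℤ).pi t ×ˢ
        ((s.filter (· ∈ A) : Finset ℤ) : Set ℤ).pi t := by
    ext p
    simp only [Set.mem_preimage, Set.mem_pi, Set.mem_prod, Finset.coe_filter, Set.mem_ofPred_eq,
      Finset.mem_coe]
    constructor
    · intro h
      exact ⟨fun n hn => by simpa [splice_of_notMem hn.2] using h n hn.1,
        fun n hn => by simpa [splice_of_mem hn.2] using h n hn.1⟩
    · rintro ⟨h1, h2⟩ n hn
      by_cases hA : n ∈ A
      · rw [splice_of_mem hA]; exact h2 n ⟨hn, hA⟩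
      · rw [splice_of_notMem hA]; exact h1 n ⟨hn, hA⟩
  rw [this, Measure.prod_prod]
  unfold seqLaw
  rw [Measure.infinitePi_pi modeLaw fun i _ => ht i, Measure.infinitePi_pi modeLaw fun i _ => ht i,
    mul_comm, Finset.prod_filter_mul_prod_filter_not]

/-- Plays the role of conditional expectation given the modes outside A: the outer variable is
frozen while the inner one is integrated. -/
theorem lintegral_splice (A : Set ℤ) {G : (ℤ → ℂ) → ℝ≥0∞} (hG : Measurable G) :
    ∫⁻ c, G c ∂seqLaw = ∫⁻ c, ∫⁻ c', G (splice A c c') ∂seqLaw ∂seqLaw := by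
  conv_lhs => rw [← seqLaw_prod_map_splice A]
  rw [lintegral_map hG (measurable_splice A)]
  exact lintegral_prod _ (hG.comp (measurable_splice A)).aemeasurable

theorem lintegral_update (k : ℤ) {G : (ℤ → ℂ) → ℝ≥0∞} (hG : Measurable G) :
    ∫⁻ c, G c ∂seqLaw = ∫⁻ c, ∫⁻ z, G (Function.update c k z) ∂modeLaw k ∂seqLaw := by
  rw [lintegral_splice {k} hG]
  refine lintegral_congr fun c => ?_
  simp only [splice_singleton]
  exact lintegral_coord_seqLaw k (f := fun z => G (Function.update c k z))
    (hG.comp (measurable_update c))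

/-- A pair of independent sequences is a sequence of independent pairs, which reduces rotation
invariance to a single coordinate. The two measures agree on products of square cylinders, and these
generate the product σ-algebra. -/
theorem infinitePi_prod_map_unzip :
    (Measure.infinitePi fun n => (modeLaw n).prod (modeLaw n)).map
      (fun w : ℤ → ℂ × ℂ => (fun n => (w n).1, fun n => (w n).2)) = seqLaw.prod seqLaw := by
  symm
  have hgen := generateFrom_squareCylinders (α := fun _ : ℤ => ℂ)
  have hpi := isPiSystem_squareCylinders (α := fun _ : ℤ => ℂ)
    (C := fun _ => {s | MeasurableSet s}) (fun _ => MeasurableSpace.isPiSystem_measurableSet)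
    (fun _ => by simp)
  have huniv : Set.univ ∈ squareCylinders fun _ : ℤ => {s : Set ℂ | MeasurableSet s} :=
    ⟨∅, fun _ => Set.univ, by simp, by simp⟩
  have hspan : seqLaw.FiniteSpanningSetsIn
      (squareCylinders fun _ : ℤ => {s : Set ℂ | MeasurableSet s}) :=
    ⟨fun _ => Set.univ, fun _ => huniv, fun _ => by simp, by simp [Set.iUnion_const]⟩
  refine Measure.prod_eq_generateFrom hgen hgen hpi hpi hspan hspan ?_
  rintro _ ⟨s, A, hA, rfl⟩ _ ⟨t, B, hB, rfl⟩
  have hA' : ∀ i, MeasurableSet (A i) := fun i => hA i (Set.mem_univ i)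
  have hB' : ∀ i, MeasurableSet (B i) := fun i => hB i (Set.mem_univ i)
  classical
  rw [Measure.map_apply (by fun_prop) ((MeasurableSet.pi s.countable_toSet fun i _ => hA' i).prod
    (MeasurableSet.pi t.countable_toSet fun i _ => hB' i))]
  have hset : (fun w : ℤ → ℂ × ℂ => ((fun n => (w n).1 : ℤ → ℂ), (fun n => (w n).2 : ℤ → ℂ))) ⁻¹'
      ((s : Set ℤ).pi A ×ˢ (t : Set ℤ).pi B) = ((s ∪ t : Finset ℤ) : Set ℤ).pi fun n =>
        (if n ∈ s then A n else Set.univ) ×ˢ (if n ∈ t then B n else Set.univ) := by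
    ext w
    simp only [Set.mem_preimage, Set.mem_prod, Set.mem_pi, Finset.mem_coe, Finset.mem_union]
    constructor
    · rintro ⟨h1, h2⟩ n _
      constructor
      · split_ifs with h
        exacts [h1 n h, Set.mem_univ _]
      · split_ifs with h
        exacts [h2 n h, Set.mem_univ _]
    · intro h
      exact ⟨fun n hn => by simpa [hn] using (h n (Or.inl hn)).1,
        fun n hn => by simpa [hn] using (h n (Or.inr hn)).2⟩
  rw [hset, Measure.infinitePi_pi]
  · simp only [Measure.prod_prod]
    unfold seqLaw
    rw [Finset.prod_mul_distrib, Measure.infinitePi_pi modeLaw fun i _ => hA' i,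
      Measure.infinitePi_pi modeLaw fun i _ => hB' i]
    congr 1
    · rw [← Finset.prod_subset Finset.subset_union_left (s₁ := s)]
      · exact Finset.prod_congr rfl fun n hn => by simp [hn]
      · intro n _ hn; simp [hn]
    · rw [← Finset.prod_subset Finset.subset_union_right (s₁ := t)]
      · exact Finset.prod_congr rfl fun n hn => by simp [hn]
      · intro n _ hn; simp [hn]
  · intro n _
    exact MeasurableSet.prod (by split_ifs; exacts [hA' n, .univ])
      (by split_ifs; exacts [hB' n, .univ])

/-- The product of two copies of the law is invariant under rotations. -/
theorem seqLaw_prod_map_rotation (θ : ℝ) :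
    (seqLaw.prod seqLaw).map (fun p : (ℤ → ℂ) × (ℤ → ℂ) =>
      ((fun n => (Real.cos θ : ℂ) * p.1 n + Real.sin θ * p.2 n),
        (fun n => -(Real.sin θ : ℂ) * p.1 n + Real.cos θ * p.2 n))) = seqLaw.prod seqLaw := by
  conv_lhs => rw [← infinitePi_prod_map_unzip]
  rw [Measure.map_map (by fun_prop) (by fun_prop)]
  conv_rhs => rw [← infinitePi_prod_map_unzip]
  have h := Measure.infinitePi_map_pi (fun n => (modeLaw n).prod (modeLaw n))
    (f := fun n (p : ℂ × ℂ) => ((Real.cos θ : ℂ) * p.1 + Real.sin θ * p.2,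
      -(Real.sin θ : ℂ) * p.1 + Real.cos θ * p.2)) (fun n => by fun_prop)
  simp only [modeLaw_prod_map_rotation] at h
  conv_rhs => rw [← h]
  rw [Measure.map_map (by fun_prop) (by fun_prop)]
  rfl

/-! ### Trigonometric polynomials, Parseval and Bessel. -/

/-- The normalized measure `dx / 2π` on a period. -/
def circLaw : Measure ℝ :=
  ENNReal.ofReal (2 * Real.pi)⁻¹ • volume.restrict (Set.Ioc 0 (2 * Real.pi))

instance : IsProbabilityMeasure circLaw := by
  constructor
  simp only [circLaw, Measure.smul_apply, Measure.restrict_apply MeasurableSet.univ,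
    Set.univ_inter, Real.volume_Ioc, smul_eq_mul, sub_zero]
  rw [← ENNReal.ofReal_mul (by positivity), inv_mul_cancel₀ (by positivity)]
  simp

theorem integral_circLaw {E : Type*} [NormedAddCommGroup E] [NormedSpace ℝ E] (G : ℝ → E) :
    ∫ x, G x ∂circLaw = (2 * Real.pi)⁻¹ • ∫ x in (0 : ℝ)..2 * Real.pi, G x := by
  rw [circLaw, integral_smul_measure, intervalIntegral.integral_of_le Real.two_pi_pos.le,
    ENNReal.toReal_ofReal (by positivity)]

theorem integrable_circLaw {E : Type*} [NormedAddCommGroup E] {G : ℝ → E} (hG : Continuous G) :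
    Integrable G circLaw := by
  unfold circLaw
  exact (hG.integrableOn_Ioc).smul_measure ENNReal.ofReal_ne_top

/-- The trigonometric polynomial with frequencies in `S` and coefficients `c`. -/
def trigPoly (S : Finset ℤ) (c : ℤ → ℂ) (x : ℝ) : ℂ :=
  ∑ n ∈ S, c n * Complex.exp (Complex.I * n * x)

/-- The Fourier coefficients of the derivative. -/
def derivSeq (c : ℤ → ℂ) (n : ℤ) : ℂ := Complex.I * n * c n

@[fun_prop]
theorem continuous_trigPoly (S : Finset ℤ) (c : ℤ → ℂ) : Continuous (trigPoly S c) := by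
  unfold trigPoly; fun_prop

theorem hasDerivAt_trigPoly (S : Finset ℤ) (c : ℤ → ℂ) (x : ℝ) :
    HasDerivAt (trigPoly S c) (trigPoly S (derivSeq c) x) x := by
  unfold trigPoly
  refine HasDerivAt.fun_sum fun n _ => ?_
  have h1 : HasDerivAt (fun y : ℝ => Complex.I * n * (y : ℂ)) (Complex.I * n) x := by
    simpa using (Complex.ofRealCLM.hasDerivAt (x := x)).const_mul (Complex.I * (n : ℂ))
  have h2 := (h1.cexp).const_mul (c n)
  refine h2.congr_deriv ?_
  simp only [derivSeq]
  ring

theorem exp_periodic (n : ℤ) (x : ℝ) :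
    Complex.exp (Complex.I * n * ((x + 2 * Real.pi : ℝ) : ℂ)) = Complex.exp (Complex.I * n * x) := by
  have : Complex.I * n * ((x + 2 * Real.pi : ℝ) : ℂ) =
      Complex.I * n * x + n * (2 * Real.pi * Complex.I) := by push_cast; ring
  rw [this, Complex.exp_add, Complex.exp_int_mul_two_pi_mul_I, mul_one]

theorem trigPoly_periodic (S : Finset ℤ) (c : ℤ → ℂ) :
    Function.Periodic (trigPoly S c) (2 * Real.pi) := by
  intro x
  unfold trigPoly
  simp only [exp_periodic]

theorem norm_exp_freq (n : ℤ) (x : ℝ) : ‖Complex.exp (Complex.I * n * x)‖ = 1 := by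
  have : Complex.I * n * x = ((n * x : ℝ) : ℂ) * Complex.I := by push_cast; ring
  rw [this, Complex.norm_exp_ofReal_mul_I]

theorem integral_deriv_circLaw {w w' : ℝ → ℂ} (hw : ∀ x, HasDerivAt w (w' x) x)
    (hc : Continuous w') (hp : Function.Periodic w (2 * Real.pi)) : ∫ x, w' x ∂circLaw = 0 := by
  rw [integral_circLaw, intervalIntegral.integral_eq_sub_of_hasDerivAt (fun x _ => hw x)
    (hc.intervalIntegrable _ _)]
  have := hp 0
  rw [zero_add] at this
  rw [this, sub_self, smul_zero]

theorem integral_exp_circLaw (n : ℤ) :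
    ∫ x : ℝ, Complex.exp (Complex.I * n * x) ∂circLaw = if n = 0 then 1 else 0 := by
  split_ifs with h
  · subst h; simp
  · have h1 := integral_deriv_circLaw (w := trigPoly {n} (fun _ => 1)) (hasDerivAt_trigPoly _ _)
      (by fun_prop) (trigPoly_periodic _ _)
    simp only [trigPoly, Finset.sum_singleton, derivSeq, mul_one] at h1
    rw [integral_const_mul] at h1
    have : Complex.I * (n : ℂ) ≠ 0 := mul_ne_zero Complex.I_ne_zero (by exact_mod_cast h)
    exact (mul_eq_zero.1 h1).resolve_left this

theorem conj_exp_freq (n : ℤ) (x : ℝ) :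
    conj (Complex.exp (Complex.I * n * x)) = Complex.exp (Complex.I * (-n : ℤ) * x) := by
  rw [← Complex.exp_conj]
  congr 1
  simp

theorem integral_exp_mul_conj_exp (n k : ℤ) :
    ∫ x : ℝ, Complex.exp (Complex.I * n * x) * conj (Complex.exp (Complex.I * k * x)) ∂circLaw =
      if n = k then 1 else 0 := by
  have : ∀ x : ℝ, Complex.exp (Complex.I * n * x) * conj (Complex.exp (Complex.I * k * x)) =
      Complex.exp (Complex.I * (n - k : ℤ) * x) := by
    intro x
    rw [conj_exp_freq, ← Complex.exp_add]
    congr 1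
    push_cast
    ring
  simp only [this]
  rw [integral_exp_circLaw]
  simp only [sub_eq_zero]

theorem integral_trigPoly_mul_conj (S : Finset ℤ) (a b : ℤ → ℂ) :
    ∫ x, trigPoly S a x * conj (trigPoly S b x) ∂circLaw = ∑ n ∈ S, a n * conj (b n) := by
  have h : ∀ x, trigPoly S a x * conj (trigPoly S b x) = ∑ n ∈ S, ∑ k ∈ S,
      (a n * conj (b k)) * (Complex.exp (Complex.I * n * x) *
        conj (Complex.exp (Complex.I * k * x))) := by
    intro x
    unfold trigPoly
    rw [map_sum, Finset.sum_mul_sum]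
    refine Finset.sum_congr rfl fun n _ => Finset.sum_congr rfl fun k _ => ?_
    rw [map_mul]; ring
  simp only [h]
  rw [integral_finsetSum _ fun n _ => integrable_circLaw (by fun_prop)]
  refine Finset.sum_congr rfl fun n hn => ?_
  rw [integral_finsetSum _ fun n _ => integrable_circLaw (by fun_prop)]
  simp only [integral_const_mul, integral_exp_mul_conj_exp]
  simp [hn]

/-- Parseval's identity. -/
theorem integral_norm_sq_trigPoly (S : Finset ℤ) (a : ℤ → ℂ) :
    ∫ x, ‖trigPoly S a x‖ ^ 2 ∂circLaw = ∑ n ∈ S, ‖a n‖ ^ 2 := by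
  have h := integral_trigPoly_mul_conj S a a
  simp only [Complex.mul_conj, Complex.normSq_eq_norm_sq] at h
  rw [integral_complex_ofReal] at h
  exact_mod_cast h

/-- Bessel's inequality. -/
theorem sum_norm_sq_fourier_le (S : Finset ℤ) {G : ℝ → ℂ} (hG : Continuous G) :
    ∑ n ∈ S, ‖∫ x : ℝ, G x * Complex.exp (Complex.I * n * x) ∂circLaw‖ ^ 2 ≤
      ∫ x, ‖G x‖ ^ 2 ∂circLaw := by
  -- These are the Fourier coefficients of the conjugate of G, so `trigPoly S a` is its orthogonal
  -- projection; Bessel's inequality is the positivity of the squared distance to it.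
  set a : ℤ → ℂ := fun n => conj (∫ x : ℝ, G x * Complex.exp (Complex.I * n * x) ∂circLaw)
  have h0 : ∫ x, G x * trigPoly S a x ∂circLaw = ((∑ n ∈ S, ‖a n‖ ^ 2 : ℝ) : ℂ) := by
    have : ∀ x, G x * trigPoly S a x = ∑ n ∈ S, a n * (G x * Complex.exp (Complex.I * n * x)) := by
      intro x
      unfold trigPoly
      rw [Finset.mul_sum]
      exact Finset.sum_congr rfl fun n _ => by ring
    simp only [this]
    rw [integral_finsetSum _ fun n _ => integrable_circLaw (by fun_prop)]
    push_cast
    refine Finset.sum_congr rfl fun n _ => ?_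
    rw [integral_const_mul]
    have h1 : (∫ x : ℝ, G x * Complex.exp (Complex.I * n * x) ∂circLaw) = conj (a n) := by
      simp [a]
    rw [h1, Complex.mul_conj, Complex.normSq_eq_norm_sq]
    push_cast
    rfl
  have h1 : ∫ x, ‖conj (G x) - trigPoly S a x‖ ^ 2 ∂circLaw =
      ∫ x, ‖G x‖ ^ 2 ∂circLaw - ∑ n ∈ S, ‖a n‖ ^ 2 := by
    have h2 : ∀ x, ‖conj (G x) - trigPoly S a x‖ ^ 2 =
        ‖G x‖ ^ 2 + ‖trigPoly S a x‖ ^ 2 - 2 * (G x * trigPoly S a x).re := by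
      intro x
      rw [Complex.sq_norm, Complex.normSq_sub, ← Complex.normSq_eq_norm_sq,
        ← Complex.normSq_eq_norm_sq, Complex.normSq_conj]
      have : ((starRingEnd ℂ) (G x) * (starRingEnd ℂ) (trigPoly S a x)).re =
          (G x * trigPoly S a x).re := by
        rw [← map_mul, Complex.conj_re]
      rw [this]
    have h3 : ∫ x, (G x * trigPoly S a x).re ∂circLaw = ∑ n ∈ S, ‖a n‖ ^ 2 := by
      have := integral_re (𝕜 := ℂ) (f := fun x => G x * trigPoly S a x)
        (integrable_circLaw (by fun_prop))
      simp only [RCLike.re_eq_complex_re] at this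
      rw [this, h0, Complex.ofReal_re]
    simp only [h2]
    rw [integral_sub (integrable_circLaw (by fun_prop)) (integrable_circLaw (by fun_prop)),
      integral_add (integrable_circLaw (by fun_prop)) (integrable_circLaw (by fun_prop)),
      integral_const_mul, h3, integral_norm_sq_trigPoly]
    ring
  have h4 : 0 ≤ ∫ x, ‖conj (G x) - trigPoly S a x‖ ^ 2 ∂circLaw :=
    integral_nonneg fun x => by positivity
  have h5 : ∀ n, ‖a n‖ = ‖∫ x : ℝ, G x * Complex.exp (Complex.I * n * x) ∂circLaw‖ := by
    intro n; simp only [a]; rw [Complex.norm_conj]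
  simp only [← h5]
  linarith

theorem integral_circLaw_neg {G : ℝ → ℂ} (hp : Function.Periodic G (2 * Real.pi)) :
    ∫ x, G (-x) ∂circLaw = ∫ x, G x ∂circLaw := by
  rw [integral_circLaw, integral_circLaw, intervalIntegral.integral_comp_neg]
  have := hp.intervalIntegral_add_eq (-(2 * Real.pi)) 0
  simp only [neg_add_cancel, zero_add] at this
  rw [neg_zero, this]

/-! ### The quartic functional and its gradient. -/

/-- `-(3i/2) ∫ u ū² uₓ` for a trigonometric polynomial `u`. -/
def quartic (S : Finset ℤ) (c : ℤ → ℂ) : ℝ :=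
  (-(3 * Complex.I / 2) * ∫ x, trigPoly S c x * conj (trigPoly S c x) ^ 2 *
    trigPoly S (derivSeq c) x ∂circLaw).re

theorem fN_eq_quartic (N : ℕ) (u : HHalfMinus) :
    fN N u = quartic (Finset.Icc (-(N : ℤ)) N) (coeff u) := by
  unfold fN quartic
  rw [integral_circLaw]
  have h : ∀ x, trunc N u x = trigPoly (Finset.Icc (-(N : ℤ)) N) (coeff u) x := fun x => rfl
  have hd : ∀ x, deriv (fun y : ℝ => trunc N u y ^ 2) x =
      2 * trigPoly (Finset.Icc (-(N : ℤ)) N) (coeff u) x *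
        trigPoly (Finset.Icc (-(N : ℤ)) N) (derivSeq (coeff u)) x := by
    intro x
    have := (hasDerivAt_trigPoly (Finset.Icc (-(N : ℤ)) N) (coeff u) x).fun_pow 2
    rw [show (fun y : ℝ => trunc N u y ^ 2) =
      fun y => trigPoly (Finset.Icc (-(N : ℤ)) N) (coeff u) y ^ 2 from rfl, this.deriv]
    simp
  congr 1
  rw [Complex.real_smul, ← mul_assoc]
  have h2 : ∀ x, conj (trigPoly (Finset.Icc (-(N : ℤ)) N) (coeff u) x) ^ 2 *
      (2 * trigPoly (Finset.Icc (-(N : ℤ)) N) (coeff u) x *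
        trigPoly (Finset.Icc (-(N : ℤ)) N) (derivSeq (coeff u)) x) =
      2 * (trigPoly (Finset.Icc (-(N : ℤ)) N) (coeff u) x *
        conj (trigPoly (Finset.Icc (-(N : ℤ)) N) (coeff u) x) ^ 2 *
        trigPoly (Finset.Icc (-(N : ℤ)) N) (derivSeq (coeff u)) x) := fun x => by ring
  have h3 : ∀ x, conj (trunc N u x) ^ 2 * deriv (fun y : ℝ => trunc N u y ^ 2) x =
      2 * (trigPoly (Finset.Icc (-(N : ℤ)) N) (coeff u) x *
        conj (trigPoly (Finset.Icc (-(N : ℤ)) N) (coeff u) x) ^ 2 *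
        trigPoly (Finset.Icc (-(N : ℤ)) N) (derivSeq (coeff u)) x) := fun x => by
    rw [hd, h, h2]
  simp only [h3]
  rw [intervalIntegral.integral_const_mul]
  push_cast
  ring

theorem truncMass_eq_sum (N : ℕ) (u : HHalfMinus) :
    truncMass N u = ∑ n ∈ Finset.Icc (-(N : ℤ)) N, ‖coeff u n‖ ^ 2 := by
  rw [← integral_norm_sq_trigPoly, integral_circLaw]
  rfl

/-- Reflecting x changes the sign of the derivative only. Since the Gaussian law is invariant under
reflection, the form has mean zero on symmetric blocks, and exponential bounds hold for both signs
at once. -/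
theorem quartic_reflect {S : Finset ℤ} (hS : ∀ n, n ∈ S ↔ -n ∈ S) (c : ℤ → ℂ) :
    quartic S (fun n => c (-n)) = -quartic S c := by
  have h1 : ∀ (a : ℤ → ℂ) x, trigPoly S (fun n => a (-n)) x = trigPoly S a (-x) := by
    intro a x
    unfold trigPoly
    refine Finset.sum_nbij' (fun n => -n) (fun n => -n) (fun n hn => (hS n).1 hn)
      (fun n hn => (hS n).1 hn) (fun n _ => neg_neg n) (fun n _ => neg_neg n) fun n _ => ?_
    congr 2
    push_cast
    ring
  have h2 : ∀ x, trigPoly S (derivSeq fun n => c (-n)) x = -trigPoly S (derivSeq c) (-x) := by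
    intro x
    rw [← h1]
    unfold trigPoly
    rw [← Finset.sum_neg_distrib]
    refine Finset.sum_congr rfl fun n _ => ?_
    simp only [derivSeq]
    push_cast
    ring
  unfold quartic
  simp only [h1, h2]
  have h3 := integral_circLaw_neg (G := fun x => trigPoly S c x * conj (trigPoly S c x) ^ 2 *
    trigPoly S (derivSeq c) x) (by
      intro x
      simp only [trigPoly_periodic S c x, trigPoly_periodic S (derivSeq c) x])
  simp only [mul_neg, integral_neg]
  rw [h3, Complex.neg_re]

/-- The derivative of `quartic` in the direction of a trigonometric polynomial. -/
theorem quartic_variation (S B : Finset ℤ) (c b : ℤ → ℂ) :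
    (-(3 * Complex.I / 2) * ∫ x, (trigPoly B b x * conj (trigPoly S c x) ^ 2 *
        trigPoly S (derivSeq c) x + 2 * trigPoly S c x * conj (trigPoly S c x) *
        conj (trigPoly B b x) * trigPoly S (derivSeq c) x +
        trigPoly S c x * conj (trigPoly S c x) ^ 2 * trigPoly B (derivSeq b) x) ∂circLaw).re =
    (∑ n ∈ B, (6 * Complex.I * ∫ x : ℝ, (trigPoly S c x * conj (trigPoly S c x) *
        conj (trigPoly S (derivSeq c) x)) * Complex.exp (Complex.I * n * x) ∂circLaw) * b n).re := by
  set u := trigPoly S c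
  set u' := trigPoly S (derivSeq c)
  set h := trigPoly B b
  set h' := trigPoly B (derivSeq b)
  have cu : Continuous u := continuous_trigPoly S c
  have cu' : Continuous u' := continuous_trigPoly S _
  have ch : Continuous h := continuous_trigPoly B b
  have ch' : Continuous h' := continuous_trigPoly B _
  have hsum : (∑ n ∈ B, (6 * Complex.I * ∫ x : ℝ, (u x * conj (u x) * conj (u' x)) *
      Complex.exp (Complex.I * n * x) ∂circLaw) * b n) =
      6 * Complex.I * ∫ x, u x * conj (u x) * conj (u' x) * h x ∂circLaw := by
    have : ∀ x, u x * conj (u x) * conj (u' x) * h x = ∑ n ∈ B,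
        b n * (u x * conj (u x) * conj (u' x) * Complex.exp (Complex.I * n * x)) := by
      intro x
      simp only [h, trigPoly]
      rw [Finset.mul_sum]
      exact Finset.sum_congr rfl fun n _ => by ring
    simp only [this]
    rw [integral_finsetSum _ fun n _ => integrable_circLaw (by fun_prop), Finset.mul_sum]
    refine Finset.sum_congr rfl fun n _ => ?_
    rw [integral_const_mul]
    ring
  rw [hsum]
  -- Integration by parts: the derivative of u ū² h has mean zero over a period. It removes the only
  -- term in which the direction h is differentiated, so the gradient involves one derivative of u
  -- and none of the direction.
  have hibp : ∫ x, (u' x * conj (u x) ^ 2 * h x + u x * (2 * conj (u x) * conj (u' x)) * h x +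
      u x * conj (u x) ^ 2 * h' x) ∂circLaw = 0 := by
    refine integral_deriv_circLaw (w := fun x => u x * conj (u x) ^ 2 * h x) ?_ (by fun_prop) ?_
    · intro x
      have d1 := hasDerivAt_trigPoly S c x
      have d2 := hasDerivAt_trigPoly B b x
      have d3 : HasDerivAt (fun y => conj (u y)) (conj (u' x)) x := d1.star
      have d4 := (d1.fun_mul (d3.fun_pow 2)).fun_mul d2
      refine d4.congr_deriv ?_
      simp only [u, u', h, h']
      push_cast
      ring
    · intro x
      have e1 : u (x + 2 * Real.pi) = u x := trigPoly_periodic S c x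
      have e2 : h (x + 2 * Real.pi) = h x := trigPoly_periodic B b x
      simp only [e1, e2]
  set Z := ∫ x, u x * conj (u x) * conj (u' x) * h x ∂circLaw with hZ
  have hZc : ∫ x, u x * conj (u x) * u' x * conj (h x) ∂circLaw = conj Z := by
    rw [hZ, ← integral_conj]
    congr 1
    ext x
    simp only [map_mul, Complex.conj_conj]
    ring
  -- Modulo the total derivative, the terms that remain are 2 conj Z and -2Z. Multiplication by
  -- -3i/2 turns -4i Im Z into -6 Im Z, which is the real part of 6iZ.
  have hmain : ∫ x, (h x * conj (u x) ^ 2 * u' x + 2 * u x * conj (u x) * conj (h x) * u' x +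
      u x * conj (u x) ^ 2 * h' x) ∂circLaw = 2 * conj Z - 2 * Z := by
    have e : ∀ x, h x * conj (u x) ^ 2 * u' x + 2 * u x * conj (u x) * conj (h x) * u' x +
      u x * conj (u x) ^ 2 * h' x =
      ((u' x * conj (u x) ^ 2 * h x + u x * (2 * conj (u x) * conj (u' x)) * h x +
      u x * conj (u x) ^ 2 * h' x) + 2 * (u x * conj (u x) * u' x * conj (h x))) -
      2 * (u x * conj (u x) * conj (u' x) * h x) := fun x => by ring
    simp only [e]
    rw [integral_sub (integrable_circLaw (by fun_prop)) (integrable_circLaw (by fun_prop)),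
      integral_add (integrable_circLaw (by fun_prop)) (integrable_circLaw (by fun_prop)),
      hibp, integral_const_mul, integral_const_mul, hZc, zero_add]
  rw [hmain]
  simp
  ring

@[fun_prop]
theorem continuous_integral_circLaw {X : Type*} [TopologicalSpace X] [FirstCountableTopology X]
    {G : X → ℝ → ℂ} (hG : Continuous (Function.uncurry G)) :
    Continuous fun t => ∫ x, G t x ∂circLaw := by
  simp only [integral_circLaw]
  exact (intervalIntegral.continuous_parametric_intervalIntegral_of_continuous' hG _ _).const_smul _

@[fun_prop]
theorem continuous_trigPoly_comp {X : Type*} [TopologicalSpace X] (S : Finset ℤ) {c : X → ℤ → ℂ}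
    {x : X → ℝ} (hc : Continuous c) (hx : Continuous x) :
    Continuous fun t => trigPoly S (c t) (x t) := by
  unfold trigPoly; fun_prop

@[fun_prop]
theorem continuous_derivSeq : Continuous derivSeq := by
  unfold derivSeq; fun_prop

theorem continuous_quartic (S : Finset ℤ) : Continuous (quartic S) := by
  unfold quartic
  refine Complex.continuous_re.comp (continuous_const.mul (continuous_integral_circLaw ?_))
  simp only [Function.uncurry_def]
  have h1 : Continuous fun p : (ℤ → ℂ) × ℝ => trigPoly S p.1 p.2 := by fun_prop
  have h2 : Continuous fun p : (ℤ → ℂ) × ℝ => trigPoly S (derivSeq p.1) p.2 :=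
    continuous_trigPoly_comp S (continuous_derivSeq.comp continuous_fst) continuous_snd
  fun_prop

/-- The `n`-th component of the gradient of `quartic`. -/
def gradSeq (S : Finset ℤ) (w : ℤ → ℂ) (n : ℤ) : ℂ :=
  6 * Complex.I * ∫ x : ℝ, (trigPoly S w x * conj (trigPoly S w x) *
    conj (trigPoly S (derivSeq w) x)) * Complex.exp (Complex.I * n * x) ∂circLaw

/-- The derivative of `quartic S` at `w` in the direction of the frequencies of `b` in `B`. -/
def dirDeriv (S B : Finset ℤ) (w b : ℤ → ℂ) : ℝ := (∑ n ∈ B, gradSeq S w n * b n).re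

theorem continuous_gradSeq (S : Finset ℤ) (n : ℤ) : Continuous fun w => gradSeq S w n := by
  unfold gradSeq
  refine continuous_const.mul (continuous_integral_circLaw ?_)
  simp only [Function.uncurry_def]
  have h1 : Continuous fun p : (ℤ → ℂ) × ℝ => trigPoly S p.1 p.2 := by fun_prop
  have h2 : Continuous fun p : (ℤ → ℂ) × ℝ => trigPoly S (derivSeq p.1) p.2 :=
    continuous_trigPoly_comp S (continuous_derivSeq.comp continuous_fst) continuous_snd
  fun_prop

theorem continuous_dirDeriv (S B : Finset ℤ) :
    Continuous fun p : (ℤ → ℂ) × (ℤ → ℂ) => dirDeriv S B p.1 p.2 := by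
  unfold dirDeriv
  have h := continuous_gradSeq S
  refine Complex.continuous_re.comp (continuous_finsetSum _ fun n _ => ?_)
  exact ((h n).comp continuous_fst).mul ((continuous_apply n).comp continuous_snd)

/-- Bessel's inequality for |u|² times the conjugate of u_x, whose Fourier coefficients are the
gradient up to the factor 6i. -/
theorem sum_norm_sq_gradSeq_le (S B : Finset ℤ) (w : ℤ → ℂ) :
    ∑ n ∈ B, ‖gradSeq S w n‖ ^ 2 ≤
      36 * ∫ x, ‖trigPoly S w x‖ ^ 4 * ‖trigPoly S (derivSeq w) x‖ ^ 2 ∂circLaw := by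
  have h := sum_norm_sq_fourier_le B (G := fun x => trigPoly S w x * conj (trigPoly S w x) *
    conj (trigPoly S (derivSeq w) x)) (by fun_prop)
  have e1 : ∀ n, ‖gradSeq S w n‖ ^ 2 = 36 * ‖∫ x : ℝ, (trigPoly S w x * conj (trigPoly S w x) *
    conj (trigPoly S (derivSeq w) x)) * Complex.exp (Complex.I * n * x) ∂circLaw‖ ^ 2 := by
    intro n
    unfold gradSeq
    rw [norm_mul, mul_pow]
    congr 1
    norm_num
  have e2 : ∀ x, ‖trigPoly S w x * conj (trigPoly S w x) * conj (trigPoly S (derivSeq w) x)‖ ^ 2 =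
      ‖trigPoly S w x‖ ^ 4 * ‖trigPoly S (derivSeq w) x‖ ^ 2 := by
    intro x
    rw [norm_mul, norm_mul, Complex.norm_conj, Complex.norm_conj]
    ring
  simp only [e1]
  rw [← Finset.mul_sum]
  simp only [e2] at h
  linarith

/-! ### Maurey–Pisier interpolation. -/

/-- Rotation of a pair of sequences: first component. -/
def rotFst (θ : ℝ) (a b : ℤ → ℂ) : ℤ → ℂ := fun n => (Real.cos θ : ℂ) * a n + Real.sin θ * b n

/-- Rotation of a pair of sequences: second component. -/
def rotSnd (θ : ℝ) (a b : ℤ → ℂ) : ℤ → ℂ := fun n => -(Real.sin θ : ℂ) * a n + Real.cos θ * b n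

theorem lintegral_rotation (θ : ℝ) {G : (ℤ → ℂ) → (ℤ → ℂ) → ℝ≥0∞}
    (hG : Measurable fun p : (ℤ → ℂ) × (ℤ → ℂ) => G p.1 p.2) :
    ∫⁻ a, ∫⁻ b, G (rotFst θ a b) (rotSnd θ a b) ∂seqLaw ∂seqLaw =
      ∫⁻ a, ∫⁻ b, G a b ∂seqLaw ∂seqLaw := by
  have hm : Measurable fun p : (ℤ → ℂ) × (ℤ → ℂ) => (rotFst θ p.1 p.2, rotSnd θ p.1 p.2) := by
    unfold rotFst rotSnd; fun_prop
  have h1 := lintegral_prod (μ := seqLaw) (ν := seqLaw)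
    (fun p => G (rotFst θ p.1 p.2) (rotSnd θ p.1 p.2)) (hG.comp hm).aemeasurable
  have h2 := lintegral_prod (μ := seqLaw) (ν := seqLaw) (fun p => G p.1 p.2) hG.aemeasurable
  have h3 := lintegral_map (μ := seqLaw.prod seqLaw) hG hm
  rw [← h1, ← h2, ← h3]
  congr 1
  exact seqLaw_prod_map_rotation θ

theorem trigPoly_splice {S B : Finset ℤ} (hB : B ⊆ S) (c e : ℤ → ℂ) (x : ℝ) :
    trigPoly S (splice B c e) x = trigPoly (S \ B) c x + trigPoly B e x := by
  unfold trigPoly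
  rw [← Finset.sum_sdiff hB]
  congr 1
  · refine Finset.sum_congr rfl fun n hn => ?_
    rw [splice_of_notMem (by simpa using (Finset.mem_sdiff.1 hn).2)]
  · refine Finset.sum_congr rfl fun n hn => ?_
    rw [splice_of_mem (by simpa using hn)]

theorem derivSeq_splice (A : Set ℤ) (c e : ℤ → ℂ) :
    derivSeq (splice A c e) = splice A (derivSeq c) (derivSeq e) := by
  ext n
  by_cases h : n ∈ A
  · simp [derivSeq, splice_of_mem h]
  · simp [derivSeq, splice_of_notMem h]

theorem trigPoly_rotFst (B : Finset ℤ) (θ : ℝ) (a b : ℤ → ℂ) (x : ℝ) :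
    trigPoly B (rotFst θ a b) x = Real.cos θ * trigPoly B a x + Real.sin θ * trigPoly B b x := by
  unfold trigPoly rotFst
  rw [Finset.mul_sum, Finset.mul_sum, ← Finset.sum_add_distrib]
  exact Finset.sum_congr rfl fun n _ => by ring

theorem trigPoly_rotSnd (B : Finset ℤ) (θ : ℝ) (a b : ℤ → ℂ) (x : ℝ) :
    trigPoly B (rotSnd θ a b) x = -Real.sin θ * trigPoly B a x + Real.cos θ * trigPoly B b x := by
  unfold trigPoly rotSnd
  rw [Finset.mul_sum, Finset.mul_sum, ← Finset.sum_add_distrib]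
  exact Finset.sum_congr rfl fun n _ => by ring

theorem derivSeq_rotFst (θ : ℝ) (a b : ℤ → ℂ) :
    derivSeq (rotFst θ a b) = rotFst θ (derivSeq a) (derivSeq b) := by
  ext n; simp only [derivSeq, rotFst]; ring

theorem derivSeq_rotSnd (θ : ℝ) (a b : ℤ → ℂ) :
    derivSeq (rotSnd θ a b) = rotSnd θ (derivSeq a) (derivSeq b) := by
  ext n; simp only [derivSeq, rotSnd]; ring

/-- The fundamental theorem of calculus in θ at each x, followed by Fubini. The functions u' and h'
are x-derivatives in the application, but only their dependence on θ matters here, so they stay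
abstract. -/
theorem re_integral_quartic_sub {u u' h h' : ℝ → ℝ → ℂ} (cu : Continuous fun p : ℝ × ℝ => u p.1 p.2)
    (cu' : Continuous fun p : ℝ × ℝ => u' p.1 p.2) (ch : Continuous fun p : ℝ × ℝ => h p.1 p.2)
    (ch' : Continuous fun p : ℝ × ℝ => h' p.1 p.2)
    (du : ∀ x θ, HasDerivAt (fun t => u t x) (h θ x) θ)
    (du' : ∀ x θ, HasDerivAt (fun t => u' t x) (h' θ x) θ) (t : ℝ) :
    (-(3 * Complex.I / 2) * ∫ x, u t x * conj (u t x) ^ 2 * u' t x ∂circLaw).re -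
      (-(3 * Complex.I / 2) * ∫ x, u 0 x * conj (u 0 x) ^ 2 * u' 0 x ∂circLaw).re =
    ∫ θ in (0 : ℝ)..t, (-(3 * Complex.I / 2) * ∫ x, (h θ x * conj (u θ x) ^ 2 * u' θ x +
      2 * u θ x * conj (u θ x) * conj (h θ x) * u' θ x +
      u θ x * conj (u θ x) ^ 2 * h' θ x) ∂circLaw).re := by
  obtain ⟨G, hG⟩ : ∃ G : ℝ → ℝ → ℂ, G = fun θ x => h θ x * conj (u θ x) ^ 2 * u' θ x +
    2 * u θ x * conj (u θ x) * conj (h θ x) * u' θ x + u θ x * conj (u θ x) ^ 2 * h' θ x := ⟨_, rfl⟩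
  have cG : Continuous fun p : ℝ × ℝ => G p.1 p.2 := by simp only [hG]; fun_prop
  have hGv : ∀ θ x, h θ x * conj (u θ x) ^ 2 * u' θ x +
    2 * u θ x * conj (u θ x) * conj (h θ x) * u' θ x + u θ x * conj (u θ x) ^ 2 * h' θ x = G θ x :=
    fun θ x => by rw [hG]
  have dψ : ∀ x θ, HasDerivAt (fun t => u t x * conj (u t x) ^ 2 * u' t x) (G θ x) θ := by
    intro x θ
    have d3 : HasDerivAt (fun t => conj (u t x)) (conj (h θ x)) θ := (du x θ).star
    refine (((du x θ).fun_mul (d3.fun_pow 2)).fun_mul (du' x θ)).congr_deriv ?_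
    rw [← hGv]
    push_cast
    ring
  simp only [hGv]
  have hx : ∀ x, u t x * conj (u t x) ^ 2 * u' t x - u 0 x * conj (u 0 x) ^ 2 * u' 0 x =
      ∫ θ in (0 : ℝ)..t, G θ x := by
    intro x
    rw [intervalIntegral.integral_eq_sub_of_hasDerivAt (fun θ _ => dψ x θ)]
    exact Continuous.intervalIntegrable (cG.comp (continuous_id.prodMk continuous_const)) _ _
  have cux : ∀ θ, Continuous (u θ) := fun θ => cu.comp (continuous_const.prodMk continuous_id)
  have cux' : ∀ θ, Continuous (u' θ) := fun θ => cu'.comp (continuous_const.prodMk continuous_id)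
  have cc : ∀ θ, Continuous fun x => u θ x * conj (u θ x) ^ 2 * u' θ x := fun θ => by
    have := cux θ
    have := cux' θ
    fun_prop
  have hswap : ∫ x, (∫ θ in (0 : ℝ)..t, G θ x) ∂circLaw =
      ∫ θ in (0 : ℝ)..t, ∫ x, G θ x ∂circLaw := by
    simp only [integral_circLaw]
    rw [intervalIntegral.integral_smul, intervalIntegral_intervalIntegral_swap]
    refine (Continuous.continuousOn ?_).integrableOn_compact
      ((isCompact_uIcc (a := (0 : ℝ))).prod (isCompact_uIcc (a := (0 : ℝ)))) |>.mono_set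
      (Set.prod_mono Set.uIoc_subset_uIcc Set.uIoc_subset_uIcc)
    exact cG.comp (continuous_snd.prodMk continuous_fst)
  have hcont : Continuous fun θ => -(3 * Complex.I / 2) * ∫ x, G θ x ∂circLaw :=
    continuous_const.mul (continuous_integral_circLaw cG)
  rw [← Complex.sub_re, ← mul_sub, ← integral_sub (integrable_circLaw (cc _))
    (integrable_circLaw (cc _))]
  simp only [hx]
  rw [hswap, ← intervalIntegral.integral_const_mul]
  exact (Complex.reCLM.intervalIntegral_comp_comm (hcont.intervalIntegrable (0 : ℝ) t)).symm

/-- The change of `quartic` along a quarter rotation. -/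
theorem quartic_sub_eq_integral {S B : Finset ℤ} (hB : B ⊆ S) (c a b : ℤ → ℂ) :
    quartic S (splice B c b) - quartic S (splice B c a) =
      ∫ θ in (0 : ℝ)..Real.pi / 2,
        dirDeriv S B (splice B c (rotFst θ a b)) (rotSnd θ a b) := by
  have eu : ∀ θ x, trigPoly S (splice B c (rotFst θ a b)) x = trigPoly (S \ B) c x +
      (Real.cos θ * trigPoly B a x + Real.sin θ * trigPoly B b x) := fun θ x => by
    rw [trigPoly_splice hB, trigPoly_rotFst]
  have eu' : ∀ θ x, trigPoly S (derivSeq (splice B c (rotFst θ a b))) x =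
      trigPoly (S \ B) (derivSeq c) x +
      (Real.cos θ * trigPoly B (derivSeq a) x + Real.sin θ * trigPoly B (derivSeq b) x) :=
    fun θ x => by rw [derivSeq_splice, trigPoly_splice hB, derivSeq_rotFst, trigPoly_rotFst]
  have eh : ∀ θ x, trigPoly B (rotSnd θ a b) x =
      -Real.sin θ * trigPoly B a x + Real.cos θ * trigPoly B b x :=
    fun θ x => trigPoly_rotSnd _ _ _ _ _
  have eh' : ∀ θ x, trigPoly B (derivSeq (rotSnd θ a b)) x =
      -Real.sin θ * trigPoly B (derivSeq a) x + Real.cos θ * trigPoly B (derivSeq b) x :=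
    fun θ x => by rw [derivSeq_rotSnd, trigPoly_rotSnd]
  have hcos : ∀ θ : ℝ, HasDerivAt (fun t : ℝ => (Real.cos t : ℂ)) (-Real.sin θ : ℂ) θ := fun θ => by
    simpa using (Real.hasDerivAt_cos θ).ofReal_comp
  have hsin : ∀ θ : ℝ, HasDerivAt (fun t : ℝ => (Real.sin t : ℂ)) (Real.cos θ : ℂ) θ := fun θ =>
    (Real.hasDerivAt_sin θ).ofReal_comp
  have h := re_integral_quartic_sub
    (u := fun θ x => trigPoly S (splice B c (rotFst θ a b)) x)
    (u' := fun θ x => trigPoly S (derivSeq (splice B c (rotFst θ a b))) x)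
    (h := fun θ x => trigPoly B (rotSnd θ a b) x)
    (h' := fun θ x => trigPoly B (derivSeq (rotSnd θ a b)) x)
    (by simp only [eu]; fun_prop) (by simp only [eu']; fun_prop) (by simp only [eh]; fun_prop)
    (by simp only [eh']; fun_prop)
    (fun x θ => by
      simp only [eu, eh]
      exact (((hcos θ).mul_const _).add ((hsin θ).mul_const _)).const_add _)
    (fun x θ => by
      simp only [eu', eh']
      exact (((hcos θ).mul_const _).add ((hsin θ).mul_const _)).const_add _) (Real.pi / 2)
  have hb : rotFst (Real.pi / 2) a b = b := by ext n; simp [rotFst]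
  have ha : rotFst 0 a b = a := by ext n; simp [rotFst]
  simp only [quartic_variation] at h
  rw [hb, ha] at h
  exact h

/-- The uniform probability measure on `(0, π/2]`. -/
def quarterLaw : Measure ℝ :=
  ENNReal.ofReal (Real.pi / 2)⁻¹ • volume.restrict (Set.Ioc 0 (Real.pi / 2))

instance : IsProbabilityMeasure quarterLaw := by
  constructor
  have := Real.pi_pos
  simp only [quarterLaw, Measure.smul_apply, Measure.restrict_apply MeasurableSet.univ,
    Set.univ_inter, Real.volume_Ioc, smul_eq_mul, sub_zero]
  rw [← ENNReal.ofReal_mul (by positivity), inv_mul_cancel₀ (by positivity)]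
  simp

theorem continuous_splice (A : Set ℤ) :
    Continuous fun p : (ℤ → ℂ) × (ℤ → ℂ) => splice A p.1 p.2 := by
  refine continuous_pi fun n => ?_
  by_cases h : n ∈ A
  · simp only [splice_of_mem h]; fun_prop
  · simp only [splice_of_notMem h]; fun_prop

/-- The Maurey–Pisier interpolation inequality, on a set `E` and an enlargement `E'` of it that
contains the rotations of pairs of points of `E`. -/
theorem lintegral_convex_sub_le {F : (ℤ → ℂ) → ℝ} {D : (ℤ → ℂ) → (ℤ → ℂ) → ℝ}
    (hD : Continuous fun p : (ℤ → ℂ) × (ℤ → ℂ) => D p.1 p.2)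
    (hFD : ∀ a b, F b - F a = ∫ θ in (0 : ℝ)..Real.pi / 2, D (rotFst θ a b) (rotSnd θ a b))
    {Φ : ℝ → ℝ} (hΦ : ConvexOn ℝ Set.univ Φ) (hΦc : Continuous Φ) (hΦ0 : ∀ x, 0 ≤ Φ x)
    {E E' : Set (ℤ → ℂ)} (hE' : MeasurableSet E')
    (hEE' : ∀ a ∈ E, ∀ b ∈ E, ∀ θ, rotFst θ a b ∈ E') :
    ∫⁻ a, ∫⁻ b, E.indicator 1 a * E.indicator 1 b * ENNReal.ofReal (Φ (F b - F a)) ∂seqLaw ∂seqLaw ≤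
      ∫⁻ a, ∫⁻ b, E'.indicator 1 a * ENNReal.ofReal (Φ (Real.pi / 2 * D a b)) ∂seqLaw ∂seqLaw := by
  have hpi := Real.pi_pos
  obtain ⟨G, hG⟩ : ∃ G : (ℤ → ℂ) → (ℤ → ℂ) → ℝ≥0∞, ∀ a b, E'.indicator 1 a *
    ENNReal.ofReal (Φ (Real.pi / 2 * D a b)) = G a b := ⟨_, fun _ _ => rfl⟩
  simp only [hG]
  have hGm : Measurable fun p : (ℤ → ℂ) × (ℤ → ℂ) => G p.1 p.2 := by
    simp only [← hG]
    refine ((measurable_one.indicator hE').comp measurable_fst).mul ?_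
    exact (hΦc.comp (continuous_const.mul hD)).measurable.ennreal_ofReal
  have hrot : Measurable fun p : (ℝ × (ℤ → ℂ)) × (ℤ → ℂ) =>
      (rotFst p.1.1 p.1.2 p.2, rotSnd p.1.1 p.1.2 p.2) := by
    unfold rotFst rotSnd; fun_prop
  -- Jensen's inequality for the uniform law of the angle. The factor π/2 turns the integral over
  -- the quarter turn into a mean, and the rotated first component stays in E'.
  have key : ∀ a b, E.indicator 1 a * E.indicator 1 b * ENNReal.ofReal (Φ (F b - F a)) ≤
      ∫⁻ θ, G (rotFst θ a b) (rotSnd θ a b) ∂quarterLaw := by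
    intro a b
    by_cases ha : a ∈ E
    swap; · simp [ha]
    by_cases hb : b ∈ E
    swap; · simp [hb]
    obtain ⟨g, hg⟩ : ∃ g : ℝ → ℝ, g = fun θ => Real.pi / 2 * D (rotFst θ a b) (rotSnd θ a b) :=
      ⟨_, rfl⟩
    have hgc : Continuous g := by
      rw [hg]
      refine continuous_const.mul (hD.comp (Continuous.prodMk (f := fun θ => rotFst θ a b)
        (g := fun θ => rotSnd θ a b) ?_ ?_))
      · unfold rotFst; fun_prop
      · unfold rotSnd; fun_prop
    have h_int : ∀ {k : ℝ → ℝ}, Continuous k → Integrable k quarterLaw := fun hk => by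
      unfold quarterLaw
      exact (hk.integrableOn_Ioc).smul_measure ENNReal.ofReal_ne_top
    have heq : F b - F a = ∫ θ, g θ ∂quarterLaw := by
      rw [hFD, quarterLaw, integral_smul_measure,
        ENNReal.toReal_ofReal (by positivity), hg, integral_const_mul,
        intervalIntegral.integral_of_le (by positivity), smul_eq_mul, ← mul_assoc,
        inv_mul_cancel₀ (by positivity), one_mul]
    have hj := hΦ.map_integral_le (μ := quarterLaw) (f := g) hΦc.continuousOn isClosed_univ
      (by simp) (h_int hgc) (h_int (hΦc.comp hgc))
    rw [heq]
    simp only [Set.indicator_of_mem ha, Set.indicator_of_mem hb, Pi.one_apply, one_mul]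
    refine (ENNReal.ofReal_le_ofReal hj).trans ?_
    rw [ofReal_integral_eq_lintegral_ofReal (f := fun θ => Φ (g θ)) (h_int (hΦc.comp hgc)) (ae_of_all _ fun _ => hΦ0 _)]
    refine lintegral_mono fun θ => ?_
    rw [← hG, Set.indicator_of_mem (hEE' a ha b hb θ), Pi.one_apply, one_mul, hg]
  have hm3 : Measurable fun p : (ℝ × (ℤ → ℂ)) × (ℤ → ℂ) =>
      G (rotFst p.1.1 p.1.2 p.2) (rotSnd p.1.1 p.1.2 p.2) := hGm.comp hrot
  calc _ ≤ ∫⁻ a, ∫⁻ b, ∫⁻ θ, G (rotFst θ a b) (rotSnd θ a b) ∂quarterLaw ∂seqLaw ∂seqLaw :=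
        lintegral_mono fun a => lintegral_mono fun b => key a b
    _ = ∫⁻ a, ∫⁻ θ, ∫⁻ b, G (rotFst θ a b) (rotSnd θ a b) ∂seqLaw ∂quarterLaw ∂seqLaw := by
        refine lintegral_congr fun a => lintegral_lintegral_swap ?_
        exact (hm3.comp ((measurable_snd.prodMk measurable_const).prodMk
          measurable_fst)).aemeasurable
    _ = ∫⁻ θ, ∫⁻ a, ∫⁻ b, G (rotFst θ a b) (rotSnd θ a b) ∂seqLaw ∂seqLaw ∂quarterLaw := by
        refine lintegral_lintegral_swap ?_
        exact (hm3.comp (measurable_swap.prodMap measurable_id)).lintegral_prod_right'.aemeasurable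
    -- Each angle contributes the same amount by rotation invariance, so the average over θ
    -- disappears.
    _ = ∫⁻ a, ∫⁻ b, G a b ∂seqLaw ∂seqLaw := by
        simp only [lintegral_rotation _ hGm, lintegral_const, measure_univ, mul_one]

/-- The Maurey–Pisier interpolation inequality for `quartic`. -/
theorem lintegral_convex_quartic_sub_le {S B : Finset ℤ} (hB : B ⊆ S) (c : ℤ → ℂ) {Φ : ℝ → ℝ}
    (hΦ : ConvexOn ℝ Set.univ Φ) (hΦc : Continuous Φ) (hΦ0 : ∀ x, 0 ≤ Φ x)
    {E E' : Set (ℤ → ℂ)} (hE' : MeasurableSet E')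
    (hEE' : ∀ a ∈ E, ∀ b ∈ E, ∀ θ, rotFst θ a b ∈ E') :
    ∫⁻ a, ∫⁻ b, E.indicator 1 a * E.indicator 1 b * ENNReal.ofReal
        (Φ (quartic S (splice B c b) - quartic S (splice B c a))) ∂seqLaw ∂seqLaw ≤
      ∫⁻ a, ∫⁻ b, E'.indicator 1 a *
        ENNReal.ofReal (Φ (Real.pi / 2 * dirDeriv S B (splice B c a) b)) ∂seqLaw ∂seqLaw := by
  have hsp : Continuous fun a : ℤ → ℂ => splice B c a :=
    (continuous_splice B).comp (continuous_const.prodMk continuous_id)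
  have hD : Continuous fun p : (ℤ → ℂ) × (ℤ → ℂ) => dirDeriv S B (splice B c p.1) p.2 :=
    Continuous.comp (f := fun p : (ℤ → ℂ) × (ℤ → ℂ) => (splice B c p.1, p.2))
      (continuous_dirDeriv S B) ((hsp.comp continuous_fst).prodMk continuous_snd)
  obtain ⟨D, hDe⟩ : ∃ D : (ℤ → ℂ) → (ℤ → ℂ) → ℝ, ∀ a b, dirDeriv S B (splice B c a) b = D a b :=
    ⟨_, fun _ _ => rfl⟩
  obtain ⟨F, hFe⟩ : ∃ F : (ℤ → ℂ) → ℝ, ∀ a, quartic S (splice B c a) = F a := ⟨_, fun _ => rfl⟩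
  have h : ∀ a b, F b - F a = ∫ θ in (0 : ℝ)..Real.pi / 2, D (rotFst θ a b) (rotSnd θ a b) := by
    intro a b
    simp only [← hDe, ← hFe]
    exact quartic_sub_eq_integral hB c a b
  simp only [hDe] at hD
  simp only [hDe, hFe]
  exact lintegral_convex_sub_le hD h hΦ hΦc hΦ0 hE' hEE'

/-- At a fixed base point the derivative is a real linear functional of the Gaussian direction. -/
theorem lintegral_exp_dirDeriv (S B : Finset ℤ) (w : ℤ → ℂ) (t : ℝ) :
    ∫⁻ b, ENNReal.ofReal (Real.exp (t * dirDeriv S B w b)) ∂seqLaw =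
      ENNReal.ofReal (Real.exp (t ^ 2 * ∑ n ∈ B, ‖gradSeq S w n‖ ^ 2 / (4 * bracketSq n))) := by
  have h := lintegral_exp_sum_re_seqLaw B fun n => (t : ℂ) * gradSeq S w n
  have e1 : ∀ b : ℤ → ℂ, (∑ n ∈ B, (t : ℂ) * gradSeq S w n * b n).re = t * dirDeriv S B w b := by
    intro b
    unfold dirDeriv
    rw [← Complex.re_ofReal_mul, Finset.mul_sum]
    congr 1
    exact Finset.sum_congr rfl fun n _ => by ring
  simp only [e1] at h
  rw [h, Finset.mul_sum]
  congr 2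
  refine Finset.sum_congr rfl fun n _ => ?_
  rw [norm_mul, mul_pow, Complex.norm_real, Real.norm_eq_abs, sq_abs]
  ring

theorem sum_gradSeq_div_le {S B : Finset ℤ} {κ : ℝ} (hκ : 0 < κ) (hB : ∀ n ∈ B, κ ≤ bracketSq n)
    (w : ℤ → ℂ) :
    ∑ n ∈ B, ‖gradSeq S w n‖ ^ 2 / (4 * bracketSq n) ≤ 9 / κ *
      ∫ x, ‖trigPoly S w x‖ ^ 4 * ‖trigPoly S (derivSeq w) x‖ ^ 2 ∂circLaw := by
  have h1 : ∑ n ∈ B, ‖gradSeq S w n‖ ^ 2 / (4 * bracketSq n) ≤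
      ∑ n ∈ B, ‖gradSeq S w n‖ ^ 2 / (4 * κ) := by
    refine Finset.sum_le_sum fun n hn => ?_
    have := hB n hn
    gcongr
  have h2 := sum_norm_sq_gradSeq_le S B w
  rw [← Finset.sum_div] at h1
  refine h1.trans ?_
  rw [div_le_iff₀ (by positivity)]
  refine h2.trans (le_of_eq ?_)
  field_simp
  ring

theorem sq_div_two_le_exp_add_exp_neg (x : ℝ) : x ^ 2 / 2 ≤ Real.exp x + Real.exp (-x) := by
  rcases le_total 0 x with h | h
  · have h1 := Real.quadratic_le_exp_of_nonneg h
    have h2 := Real.exp_pos (-x)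
    linarith
  · have h1 := Real.quadratic_le_exp_of_nonneg (x := -x) (by linarith)
    have h2 := Real.exp_pos x
    rw [neg_sq] at h1
    linarith

/-- The second moment is read off from exponential moments at t = ±s^{-1/2}, through x²/2 ≤ e^x +
e^{-x}. This gives 4e·s, which 12s covers. When s = 0 the gradient vanishes on B and there is no
such t. -/
theorem lintegral_dirDeriv_sq_le (S B : Finset ℤ) (w : ℤ → ℂ) :
    ∫⁻ b, ENNReal.ofReal (dirDeriv S B w b ^ 2) ∂seqLaw ≤
      ENNReal.ofReal (12 * ∑ n ∈ B, ‖gradSeq S w n‖ ^ 2 / (4 * bracketSq n)) := by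
  set s := ∑ n ∈ B, ‖gradSeq S w n‖ ^ 2 / (4 * bracketSq n) with hs
  have hterm : ∀ n ∈ B, 0 ≤ ‖gradSeq S w n‖ ^ 2 / (4 * bracketSq n) := fun n _ => by
    have := bracketSq_pos n; positivity
  have hs0 : 0 ≤ s := Finset.sum_nonneg hterm
  rcases hs0.eq_or_lt with h | h
  · have hz : ∀ n ∈ B, gradSeq S w n = 0 := by
      intro n hn
      have := (Finset.sum_eq_zero_iff_of_nonneg hterm).1 h.symm n hn
      have hk := bracketSq_pos n
      rw [div_eq_zero_iff] at this
      rcases this with h1 | h1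
      · simpa using h1
      · linarith
    have : ∀ b, dirDeriv S B w b = 0 := fun b => by
      unfold dirDeriv
      rw [Finset.sum_eq_zero fun n hn => by rw [hz n hn, zero_mul], Complex.zero_re]
    simp [this]
  · set t := (Real.sqrt s)⁻¹ with ht
    have hss : 0 < Real.sqrt s := Real.sqrt_pos.2 h
    have hts : t ^ 2 * s = 1 := by
      rw [ht, inv_pow, Real.sq_sqrt hs0, inv_mul_cancel₀ h.ne']
    have hpt : ∀ b, ENNReal.ofReal (dirDeriv S B w b ^ 2) ≤ ENNReal.ofReal (2 * s) *
        (ENNReal.ofReal (Real.exp (t * dirDeriv S B w b)) +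
          ENNReal.ofReal (Real.exp (-t * dirDeriv S B w b))) := by
      intro b
      rw [← ENNReal.ofReal_add (Real.exp_pos _).le (Real.exp_pos _).le, ← ENNReal.ofReal_mul (by positivity)]
      refine ENNReal.ofReal_le_ofReal ?_
      have h1 := sq_div_two_le_exp_add_exp_neg (t * dirDeriv S B w b)
      rw [← neg_mul] at h1
      have h2 : dirDeriv S B w b ^ 2 = s * (t * dirDeriv S B w b) ^ 2 := by
        rw [mul_pow, ← mul_assoc, mul_comm s, hts, one_mul]
      rw [h2]
      nlinarith
    refine (lintegral_mono hpt).trans ?_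
    have hm : Measurable fun b => dirDeriv S B w b :=
      ((continuous_dirDeriv S B).comp (f := fun b : ℤ → ℂ => (w, b))
        (continuous_const.prodMk continuous_id)).measurable
    rw [lintegral_const_mul _ (by fun_prop), lintegral_add_left (by fun_prop),
      lintegral_exp_dirDeriv, lintegral_exp_dirDeriv, neg_sq, ← hs, hts,
      ← ENNReal.ofReal_add (Real.exp_pos _).le (Real.exp_pos _).le, ← ENNReal.ofReal_mul (by positivity)]
    refine ENNReal.ofReal_le_ofReal ?_
    nlinarith [Real.exp_one_lt_d9]

/-! ### The mean of the quartic functional over a block. -/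

/-- `∑ n |c_n|²` over the frequencies in `S`. -/
def momentum (S : Finset ℤ) (c : ℤ → ℂ) : ℝ := ∑ n ∈ S, (n : ℝ) * ‖c n‖ ^ 2

theorem integral_deriv_mul_conj (S : Finset ℤ) (c : ℤ → ℂ) :
    ∫ x, trigPoly S (derivSeq c) x * conj (trigPoly S c x) ∂circLaw =
      Complex.I * (momentum S c : ℂ) := by
  rw [integral_trigPoly_mul_conj]
  unfold momentum derivSeq
  push_cast
  rw [Finset.mul_sum]
  refine Finset.sum_congr rfl fun n _ => ?_
  rw [mul_assoc, Complex.mul_conj, Complex.normSq_eq_norm_sq]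
  push_cast
  ring

theorem norm_trigPoly_le (S : Finset ℤ) (c : ℤ → ℂ) (x : ℝ) :
    ‖trigPoly S c x‖ ≤ ∑ n ∈ S, ‖c n‖ := by
  unfold trigPoly
  refine (norm_sum_le _ _).trans (Finset.sum_le_sum fun n _ => ?_)
  rw [norm_mul, norm_exp_freq, mul_one]

theorem norm_sq_trigPoly_le (S : Finset ℤ) (c : ℤ → ℂ) (x : ℝ) :
    ‖trigPoly S c x‖ ^ 2 ≤ S.card * ∑ n ∈ S, ‖c n‖ ^ 2 :=
  (pow_le_pow_left₀ (norm_nonneg _) (norm_trigPoly_le S c x) 2).trans sq_sum_le_card_mul_sum_sq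

theorem norm_derivSeq (c : ℤ → ℂ) (n : ℤ) : ‖derivSeq c n‖ = |(n : ℝ)| * ‖c n‖ := by
  unfold derivSeq
  rw [norm_mul, norm_mul, Complex.norm_I, one_mul, Complex.norm_intCast]

theorem abs_quartic_le_integral (S : Finset ℤ) (c : ℤ → ℂ) :
    |quartic S c| ≤ 3 / 2 * ∫ x, ‖trigPoly S c x‖ ^ 3 * ‖trigPoly S (derivSeq c) x‖ ∂circLaw := by
  unfold quartic
  refine (Complex.abs_re_le_norm _).trans ?_
  rw [norm_mul]
  have : ‖-(3 * Complex.I / 2)‖ = 3 / 2 := by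
    rw [norm_neg, norm_div, norm_mul, Complex.norm_I]; norm_num
  rw [this]
  refine mul_le_mul_of_nonneg_left ((norm_integral_le_integral_norm _).trans (le_of_eq ?_))
    (by norm_num)
  congr 1
  ext x
  rw [norm_mul, norm_mul, norm_pow, Complex.norm_conj]
  ring

/-- A crude bound whose constant depends on S. It serves only for integrability. -/
theorem exists_abs_quartic_le (S : Finset ℤ) :
    ∃ C : ℝ, 0 ≤ C ∧ ∀ c, |quartic S c| ≤ C * (∑ n ∈ S, ‖c n‖ ^ 2) ^ 2 := by
  set D := ∑ n ∈ S, |(n : ℝ)| with hD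
  have hD0 : 0 ≤ D := Finset.sum_nonneg fun _ _ => abs_nonneg _
  refine ⟨3 / 2 * (D * (S.card : ℝ) ^ 2), by positivity, fun c => ?_⟩
  set l := ∑ n ∈ S, ‖c n‖ with hl
  have hl0 : 0 ≤ l := Finset.sum_nonneg fun _ _ => norm_nonneg _
  have hl2 : l ^ 2 ≤ S.card * ∑ n ∈ S, ‖c n‖ ^ 2 := sq_sum_le_card_mul_sum_sq
  have hder : ∀ x, ‖trigPoly S (derivSeq c) x‖ ≤ D * l := fun x => by
    refine (norm_trigPoly_le S _ x).trans ?_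
    rw [hl, Finset.mul_sum]
    refine Finset.sum_le_sum fun n hn => ?_
    rw [norm_derivSeq]
    exact mul_le_mul_of_nonneg_right
      (Finset.single_le_sum (f := fun n : ℤ => |(n : ℝ)|) (fun _ _ => abs_nonneg _) hn)
      (norm_nonneg _)
  have h_int : ∫ x, ‖trigPoly S c x‖ ^ 3 * ‖trigPoly S (derivSeq c) x‖ ∂circLaw ≤ D * l ^ 4 := by
    have : ∫ x, ‖trigPoly S c x‖ ^ 3 * ‖trigPoly S (derivSeq c) x‖ ∂circLaw ≤
        ∫ _, D * l ^ 4 ∂circLaw := by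
      refine integral_mono (integrable_circLaw (by fun_prop)) (integrable_const _) fun x => ?_
      calc ‖trigPoly S c x‖ ^ 3 * ‖trigPoly S (derivSeq c) x‖ ≤ l ^ 3 * (D * l) :=
            mul_le_mul (pow_le_pow_left₀ (norm_nonneg _) (norm_trigPoly_le S c x) 3) (hder x)
              (norm_nonneg _) (by positivity)
        _ = D * l ^ 4 := by ring
    simpa using this
  refine (abs_quartic_le_integral S c).trans ?_
  have h4 : l ^ 4 ≤ (S.card : ℝ) ^ 2 * (∑ n ∈ S, ‖c n‖ ^ 2) ^ 2 := by
    have := pow_le_pow_left₀ (by positivity) hl2 2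
    calc l ^ 4 = (l ^ 2) ^ 2 := by ring
      _ ≤ _ := this
      _ = _ := by ring
  calc 3 / 2 * ∫ x, ‖trigPoly S c x‖ ^ 3 * ‖trigPoly S (derivSeq c) x‖ ∂circLaw
      ≤ 3 / 2 * (D * l ^ 4) := by linarith
    _ ≤ 3 / 2 * (D * ((S.card : ℝ) ^ 2 * (∑ n ∈ S, ‖c n‖ ^ 2) ^ 2)) := by gcongr
    _ = _ := by ring

/-- Quadratic growth in the mass is dominated by exp(½ Σ |a_n|²), which is integrable because ⟨n⟩² ≥
1 > ½. -/
theorem integrable_of_le_sq_sum {G : (ℤ → ℂ) → ℂ} (hG : Measurable G) (B : Finset ℤ) {A C : ℝ}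
    (h : ∀ a, ‖G a‖ ≤ C * (A + ∑ n ∈ B, ‖a n‖ ^ 2) ^ 2) : Integrable G seqLaw := by
  have hexp : Integrable (fun a : ℤ → ℂ => Real.exp (∑ n ∈ B, (1 / 2 : ℝ) * ‖a n‖ ^ 2)) seqLaw := by
    refine ⟨Measurable.aestronglyMeasurable (by fun_prop), ?_⟩
    rw [hasFiniteIntegral_iff_ofReal (ae_of_all _ fun _ => (Real.exp_pos _).le),
      lintegral_exp_sum_norm_sq_seqLaw B (t := fun _ => 1 / 2)
        (fun n _ => by have := one_le_bracketSq n; linarith)]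
    exact ENNReal.ofReal_lt_top
  have hC : 0 ≤ |C| := abs_nonneg C
  refine Integrable.mono' (hexp.const_mul (|C| * (8 * Real.exp (|A| / 2)))) hG.aestronglyMeasurable
    (ae_of_all _ fun a => (h a).trans ?_)
  have hx : 0 ≤ ∑ n ∈ B, ‖a n‖ ^ 2 := Finset.sum_nonneg fun _ _ => by positivity
  set x := ∑ n ∈ B, ‖a n‖ ^ 2
  have h1 : (A + x) ^ 2 ≤ (|A| + x) ^ 2 := by
    refine sq_le_sq' ?_ ?_ <;> cases abs_cases A <;> linarith
  have h2 := Real.quadratic_le_exp_of_nonneg (x := (|A| + x) / 2) (by positivity)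
  have h3 : Real.exp ((|A| + x) / 2) = Real.exp (|A| / 2) *
      Real.exp (∑ n ∈ B, (1 / 2 : ℝ) * ‖a n‖ ^ 2) := by
    rw [← Real.exp_add, ← Finset.mul_sum]
    congr 1
    ring
  have h4 : (|A| + x) ^ 2 ≤ 8 * Real.exp ((|A| + x) / 2) := by
    have : 0 ≤ |A| + x := by positivity
    nlinarith
  rw [mul_assoc, mul_assoc, ← h3]
  calc C * (A + x) ^ 2 ≤ |C| * (A + x) ^ 2 := by gcongr; exact le_abs_self C
    _ ≤ |C| * (8 * Real.exp ((|A| + x) / 2)) := by gcongr; exact h1.trans h4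

theorem integrable_quartic_splice {S B : Finset ℤ} (hB : B ⊆ S) (c : ℤ → ℂ) :
    Integrable (fun a => quartic S (splice B c a)) seqLaw := by
  obtain ⟨C, _, hC⟩ := exists_abs_quartic_le S
  have hm : Measurable fun a => quartic S (splice B c a) := by
    refine ((continuous_quartic S).comp (f := fun a : ℤ → ℂ => splice B c a) ?_).measurable
    exact (continuous_splice B).comp (continuous_const.prodMk continuous_id)
  have h := integrable_of_le_sq_sum (G := fun a => ((quartic S (splice B c a) : ℝ) : ℂ))
    (by fun_prop) B (A := ∑ n ∈ S \ B, ‖c n‖ ^ 2) (C := C) (fun a => ?_)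
  · exact h.re
  · rw [Complex.norm_real, Real.norm_eq_abs]
    refine (hC _).trans (le_of_eq ?_)
    rw [← Finset.sum_sdiff hB]
    congr 3
    · refine Finset.sum_congr rfl fun n hn => ?_
      rw [splice_of_notMem (by simpa using (Finset.mem_sdiff.1 hn).2)]
    · refine Finset.sum_congr rfl fun n hn => ?_
      rw [splice_of_mem (by simpa using hn)]

theorem integrable_mul_conj (n k : ℤ) : Integrable (fun a : ℤ → ℂ => a n * conj (a k)) seqLaw := by
  refine integrable_of_le_sq_sum (by fun_prop) {n, k} (A := 1) (C := 1) fun a => ?_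
  rw [norm_mul, Complex.norm_conj, one_mul]
  have h1 : ‖a n‖ ^ 2 ≤ ∑ j ∈ {n, k}, ‖a j‖ ^ 2 :=
    Finset.single_le_sum (f := fun j => ‖a j‖ ^ 2) (fun _ _ => by positivity) (by simp)
  have h2 : ‖a k‖ ^ 2 ≤ ∑ j ∈ {n, k}, ‖a j‖ ^ 2 :=
    Finset.single_le_sum (f := fun j => ‖a j‖ ^ 2) (fun _ _ => by positivity) (by simp)
  nlinarith [sq_nonneg (‖a n‖ - ‖a k‖)]

theorem setIntegral_comp_eq {F : Type*} [NormedAddCommGroup F] [NormedSpace ℝ F]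
    {T : (ℤ → ℂ) → ℤ → ℂ} (hT : Measurable T) (hmap : seqLaw.map T = seqLaw)
    {E : Set (ℤ → ℂ)} (hE : MeasurableSet E) (hinv : ∀ a, T a ∈ E ↔ a ∈ E) {G : (ℤ → ℂ) → F}
    (hG : AEStronglyMeasurable G seqLaw) :
    ∫ a in E, G (T a) ∂seqLaw = ∫ a in E, G a ∂seqLaw := by
  have h : T ⁻¹' E = E := by ext a; exact hinv a
  have h1 : ∫ a in E, G a ∂seqLaw = ∫ a in E, G a ∂(seqLaw.map T) := by rw [hmap]
  rw [h1, setIntegral_map hE (by rw [hmap]; exact hG) hT.aemeasurable, h]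

theorem trigPoly_const_mul (S : Finset ℤ) (e : ℂ) (a : ℤ → ℂ) (x : ℝ) :
    trigPoly S (fun n => e * a n) x = e * trigPoly S a x := by
  unfold trigPoly
  rw [Finset.mul_sum]
  exact Finset.sum_congr rfl fun n _ => by ring

theorem derivSeq_const_mul (e : ℂ) (a : ℤ → ℂ) :
    derivSeq (fun n => e * a n) = fun n => e * derivSeq a n := by
  ext n; simp only [derivSeq]; ring

/-- The coefficients of the part of `quartic` that is sesquilinear in the high frequencies. -/
def crossCoeff (V : Finset ℤ) (c : ℤ → ℂ) (n k : ℤ) : ℂ :=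
  ∫ x : ℝ, (2 * (trigPoly V (derivSeq c) x * conj (trigPoly V c x)) +
    2 * (Complex.I * n) * (trigPoly V c x * conj (trigPoly V c x))) *
    (Complex.exp (Complex.I * n * x) * conj (Complex.exp (Complex.I * k * x))) ∂circLaw

/-- A term of bidegree (j, k) in (a, ā) is multiplied by e^{j-k} for a phase e. Here |j - k| ≤ 2, so
summing over the fourth roots of unity leaves bidegrees (0,0), (1,1) and (2,2): the low part, the
sesquilinear cross term and the high part. -/
theorem sum_phase_quartic {S B : Finset ℤ} (hB : B ⊆ S) (c a : ℤ → ℂ) :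
    quartic S (splice B c a) + quartic S (splice B c fun n => Complex.I * a n) +
      quartic S (splice B c fun n => -1 * a n) + quartic S (splice B c fun n => -Complex.I * a n) =
    4 * (quartic (S \ B) c + quartic B a + (-(3 * Complex.I / 2) *
      ∑ n ∈ B, ∑ k ∈ B, crossCoeff (S \ B) c n k * (a n * conj (a k))).re) := by
  have hq : ∀ e : ℂ, quartic S (splice B c fun n => e * a n) = (-(3 * Complex.I / 2) *
      ∫ x, (trigPoly (S \ B) c x + e * trigPoly B a x) *
        (conj (trigPoly (S \ B) c x) + conj e * conj (trigPoly B a x)) ^ 2 *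
        (trigPoly (S \ B) (derivSeq c) x + e * trigPoly B (derivSeq a) x) ∂circLaw).re := by
    intro e
    unfold quartic
    simp only [derivSeq_splice, derivSeq_const_mul, trigPoly_splice hB, trigPoly_const_mul, map_add,
      map_mul]
  have hq1 := hq 1
  simp only [one_mul, map_one] at hq1
  have hcross : ∑ n ∈ B, ∑ k ∈ B, crossCoeff (S \ B) c n k * (a n * conj (a k)) =
      ∫ x, (2 * (trigPoly (S \ B) (derivSeq c) x * conj (trigPoly (S \ B) c x)) *
        (trigPoly B a x * conj (trigPoly B a x)) +
        2 * (trigPoly (S \ B) c x * conj (trigPoly (S \ B) c x)) *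
        (trigPoly B (derivSeq a) x * conj (trigPoly B a x))) ∂circLaw := by
    have : ∀ x, 2 * (trigPoly (S \ B) (derivSeq c) x * conj (trigPoly (S \ B) c x)) *
        (trigPoly B a x * conj (trigPoly B a x)) +
        2 * (trigPoly (S \ B) c x * conj (trigPoly (S \ B) c x)) *
        (trigPoly B (derivSeq a) x * conj (trigPoly B a x)) = ∑ n ∈ B, ∑ k ∈ B,
        (a n * conj (a k)) * ((2 * (trigPoly (S \ B) (derivSeq c) x *
        conj (trigPoly (S \ B) c x)) + 2 * (Complex.I * n) * (trigPoly (S \ B) c x *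
        conj (trigPoly (S \ B) c x))) * (Complex.exp (Complex.I * n * x) *
        conj (Complex.exp (Complex.I * k * x)))) := by
      intro x
      have e1 : trigPoly B a x * conj (trigPoly B a x) = ∑ n ∈ B, ∑ k ∈ B,
          (a n * conj (a k)) * (Complex.exp (Complex.I * n * x) *
          conj (Complex.exp (Complex.I * k * x))) := by
        unfold trigPoly
        rw [map_sum, Finset.sum_mul_sum]
        refine Finset.sum_congr rfl fun n _ => Finset.sum_congr rfl fun k _ => ?_
        rw [map_mul]; ring
      have e2 : trigPoly B (derivSeq a) x * conj (trigPoly B a x) = ∑ n ∈ B, ∑ k ∈ B,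
          (Complex.I * n) * ((a n * conj (a k)) * (Complex.exp (Complex.I * n * x) *
          conj (Complex.exp (Complex.I * k * x)))) := by
        unfold trigPoly derivSeq
        rw [map_sum, Finset.sum_mul_sum]
        refine Finset.sum_congr rfl fun n _ => Finset.sum_congr rfl fun k _ => ?_
        rw [map_mul]; ring
      rw [e1, e2, Finset.mul_sum, Finset.mul_sum, ← Finset.sum_add_distrib]
      refine Finset.sum_congr rfl fun n _ => ?_
      rw [Finset.mul_sum, Finset.mul_sum, ← Finset.sum_add_distrib]
      refine Finset.sum_congr rfl fun k _ => ?_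
      ring
    simp only [this]
    rw [integral_finsetSum _ fun n _ => integrable_circLaw (by fun_prop)]
    refine Finset.sum_congr rfl fun n _ => ?_
    rw [integral_finsetSum _ fun n _ => integrable_circLaw (by fun_prop)]
    refine Finset.sum_congr rfl fun k _ => ?_
    rw [integral_const_mul, crossCoeff, mul_comm]
  rw [hq1, hq, hq, hq, hcross]
  unfold quartic
  simp only [← Complex.add_re, ← mul_add]
  rw [← Complex.re_ofReal_mul]
  congr 1
  rw [← integral_add (integrable_circLaw (by fun_prop)) (integrable_circLaw (by fun_prop)),
    ← integral_add (integrable_circLaw (by fun_prop)) (integrable_circLaw (by fun_prop)),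
    ← integral_add (integrable_circLaw (by fun_prop)) (integrable_circLaw (by fun_prop)),
    ← integral_add (integrable_circLaw (by fun_prop)) (integrable_circLaw (by fun_prop)),
    ← integral_add (integrable_circLaw (by fun_prop)) (integrable_circLaw (by fun_prop)),
    mul_left_comm, ← integral_const_mul, ← integral_const_mul, ← integral_const_mul]
  refine integral_congr_ae (ae_of_all _ fun x => ?_)
  dsimp only
  generalize trigPoly (S \ B) c x = v
  generalize trigPoly B a x = h
  generalize trigPoly (S \ B) (derivSeq c) x = v'
  generalize trigPoly B (derivSeq a) x = h'
  simp only [map_neg, map_one, Complex.conj_I]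
  generalize conj v = w
  generalize conj h = k
  have h3 : Complex.I ^ 3 = -Complex.I := Complex.I_pow_three
  have h5 : Complex.I ^ 5 = Complex.I := by rw [pow_succ, Complex.I_pow_four, one_mul]
  push_cast
  ring_nf
  simp only [h3, h5]
  ring

/-- Measurable sets of sequences invariant under translation, multiplication by `i` and
reflection. -/
structure BlockInvariant (E : Set (ℤ → ℂ)) : Prop where
  measurableSet : MeasurableSet E
  translate : ∀ (y : ℝ) (a : ℤ → ℂ), (fun n : ℤ => Complex.exp (Complex.I * n * y) * a n) ∈ E ↔ a ∈ E
  mul_I : ∀ a : ℤ → ℂ, (fun n => Complex.I * a n) ∈ E ↔ a ∈ E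
  reflect : ∀ a : ℤ → ℂ, (fun n => a (-n)) ∈ E ↔ a ∈ E

/-- Translation by π/(n - k) multiplies a_n ā_k by e^{iπ} = -1 and preserves both the law and the
set. -/
theorem setIntegral_mul_conj_eq_zero {E : Set (ℤ → ℂ)} (hE : BlockInvariant E) {n k : ℤ}
    (hnk : n ≠ k) : ∫ a in E, a n * conj (a k) ∂seqLaw = 0 := by
  have hd : ((n : ℝ) - k) ≠ 0 := sub_ne_zero.2 (by exact_mod_cast hnk)
  have hdc : ((n : ℂ) - k) ≠ 0 := sub_ne_zero.2 (by exact_mod_cast hnk)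
  have h := setIntegral_comp_eq
    (T := fun a j => Complex.exp (Complex.I * j * ((Real.pi / (n - k) : ℝ) : ℂ)) * a j)
    (by fun_prop) (seqLaw_map_phase fun j => norm_exp_freq j _) hE.measurableSet
    (fun a => hE.translate _ a) (integrable_mul_conj n k).aestronglyMeasurable
  have e : ∀ a : ℤ → ℂ, Complex.exp (Complex.I * n * ((Real.pi / (n - k) : ℝ) : ℂ)) * a n *
      conj (Complex.exp (Complex.I * k * ((Real.pi / (n - k) : ℝ) : ℂ)) * a k) =
      -(a n * conj (a k)) := by
    intro a
    rw [map_mul, conj_exp_freq]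
    have : Complex.exp (Complex.I * n * ((Real.pi / (n - k) : ℝ) : ℂ)) *
        Complex.exp (Complex.I * (-k : ℤ) * ((Real.pi / (n - k) : ℝ) : ℂ)) = -1 := by
      rw [← Complex.exp_add, ← Complex.exp_pi_mul_I]
      congr 1
      push_cast
      field_simp
      ring
    linear_combination (a n * conj (a k)) * this
  simp only [e] at h
  rw [integral_neg] at h
  exact self_eq_neg.1 h.symm

theorem integrable_norm_sq (n : ℤ) : Integrable (fun a : ℤ → ℂ => ‖a n‖ ^ 2) seqLaw := by
  have h := (integrable_mul_conj n n).re
  refine h.congr (ae_of_all _ fun a => ?_)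
  simp only [Complex.mul_conj, Complex.normSq_eq_norm_sq]
  simp only [RCLike.re_eq_complex_re, Complex.ofReal_re]

theorem setIntegral_norm_sq_neg {E : Set (ℤ → ℂ)} (hE : BlockInvariant E) (n : ℤ) :
    ∫ a in E, ‖a (-n)‖ ^ 2 ∂seqLaw = ∫ a in E, ‖a n‖ ^ 2 ∂seqLaw :=
  setIntegral_comp_eq (T := fun a j => a (-j)) (by fun_prop) seqLaw_map_reflect hE.measurableSet
    hE.reflect (integrable_norm_sq n).aestronglyMeasurable

theorem integral_norm_sq_trigPoly_complex (S : Finset ℤ) (c : ℤ → ℂ) :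
    ∫ x, trigPoly S c x * conj (trigPoly S c x) ∂circLaw = ((∑ n ∈ S, ‖c n‖ ^ 2 : ℝ) : ℂ) := by
  rw [integral_trigPoly_mul_conj]
  push_cast
  refine Finset.sum_congr rfl fun n _ => ?_
  rw [Complex.mul_conj, Complex.normSq_eq_norm_sq]
  push_cast
  rfl

theorem crossCoeff_self (V : Finset ℤ) (c : ℤ → ℂ) (n : ℤ) :
    crossCoeff V c n n = 2 * (Complex.I * (momentum V c : ℂ)) +
      2 * (Complex.I * n) * ((∑ k ∈ V, ‖c k‖ ^ 2 : ℝ) : ℂ) := by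
  unfold crossCoeff
  have h : ∀ x : ℝ, Complex.exp (Complex.I * n * x) * conj (Complex.exp (Complex.I * n * x)) = 1 := by
    intro x
    rw [Complex.mul_conj, Complex.normSq_eq_norm_sq, norm_exp_freq]
    simp
  simp only [h, mul_one]
  rw [integral_add (integrable_circLaw (by fun_prop)) (integrable_circLaw (by fun_prop)),
    integral_const_mul, integral_const_mul, integral_deriv_mul_conj,
    integral_norm_sq_trigPoly_complex]

/-- The mean of `quartic` over the high frequencies, on an invariant set. -/
theorem setIntegral_quartic_splice {S B : Finset ℤ} (hB : B ⊆ S) (hBs : ∀ n, n ∈ B ↔ -n ∈ B)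
    {E : Set (ℤ → ℂ)} (hE : BlockInvariant E) (c : ℤ → ℂ) :
    ∫ a in E, quartic S (splice B c a) ∂seqLaw = seqLaw.real E * quartic (S \ B) c +
      3 * momentum (S \ B) c * ∑ n ∈ B, ∫ a in E, ‖a n‖ ^ 2 ∂seqLaw := by
  have hEm := hE.measurableSet
  have h_int := integrable_quartic_splice hB c
  have hI2 : ∀ a : ℤ → ℂ, (fun n => -1 * a n) ∈ E ↔ a ∈ E := by
    intro a
    rw [← hE.mul_I a, ← hE.mul_I fun n => Complex.I * a n]
    have : (fun n => Complex.I * (Complex.I * a n)) = fun n => -1 * a n := by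
      ext n; rw [← mul_assoc, Complex.I_mul_I]
    rw [this]
  have hI3 : ∀ a : ℤ → ℂ, (fun n => -Complex.I * a n) ∈ E ↔ a ∈ E := by
    intro a
    rw [← hI2 a, ← hE.mul_I fun n => -1 * a n]
    have : (fun n => Complex.I * (-1 * a n)) = fun n => -Complex.I * a n := by
      ext n; ring
    rw [this]
  have hrot : ∀ e : ℂ, ‖e‖ = 1 → (∀ a : ℤ → ℂ, (fun n => e * a n) ∈ E ↔ a ∈ E) →
      ∫ a in E, quartic S (splice B c fun n => e * a n) ∂seqLaw =
        ∫ a in E, quartic S (splice B c a) ∂seqLaw := fun e he h =>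
    setIntegral_comp_eq (T := fun a n => e * a n) (G := fun a => quartic S (splice B c a))
      (by fun_prop) (seqLaw_map_phase fun _ => he) hEm h h_int.aestronglyMeasurable
  have hinte : ∀ e : ℂ, ‖e‖ = 1 →
      Integrable (fun a : ℤ → ℂ => quartic S (splice B c fun n => e * a n)) seqLaw := by
    intro e he
    have h := h_int
    rw [← seqLaw_map_phase (e := fun _ => e) fun _ => he] at h
    exact h.comp_measurable (by fun_prop)
  have hBB := integrable_quartic_splice (Finset.Subset.refl B) (0 : ℤ → ℂ)
  have hqB : Integrable (quartic B) seqLaw := by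
    refine hBB.congr (ae_of_all _ fun a => ?_)
    unfold quartic
    simp only [derivSeq_splice, trigPoly_splice (Finset.Subset.refl B), sdiff_self]
    simp [trigPoly]
  -- The purely high part is odd under reflection, which preserves the set E.
  have hqB0 : ∫ a in E, quartic B a ∂seqLaw = 0 := by
    have h := setIntegral_comp_eq (T := fun a j => a (-j)) (by fun_prop) seqLaw_map_reflect hEm
      hE.reflect hqB.aestronglyMeasurable
    simp only [quartic_reflect hBs] at h
    rw [integral_neg] at h
    exact self_eq_neg.1 h.symm
  have hsumi : Integrable (fun a : ℤ → ℂ => -(3 * Complex.I / 2) * ∑ n ∈ B, ∑ k ∈ B,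
      crossCoeff (S \ B) c n k * (a n * conj (a k))) seqLaw :=
    (integrable_finsetSum _ fun n _ => integrable_finsetSum _ fun k _ =>
      (integrable_mul_conj n k).const_mul _).const_mul _
  -- The block has zero mean momentum by the symmetry n ↔ -n. Of the two terms in the diagonal cross
  -- coefficient, only the one carrying the momentum of the lower modes survives.
  have hsym : ∑ n ∈ B, (n : ℝ) * ∫ a in E, ‖a n‖ ^ 2 ∂seqLaw = 0 := by
    have : ∑ n ∈ B, (n : ℝ) * ∫ a in E, ‖a n‖ ^ 2 ∂seqLaw =
        ∑ n ∈ B, -((n : ℝ) * ∫ a in E, ‖a n‖ ^ 2 ∂seqLaw) := by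
      refine Finset.sum_nbij' (fun n => -n) (fun n => -n) (fun n hn => (hBs n).1 hn)
        (fun n hn => (hBs n).1 hn) (fun n _ => neg_neg n) (fun n _ => neg_neg n) fun n _ => ?_
      rw [setIntegral_norm_sq_neg hE]
      push_cast
      ring
    rw [Finset.sum_neg_distrib] at this
    exact self_eq_neg.1 this
  have hcross : ∫ a in E, (-(3 * Complex.I / 2) * ∑ n ∈ B, ∑ k ∈ B,
      crossCoeff (S \ B) c n k * (a n * conj (a k))) ∂seqLaw =
      ((3 * momentum (S \ B) c * ∑ n ∈ B, ∫ a in E, ‖a n‖ ^ 2 ∂seqLaw : ℝ) : ℂ) := by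
    rw [integral_const_mul, integral_finsetSum _ fun n _ => integrable_finsetSum _ fun k _ =>
      ((integrable_mul_conj n k).const_mul _).integrableOn]
    have h1 : ∀ n ∈ B, ∫ a in E, ∑ k ∈ B, crossCoeff (S \ B) c n k * (a n * conj (a k)) ∂seqLaw =
        crossCoeff (S \ B) c n n * ((∫ a in E, ‖a n‖ ^ 2 ∂seqLaw : ℝ) : ℂ) := by
      intro n hn
      rw [integral_finsetSum _ fun k _ => ((integrable_mul_conj n k).const_mul _).integrableOn,
        Finset.sum_eq_single n]
      · rw [integral_const_mul, ← integral_complex_ofReal]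
        congr 2
        ext a
        rw [Complex.mul_conj, Complex.normSq_eq_norm_sq]
      · intro k _ hk
        rw [integral_const_mul, setIntegral_mul_conj_eq_zero hE hk.symm, mul_zero]
      · exact fun h => absurd hn h
    rw [Finset.sum_congr rfl h1]
    have h2 : ∑ n ∈ B, crossCoeff (S \ B) c n n * ((∫ a in E, ‖a n‖ ^ 2 ∂seqLaw : ℝ) : ℂ) =
        2 * (Complex.I * (momentum (S \ B) c : ℂ)) *
          ((∑ n ∈ B, ∫ a in E, ‖a n‖ ^ 2 ∂seqLaw : ℝ) : ℂ) +
        2 * Complex.I * ((∑ k ∈ S \ B, ‖c k‖ ^ 2 : ℝ) : ℂ) *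
          ((∑ n ∈ B, (n : ℝ) * ∫ a in E, ‖a n‖ ^ 2 ∂seqLaw : ℝ) : ℂ) := by
      simp only [crossCoeff_self]
      push_cast
      rw [Finset.mul_sum, Finset.mul_sum, ← Finset.sum_add_distrib]
      refine Finset.sum_congr rfl fun n _ => ?_
      ring
    rw [h2, hsym]
    push_cast
    linear_combination (-3 * (momentum (S \ B) c : ℂ) *
      ∑ n ∈ B, ((∫ a in E, ‖a n‖ ^ 2 ∂seqLaw : ℝ) : ℂ)) * Complex.I_sq
  have hfin := congrArg Complex.re hcross
  rw [Complex.ofReal_re] at hfin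
  have hre := (Complex.reCLM.integral_comp_comm hsumi.integrableOn (μ := seqLaw.restrict E))
  simp only [Complex.reCLM_apply] at hre
  rw [hfin] at hre
  have htot : ∫ a in E, (quartic S (splice B c a) + quartic S (splice B c fun n => Complex.I * a n) +
      quartic S (splice B c fun n => -1 * a n) +
      quartic S (splice B c fun n => -Complex.I * a n)) ∂seqLaw =
      4 * ∫ a in E, quartic S (splice B c a) ∂seqLaw := by
    rw [integral_add, integral_add, integral_add, hrot _ (by simp) hE.mul_I,
      hrot _ (by simp) hI2, hrot _ (by simp) hI3]
    · ring
    · exact h_int.integrableOn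
    · exact (hinte _ (by simp)).integrableOn
    · exact (h_int.add (hinte _ (by simp))).integrableOn
    · exact (hinte _ (by simp)).integrableOn
    · exact ((h_int.add (hinte _ (by simp))).add (hinte _ (by simp))).integrableOn
    · exact (hinte _ (by simp)).integrableOn
  simp only [sum_phase_quartic hB] at htot
  rw [integral_const_mul, integral_add, integral_add, hqB0, hre] at htot
  · simp only [integral_const, smul_eq_mul, measureReal_restrict_apply_univ] at htot
    linarith
  · exact integrable_const _
  · exact hqB.integrableOn
  · exact ((integrable_const _).add hqB).integrableOn
  · exact hsumi.re.integrableOn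

/-! ### Exponential moments of the increment of one block. -/

theorem ofReal_integral_le_lintegral_ofReal {α : Type*} [MeasurableSpace α] {μ : Measure α}
    {g : α → ℝ} (hg : Integrable g μ) :
    ENNReal.ofReal (∫ x, g x ∂μ) ≤ ∫⁻ x, ENNReal.ofReal (g x) ∂μ := by
  have h1 : ∫ x, g x ∂μ ≤ ∫ x, max (g x) 0 ∂μ :=
    integral_mono hg hg.pos_part fun x => le_max_left _ _
  refine (ENNReal.ofReal_le_ofReal h1).trans ?_
  rw [ofReal_integral_eq_lintegral_ofReal hg.pos_part (ae_of_all _ fun _ => le_max_right _ _)]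
  refine lintegral_mono fun x => ?_
  rcases le_total (g x) 0 with h | h
  · rw [max_eq_right h]; simp
  · rw [max_eq_left h]

theorem measurable_quartic_splice (S B : Finset ℤ) (c : ℤ → ℂ) :
    Measurable fun a => quartic S (splice B c a) := by
  refine ((continuous_quartic S).comp (f := fun a : ℤ → ℂ => splice B c a) ?_).measurable
  exact (continuous_splice B).comp (continuous_const.prodMk continuous_id)

/-- Jensen's inequality: the mean of the increment is known exactly, which bounds the mean of
e^{-tX} from below. The interpolation inequality controls the product of the means of e^{-tX} and
e^{tX}, so a lower bound for the first is an upper bound for the second. -/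
theorem ofReal_le_lintegral_exp_neg_block {S B : Finset ℤ} (hB : B ⊆ S)
    (hBs : ∀ n, n ∈ B ↔ -n ∈ B) {E : Set (ℤ → ℂ)} (hE : BlockInvariant E) (c : ℤ → ℂ)
    {t p s : ℝ} (ht : 0 ≤ t) (hp : 0 < p) (hpE : p ≤ seqLaw.real E)
    (hs : ∑ n ∈ B, ∫ a in E, ‖a n‖ ^ 2 ∂seqLaw ≤ s) :
    ENNReal.ofReal (p * Real.exp (-(3 * t * s * |momentum (S \ B) c| / p))) ≤
      ∫⁻ a in E, ENNReal.ofReal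
        (Real.exp (-(t * (quartic S (splice B c a) - quartic (S \ B) c)))) ∂seqLaw := by
  set Y := momentum (S \ B) c with hY
  set q₀ := quartic (S \ B) c with hq₀
  set m := -(3 * t * s * |Y| / p) with hm
  set σ := ∑ n ∈ B, ∫ a in E, ‖a n‖ ^ 2 ∂seqLaw with hσ
  have hσ0 : 0 ≤ σ := Finset.sum_nonneg fun n _ => integral_nonneg fun a => by positivity
  have h_int : Integrable (fun a => quartic S (splice B c a)) (seqLaw.restrict E) :=
    (integrable_quartic_splice hB c).integrableOn
  have hmean := setIntegral_quartic_splice hB hBs hE c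
  rw [← hY, ← hq₀, ← hσ] at hmean
  set P := seqLaw.real E with hP
  have hint3 : Integrable (fun a => t * (quartic S (splice B c a) - q₀)) (seqLaw.restrict E) :=
    (h_int.sub (integrable_const _)).const_mul t
  have hgi : Integrable (fun a => Real.exp m *
      (1 - m - t * (quartic S (splice B c a) - q₀))) (seqLaw.restrict E) :=
    ((integrable_const _).sub hint3).const_mul _
  have hval : ∫ a in E, Real.exp m * (1 - m - t * (quartic S (splice B c a) - q₀)) ∂seqLaw =
      Real.exp m * (P * (1 - m) - t * (3 * Y * σ)) := by
    rw [integral_const_mul, integral_sub (integrable_const _) hint3, integral_const_mul,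
      integral_sub h_int (integrable_const _), hmean]
    simp only [integral_const, smul_eq_mul, measureReal_restrict_apply_univ, ← hP]
    ring
  calc ENNReal.ofReal (p * Real.exp m)
      ≤ ENNReal.ofReal (Real.exp m * (P * (1 - m) - t * (3 * Y * σ))) := by
        refine ENNReal.ofReal_le_ofReal ?_
        rw [mul_comm p]
        refine mul_le_mul_of_nonneg_left ?_ (Real.exp_pos _).le
        have h1 : Y * σ ≤ |Y| * s :=
          mul_le_mul (le_abs_self _) hs hσ0 (abs_nonneg _)
        have h2 : 3 * t * s * |Y| ≤ P * -m := by
          have h3 : p * -m = 3 * t * s * |Y| := by rw [hm]; field_simp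
          have h4 : 0 ≤ -m := by
            have : 0 ≤ s := hσ0.trans hs
            rw [hm, neg_neg]; positivity
          rw [← h3]
          exact mul_le_mul_of_nonneg_right hpE h4
        nlinarith [mul_le_mul_of_nonneg_left h1 ht]
    _ ≤ ∫⁻ a in E, ENNReal.ofReal (Real.exp m *
          (1 - m - t * (quartic S (splice B c a) - q₀))) ∂seqLaw := by
        rw [← hval]
        exact ofReal_integral_le_lintegral_ofReal hgi
    _ ≤ _ := by
        refine lintegral_mono fun a => ENNReal.ofReal_le_ofReal ?_
        -- The tangent line of exp at m. With this m, the loss from the mean drift is absorbed by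
        -- the term -m times the measure of E, and no division by that measure is needed beyond its
        -- lower bound p.
        have h1 := Real.add_one_le_exp (-(t * (quartic S (splice B c a) - q₀)) - m)
        calc Real.exp m * (1 - m - t * (quartic S (splice B c a) - q₀))
            ≤ Real.exp m * Real.exp (-(t * (quartic S (splice B c a) - q₀)) - m) :=
              mul_le_mul_of_nonneg_left (by linarith) (Real.exp_pos _).le
          _ = _ := by rw [← Real.exp_add]; congr 1; ring

/-- The exponential moment of the change of `quartic` when a block of frequencies is added, on an
invariant set. -/
theorem lintegral_exp_block_le {S B : Finset ℤ} (hB : B ⊆ S)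
    (hBs : ∀ n, n ∈ B ↔ -n ∈ B) {E E' : Set (ℤ → ℂ)} (hE : BlockInvariant E)
    (hE' : MeasurableSet E') (hEE' : ∀ a ∈ E, ∀ b ∈ E, ∀ θ, rotFst θ a b ∈ E') (c : ℤ → ℂ)
    {t p s κ W : ℝ} (ht : 0 ≤ t) (hp : 0 < p) (hpE : p ≤ seqLaw.real E)
    (hs : ∑ n ∈ B, ∫ a in E, ‖a n‖ ^ 2 ∂seqLaw ≤ s) (hκ : 0 < κ)
    (hκB : ∀ n ∈ B, κ ≤ bracketSq n)
    (hW : ∀ a ∈ E', ∫ x, ‖trigPoly S (splice B c a) x‖ ^ 4 *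
      ‖trigPoly S (derivSeq (splice B c a)) x‖ ^ 2 ∂circLaw ≤ W) :
    ∫⁻ a in E, ENNReal.ofReal
        (Real.exp (t * (quartic S (splice B c a) - quartic (S \ B) c))) ∂seqLaw ≤
      ENNReal.ofReal (p⁻¹ * Real.exp (3 * t * s * |momentum (S \ B) c| / p +
        t ^ 2 * Real.pi ^ 2 * (9 / 4) * (W / κ))) := by
  have hJ := ofReal_le_lintegral_exp_neg_block hB hBs hE c ht hp hpE hs
  have hm := measurable_quartic_splice S B c
  set q₀ := quartic (S \ B) c with hq₀
  set m := 3 * t * s * |momentum (S \ B) c| / p with hmdef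
  have hEm := hE.measurableSet
  have hcv : ConvexOn ℝ Set.univ fun x : ℝ => Real.exp (t * x) := by
    refine ⟨convex_univ, fun x _ y _ a b ha hb hab => ?_⟩
    have := convexOn_exp.2 (Set.mem_univ (t * x)) (Set.mem_univ (t * y)) ha hb hab
    simp only [smul_eq_mul] at this ⊢
    rwa [show t * (a * x + b * y) = a * (t * x) + b * (t * y) by ring]
  have hpis := lintegral_convex_quartic_sub_le hB c hcv (by fun_prop)
    (fun x => (Real.exp_pos _).le) hE' hEE'
  -- Subtracting the same reference value q₀ at both points makes the two copies separate.
  have hleft : ∫⁻ a, ∫⁻ b, E.indicator 1 a * E.indicator 1 b * ENNReal.ofReal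
      (Real.exp (t * (quartic S (splice B c b) - quartic S (splice B c a)))) ∂seqLaw ∂seqLaw =
      (∫⁻ a in E, ENNReal.ofReal (Real.exp (-(t * (quartic S (splice B c a) - q₀)))) ∂seqLaw) *
      ∫⁻ b in E, ENNReal.ofReal (Real.exp (t * (quartic S (splice B c b) - q₀))) ∂seqLaw := by
    rw [← lintegral_indicator hEm, ← lintegral_indicator hEm, ← lintegral_mul_const]
    · refine lintegral_congr fun a => ?_
      rw [← lintegral_const_mul]
      · refine lintegral_congr fun b => ?_
        by_cases ha : a ∈ E
        swap; · simp [ha]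
        by_cases hb : b ∈ E
        swap; · simp [hb]
        simp only [Set.indicator_of_mem ha, Set.indicator_of_mem hb, Pi.one_apply, one_mul]
        rw [← ENNReal.ofReal_mul (Real.exp_pos _).le, ← Real.exp_add]
        congr 2
        ring
      · exact (Measurable.indicator (by fun_prop) hEm)
    · exact (Measurable.indicator (by fun_prop) hEm)
  have hright : ∫⁻ a, ∫⁻ b, E'.indicator 1 a * ENNReal.ofReal
      (Real.exp (t * (Real.pi / 2 * dirDeriv S B (splice B c a) b))) ∂seqLaw ∂seqLaw ≤
      ENNReal.ofReal (Real.exp (t ^ 2 * Real.pi ^ 2 * (9 / 4) * (W / κ))) := by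
    have hb : ∀ a, ∫⁻ b, E'.indicator 1 a * ENNReal.ofReal
        (Real.exp (t * (Real.pi / 2 * dirDeriv S B (splice B c a) b))) ∂seqLaw ≤
        ENNReal.ofReal (Real.exp (t ^ 2 * Real.pi ^ 2 * (9 / 4) * (W / κ))) := by
      intro a
      by_cases ha : a ∈ E'
      swap; · simp [ha]
      simp only [Set.indicator_of_mem ha, Pi.one_apply, one_mul, ← mul_assoc t]
      rw [lintegral_exp_dirDeriv]
      refine ENNReal.ofReal_le_ofReal (Real.exp_le_exp.2 ?_)
      have h1 := sum_gradSeq_div_le (S := S) hκ hκB (splice B c a)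
      have h2 : 9 / κ * ∫ x, ‖trigPoly S (splice B c a) x‖ ^ 4 *
          ‖trigPoly S (derivSeq (splice B c a)) x‖ ^ 2 ∂circLaw ≤ 9 / κ * W :=
        mul_le_mul_of_nonneg_left (hW a ha) (by positivity)
      calc (t * (Real.pi / 2)) ^ 2 * ∑ n ∈ B, ‖gradSeq S (splice B c a) n‖ ^ 2 / (4 * bracketSq n)
          ≤ (t * (Real.pi / 2)) ^ 2 * (9 / κ * W) :=
            mul_le_mul_of_nonneg_left (h1.trans h2) (by positivity)
        _ = _ := by ring
    refine (lintegral_mono hb).trans ?_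
    simp
  rw [hleft] at hpis
  -- Replacing the factor with e^{-tX} by its lower bound and dividing by it isolates the factor
  -- with e^{tX}.
  have hfin := (mul_le_mul_left hJ _).trans (hpis.trans hright)
  have hpos : 0 < p * Real.exp (-m) := by positivity
  rw [mul_comm, ← ENNReal.le_div_iff_mul_le (Or.inl (by simpa using hpos))
    (Or.inl ENNReal.ofReal_ne_top), ← ENNReal.ofReal_div_of_pos hpos] at hfin
  refine hfin.trans (le_of_eq ?_)
  congr 1
  rw [Real.exp_add, Real.exp_neg]
  field_simp

/-! ### Gaussian tails of the supremum and the mass of a block. -/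

/-- The supremum of a differentiable function on a period is bounded by its mean and the mean of
the absolute value of its derivative. -/
theorem le_integral_circLaw_add {G G' H : ℝ → ℝ} (hG : ∀ x, HasDerivAt G (G' x) x)
    (hG' : Continuous G') (hH : Continuous H) (hGH : ∀ x, |G' x| ≤ H x)
    (hp : Function.Periodic G (2 * Real.pi)) (x : ℝ) :
    G x ≤ ∫ y, (G y + 2 * Real.pi * H y) ∂circLaw := by
  have hpi := Real.pi_pos
  have hGc : Continuous G := continuous_iff_continuousAt.2 fun x => (hG x).continuousAt
  obtain ⟨x', hx', hxx⟩ := hp.exists_mem_Ico₀ (by positivity : (0 : ℝ) < 2 * Real.pi) x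
  rw [hxx]
  have hH0 : ∀ y, 0 ≤ H y := fun y => (abs_nonneg _).trans (hGH y)
  have key : ∀ y ∈ Set.Ioc 0 (2 * Real.pi), G x' ≤ G y + ∫ z in (0 : ℝ)..2 * Real.pi, H z := by
    intro y hy
    have h1 : ∫ z in y..x', G' z = G x' - G y :=
      intervalIntegral.integral_eq_sub_of_hasDerivAt (fun z _ => hG z)
        (hG'.intervalIntegrable _ _)
    have h2 : |∫ z in y..x', G' z| ≤ ∫ z in (0 : ℝ)..2 * Real.pi, H z := by
      rw [← Real.norm_eq_abs]
      refine (intervalIntegral.norm_integral_le_integral_norm_uIoc).trans ?_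
      rw [intervalIntegral.integral_of_le (by positivity)]
      have hsub : Set.uIoc y x' ⊆ Set.Ioc 0 (2 * Real.pi) := by
        intro z hz
        rw [Set.mem_uIoc] at hz
        rcases hz with hz | hz
        · exact ⟨hy.1.trans hz.1, hz.2.trans hx'.2.le⟩
        · exact ⟨hx'.1.trans_lt hz.1, hz.2.trans hy.2⟩
      have h_int : IntegrableOn H (Set.Ioc 0 (2 * Real.pi)) :=
        (hH.intervalIntegrable _ _).1
      calc ∫ z in Set.uIoc y x', ‖G' z‖ ≤ ∫ z in Set.uIoc y x', H z :=
            integral_mono ((hG'.norm.integrableOn_uIoc)) (h_int.mono_set hsub) fun z => hGH z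
        _ ≤ ∫ z in Set.Ioc 0 (2 * Real.pi), H z :=
            setIntegral_mono_set h_int (ae_of_all _ hH0) hsub.eventuallyLE
    linarith [le_abs_self (∫ z in y..x', G' z)]
  have hHint : ∫ z in (0 : ℝ)..2 * Real.pi, H z = 2 * Real.pi * ∫ z, H z ∂circLaw := by
    rw [integral_circLaw, smul_eq_mul]; field_simp
  have hle : ∫ _, G x' ∂circLaw ≤ ∫ y, (G y + ∫ z in (0 : ℝ)..2 * Real.pi, H z) ∂circLaw := by
    refine integral_mono_ae (integrable_const _) (integrable_circLaw (by fun_prop)) ?_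
    refine Measure.ae_smul_measure ?_ _
    exact (ae_restrict_iff' measurableSet_Ioc).2 (ae_of_all _ key)
  rw [integral_add (integrable_circLaw hGc) (integrable_const _)] at hle
  rw [integral_add (integrable_circLaw hGc) (integrable_circLaw (by fun_prop)),
    integral_const_mul, ← hHint]
  simpa using hle

/-- Sobolev-type bound for the exponential of the square of a trigonometric polynomial. -/
theorem exp_norm_sq_trigPoly_le (S : Finset ℤ) (a : ℤ → ℂ) {l D : ℝ} (hl : 0 ≤ l) (hD : 0 < D)
    (x : ℝ) :
    Real.exp (l * ‖trigPoly S a x‖ ^ 2) ≤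
      ∫ y, (Real.exp (l * ‖trigPoly S a y‖ ^ 2) + 2 * Real.pi * (D *
        (Real.exp (3 * l * ‖trigPoly S a y‖ ^ 2) +
          Real.exp (l / D ^ 2 * ‖trigPoly S (derivSeq a) y‖ ^ 2)))) ∂circLaw := by
  have hu := continuous_trigPoly S a
  have hu' := continuous_trigPoly S (derivSeq a)
  have hd : ∀ y, HasDerivAt (fun y => Real.exp (l * ‖trigPoly S a y‖ ^ 2))
      (Real.exp (l * ‖trigPoly S a y‖ ^ 2) *
        (l * (2 * inner ℝ (trigPoly S a y) (trigPoly S (derivSeq a) y)))) y := fun y =>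
    ((hasDerivAt_trigPoly S a y).norm_sq.const_mul l).exp
  refine le_integral_circLaw_add hd (by fun_prop) (by fun_prop) (fun y => ?_) (fun y => ?_) x
  · set u := trigPoly S a y
    set v := trigPoly S (derivSeq a) y
    have h1 : |inner ℝ u v| ≤ ‖u‖ * ‖v‖ := abs_real_inner_le_norm u v
    rw [abs_mul, abs_of_pos (Real.exp_pos _), abs_mul, abs_of_nonneg hl, abs_mul, abs_two]
    -- Weighted Young inequality: with D a bound for the frequencies, u and u_x/D have comparable
    -- size, so only one power of D is lost.
    have h2 : l * (2 * |inner ℝ u v|) ≤ 2 * D * ((l * ‖u‖ ^ 2 + l / D ^ 2 * ‖v‖ ^ 2) / 2) := by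
      have h3 : 2 * (‖u‖ * ‖v‖) ≤ D * ‖u‖ ^ 2 + 1 / D * ‖v‖ ^ 2 := by
        have h4 : 0 ≤ 1 / D * (D * ‖u‖ - ‖v‖) ^ 2 := by positivity
        have h5 : 1 / D * (D * ‖u‖ - ‖v‖) ^ 2 =
            D * ‖u‖ ^ 2 + 1 / D * ‖v‖ ^ 2 - 2 * (‖u‖ * ‖v‖) := by field_simp; ring
        linarith
      calc l * (2 * |inner ℝ u v|) ≤ l * (D * ‖u‖ ^ 2 + 1 / D * ‖v‖ ^ 2) :=
            mul_le_mul_of_nonneg_left (by linarith) hl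
        _ = _ := by field_simp
    have h6 : (l * ‖u‖ ^ 2 + l / D ^ 2 * ‖v‖ ^ 2) / 2 ≤
        Real.exp ((l * ‖u‖ ^ 2 + l / D ^ 2 * ‖v‖ ^ 2) / 2) :=
      (le_add_of_nonneg_right zero_le_one).trans (Real.add_one_le_exp _)
    have h7 : Real.exp (l * ‖u‖ ^ 2) * Real.exp ((l * ‖u‖ ^ 2 + l / D ^ 2 * ‖v‖ ^ 2) / 2) =
        Real.exp (3 * l * ‖u‖ ^ 2 / 2) * Real.exp (l / D ^ 2 * ‖v‖ ^ 2 / 2) := by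
      rw [← Real.exp_add, ← Real.exp_add]; congr 1; ring
    have h8 : ∀ z : ℝ, Real.exp z = Real.exp (z / 2) ^ 2 := fun z => by
      rw [← Real.exp_nat_mul]; congr 1; push_cast; ring
    calc Real.exp (l * ‖u‖ ^ 2) * (l * (2 * |inner ℝ u v|))
        ≤ Real.exp (l * ‖u‖ ^ 2) *
          (2 * D * Real.exp ((l * ‖u‖ ^ 2 + l / D ^ 2 * ‖v‖ ^ 2) / 2)) := by
          refine mul_le_mul_of_nonneg_left (h2.trans ?_) (Real.exp_pos _).le
          exact mul_le_mul_of_nonneg_left h6 (by positivity)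
      _ = D * (2 * (Real.exp (3 * l * ‖u‖ ^ 2 / 2) * Real.exp (l / D ^ 2 * ‖v‖ ^ 2 / 2))) := by
          rw [← h7]; ring
      _ ≤ _ := by
          refine mul_le_mul_of_nonneg_left ?_ hD.le
          rw [h8 (3 * l * ‖u‖ ^ 2), h8 (l / D ^ 2 * ‖v‖ ^ 2)]
          nlinarith [sq_nonneg (Real.exp (3 * l * ‖u‖ ^ 2 / 2) - Real.exp (l / D ^ 2 * ‖v‖ ^ 2 / 2))]
  · simp only [trigPoly_periodic S a y]

theorem continuous_trigPoly_prod (S : Finset ℤ) :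
    Continuous fun p : (ℤ → ℂ) × ℝ => trigPoly S p.1 p.2 :=
  continuous_trigPoly_comp S continuous_fst continuous_snd

theorem continuous_trigPoly_derivSeq_prod (S : Finset ℤ) :
    Continuous fun p : (ℤ → ℂ) × ℝ => trigPoly S (derivSeq p.1) p.2 :=
  continuous_trigPoly_comp S (continuous_derivSeq.comp continuous_fst) continuous_snd

theorem lintegral_exp_norm_sq_trigPoly_le (S : Finset ℤ) {l : ℝ} (hl : 0 ≤ l)
    (hs : 2 * (l * ∑ n ∈ S, 1 / bracketSq n) ≤ 1) (x : ℝ) :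
    ∫⁻ a, ENNReal.ofReal (Real.exp (l * ‖trigPoly S a x‖ ^ 2)) ∂seqLaw ≤ 2 := by
  have h1 := lintegral_exp_norm_sq_sum_seqLaw S (fun n => Complex.exp (Complex.I * n * x)) hl
  simp only [norm_exp_freq, one_pow] at h1
  have h2 : ∀ a : ℤ → ℂ, trigPoly S a x = ∑ n ∈ S, Complex.exp (Complex.I * n * x) * a n :=
    fun a => Finset.sum_congr rfl fun n _ => mul_comm _ _
  simp only [h2]
  rw [h1 (by linarith), ← ENNReal.ofReal_ofNat]
  refine ENNReal.ofReal_le_ofReal ?_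
  refine inv_le_of_inv_le₀ (by norm_num) ?_
  linarith

/-- Division by D² makes the weights n²/D² at most one, so the variance is no larger than that of
the polynomial itself. -/
theorem lintegral_exp_norm_sq_trigPoly_derivSeq_le (S : Finset ℤ) {l D : ℝ} (hl : 0 ≤ l)
    (hD : 0 < D) (hSD : ∀ n ∈ S, |(n : ℝ)| ≤ D)
    (hs : 2 * (l * ∑ n ∈ S, 1 / bracketSq n) ≤ 1) (x : ℝ) :
    ∫⁻ a, ENNReal.ofReal (Real.exp (l / D ^ 2 * ‖trigPoly S (derivSeq a) x‖ ^ 2)) ∂seqLaw ≤ 2 := by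
  have h1 := lintegral_exp_norm_sq_sum_seqLaw S
    (fun n => Complex.I * n * Complex.exp (Complex.I * n * x)) (l := l / D ^ 2) (by positivity)
  have h2 : ∀ a : ℤ → ℂ, trigPoly S (derivSeq a) x =
      ∑ n ∈ S, Complex.I * n * Complex.exp (Complex.I * n * x) * a n :=
    fun a => Finset.sum_congr rfl fun n _ => by rw [derivSeq]; ring
  have h3 : l / D ^ 2 * ∑ n ∈ S, ‖Complex.I * n * Complex.exp (Complex.I * n * x)‖ ^ 2 /
      bracketSq n ≤ l * ∑ n ∈ S, 1 / bracketSq n := by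
    rw [Finset.mul_sum, Finset.mul_sum]
    refine Finset.sum_le_sum fun n hn => ?_
    have hk := bracketSq_pos n
    rw [norm_mul, norm_exp_freq, norm_mul, Complex.norm_I, one_mul, mul_one, Complex.norm_intCast]
    have h4 : |(n : ℝ)| ^ 2 ≤ D ^ 2 := pow_le_pow_left₀ (abs_nonneg _) (hSD n hn) 2
    rw [div_mul_div_comm, mul_one_div, div_le_div_iff₀ (by positivity) hk]
    have : l * |(n : ℝ)| ^ 2 * bracketSq n ≤ l * D ^ 2 * bracketSq n := by gcongr
    linarith
  simp only [h2]
  rw [h1 (by linarith), ← ENNReal.ofReal_ofNat]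
  refine ENNReal.ofReal_le_ofReal ?_
  refine inv_le_of_inv_le₀ (by norm_num) ?_
  linarith

/-- Gaussian tail of the supremum norm of a random trigonometric polynomial. -/
theorem seqLaw_exists_norm_trigPoly_gt_le (S : Finset ℤ) {l D b : ℝ} (hl : 0 ≤ l) (hD : 1 ≤ D)
    (hb : 0 ≤ b) (hSD : ∀ n ∈ S, |(n : ℝ)| ≤ D)
    (hs : 6 * (l * ∑ n ∈ S, 1 / bracketSq n) ≤ 1) :
    seqLaw {a | ∃ x, b < ‖trigPoly S a x‖} ≤ ENNReal.ofReal (30 * D * Real.exp (-(l * b ^ 2))) := by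
  have hσ : 0 ≤ ∑ n ∈ S, 1 / bracketSq n :=
    Finset.sum_nonneg fun n _ => (one_div_pos.2 (bracketSq_pos n)).le
  have hlσ : 0 ≤ l * ∑ n ∈ S, 1 / bracketSq n := mul_nonneg hl hσ
  obtain ⟨g, hg⟩ : ∃ g : (ℤ → ℂ) → ℝ → ℝ, g = fun a y =>
    (Real.exp (l * ‖trigPoly S a y‖ ^ 2) + 2 * Real.pi * (D *
        (Real.exp (3 * l * ‖trigPoly S a y‖ ^ 2) +
          Real.exp (l / D ^ 2 * ‖trigPoly S (derivSeq a) y‖ ^ 2)))) := ⟨_, rfl⟩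
  have c1 := continuous_trigPoly_prod S
  have c2 := continuous_trigPoly_derivSeq_prod S
  have hpi := Real.pi_pos
  have hg0 : ∀ a y, 0 ≤ g a y := fun a y => by rw [hg]; positivity
  have hgc : Continuous fun p : (ℤ → ℂ) × ℝ => g p.1 p.2 := by rw [hg]; fun_prop
  have hgm : Measurable fun p : (ℤ → ℂ) × ℝ => ENNReal.ofReal (g p.1 p.2) :=
    ENNReal.measurable_ofReal.comp hgc.measurable
  have hZ : Measurable fun a => ∫⁻ y, ENNReal.ofReal (g a y) ∂circLaw := hgm.lintegral_prod_right'
  -- The exponential of l times the squared supremum is dominated by the integral of g over x, a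
  -- measurable quantity with a computable mean. Markov's inequality then applies without taking a
  -- supremum over uncountably many points.
  have hsub : {a | ∃ x, b < ‖trigPoly S a x‖} ⊆
      {a | ENNReal.ofReal (Real.exp (l * b ^ 2)) ≤ ∫⁻ y, ENNReal.ofReal (g a y) ∂circLaw} := by
    intro a ha
    simp only [Set.mem_ofPred_eq] at ha ⊢
    obtain ⟨x, hx⟩ := ha
    have hgi : Integrable (g a) circLaw :=
      integrable_circLaw (hgc.comp (f := fun y => (a, y)) (by fun_prop))
    rw [← ofReal_integral_eq_lintegral_ofReal hgi (ae_of_all _ (hg0 a))]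
    refine ENNReal.ofReal_le_ofReal ?_
    have h1 := exp_norm_sq_trigPoly_le S a hl (zero_lt_one.trans_le hD) x
    have h2 : Real.exp (l * b ^ 2) ≤ Real.exp (l * ‖trigPoly S a x‖ ^ 2) :=
      Real.exp_le_exp.2 (mul_le_mul_of_nonneg_left (pow_le_pow_left₀ hb hx.le 2) hl)
    rw [hg]
    exact h2.trans h1
  have hE : ∫⁻ a, ∫⁻ y, ENNReal.ofReal (g a y) ∂circLaw ∂seqLaw ≤ ENNReal.ofReal (30 * D) := by
    rw [lintegral_lintegral_swap hgm.aemeasurable]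
    have hy : ∀ y, ∫⁻ a, ENNReal.ofReal (g a y) ∂seqLaw ≤ ENNReal.ofReal (30 * D) := by
      intro y
      have e1 := lintegral_exp_norm_sq_trigPoly_le S hl (by linarith) y
      have e2 := lintegral_exp_norm_sq_trigPoly_le S (l := 3 * l) (by positivity)
        (by linarith) y
      have e3 := lintegral_exp_norm_sq_trigPoly_derivSeq_le S hl (by linarith) hSD (by linarith) y
      have c3 : Continuous fun a => trigPoly S a y :=
        c1.comp (f := fun a => (a, y)) (by fun_prop)
      have c4 : Continuous fun a => trigPoly S (derivSeq a) y :=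
        c2.comp (f := fun a => (a, y)) (by fun_prop)
      have hsplit : ∀ a, ENNReal.ofReal (g a y) =
          ENNReal.ofReal (Real.exp (l * ‖trigPoly S a y‖ ^ 2)) +
          ENNReal.ofReal (2 * Real.pi * D) *
            (ENNReal.ofReal (Real.exp (3 * l * ‖trigPoly S a y‖ ^ 2)) +
            ENNReal.ofReal (Real.exp (l / D ^ 2 * ‖trigPoly S (derivSeq a) y‖ ^ 2))) := by
        intro a
        rw [hg, ← ENNReal.ofReal_add (by positivity) (by positivity),
          ← ENNReal.ofReal_mul (by positivity), ← ENNReal.ofReal_add (by positivity)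
          (by positivity)]
        congr 1
        ring
      simp only [hsplit]
      rw [lintegral_add_left (by fun_prop), lintegral_const_mul _ (by fun_prop),
        lintegral_add_left (by fun_prop)]
      -- The three exponential moments, at rates l, 3l and l/D², are each at most 2; the rate 3l is
      -- the reason for the factor 6 in the hypothesis. The sum 2 + 8πD is at most 30D since D ≥ 1.
      calc _ ≤ 2 + ENNReal.ofReal (2 * Real.pi * D) * (2 + 2) := by gcongr
        _ = ENNReal.ofReal (2 + 2 * Real.pi * D * (2 + 2)) := by
          rw [ENNReal.ofReal_add (by positivity) (by positivity),
            ENNReal.ofReal_mul (p := 2 * Real.pi * D) (by positivity),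
            ENNReal.ofReal_add (by positivity) (by positivity), ENNReal.ofReal_ofNat]
        _ ≤ _ := ENNReal.ofReal_le_ofReal (by nlinarith [Real.pi_lt_d2])
    refine (lintegral_mono hy).trans ?_
    simp
  calc seqLaw {a | ∃ x, b < ‖trigPoly S a x‖}
      ≤ (∫⁻ a, ∫⁻ y, ENNReal.ofReal (g a y) ∂circLaw ∂seqLaw) /
        ENNReal.ofReal (Real.exp (l * b ^ 2)) :=
        (measure_mono hsub).trans (meas_ge_le_lintegral_div hZ.aemeasurable
          (by simpa using Real.exp_pos _) ENNReal.ofReal_ne_top)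
    _ ≤ ENNReal.ofReal (30 * D) / ENNReal.ofReal (Real.exp (l * b ^ 2)) := by gcongr
    _ = _ := by
      rw [← ENNReal.ofReal_div_of_pos (Real.exp_pos _), Real.exp_neg, div_eq_mul_inv]

/-- Tail of the mass of a block of frequencies. -/
theorem seqLaw_sum_norm_sq_gt_le (S : Finset ℤ) {κ s : ℝ} (hκ : 0 < κ)
    (hS : ∀ n ∈ S, κ ≤ bracketSq n) :
    seqLaw {a | s < ∑ n ∈ S, ‖a n‖ ^ 2} ≤
      ENNReal.ofReal (2 ^ S.card * Real.exp (-(κ / 2 * s))) := by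
  -- At rate κ/2 each mode contributes a factor of at most 2.
  have h1 := lintegral_exp_sum_norm_sq_seqLaw S (t := fun _ => κ / 2)
    (fun n hn => by linarith [hS n hn])
  have hm : Measurable fun c : ℤ → ℂ =>
      ENNReal.ofReal (Real.exp (∑ n ∈ S, κ / 2 * ‖c n‖ ^ 2)) := by fun_prop
  have hsub : {a : ℤ → ℂ | s < ∑ n ∈ S, ‖a n‖ ^ 2} ⊆ {a | ENNReal.ofReal (Real.exp (κ / 2 * s)) ≤
      ENNReal.ofReal (Real.exp (∑ n ∈ S, κ / 2 * ‖a n‖ ^ 2))} := by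
    intro a ha
    simp only [Set.mem_ofPred_eq] at ha ⊢
    refine ENNReal.ofReal_le_ofReal (Real.exp_le_exp.2 ?_)
    rw [← Finset.mul_sum]
    exact mul_le_mul_of_nonneg_left ha.le (by positivity)
  refine (measure_mono hsub).trans ((meas_ge_le_lintegral_div hm.aemeasurable
    (by simpa using Real.exp_pos _) ENNReal.ofReal_ne_top).trans ?_)
  rw [h1, ← ENNReal.ofReal_div_of_pos (Real.exp_pos _), Real.exp_neg, div_eq_mul_inv]
  refine ENNReal.ofReal_le_ofReal (mul_le_mul_of_nonneg_right ?_ (by positivity))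
  rw [← Finset.prod_const]
  refine Finset.prod_le_prod (fun n hn => ?_) fun n hn => ?_
  · have : κ / 2 / bracketSq n ≤ 1 / 2 := by
      rw [div_le_iff₀ (bracketSq_pos n)]; linarith [hS n hn]
    exact inv_nonneg.2 (by linarith)
  · have : κ / 2 / bracketSq n ≤ 1 / 2 := by
      rw [div_le_iff₀ (bracketSq_pos n)]; linarith [hS n hn]
    exact inv_le_of_inv_le₀ (by norm_num) (by linarith)

/-- The event that a block of frequencies is bounded by `b` in `L^∞` and by `√s` in `L²`. -/
def blockEvent (B : Finset ℤ) (b s : ℝ) : Set (ℤ → ℂ) :=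
  {a | (∀ x, ‖trigPoly B a x‖ ≤ b) ∧ ∑ n ∈ B, ‖a n‖ ^ 2 ≤ s}

theorem mem_blockEvent {B : Finset ℤ} {b s : ℝ} {a : ℤ → ℂ} :
    a ∈ blockEvent B b s ↔ (∀ x, ‖trigPoly B a x‖ ≤ b) ∧ ∑ n ∈ B, ‖a n‖ ^ 2 ≤ s := by
  simp [blockEvent]

theorem measurableSet_blockEvent (B : Finset ℤ) (b s : ℝ) : MeasurableSet (blockEvent B b s) := by
  refine IsClosed.measurableSet ?_
  have h : blockEvent B b s = (⋂ x : ℝ, {a : ℤ → ℂ | ‖trigPoly B a x‖ ≤ b}) ∩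
      {a | ∑ n ∈ B, ‖a n‖ ^ 2 ≤ s} := by
    ext a; simp [mem_blockEvent]
  rw [h]
  refine IsClosed.inter (isClosed_iInter fun x => ?_) ?_
  · refine isClosed_le ?_ continuous_const
    exact (continuous_trigPoly_comp B continuous_id continuous_const).norm
  · exact isClosed_le (by fun_prop) continuous_const

theorem trigPoly_reflect {B : Finset ℤ} (hB : ∀ n, n ∈ B ↔ -n ∈ B) (a : ℤ → ℂ) (x : ℝ) :
    trigPoly B (fun n => a (-n)) x = trigPoly B a (-x) := by
  refine Finset.sum_bij' (fun n _ => -n) (fun n _ => -n) (fun n hn => (hB n).1 hn)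
    (fun n hn => (hB n).1 hn) (by simp) (by simp) fun n _ => ?_
  push_cast
  rw [show Complex.I * -(n : ℂ) * -(x : ℂ) = Complex.I * n * x by ring]

theorem sum_norm_sq_reflect {B : Finset ℤ} (hB : ∀ n, n ∈ B ↔ -n ∈ B) (a : ℤ → ℂ) :
    ∑ n ∈ B, ‖a (-n)‖ ^ 2 = ∑ n ∈ B, ‖a n‖ ^ 2 :=
  Finset.sum_bij' (fun n _ => -n) (fun n _ => -n) (fun n hn => (hB n).1 hn)
    (fun n hn => (hB n).1 hn) (by simp) (by simp) fun n _ => rfl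

theorem blockInvariant_blockEvent {B : Finset ℤ} (hB : ∀ n, n ∈ B ↔ -n ∈ B) (b s : ℝ) :
    BlockInvariant (blockEvent B b s) where
  measurableSet := measurableSet_blockEvent B b s
  translate y a := by
    have h : ∀ x, trigPoly B (fun n : ℤ => Complex.exp (Complex.I * n * y) * a n) x =
        trigPoly B a (x + y) := fun x => Finset.sum_congr rfl fun n _ => by
      beta_reduce
      rw [mul_comm (Complex.exp _) (a n), mul_assoc, ← Complex.exp_add]
      congr 2; push_cast; ring
    simp only [mem_blockEvent, h, norm_mul, norm_exp_freq, one_mul]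
    refine and_congr_left' ⟨fun hx x => ?_, fun hx x => hx _⟩
    have := hx (x - y)
    rwa [sub_add_cancel] at this
  mul_I a := by
    simp only [mem_blockEvent, trigPoly_const_mul, norm_mul, Complex.norm_I, one_mul]
  reflect a := by
    simp only [mem_blockEvent, trigPoly_reflect hB, sum_norm_sq_reflect hB]
    refine and_congr_left' ⟨fun hx x => ?_, fun hx x => hx _⟩
    have := hx (-x)
    rwa [neg_neg] at this

/-- Supplies the enlarged set in the interpolation inequality. The supremum is at most doubled since
|cos|, |sin| ≤ 1, and the masses at worst add up by Cauchy–Schwarz. -/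
theorem rotFst_mem_blockEvent {B : Finset ℤ} {b s : ℝ} {a a' : ℤ → ℂ}
    (ha : a ∈ blockEvent B b s) (ha' : a' ∈ blockEvent B b s) (θ : ℝ) :
    rotFst θ a a' ∈ blockEvent B (2 * b) (2 * s) := by
  rw [mem_blockEvent] at *
  refine ⟨fun x => ?_, ?_⟩
  · rw [trigPoly_rotFst]
    refine (norm_add_le _ _).trans ?_
    rw [norm_mul, norm_mul, Complex.norm_real, Complex.norm_real, Real.norm_eq_abs,
      Real.norm_eq_abs]
    have h1 := mul_le_mul (Real.abs_cos_le_one θ) (ha.1 x) (norm_nonneg _) zero_le_one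
    have h2 := mul_le_mul (Real.abs_sin_le_one θ) (ha'.1 x) (norm_nonneg _) zero_le_one
    linarith
  · have h : ∀ n, ‖rotFst θ a a' n‖ ^ 2 ≤ ‖a n‖ ^ 2 + ‖a' n‖ ^ 2 := by
      intro n
      have h1 : ‖rotFst θ a a' n‖ ≤ |Real.cos θ| * ‖a n‖ + |Real.sin θ| * ‖a' n‖ := by
        refine (norm_add_le _ _).trans (le_of_eq ?_)
        rw [norm_mul, norm_mul, Complex.norm_real, Complex.norm_real, Real.norm_eq_abs,
          Real.norm_eq_abs]
      refine (pow_le_pow_left₀ (norm_nonneg _) h1 2).trans ?_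
      have h2 : |Real.cos θ| ^ 2 + |Real.sin θ| ^ 2 = 1 := by
        rw [sq_abs, sq_abs]; exact Real.cos_sq_add_sin_sq θ
      have h3 : (|Real.cos θ| * ‖a n‖ + |Real.sin θ| * ‖a' n‖) ^ 2 +
          (|Real.sin θ| * ‖a n‖ - |Real.cos θ| * ‖a' n‖) ^ 2 =
          (|Real.cos θ| ^ 2 + |Real.sin θ| ^ 2) * (‖a n‖ ^ 2 + ‖a' n‖ ^ 2) := by ring
      rw [h2, one_mul] at h3
      nlinarith [sq_nonneg (|Real.sin θ| * ‖a n‖ - |Real.cos θ| * ‖a' n‖)]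
    refine (Finset.sum_le_sum fun n _ => h n).trans ?_
    rw [Finset.sum_add_distrib]
    linarith [ha.2, ha'.2]

theorem seqLaw_compl_blockEvent_le (B : Finset ℤ) {l D b κ s : ℝ} (hl : 0 ≤ l) (hD : 1 ≤ D)
    (hb : 0 ≤ b) (hBD : ∀ n ∈ B, |(n : ℝ)| ≤ D)
    (hs : 6 * (l * ∑ n ∈ B, 1 / bracketSq n) ≤ 1) (hκ : 0 < κ) (hB : ∀ n ∈ B, κ ≤ bracketSq n) :
    seqLaw (blockEvent B b s)ᶜ ≤ ENNReal.ofReal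
      (30 * D * Real.exp (-(l * b ^ 2)) + 2 ^ B.card * Real.exp (-(κ / 2 * s))) := by
  have hsub : (blockEvent B b s)ᶜ ⊆ {a | ∃ x, b < ‖trigPoly B a x‖} ∪
      {a | s < ∑ n ∈ B, ‖a n‖ ^ 2} := by
    intro a ha
    rw [Set.mem_compl_iff, mem_blockEvent] at ha
    by_contra h
    simp only [Set.mem_union, Set.mem_ofPred_eq, not_or, not_exists, not_lt] at h
    exact ha h
  rw [ENNReal.ofReal_add (by positivity) (by positivity)]
  exact (measure_mono hsub).trans ((measure_union_le _ _).trans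
    (add_le_add (seqLaw_exists_norm_trigPoly_gt_le B hl hD hb hBD hs)
      (seqLaw_sum_norm_sq_gt_le B hκ hB)))

/-! ### Dyadic blocks and the bounds available on good sets. -/

/-- The frequencies `|n| ≤ N`. -/
def box (N : ℕ) : Finset ℤ := Finset.Icc (-(N : ℤ)) N

/-- The frequencies `|n| ≤ N` with `|n| < 2 ^ j`. -/
def lowFreq (N j : ℕ) : Finset ℤ := (box N).filter fun n => |n| < 2 ^ j

/-- The dyadic block of frequencies `|n| ≤ N` with `2 ^ j ≤ |n| < 2 ^ (j + 1)`. -/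
def dyadic (N j : ℕ) : Finset ℤ := (box N).filter fun n => 2 ^ j ≤ |n| ∧ |n| < 2 ^ (j + 1)

theorem mem_lowFreq {N j : ℕ} {n : ℤ} : n ∈ lowFreq N j ↔ n ∈ box N ∧ |n| < 2 ^ j := by
  simp [lowFreq]

theorem mem_dyadic {N j : ℕ} {n : ℤ} :
    n ∈ dyadic N j ↔ n ∈ box N ∧ 2 ^ j ≤ |n| ∧ |n| < 2 ^ (j + 1) := by
  simp [dyadic]

theorem mem_box_neg (N : ℕ) (n : ℤ) : n ∈ box N ↔ -n ∈ box N := by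
  simp only [box, Finset.mem_Icc]; omega

theorem mem_dyadic_neg (N j : ℕ) (n : ℤ) : n ∈ dyadic N j ↔ -n ∈ dyadic N j := by
  rw [mem_dyadic, mem_dyadic, abs_neg, ← mem_box_neg]

theorem dyadic_subset (N j : ℕ) : dyadic N j ⊆ lowFreq N (j + 1) := fun n hn => by
  rw [mem_dyadic] at hn; exact mem_lowFreq.2 ⟨hn.1, hn.2.2⟩

theorem lowFreq_sdiff (N j : ℕ) : lowFreq N (j + 1) \ dyadic N j = lowFreq N j := by
  ext n
  have : (2 : ℤ) ^ j ≤ 2 ^ (j + 1) := pow_le_pow_right₀ (by norm_num) (by omega)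
  simp only [Finset.mem_sdiff, mem_lowFreq, mem_dyadic]
  grind

theorem disjoint_lowFreq_dyadic {N i j : ℕ} (h : i ≤ j) {n : ℤ} (hn : n ∈ lowFreq N i) :
    n ∉ dyadic N j := by
  have : (2 : ℤ) ^ i ≤ 2 ^ j := pow_le_pow_right₀ (by norm_num) h
  rw [mem_lowFreq] at hn
  rw [mem_dyadic]
  intro h'
  omega

theorem sum_lowFreq_succ {E : Type*} [AddCommMonoid E] (N j : ℕ) (f : ℤ → E) :
    ∑ n ∈ lowFreq N (j + 1), f n = ∑ n ∈ lowFreq N j, f n + ∑ n ∈ dyadic N j, f n := by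
  rw [← lowFreq_sdiff N j, Finset.sum_sdiff (dyadic_subset N j)]

theorem lowFreq_eq_box {N j : ℕ} (h : N < 2 ^ j) : lowFreq N j = box N := by
  ext n
  have h' : (N : ℤ) < 2 ^ j := by exact_mod_cast h
  simp only [mem_lowFreq, box, Finset.mem_Icc]
  refine ⟨fun h => h.1, fun hn => ⟨hn, ?_⟩⟩
  rw [abs_lt]
  omega

theorem card_lowFreq_le (N j : ℕ) : ((lowFreq N j).card : ℝ) ≤ 2 * 2 ^ j := by
  have h : lowFreq N j ⊆ Finset.Ioo (-(2 : ℤ) ^ j) (2 ^ j) := fun n hn => by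
    rw [mem_lowFreq, abs_lt] at hn
    exact Finset.mem_Ioo.2 hn.2
  have h1 := Finset.card_le_card h
  rw [Int.card_Ioo] at h1
  have h2 : (lowFreq N j).card ≤ 2 * 2 ^ j := by
    refine h1.trans ?_
    have : ((2 : ℤ) ^ j) = ((2 ^ j : ℕ) : ℤ) := by push_cast; rfl
    rw [this]
    omega
  exact_mod_cast h2

theorem card_dyadic_le (N j : ℕ) : (dyadic N j).card ≤ 4 * 2 ^ j := by
  have h1 := Finset.card_le_card (dyadic_subset N j)
  have h2 : ((lowFreq N (j + 1)).card : ℝ) ≤ ((4 * 2 ^ j : ℕ) : ℝ) := by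
    refine (card_lowFreq_le N (j + 1)).trans (le_of_eq ?_)
    push_cast; ring
  exact h1.trans (by exact_mod_cast h2)

theorem abs_le_of_mem_lowFreq {N j : ℕ} {n : ℤ} (hn : n ∈ lowFreq N j) : |(n : ℝ)| ≤ 2 ^ j := by
  have := (mem_lowFreq.1 hn).2.le
  exact_mod_cast this

theorem abs_le_of_mem_dyadic {N j : ℕ} {n : ℤ} (hn : n ∈ dyadic N j) :
    |(n : ℝ)| ≤ 2 ^ (j + 1) :=
  abs_le_of_mem_lowFreq (dyadic_subset N j hn)

theorem le_bracketSq_of_mem_dyadic {N j : ℕ} {n : ℤ} (hn : n ∈ dyadic N j) :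
    (4 : ℝ) ^ j ≤ bracketSq n := by
  have h1 := (mem_dyadic.1 hn).2.1
  have h2 : (2 : ℝ) ^ j ≤ |(n : ℝ)| := by exact_mod_cast h1
  have h3 := pow_le_pow_left₀ (by positivity) h2 2
  rw [sq_abs, ← pow_mul, mul_comm j 2, pow_mul] at h3
  norm_num at h3
  rw [bracketSq]
  linarith

theorem sum_inv_bracketSq_dyadic_le (N j : ℕ) :
    ∑ n ∈ dyadic N j, 1 / bracketSq n ≤ 4 / 2 ^ j := by
  calc ∑ n ∈ dyadic N j, 1 / bracketSq n ≤ ∑ _n ∈ dyadic N j, 1 / (4 : ℝ) ^ j :=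
        Finset.sum_le_sum fun n hn =>
          one_div_le_one_div_of_le (by positivity) (le_bracketSq_of_mem_dyadic hn)
    _ = (dyadic N j).card * (1 / 4 ^ j) := by rw [Finset.sum_const, nsmul_eq_mul]
    _ ≤ (4 * 2 ^ j) * (1 / 4 ^ j) := by
        refine mul_le_mul_of_nonneg_right ?_ (by positivity)
        exact_mod_cast card_dyadic_le N j
    _ = 4 / 2 ^ j := by
        rw [show (4 : ℝ) ^ j = 2 ^ j * 2 ^ j by rw [← mul_pow]; norm_num]
        field_simp

/-- From 1 + x ≤ e^x at rate ⟨n⟩²/2, where the exponential moment equals 2. The loss of a factor is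
harmless. -/
theorem integral_norm_sq_seqLaw_le (n : ℤ) : ∫ a, ‖a n‖ ^ 2 ∂seqLaw ≤ 2 / bracketSq n := by
  have hk := bracketSq_pos n
  have h := lintegral_coord_seqLaw n
    (f := fun z => ENNReal.ofReal (Real.exp (bracketSq n / 2 * ‖z‖ ^ 2))) (by fun_prop)
  rw [lintegral_exp_norm_sq_modeLaw n (by linarith)] at h
  have h2 : ENNReal.ofReal (∫ a, (1 + bracketSq n / 2 * ‖a n‖ ^ 2) ∂seqLaw) ≤
      ENNReal.ofReal 2 := by
    refine (ofReal_integral_le_lintegral_ofReal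
      ((integrable_const _).add ((integrable_norm_sq n).const_mul _))).trans ?_
    have h3 : (1 - bracketSq n / 2 / bracketSq n)⁻¹ = 2 := by field_simp; norm_num
    rw [h3] at h
    rw [← h]
    refine lintegral_mono fun a => ENNReal.ofReal_le_ofReal ?_
    rw [add_comm]
    exact Real.add_one_le_exp _
  rw [ENNReal.ofReal_le_ofReal_iff (by norm_num), integral_add (integrable_const _)
    ((integrable_norm_sq n).const_mul _), integral_const_mul] at h2
  simp only [integral_const, probReal_univ, smul_eq_mul, one_mul] at h2
  rw [le_div_iff₀ hk]
  nlinarith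

theorem sum_setIntegral_dyadic_le (N j : ℕ) (E : Set (ℤ → ℂ)) :
    ∑ n ∈ dyadic N j, ∫ a in E, ‖a n‖ ^ 2 ∂seqLaw ≤ 8 / 2 ^ j := by
  have h := sum_inv_bracketSq_dyadic_le N j
  calc ∑ n ∈ dyadic N j, ∫ a in E, ‖a n‖ ^ 2 ∂seqLaw
      ≤ ∑ n ∈ dyadic N j, 2 * (1 / bracketSq n) := by
        refine Finset.sum_le_sum fun n _ => ?_
        refine (setIntegral_le_integral (integrable_norm_sq n)
          (ae_of_all _ fun a => by positivity)).trans ?_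
        rw [mul_one_div]
        exact integral_norm_sq_seqLaw_le n
    _ = 2 * ∑ n ∈ dyadic N j, 1 / bracketSq n := by rw [Finset.mul_sum]
    _ ≤ 2 * (4 / 2 ^ j) := by linarith
    _ = _ := by ring

theorem blockEvent_congr {B : Finset ℤ} {a a' : ℤ → ℂ} (h : ∀ n ∈ B, a n = a' n) (b s : ℝ) :
    a ∈ blockEvent B b s ↔ a' ∈ blockEvent B b s := by
  have h1 : ∀ x, trigPoly B a x = trigPoly B a' x := fun x =>
    Finset.sum_congr rfl fun n hn => by rw [h n hn]
  have h2 : ∑ n ∈ B, ‖a n‖ ^ 2 = ∑ n ∈ B, ‖a' n‖ ^ 2 :=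
    Finset.sum_congr rfl fun n hn => by rw [h n hn]
  simp only [mem_blockEvent, h1, h2]

/-- The event that the `i`-th dyadic block above frequency `2 ^ k` is small. -/
def tailEvent (N : ℕ) (K : ℝ) (k i : ℕ) : Set (ℤ → ℂ) :=
  blockEvent (dyadic N (k + i)) (Real.sqrt (2 ^ k / K) * (3 / 4) ^ i) (8 * (1 / 2) ^ i)

/-- The event that the mass below frequency `2 ^ k` is less than `M` and the next `i` dyadic blocks
are small. -/
def goodSet (N : ℕ) (K M : ℝ) (k i : ℕ) : Set (ℤ → ℂ) :=
  {c | ∑ n ∈ lowFreq N k, ‖c n‖ ^ 2 < M ∧ ∀ l < i, c ∈ tailEvent N K k l}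

theorem mem_goodSet {N : ℕ} {K M : ℝ} {k i : ℕ} {c : ℤ → ℂ} :
    c ∈ goodSet N K M k i ↔
      ∑ n ∈ lowFreq N k, ‖c n‖ ^ 2 < M ∧ ∀ l < i, c ∈ tailEvent N K k l := by
  simp [goodSet]

theorem measurableSet_tailEvent (N : ℕ) (K : ℝ) (k i : ℕ) : MeasurableSet (tailEvent N K k i) :=
  measurableSet_blockEvent _ _ _

theorem measurableSet_goodSet (N : ℕ) (K M : ℝ) (k i : ℕ) : MeasurableSet (goodSet N K M k i) := by
  have h : goodSet N K M k i = {c | ∑ n ∈ lowFreq N k, ‖c n‖ ^ 2 < M} ∩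
      ⋂ l, ⋂ (_ : l < i), tailEvent N K k l := by
    ext c; simp [mem_goodSet]
  rw [h]
  exact (measurableSet_lt (by fun_prop) measurable_const).inter
    (MeasurableSet.iInter fun l => MeasurableSet.iInter fun _ => measurableSet_tailEvent N K k l)

theorem goodSet_succ_subset {N : ℕ} {K M : ℝ} {k i : ℕ} {c : ℤ → ℂ}
    (hc : c ∈ goodSet N K M k (i + 1)) : c ∈ goodSet N K M k i ∧ c ∈ tailEvent N K k i := by
  rw [mem_goodSet] at *
  exact ⟨⟨hc.1, fun l hl => hc.2 l (by omega)⟩, hc.2 i (by omega)⟩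

/-- The conditions on the lower modes and on the new block involve disjoint sets of coordinates, so
they separate after splicing. This permits integrating out the top block with the others fixed. -/
theorem splice_mem_goodSet_succ {N : ℕ} {K M : ℝ} {k i : ℕ} {c a : ℤ → ℂ}
    (h : splice (dyadic N (k + i)) c a ∈ goodSet N K M k (i + 1)) :
    c ∈ goodSet N K M k i ∧ a ∈ tailEvent N K k i := by
  have hlow : ∀ j ≤ k + i, ∀ n ∈ lowFreq N j, splice (dyadic N (k + i)) c a n = c n :=
    fun j hj n hn => splice_of_notMem (by
      have := disjoint_lowFreq_dyadic hj hn
      simpa using this) c a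
  obtain ⟨h1, h2⟩ := goodSet_succ_subset h
  rw [mem_goodSet] at h1 ⊢
  refine ⟨⟨?_, fun l hl => ?_⟩, ?_⟩
  · refine (Finset.sum_congr rfl fun n hn => ?_).trans_lt h1.1
    rw [hlow k (by omega) n hn]
  · refine (blockEvent_congr (fun n hn => ?_) _ _).1 (h1.2 l hl)
    exact hlow (k + l + 1) (by omega) n (dyadic_subset N _ hn)
  · refine (blockEvent_congr (fun n hn => ?_) _ _).1 h2
    exact splice_of_mem (by simpa using hn) c a

section Bounds

variable {N : ℕ} {K M : ℝ} {k i : ℕ} {c : ℤ → ℂ}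

theorem trigPoly_lowFreq_succ (N j : ℕ) (c : ℤ → ℂ) (x : ℝ) :
    trigPoly (lowFreq N (j + 1)) c x = trigPoly (lowFreq N j) c x + trigPoly (dyadic N j) c x :=
  sum_lowFreq_succ N j _

/-- Below 2^k Cauchy–Schwarz applies: at most 2·2^k frequencies and mass below 1/(2K). Above, the
block bounds form the geometric series Σ (3/4)^l = 4(1 - (3/4)^i). The supremum is thus at most five
times √(2^k/K) for every i. -/
theorem norm_trigPoly_le_of_mem_goodSet (hK : 1 ≤ K) (hM : 2 * M * K ≤ 1)
    (hc : c ∈ goodSet N K M k i) (x : ℝ) :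
    ‖trigPoly (lowFreq N (k + i)) c x‖ ≤ Real.sqrt (2 ^ k / K) * (5 - 4 * (3 / 4) ^ i) := by
  induction i with
  | zero =>
    have h1 := (mem_goodSet.1 hc).1
    have h2 := norm_sq_trigPoly_le (lowFreq N k) c x
    have h3 := card_lowFreq_le N k
    have h0 : 0 ≤ ∑ n ∈ lowFreq N k, ‖c n‖ ^ 2 := Finset.sum_nonneg fun n _ => by positivity
    have h4 : ‖trigPoly (lowFreq N k) c x‖ ^ 2 ≤ 2 ^ k / K := by
      refine h2.trans ((mul_le_mul h3 h1.le h0 (by positivity)).trans ?_)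
      rw [le_div_iff₀ (by positivity)]
      have : (0 : ℝ) < 2 ^ k := by positivity
      nlinarith
    have h5 := Real.le_sqrt_of_sq_le h4
    simpa [show (5 : ℝ) - 4 = 1 by norm_num] using h5
  | succ i ih =>
    obtain ⟨h1, h2⟩ := goodSet_succ_subset hc
    rw [← add_assoc, trigPoly_lowFreq_succ]
    have h3 := (mem_blockEvent.1 h2).1 x
    refine (norm_add_le _ _).trans ((add_le_add (ih h1) h3).trans (le_of_eq ?_))
    rw [pow_succ]; ring

theorem sum_weight_dyadic_le (N j : ℕ) (c : ℤ → ℂ) :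
    ∑ n ∈ dyadic N j, (n : ℝ) ^ 2 * ‖c n‖ ^ 2 ≤ 4 ^ (j + 1) * ∑ n ∈ dyadic N j, ‖c n‖ ^ 2 := by
  rw [Finset.mul_sum]
  refine Finset.sum_le_sum fun n hn => mul_le_mul_of_nonneg_right ?_ (by positivity)
  have h := pow_le_pow_left₀ (abs_nonneg _) (abs_le_of_mem_dyadic hn) 2
  rw [sq_abs, ← pow_mul, mul_comm (j + 1) 2, pow_mul] at h
  norm_num at h
  exact h

theorem sum_weight_lowFreq_le (N j : ℕ) (c : ℤ → ℂ) :
    ∑ n ∈ lowFreq N j, (n : ℝ) ^ 2 * ‖c n‖ ^ 2 ≤ 4 ^ j * ∑ n ∈ lowFreq N j, ‖c n‖ ^ 2 := by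
  rw [Finset.mul_sum]
  refine Finset.sum_le_sum fun n hn => mul_le_mul_of_nonneg_right ?_ (by positivity)
  have h := pow_le_pow_left₀ (abs_nonneg _) (abs_le_of_mem_lowFreq hn) 2
  rw [sq_abs, ← pow_mul, mul_comm j 2, pow_mul] at h
  norm_num at h
  exact h

/-- Block l contributes at most 4^{k+l+1} · 8 · 2^{-l} = 32 · 4^k · 2^l, so the last block
dominates. The growth 2^i is half, in exponent, of the gain 4^i from the Gaussian variances. -/
theorem sum_weight_le_of_mem_goodSet (hM : M ≤ 1) (hc : c ∈ goodSet N K M k i) :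
    ∑ n ∈ lowFreq N (k + i), (n : ℝ) ^ 2 * ‖c n‖ ^ 2 ≤ 32 * 4 ^ k * 2 ^ i := by
  have h4 : (0 : ℝ) < 4 ^ k := by positivity
  induction i with
  | zero =>
    have h1 := (mem_goodSet.1 hc).1
    refine (sum_weight_lowFreq_le N k c).trans ?_
    rw [pow_zero, mul_one]
    nlinarith
  | succ i ih =>
    obtain ⟨h1, h2⟩ := goodSet_succ_subset hc
    rw [← add_assoc, sum_lowFreq_succ]
    have h3 := (mem_blockEvent.1 h2).2
    have h5 := (sum_weight_dyadic_le N (k + i) c).trans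
      (mul_le_mul_of_nonneg_left h3 (by positivity))
    refine (add_le_add (ih h1) h5).trans (le_of_eq ?_)
    have : (4 : ℝ) ^ i = 2 ^ i * 2 ^ i := by rw [← mul_pow]; norm_num
    rw [pow_succ, pow_add, this, one_div, inv_pow]
    field_simp
    ring

/-- Each block contributes at most 2^{k+l+1} · 8 · 2^{-l} = 16 · 2^k, hence linear growth in i only.
-/
theorem abs_momentum_le_of_mem_goodSet (hM : M ≤ 1) (hc : c ∈ goodSet N K M k i) :
    |momentum (lowFreq N (k + i)) c| ≤ 2 ^ k * (1 + 16 * i) := by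
  suffices h : ∑ n ∈ lowFreq N (k + i), |(n : ℝ)| * ‖c n‖ ^ 2 ≤ 2 ^ k * (1 + 16 * i) by
    refine (Finset.abs_sum_le_sum_abs _ _).trans (le_trans (le_of_eq ?_) h)
    exact Finset.sum_congr rfl fun n _ => by rw [abs_mul, abs_of_nonneg (sq_nonneg ‖c n‖)]
  have h4 : (0 : ℝ) < 2 ^ k := by positivity
  induction i with
  | zero =>
    have h1 := (mem_goodSet.1 hc).1
    calc ∑ n ∈ lowFreq N (k + 0), |(n : ℝ)| * ‖c n‖ ^ 2
        ≤ ∑ n ∈ lowFreq N k, 2 ^ k * ‖c n‖ ^ 2 := Finset.sum_le_sum fun n hn =>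
          mul_le_mul_of_nonneg_right (abs_le_of_mem_lowFreq hn) (by positivity)
      _ = 2 ^ k * ∑ n ∈ lowFreq N k, ‖c n‖ ^ 2 := by rw [Finset.mul_sum]
      _ ≤ _ := by simp only [Nat.cast_zero, mul_zero, add_zero]; nlinarith
  | succ i ih =>
    obtain ⟨h1, h2⟩ := goodSet_succ_subset hc
    rw [← add_assoc, sum_lowFreq_succ]
    have h3 := (mem_blockEvent.1 h2).2
    have h5 : ∑ n ∈ dyadic N (k + i), |(n : ℝ)| * ‖c n‖ ^ 2 ≤
        2 ^ (k + i + 1) * (8 * (1 / 2) ^ i) := by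
      refine le_trans ?_ (mul_le_mul_of_nonneg_left h3 (by positivity))
      rw [Finset.mul_sum]
      exact Finset.sum_le_sum fun n hn =>
        mul_le_mul_of_nonneg_right (abs_le_of_mem_dyadic hn) (by positivity)
    refine (add_le_add (ih h1) h5).trans (le_of_eq ?_)
    rw [pow_succ, pow_add, one_div, inv_pow]
    push_cast
    field_simp
    ring

theorem integral_norm_pow_le (S : Finset ℤ) (c : ℤ → ℂ) {b w : ℝ}
    (hb : ∀ x, ‖trigPoly S c x‖ ≤ b) (hw : ∑ n ∈ S, (n : ℝ) ^ 2 * ‖c n‖ ^ 2 ≤ w) :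
    ∫ x, ‖trigPoly S c x‖ ^ 4 * ‖trigPoly S (derivSeq c) x‖ ^ 2 ∂circLaw ≤ b ^ 4 * w := by
  have cu := continuous_trigPoly S c
  have cu' := continuous_trigPoly S (derivSeq c)
  have hb0 : 0 ≤ b := (norm_nonneg _).trans (hb 0)
  calc ∫ x, ‖trigPoly S c x‖ ^ 4 * ‖trigPoly S (derivSeq c) x‖ ^ 2 ∂circLaw
      ≤ ∫ x, b ^ 4 * ‖trigPoly S (derivSeq c) x‖ ^ 2 ∂circLaw := by
        refine integral_mono (integrable_circLaw (by fun_prop)) (integrable_circLaw (by fun_prop))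
          fun x => ?_
        exact mul_le_mul_of_nonneg_right (pow_le_pow_left₀ (norm_nonneg _) (hb x) 4)
          (by positivity)
    _ = b ^ 4 * ∑ n ∈ S, (n : ℝ) ^ 2 * ‖c n‖ ^ 2 := by
        rw [integral_const_mul, integral_norm_sq_trigPoly]
        congr 1
        exact Finset.sum_congr rfl fun n _ => by rw [norm_derivSeq, mul_pow, sq_abs]
    _ ≤ _ := mul_le_mul_of_nonneg_left hw (by positivity)

/-- The lower modes satisfy the good bounds and the new block the doubled ones, as after a rotation.
The constants are 7 = 5 + 2 for the supremum and 96 = 32 + 64 for the derivative. -/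
theorem integral_norm_pow_splice_le (hK : 1 ≤ K) (hM : 2 * M * K ≤ 1) (hM1 : M ≤ 1)
    (hc : c ∈ goodSet N K M k i) {a : ℤ → ℂ}
    (ha : a ∈ blockEvent (dyadic N (k + i)) (2 * (Real.sqrt (2 ^ k / K) * (3 / 4) ^ i))
      (2 * (8 * (1 / 2) ^ i))) :
    ∫ x, ‖trigPoly (lowFreq N (k + i + 1)) (splice (dyadic N (k + i)) c a) x‖ ^ 4 *
      ‖trigPoly (lowFreq N (k + i + 1)) (derivSeq (splice (dyadic N (k + i)) c a)) x‖ ^ 2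
      ∂circLaw ≤ 7 ^ 4 * (4 ^ k / K ^ 2) * (96 * 4 ^ k * 2 ^ i) := by
  rw [mem_blockEvent] at ha
  have hsq : Real.sqrt (2 ^ k / K) ^ 4 = 4 ^ k / K ^ 2 := by
    rw [show (4 : ℕ) = 2 * 2 from rfl, pow_mul, Real.sq_sqrt (by positivity), div_pow, ← pow_mul,
      mul_comm k 2, pow_mul]
    norm_num
  have h34 : (0 : ℝ) < (3 / 4) ^ i ∧ ((3 : ℝ) / 4) ^ i ≤ 1 :=
    ⟨by positivity, pow_le_one₀ (by norm_num) (by norm_num)⟩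
  have hs0 := Real.sqrt_nonneg (2 ^ k / K)
  rw [← hsq, ← mul_pow]
  refine integral_norm_pow_le _ _ (fun x => ?_) ?_
  · rw [trigPoly_splice (dyadic_subset N _), lowFreq_sdiff]
    have h1 := norm_trigPoly_le_of_mem_goodSet hK hM hc x
    refine (norm_add_le _ _).trans ((add_le_add h1 (ha.1 x)).trans ?_)
    nlinarith
  · rw [sum_lowFreq_succ]
    have h1 := sum_weight_le_of_mem_goodSet hM1 hc
    have h2 : ∑ n ∈ lowFreq N (k + i), (n : ℝ) ^ 2 * ‖splice (dyadic N (k + i)) c a n‖ ^ 2 =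
        ∑ n ∈ lowFreq N (k + i), (n : ℝ) ^ 2 * ‖c n‖ ^ 2 :=
      Finset.sum_congr rfl fun n hn => by
        rw [splice_of_notMem (by simpa using disjoint_lowFreq_dyadic le_rfl hn)]
    have h3 : ∑ n ∈ dyadic N (k + i), (n : ℝ) ^ 2 * ‖splice (dyadic N (k + i)) c a n‖ ^ 2 =
        ∑ n ∈ dyadic N (k + i), (n : ℝ) ^ 2 * ‖a n‖ ^ 2 :=
      Finset.sum_congr rfl fun n hn => by rw [splice_of_mem (by simpa using hn)]
    rw [h2, h3]
    have h5 := (sum_weight_dyadic_le N (k + i) a).trans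
      (mul_le_mul_of_nonneg_left ha.2 (by positivity))
    refine (add_le_add h1 h5).trans (le_of_eq ?_)
    have : (4 : ℝ) ^ i = 2 ^ i * 2 ^ i := by rw [← mul_pow]; norm_num
    rw [pow_succ, pow_add, this, one_div, inv_pow]
    field_simp
    ring

/-- Bernstein-type estimate: u² is bounded pointwise by 2·2^k times the mass, and u_x costs another
2^k in L². The quadratic smallness in M makes this starting cost negligible against 4^k/K. -/
theorem abs_quartic_lowFreq_le (hc : ∑ n ∈ lowFreq N k, ‖c n‖ ^ 2 < M) :
    |quartic (lowFreq N k) c| ≤ 3 * M ^ 2 * 4 ^ k := by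
  have cu := continuous_trigPoly (lowFreq N k) c
  have cu' := continuous_trigPoly (lowFreq N k) (derivSeq c)
  set m := ∑ n ∈ lowFreq N k, ‖c n‖ ^ 2 with hm
  have hm0 : 0 ≤ m := Finset.sum_nonneg fun n _ => by positivity
  have h2k : (0 : ℝ) < 2 ^ k := by positivity
  have h4 : (4 : ℝ) ^ k = 2 ^ k * 2 ^ k := by rw [← mul_pow]; norm_num
  have h1 : ∫ x, ‖trigPoly (lowFreq N k) c x‖ ^ 3 * ‖trigPoly (lowFreq N k) (derivSeq c) x‖
      ∂circLaw ≤ 2 * M ^ 2 * 4 ^ k := by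
    calc ∫ x, ‖trigPoly (lowFreq N k) c x‖ ^ 3 * ‖trigPoly (lowFreq N k) (derivSeq c) x‖ ∂circLaw
        ≤ ∫ x, 2 ^ k * m * (2 ^ k * ‖trigPoly (lowFreq N k) c x‖ ^ 2 +
          (2 ^ k)⁻¹ * ‖trigPoly (lowFreq N k) (derivSeq c) x‖ ^ 2) ∂circLaw := by
          refine integral_mono (integrable_circLaw (by fun_prop)) (integrable_circLaw (by fun_prop))
            fun x => ?_
          beta_reduce
          set U := ‖trigPoly (lowFreq N k) c x‖
          set V := ‖trigPoly (lowFreq N k) (derivSeq c) x‖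
          have e1 : U ^ 2 ≤ 2 * 2 ^ k * m := (norm_sq_trigPoly_le (lowFreq N k) c x).trans
            (mul_le_mul_of_nonneg_right (card_lowFreq_le N k) hm0)
          have e2 : 2 * (U * V) ≤ 2 ^ k * U ^ 2 + (2 ^ k)⁻¹ * V ^ 2 := by
            have h4 : 0 ≤ ((2 : ℝ) ^ k)⁻¹ * (2 ^ k * U - V) ^ 2 := by positivity
            have h5 : ((2 : ℝ) ^ k)⁻¹ * (2 ^ k * U - V) ^ 2 =
                2 ^ k * U ^ 2 + (2 ^ k)⁻¹ * V ^ 2 - 2 * (U * V) := by field_simp; ring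
            linarith
          calc U ^ 3 * V = U ^ 2 * (U * V) := by ring
            _ ≤ 2 * 2 ^ k * m * (U * V) := mul_le_mul_of_nonneg_right e1 (by positivity)
            _ = 2 ^ k * m * (2 * (U * V)) := by ring
            _ ≤ _ := mul_le_mul_of_nonneg_left e2 (by positivity)
      _ = 2 ^ k * m * (2 ^ k * m + (2 ^ k)⁻¹ *
            ∑ n ∈ lowFreq N k, (n : ℝ) ^ 2 * ‖c n‖ ^ 2) := by
          rw [integral_const_mul, integral_add (integrable_circLaw (by fun_prop))
            (integrable_circLaw (by fun_prop)), integral_const_mul, integral_const_mul,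
            integral_norm_sq_trigPoly, integral_norm_sq_trigPoly]
          congr 3
          exact Finset.sum_congr rfl fun n _ => by rw [norm_derivSeq, mul_pow, sq_abs]
      _ ≤ 2 ^ k * m * (2 ^ k * m + (2 ^ k)⁻¹ * (4 ^ k * m)) := by
          gcongr
          exact sum_weight_lowFreq_le N k c
      _ = 2 * m ^ 2 * 4 ^ k := by rw [h4]; field_simp; ring
      _ ≤ _ := by gcongr
  refine (abs_quartic_le_integral _ _).trans ?_
  linarith

end Bounds

/-! ### Iterating over the dyadic blocks. -/

/-- The exponent gained when the `i`-th dyadic block above frequency `2 ^ k` is added. -/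
def blockCost (t K τ : ℝ) (k i : ℕ) : ℝ :=
  2 * τ + 48 * t * ((1 / 2) ^ i * (1 + 16 * i)) +
    t ^ 2 * Real.pi ^ 2 * (9 / 4) * (7 ^ 4 * 96 * (4 ^ k / K ^ 2)) * (1 / 2) ^ i

theorem inv_one_sub_le_exp {τ : ℝ} (h0 : 0 ≤ τ) (h : τ ≤ 1 / 2) :
    (1 - τ)⁻¹ ≤ Real.exp (2 * τ) := by
  have h1 := Real.add_one_le_exp (2 * τ)
  refine le_trans ?_ h1
  rw [inv_le_iff_one_le_mul₀ (by linarith)]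
  nlinarith

/-- The three terms of `blockCost` come from the normalization 1/(1 - τ), the mean drift and the
Gaussian fluctuation. In the last, 4^k · 4^k · 2^i is divided by the variance scale 4^{k+i}, which
leaves the summable factor 2^{-i}. -/
theorem lintegral_exp_tailEvent_le {N : ℕ} {K M t τ : ℝ} {k i : ℕ} (hK : 1 ≤ K)
    (hM : 2 * M * K ≤ 1) (hM1 : M ≤ 1) (ht : 0 ≤ t) (hτ0 : 0 ≤ τ) (hτ : τ ≤ 1 / 2)
    (hE : seqLaw (tailEvent N K k i)ᶜ ≤ ENNReal.ofReal τ) {c : ℤ → ℂ}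
    (hc : c ∈ goodSet N K M k i) :
    ∫⁻ a in tailEvent N K k i, ENNReal.ofReal (Real.exp (t *
        quartic (lowFreq N (k + i + 1)) (splice (dyadic N (k + i)) c a))) ∂seqLaw ≤
      ENNReal.ofReal (Real.exp (blockCost t K τ k i)) *
        ENNReal.ofReal (Real.exp (t * quartic (lowFreq N (k + i)) c)) := by
  have hp : 1 - τ ≤ seqLaw.real (tailEvent N K k i) := by
    have h1 : seqLaw.real (tailEvent N K k i)ᶜ ≤ τ :=
      ENNReal.toReal_le_of_le_ofReal hτ0 hE
    rw [probReal_compl_eq_one_sub (measurableSet_tailEvent N K k i)] at h1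
    linarith
  have h := lintegral_exp_block_le (S := lowFreq N (k + i + 1)) (dyadic_subset N (k + i))
    (mem_dyadic_neg N (k + i))
    (blockInvariant_blockEvent (mem_dyadic_neg N (k + i))
      (Real.sqrt (2 ^ k / K) * (3 / 4) ^ i) (8 * (1 / 2) ^ i))
    (measurableSet_blockEvent _ _ _) (fun a ha b hb θ => rotFst_mem_blockEvent ha hb θ) c ht
    (p := 1 - τ) (by linarith) hp (sum_setIntegral_dyadic_le N (k + i) _)
    (κ := 4 ^ (k + i)) (by positivity) (fun n hn => le_bracketSq_of_mem_dyadic hn)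
    (fun a ha => integral_norm_pow_splice_le hK hM hM1 hc ha)
  rw [lowFreq_sdiff] at h
  have hY := abs_momentum_le_of_mem_goodSet hM1 hc
  have hsplit : ∀ a, ENNReal.ofReal (Real.exp (t *
      quartic (lowFreq N (k + i + 1)) (splice (dyadic N (k + i)) c a))) =
      ENNReal.ofReal (Real.exp (t * (quartic (lowFreq N (k + i + 1))
        (splice (dyadic N (k + i)) c a) - quartic (lowFreq N (k + i)) c))) *
      ENNReal.ofReal (Real.exp (t * quartic (lowFreq N (k + i)) c)) := fun a => by
    rw [← ENNReal.ofReal_mul (Real.exp_pos _).le, ← Real.exp_add]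
    congr 2; ring
  simp only [hsplit]
  have hm := measurable_quartic_splice (lowFreq N (k + i + 1)) (dyadic N (k + i)) c
  rw [lintegral_mul_const _ (by fun_prop)]
  gcongr
  refine h.trans (ENNReal.ofReal_le_ofReal ?_)
  -- The powers 2^k cancel between the momentum and the expected block mass. Since 1 - τ ≥ 1/2,
  -- dividing by it doubles 24 to 48.
  have hA : 3 * t * (8 / 2 ^ (k + i)) * |momentum (lowFreq N (k + i)) c| / (1 - τ) ≤
      48 * t * ((1 / 2) ^ i * (1 + 16 * i)) := by
    rw [div_le_iff₀ (by linarith)]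
    have e1 : 3 * t * (8 / 2 ^ (k + i)) * |momentum (lowFreq N (k + i)) c| ≤
        3 * t * (8 / 2 ^ (k + i)) * (2 ^ k * (1 + 16 * i)) :=
      mul_le_mul_of_nonneg_left hY (by positivity)
    have e2 : 3 * t * (8 / 2 ^ (k + i)) * (2 ^ k * (1 + 16 * (i : ℝ))) =
        48 * t * ((1 / 2) ^ i * (1 + 16 * i)) * (1 / 2) := by
      rw [pow_add, one_div_pow]; field_simp; ring
    rw [e2] at e1
    refine e1.trans (mul_le_mul_of_nonneg_left (by linarith) (by positivity))
  have hB : t ^ 2 * Real.pi ^ 2 * (9 / 4) *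
      (7 ^ 4 * (4 ^ k / K ^ 2) * (96 * 4 ^ k * 2 ^ i) / 4 ^ (k + i)) =
      t ^ 2 * Real.pi ^ 2 * (9 / 4) * (7 ^ 4 * 96 * (4 ^ k / K ^ 2)) * (1 / 2) ^ i := by
    have : (4 : ℝ) ^ i = 2 ^ i * 2 ^ i := by rw [← mul_pow]; norm_num
    rw [pow_add, this, one_div_pow]
    field_simp
  calc (1 - τ)⁻¹ * Real.exp _ ≤ Real.exp (2 * τ) * Real.exp
        (48 * t * ((1 / 2) ^ i * (1 + 16 * i)) + t ^ 2 * Real.pi ^ 2 * (9 / 4) *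
          (7 ^ 4 * 96 * (4 ^ k / K ^ 2)) * (1 / 2) ^ i) := by
        refine mul_le_mul (inv_one_sub_le_exp hτ0 hτ) (Real.exp_le_exp.2 ?_)
          (Real.exp_pos _).le (Real.exp_pos _).le
        rw [hB]
        linarith
    _ = _ := by rw [← Real.exp_add, blockCost]; congr 1; ring

/-- Induction on the number of blocks: the top block is resampled and integrated out while the lower
modes, which lie in the previous good set, stay fixed. -/
theorem lintegral_exp_goodSet_le {N : ℕ} {K M t : ℝ} {k : ℕ} {τ : ℕ → ℝ} (hK : 1 ≤ K)
    (hM : 2 * M * K ≤ 1) (hM1 : M ≤ 1) (ht : 0 ≤ t) (hτ0 : ∀ i, 0 ≤ τ i) (hτ : ∀ i, τ i ≤ 1 / 2)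
    (hE : ∀ i, seqLaw (tailEvent N K k i)ᶜ ≤ ENNReal.ofReal (τ i)) (i : ℕ) :
    ∫⁻ c in goodSet N K M k i,
        ENNReal.ofReal (Real.exp (t * quartic (lowFreq N (k + i)) c)) ∂seqLaw ≤
      ENNReal.ofReal (Real.exp (3 * t * M ^ 2 * 4 ^ k +
        ∑ l ∈ Finset.range i, blockCost t K (τ l) k l)) := by
  induction i with
  | zero =>
    rw [Finset.sum_range_zero, add_zero, add_zero]
    calc _ ≤ ∫⁻ _ in goodSet N K M k 0, ENNReal.ofReal (Real.exp (3 * t * M ^ 2 * 4 ^ k)) ∂seqLaw := by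
          refine setLIntegral_mono measurable_const fun c hc => ?_
          refine ENNReal.ofReal_le_ofReal (Real.exp_le_exp.2 ?_)
          have h := (le_abs_self _).trans (abs_quartic_lowFreq_le (mem_goodSet.1 hc).1)
          nlinarith
      _ ≤ _ := by
          rw [lintegral_const]
          exact mul_le_of_le_one_right' (by rw [Measure.restrict_apply_univ]; exact prob_le_one)
  | succ i ih =>
    obtain ⟨F, hF⟩ : ∃ F : ℕ → (ℤ → ℂ) → ℝ≥0∞, F = fun j c =>
      ENNReal.ofReal (Real.exp (t * quartic (lowFreq N (k + j)) c)) := ⟨_, rfl⟩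
    have hFm : ∀ j, Measurable (F j) := fun j => by
      have := (continuous_quartic (lowFreq N (k + j))).measurable
      rw [hF]; fun_prop
    have hg := measurableSet_goodSet N K M k
    have hind : Measurable ((goodSet N K M k (i + 1)).indicator (F (i + 1))) :=
      (hFm _).indicator (hg _)
    have hgoal : ∫⁻ c in goodSet N K M k (i + 1), F (i + 1) c ∂seqLaw ≤
        ENNReal.ofReal (Real.exp (blockCost t K (τ i) k i)) *
          ∫⁻ c in goodSet N K M k i, F i c ∂seqLaw := by
      rw [← lintegral_indicator (hg _), lintegral_splice (dyadic N (k + i)) hind,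
        ← lintegral_indicator (hg _), ← lintegral_const_mul _ ((hFm _).indicator (hg _))]
      refine lintegral_mono fun c => ?_
      by_cases hc : c ∈ goodSet N K M k i
      · rw [Set.indicator_of_mem hc]
        have h1 := lintegral_exp_tailEvent_le hK hM hM1 ht (hτ0 i) (hτ i) (hE i) hc
        rw [hF]
        refine le_trans ?_ h1
        rw [← lintegral_indicator (measurableSet_tailEvent N K k i)]
        refine lintegral_mono fun a => ?_
        by_cases ha : splice (dyadic N (k + i)) c a ∈ goodSet N K M k (i + 1)
        · rw [Set.indicator_of_mem ha, Set.indicator_of_mem (splice_mem_goodSet_succ ha).2]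
          rfl
        · rw [Set.indicator_of_notMem ha]; exact zero_le
      · rw [Set.indicator_of_notMem hc, mul_zero, nonpos_iff_eq_zero]
        refine (lintegral_congr fun a => ?_).trans lintegral_zero
        exact Set.indicator_of_notMem (fun h => hc (splice_mem_goodSet_succ h).1) _
    rw [hF] at hgoal
    refine hgoal.trans ((mul_le_mul_right ih _).trans (le_of_eq ?_))
    rw [← ENNReal.ofReal_mul (Real.exp_pos _).le, ← Real.exp_add, Finset.sum_range_succ]
    congr 2
    ring

theorem sum_half_pow_mul_le (i : ℕ) :
    ∑ l ∈ Finset.range i, ((1 : ℝ) / 2) ^ l * (1 + 16 * l) ≤ 34 := by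
  have h : ∑ l ∈ Finset.range i, ((1 : ℝ) / 2) ^ l * (1 + 16 * l) =
      34 - (1 / 2) ^ i * (32 * i + 34) := by
    induction i with
    | zero => simp
    | succ i ih => rw [Finset.sum_range_succ, ih, pow_succ]; push_cast; ring
  rw [h]
  have : (0 : ℝ) ≤ (1 / 2) ^ i * (32 * i + 34) := by positivity
  linarith

theorem sum_half_pow_le (i : ℕ) : ∑ l ∈ Finset.range i, ((1 : ℝ) / 2) ^ l ≤ 2 := by
  have h : ∑ l ∈ Finset.range i, ((1 : ℝ) / 2) ^ l = 2 - 2 * (1 / 2) ^ i := by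
    induction i with
    | zero => simp
    | succ i ih => rw [Finset.sum_range_succ, ih, pow_succ]; ring
  rw [h]
  have : (0 : ℝ) ≤ 2 * (1 / 2) ^ i := by positivity
  linarith

theorem sum_blockCost_le {t K : ℝ} (ht : 0 ≤ t) (hK : 1 ≤ K) {k : ℕ} {τ : ℕ → ℝ} {T : ℝ}
    (hτ : ∀ i, ∑ l ∈ Finset.range i, τ l ≤ T) (i : ℕ) :
    ∑ l ∈ Finset.range i, blockCost t K (τ l) k l ≤
      2 * T + 1632 * t + 11000000 * t ^ 2 / K ^ 2 * 4 ^ k := by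
  simp only [blockCost, Finset.sum_add_distrib, ← Finset.mul_sum]
  have h1 := hτ i
  have h2 := mul_le_mul_of_nonneg_left (sum_half_pow_mul_le i) (by positivity : 0 ≤ 48 * t)
  have hpi : Real.pi ^ 2 ≤ 10 := by nlinarith [Real.pi_lt_d2, Real.pi_pos]
  have h3 : t ^ 2 * Real.pi ^ 2 * (9 / 4) * (7 ^ 4 * 96 * (4 ^ k / K ^ 2)) *
      ∑ l ∈ Finset.range i, ((1 : ℝ) / 2) ^ l ≤
      t ^ 2 * 10 * (9 / 4) * (7 ^ 4 * 96 * (4 ^ k / K ^ 2)) * 2 := by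
    gcongr
    exact sum_half_pow_le i
  have h4 : t ^ 2 * 10 * (9 / 4) * (7 ^ 4 * 96 * (4 ^ k / K ^ 2)) * 2 ≤
      11000000 * t ^ 2 / K ^ 2 * 4 ^ k := by
    have : 0 ≤ t ^ 2 / K ^ 2 * 4 ^ k := by positivity
    calc _ = 10372320 * (t ^ 2 / K ^ 2 * 4 ^ k) := by ring
      _ ≤ 11000000 * (t ^ 2 / K ^ 2 * 4 ^ k) := by linarith
      _ = _ := by ring
  linarith

/-! ### Probability of bad blocks and the admissible thresholds. -/

/-- The constant in the tail bound for the dyadic blocks. -/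
def tailConst (K : ℝ) : ℝ := 121 * ((48 * K) ^ 12 * (Nat.factorial 12 : ℕ))

/-- The block has pointwise variance at most 4/2^{k+i}, so the rate 2^{k+i}/24 is allowed in the
tail bound, and against the squared level (2^k/K)(9/16)^i the exponent is 2y, with y = 4^k
(9/8)^i/(48K). The ratio 3/4 is a compromise: its powers are summable, and 2·(3/4)² = 9/8 > 1 still
makes the exponent grow. One factor e^{-y} gives the decay in k; the other absorbs the counting
factors and yields 2^{-i}. The mass level 8·2^{-i} gives an exponent that beats the factor 2 for
each of the at most 4·2^{k+i} modes. -/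
theorem seqLaw_compl_tailEvent_le (N : ℕ) {K : ℝ} (hK : 1 ≤ K) (k i : ℕ) :
    seqLaw (tailEvent N K k i)ᶜ ≤ ENNReal.ofReal
      (tailConst K * Real.exp (-(4 ^ k / (48 * K))) * (1 / 2) ^ i) := by
  have hσ := sum_inv_bracketSq_dyadic_le N (k + i)
  have h := seqLaw_compl_blockEvent_le (dyadic N (k + i)) (l := 2 ^ (k + i) / 24)
    (D := 2 ^ (k + i + 1)) (b := Real.sqrt (2 ^ k / K) * (3 / 4) ^ i) (κ := 4 ^ (k + i))
    (s := 8 * (1 / 2) ^ i) (by positivity) (one_le_pow₀ (by norm_num)) (by positivity)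
    (fun n hn => abs_le_of_mem_dyadic hn) (by
      have := mul_le_mul_of_nonneg_left hσ (by positivity : (0 : ℝ) ≤ 6 * (2 ^ (k + i) / 24))
      refine (le_of_eq (by ring)).trans (this.trans (le_of_eq ?_))
      field_simp
      norm_num) (by positivity) (fun n hn => le_bracketSq_of_mem_dyadic hn)
  refine h.trans (ENNReal.ofReal_le_ofReal ?_)
  have hk4 : (4 : ℝ) ^ k = 2 ^ k * 2 ^ k := by rw [← mul_pow]; norm_num
  have hi4 : (4 : ℝ) ^ i = 2 ^ i * 2 ^ i := by rw [← mul_pow]; norm_num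
  set y : ℝ := 4 ^ k * (9 / 8) ^ i / (48 * K) with hy
  have hk1 : (1 : ℝ) ≤ 4 ^ k := one_le_pow₀ (by norm_num)
  have h2k1 : (1 : ℝ) ≤ 2 ^ k := one_le_pow₀ (by norm_num)
  have h2i1 : (1 : ℝ) ≤ 2 ^ i := one_le_pow₀ (by norm_num)
  have h98 : (1 : ℝ) ≤ (9 / 8) ^ i := one_le_pow₀ (by norm_num)
  have e1 : 2 ^ (k + i) / 24 * (Real.sqrt (2 ^ k / K) * (3 / 4) ^ i) ^ 2 = 2 * y := by
    rw [mul_pow, Real.sq_sqrt (by positivity), hy, hk4, pow_add, ← pow_mul, mul_comm i 2, pow_mul,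
      show ((9 : ℝ) / 8) = 2 * (3 / 4) ^ 2 by norm_num, mul_pow]
    field_simp
    norm_num
  have e2 : (2 : ℝ) ^ (dyadic N (k + i)).card * Real.exp (-(4 ^ (k + i) / 2 * (8 * (1 / 2) ^ i))) ≤
      Real.exp (-(2 * y)) := by
    have f1 : (2 : ℝ) ^ (dyadic N (k + i)).card ≤ Real.exp (3 * (2 ^ k * 2 ^ i)) := by
      calc (2 : ℝ) ^ (dyadic N (k + i)).card ≤ 2 ^ (4 * 2 ^ (k + i)) :=
            pow_le_pow_right₀ (by norm_num) (card_dyadic_le N (k + i))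
        _ = 16 ^ (2 ^ (k + i)) := by rw [pow_mul]; norm_num
        _ ≤ Real.exp 3 ^ (2 ^ (k + i)) := by
            refine pow_le_pow_left₀ (by norm_num) ?_ _
            have h1 := Real.exp_one_gt_d9
            have h3 : Real.exp 3 = Real.exp 1 ^ 3 := by
              rw [← Real.exp_nat_mul]; norm_num
            rw [h3]
            have := pow_le_pow_left₀ (by norm_num) h1.le 3
            refine le_trans (by norm_num) this
        _ = _ := by
            rw [← Real.exp_nat_mul]
            congr 1
            push_cast
            rw [pow_add]; ring
    have f2 : (4 : ℝ) ^ (k + i) / 2 * (8 * (1 / 2) ^ i) = 4 * (4 ^ k * 2 ^ i) := by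
      rw [pow_add, hi4, one_div_pow]; field_simp; norm_num
    have f3 : 2 * y ≤ 4 ^ k * 2 ^ i := by
      rw [hy]
      have : ((9 : ℝ) / 8) ^ i ≤ 2 ^ i := pow_le_pow_left₀ (by norm_num) (by norm_num) i
      calc 2 * (4 ^ k * (9 / 8) ^ i / (48 * K)) = 4 ^ k * (9 / 8) ^ i / (24 * K) := by
            field_simp; norm_num
        _ ≤ 4 ^ k * (9 / 8) ^ i := div_le_self (by positivity) (by linarith)
        _ ≤ _ := by gcongr
    rw [f2]
    refine (mul_le_mul_of_nonneg_right f1 (Real.exp_pos _).le).trans ?_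
    rw [← Real.exp_add]
    refine Real.exp_le_exp.2 ?_
    have : (2 : ℝ) ^ k * 2 ^ i ≤ 4 ^ k * 2 ^ i := by
      gcongr; norm_num
    linarith
  rw [e1]
  have hy0 : 0 < y := by rw [hy]; positivity
  have hyk : (4 : ℝ) ^ k / (48 * K) ≤ y := by
    rw [hy]; gcongr; nlinarith
  have e3 : y ^ 12 * Real.exp (-y) ≤ (Nat.factorial 12 : ℕ) := by
    have := Real.pow_div_factorial_le_exp y hy0.le 12
    rw [div_le_iff₀ (by positivity)] at this
    rw [Real.exp_neg, ← div_eq_mul_inv, div_le_iff₀ (Real.exp_pos _)]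
    linarith
  -- The power 12 is chosen because (9/8)^12 > 4.
  have e4 : (2 : ℝ) ^ k * 4 ^ i ≤ (48 * K * y) ^ 12 := by
    have : 48 * K * y = 4 ^ k * (9 / 8) ^ i := by rw [hy]; field_simp
    rw [this, mul_pow, ← pow_mul, ← pow_mul, mul_comm i 12, pow_mul (9 / 8 : ℝ)]
    refine mul_le_mul ?_ (pow_le_pow_left₀ (by norm_num) (by norm_num) i) (by positivity)
      (by positivity)
    calc (2 : ℝ) ^ k ≤ 4 ^ k := by gcongr; norm_num
      _ ≤ 4 ^ (k * 12) := pow_le_pow_right₀ (by norm_num) (by omega)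
  have e5 : Real.exp (-(2 * y)) = Real.exp (-y) * Real.exp (-y) := by
    rw [← Real.exp_add]; congr 1; ring
  calc 30 * 2 ^ (k + i + 1) * Real.exp (-(2 * y)) + 2 ^ (dyadic N (k + i)).card *
        Real.exp (-(4 ^ (k + i) / 2 * (8 * (1 / 2) ^ i)))
      ≤ 30 * 2 ^ (k + i + 1) * Real.exp (-(2 * y)) + Real.exp (-(2 * y)) := by gcongr
    _ = (60 * (2 ^ k * 2 ^ i) + 1) * Real.exp (-(2 * y)) := by rw [pow_succ, pow_add]; ring
    _ ≤ 121 * (2 ^ k * 2 ^ i) * Real.exp (-(2 * y)) := by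
        gcongr
        nlinarith [one_le_mul_of_one_le_of_one_le h2k1 h2i1]
    _ = 121 * ((2 ^ k * 4 ^ i) * Real.exp (-y)) * Real.exp (-y) * (1 / 2) ^ i := by
        rw [e5, hi4, one_div_pow]; field_simp
    _ ≤ 121 * ((48 * K * y) ^ 12 * Real.exp (-y)) * Real.exp (-(4 ^ k / (48 * K))) *
          (1 / 2) ^ i := by
        gcongr
    _ = 121 * ((48 * K) ^ 12 * (y ^ 12 * Real.exp (-y))) * Real.exp (-(4 ^ k / (48 * K))) *
          (1 / 2) ^ i := by ring
    _ ≤ _ := by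
        rw [tailConst]
        gcongr

/-- The event that the first `i` dyadic blocks above frequency `2 ^ k` are small. -/
def tailGood (N : ℕ) (K : ℝ) (k i : ℕ) : Set (ℤ → ℂ) := ⋂ l ∈ Finset.range i, tailEvent N K k l

theorem measurableSet_tailGood (N : ℕ) (K : ℝ) (k i : ℕ) : MeasurableSet (tailGood N K k i) :=
  Finset.measurableSet_biInter _ fun l _ => measurableSet_tailEvent N K k l

theorem seqLaw_compl_tailGood_le (N : ℕ) {K : ℝ} (hK : 1 ≤ K) (k i : ℕ) :
    seqLaw (tailGood N K k i)ᶜ ≤ ENNReal.ofReal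
      (2 * tailConst K * Real.exp (-(4 ^ k / (48 * K)))) := by
  have hC : 0 ≤ tailConst K := by rw [tailConst]; positivity
  have h1 : (tailGood N K k i)ᶜ = ⋃ l ∈ Finset.range i, (tailEvent N K k l)ᶜ := by
    simp [tailGood, Set.compl_iInter]
  rw [h1]
  refine (measure_biUnion_finset_le _ _).trans ((Finset.sum_le_sum fun l _ =>
    seqLaw_compl_tailEvent_le N hK k l).trans ?_)
  rw [← ENNReal.ofReal_sum_of_nonneg fun l _ => by positivity]
  refine ENNReal.ofReal_le_ofReal ?_
  rw [← Finset.mul_sum]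
  calc _ ≤ tailConst K * Real.exp (-(4 ^ k / (48 * K))) * 2 :=
        mul_le_mul_of_nonneg_left (sum_half_pow_le i) (by positivity)
    _ = _ := by ring

theorem sum_lowFreq_le_sum_box (N k : ℕ) (c : ℤ → ℂ) :
    ∑ n ∈ lowFreq N k, ‖c n‖ ^ 2 ≤ ∑ n ∈ box N, ‖c n‖ ^ 2 :=
  Finset.sum_le_sum_of_subset_of_nonneg (Finset.filter_subset _ _) fun n _ _ => by positivity

/-- Truncation at the level y: either x ≤ y, or e^x ≤ e^{2x-y}. Unlike Hölder's inequality it leaves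
the level free to be chosen at each scale. -/
theorem exp_le_add_exp_two (x y : ℝ) : Real.exp x ≤ Real.exp y + Real.exp (-y) * Real.exp (2 * x) := by
  have h1 : Real.exp (-y) * Real.exp (2 * x) = Real.exp (x - y) * Real.exp x := by
    rw [← Real.exp_add, ← Real.exp_add]; congr 1; ring
  have h2 : Real.exp x = Real.exp (x - y) * Real.exp y := by
    rw [← Real.exp_add]; congr 1; ring
  have h3 := Real.exp_pos (x - y)
  have h4 := Real.exp_pos y
  rw [h1]
  rcases le_total x y with h | h
  · have := Real.exp_le_exp.2 h
    have : 0 ≤ Real.exp (x - y) * Real.exp x := by positivity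
    linarith
  · have : 1 ≤ Real.exp (x - y) := Real.one_le_exp (by linarith)
    nlinarith [Real.exp_pos x]

theorem exp_neg_le_inv {y : ℝ} (hy : 0 < y) : Real.exp (-y) ≤ y⁻¹ := by
  rw [Real.exp_neg]
  exact inv_anti₀ hy (by linarith [Real.add_one_le_exp y])

theorem exists_exp_neg_four_pow_le {K : ℝ} (hK : 0 < K) (C : ℝ) :
    ∃ k₀ : ℕ, ∀ k ≥ k₀, C * Real.exp (-(4 ^ k / (48 * K))) ≤ 1 / 2 := by
  have h1 : Tendsto (fun k : ℕ => (4 : ℝ) ^ k / (48 * K)) atTop atTop :=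
    (tendsto_pow_atTop_atTop_of_one_lt (by norm_num)).atTop_div_const (by positivity)
  have h2 : Tendsto (fun k : ℕ => C * Real.exp (-((4 : ℝ) ^ k / (48 * K)))) atTop (𝓝 (C * 0)) :=
    ((Real.tendsto_exp_neg_atTop_nhds_zero).comp h1).const_mul C
  rw [mul_zero] at h2
  exact eventually_atTop.1 (h2.eventually_le_const (by norm_num))

/-- Exponential integrability of the quartic functional below a small mass threshold. -/
theorem exists_lintegral_exp_quartic_le {q : ℝ} (hq : 1 ≤ q) :
    ∃ M : ℝ, 0 < M ∧ ∃ C : ℝ, ∀ N : ℕ,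
      ∫⁻ c in {c | ∑ n ∈ box N, ‖c n‖ ^ 2 < M},
        ENNReal.ofReal (Real.exp (q * quartic (box N) c)) ∂seqLaw ≤ ENNReal.ofReal C := by
  -- The fluctuation cost is of order q² 4^k/K² and the failure probability has exponent 4^k/(48K),
  -- so K must be a large multiple of q². The mass M is then taken small enough that the
  -- low-frequency cost is below the same scale 4^k/K.
  obtain ⟨K, hKdef⟩ : ∃ K : ℝ, K = 80000000000 * q ^ 2 := ⟨_, rfl⟩
  have hq2 : 1 ≤ q ^ 2 := one_le_pow₀ hq
  have hK : 1 ≤ K := by rw [hKdef]; linarith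
  have hK0 : 0 < K := by linarith
  obtain ⟨M, hMdef⟩ : ∃ M : ℝ, M = 1 / (10000 * q * K) := ⟨_, rfl⟩
  have hM0 : 0 < M := by rw [hMdef]; positivity
  have hqK : 1 ≤ q * K := one_le_mul_of_one_le_of_one_le hq hK
  have hM1 : M ≤ 1 := by
    rw [hMdef, div_le_one (by positivity)]; nlinarith
  have hMK : 2 * M * K ≤ 1 := by
    rw [hMdef, show 2 * (1 / (10000 * q * K)) * K = 1 / (5000 * q) by field_simp; norm_num,
      div_le_one (by positivity)]
    linarith
  have hexp : 6 * q * M ^ 2 + 11000000 * (2 * q) ^ 2 / K ^ 2 ≤ 1 / (800 * K) := by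
    have e1 : 6 * q * M ^ 2 ≤ 1 / (1600 * K) := by
      have : 6 * q * M ^ 2 = 6 / (100000000 * (q * K)) * (1 / K) := by rw [hMdef]; field_simp; norm_num
      rw [this, show 1 / (1600 * K) = 1 / 1600 * (1 / K) by field_simp]
      refine mul_le_mul_of_nonneg_right ?_ (by positivity)
      rw [div_le_div_iff₀ (by positivity) (by norm_num)]
      nlinarith
    have e2 : 11000000 * (2 * q) ^ 2 / K ^ 2 ≤ 1 / (1600 * K) := by
      have : 11000000 * (2 * q) ^ 2 / K ^ 2 = 44000000 / 80000000000 * (1 / K) := by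
        rw [show K ^ 2 = K * (80000000000 * q ^ 2) by rw [← hKdef]; ring]
        field_simp; norm_num
      rw [this, show 1 / (1600 * K) = 1 / 1600 * (1 / K) by field_simp]
      refine mul_le_mul_of_nonneg_right (by norm_num) (by positivity)
    have e3 : 1 / (800 * K) = 1 / (1600 * K) + 1 / (1600 * K) := by field_simp; norm_num
    linarith
  obtain ⟨k₀, hk₀⟩ := exists_exp_neg_four_pow_le hK0 (tailConst K)
  have hC0 : 0 ≤ tailConst K := by rw [tailConst]; positivity
  obtain ⟨Cq, hCq⟩ : ∃ Cq : ℝ, Cq = Real.exp (2 + 3264 * q) := ⟨_, rfl⟩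
  have hCq0 : 0 < Cq := by rw [hCq]; exact Real.exp_pos _
  refine ⟨M, hM0, (1 + Cq * Real.exp (4 ^ k₀ / (800 * K))) +
    (2 * tailConst K + Cq) * (800 * K), fun N => ?_⟩
  obtain ⟨J₀, hJ₀⟩ : ∃ J, N < 2 ^ J := ⟨N, Nat.lt_two_pow_self⟩
  -- At scale J every frequency is low and there are no tail conditions, so the full integral is the
  -- term k = J. It is compared downwards with k = k₀, where the failure probabilities first become
  -- small; k₀ does not depend on N.
  obtain ⟨J, hJdef⟩ : ∃ J, J = max J₀ k₀ := ⟨_, rfl⟩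
  have hJN : N < 2 ^ J := hJ₀.trans_le (Nat.pow_le_pow_right (by norm_num) (by omega))
  have hJk : k₀ ≤ J := by omega
  obtain ⟨D, hD⟩ : ∃ D : Set (ℤ → ℂ), D = {c | ∑ n ∈ box N, ‖c n‖ ^ 2 < M} := ⟨_, rfl⟩
  have hDm : MeasurableSet D := by
    rw [hD]; exact measurableSet_lt (by fun_prop) measurable_const
  rw [← hD]
  have hqm := (continuous_quartic (box N)).measurable
  have hsub : ∀ k ≤ J, D ∩ tailGood N K k (J - k) ⊆ goodSet N K M k (J - k) := by
    intro k _ c hc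
    rw [hD, Set.mem_inter_iff, Set.mem_ofPred_eq, tailGood] at hc
    rw [mem_goodSet]
    exact ⟨(sum_lowFreq_le_sum_box N k c).trans_lt hc.1, fun l hl => by
      have := Set.mem_iInter₂.1 hc.2 l (Finset.mem_range.2 hl)
      exact this⟩
  have h2q : ∀ k, k₀ ≤ k → k ≤ J → ∫⁻ c in D ∩ tailGood N K k (J - k),
      ENNReal.ofReal (Real.exp (2 * (q * quartic (box N) c))) ∂seqLaw ≤
      ENNReal.ofReal (Cq * Real.exp (4 ^ k / (800 * K))) := by
    intro k hk hkJ
    refine (lintegral_mono_set (hsub k hkJ)).trans ?_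
    have hτ := hk₀ k hk
    have h := lintegral_exp_goodSet_le (N := N) (k := k) (t := 2 * q)
      (τ := fun i => tailConst K * Real.exp (-(4 ^ k / (48 * K))) * (1 / 2) ^ i) hK hMK hM1
      (by positivity) (fun i => by positivity)
      (fun i => (mul_le_of_le_one_right (by positivity)
        (pow_le_one₀ (by norm_num) (by norm_num))).trans hτ)
      (fun i => seqLaw_compl_tailEvent_le N hK k i) (J - k)
    rw [Nat.add_sub_cancel' hkJ, lowFreq_eq_box hJN] at h
    simp only [mul_assoc (2 : ℝ) q] at h
    refine h.trans (ENNReal.ofReal_le_ofReal ?_)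
    rw [hCq, ← Real.exp_add]
    refine Real.exp_le_exp.2 ?_
    have hs := sum_blockCost_le (t := 2 * q) (by positivity) hK (k := k) (T := 1)
      (τ := fun i => tailConst K * Real.exp (-(4 ^ k / (48 * K))) * (1 / 2) ^ i) (fun i => by
        rw [← Finset.mul_sum]
        have := mul_le_mul_of_nonneg_left (sum_half_pow_le i)
          (by positivity : 0 ≤ tailConst K * Real.exp (-(4 ^ k / (48 * K))))
        linarith) (J - k)
    have h5 := mul_le_mul_of_nonneg_right hexp (by positivity : (0 : ℝ) ≤ 4 ^ k)
    have h6 : 1 / (800 * K) * 4 ^ k = 4 ^ k / (800 * K) := by ring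
    simp only [← mul_assoc] at hs ⊢
    linarith
  have hyoung : ∀ (A B : Set (ℤ → ℂ)), MeasurableSet A → MeasurableSet B → ∀ y : ℝ,
      ∫⁻ c in A ∩ B, ENNReal.ofReal (Real.exp (q * quartic (box N) c)) ∂seqLaw ≤
      ENNReal.ofReal (Real.exp y) * seqLaw B + ENNReal.ofReal (Real.exp (-y)) *
        ∫⁻ c in A, ENNReal.ofReal (Real.exp (2 * (q * quartic (box N) c))) ∂seqLaw := by
    intro A B hA hB y
    calc _ ≤ ∫⁻ c in A ∩ B, (ENNReal.ofReal (Real.exp y) + ENNReal.ofReal (Real.exp (-y)) *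
          ENNReal.ofReal (Real.exp (2 * (q * quartic (box N) c)))) ∂seqLaw := by
          refine lintegral_mono fun c => ?_
          rw [← ENNReal.ofReal_mul (Real.exp_pos _).le,
            ← ENNReal.ofReal_add (Real.exp_pos _).le (by positivity)]
          exact ENNReal.ofReal_le_ofReal (exp_le_add_exp_two _ _)
      _ ≤ _ := by
          rw [lintegral_add_left measurable_const, lintegral_const, Measure.restrict_apply_univ,
            lintegral_const_mul _ (by fun_prop)]
          gcongr
          · exact Set.inter_subset_right
          · exact Set.inter_subset_left
  obtain ⟨a, ha⟩ : ∃ a : ℕ → ℝ≥0∞, a = fun k => ∫⁻ c in D ∩ tailGood N K k (J - k),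
    ENNReal.ofReal (Real.exp (q * quartic (box N) c)) ∂seqLaw := ⟨_, rfl⟩
  have haJ : ∫⁻ c in D, ENNReal.ofReal (Real.exp (q * quartic (box N) c)) ∂seqLaw = a J := by
    rw [ha]; simp [tailGood]
  have ha0 : a k₀ ≤ ENNReal.ofReal (1 + Cq * Real.exp (4 ^ k₀ / (800 * K))) := by
    have h := hyoung (D ∩ tailGood N K k₀ (J - k₀)) Set.univ
      (hDm.inter (measurableSet_tailGood _ _ _ _)) MeasurableSet.univ 0
    simp only [Set.inter_univ, neg_zero, Real.exp_zero, ENNReal.ofReal_one, measure_univ,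
      one_mul] at h
    rw [ENNReal.ofReal_add zero_le_one (by positivity), ENNReal.ofReal_one, ha]
    exact h.trans (by gcongr; exact h2q k₀ le_rfl hJk)
  -- What is gained in passing from k to k + 1 lies where the bounds hold above 2^{k+1} but fail
  -- above 2^k.
  have hstep : ∀ k, k₀ ≤ k → k < J →
      a (k + 1) ≤ a k + ENNReal.ofReal ((2 * tailConst K + Cq) * (800 * K) * (1 / 4) ^ (k + 1)) := by
    intro k hk hkJ
    have hA : MeasurableSet (D ∩ tailGood N K (k + 1) (J - (k + 1))) :=
      hDm.inter (measurableSet_tailGood _ _ _ _)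
    have hG := measurableSet_tailGood N K k (J - k)
    -- With z = 4^{k+1}/(800K), the second moment costs e^z and the failure probability is of order
    -- e^{-800z/192}, an exponent above 4z. The level 2z makes both terms at most a constant times
    -- e^{-z} ≤ 1/z, which is summable in k.
    have h := hyoung _ _ hA hG.compl (4 ^ (k + 1) / (400 * K))
    have hbad : ∫⁻ c in (D ∩ tailGood N K (k + 1) (J - (k + 1))) ∩ (tailGood N K k (J - k))ᶜ,
        ENNReal.ofReal (Real.exp (q * quartic (box N) c)) ∂seqLaw ≤
        ENNReal.ofReal ((2 * tailConst K + Cq) * (800 * K) * (1 / 4) ^ (k + 1)) := by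
      refine h.trans ((add_le_add (mul_le_mul_right (seqLaw_compl_tailGood_le N hK k _) _)
        (mul_le_mul_right (h2q (k + 1) (by omega) hkJ) _)).trans ?_)
      rw [← ENNReal.ofReal_mul (Real.exp_pos _).le, ← ENNReal.ofReal_mul (Real.exp_pos _).le,
        ← ENNReal.ofReal_add (by positivity) (by positivity)]
      refine ENNReal.ofReal_le_ofReal ?_
      set z : ℝ := 4 ^ (k + 1) / (800 * K) with hz
      have hz0 : 0 < z := by rw [hz]; positivity
      have e1 : (4 : ℝ) ^ (k + 1) / (400 * K) = 2 * z := by rw [hz]; field_simp; norm_num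
      have e2 : (4 : ℝ) ^ k / (48 * K) = 800 / 192 * z := by
        rw [hz, pow_succ]; field_simp; norm_num
      have e3 : Real.exp (2 * z) * (2 * tailConst K * Real.exp (-(800 / 192 * z))) ≤
          2 * tailConst K * Real.exp (-z) := by
        rw [mul_left_comm, ← Real.exp_add]
        gcongr
        linarith
      have e4 : Real.exp (-(2 * z)) * (Cq * Real.exp z) = Cq * Real.exp (-z) := by
        rw [mul_left_comm, ← Real.exp_add]; congr 2; ring
      rw [e1, e2, e4]
      have e5 : z⁻¹ = 800 * K * (1 / 4) ^ (k + 1) := by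
        rw [hz, inv_div, one_div_pow]; ring
      calc _ ≤ (2 * tailConst K + Cq) * Real.exp (-z) := by linarith
        _ ≤ (2 * tailConst K + Cq) * z⁻¹ := by
            gcongr; exact exp_neg_le_inv hz0
        _ = _ := by rw [e5]; ring
    have hsplit := lintegral_inter_add_sdiff (μ := seqLaw)
      (fun c => ENNReal.ofReal (Real.exp (q * quartic (box N) c)))
      (D ∩ tailGood N K (k + 1) (J - (k + 1))) hG
    rw [Set.sdiff_eq] at hsplit
    calc a (k + 1) = _ := by rw [ha]; exact hsplit.symm
      _ ≤ _ := add_le_add (by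
            rw [ha]
            refine lintegral_mono_set ?_
            exact fun c hc => ⟨hc.1.1, hc.2⟩) hbad
  have hsum : ∀ d, k₀ + d ≤ J → a (k₀ + d) ≤ a k₀ + ENNReal.ofReal
      ((2 * tailConst K + Cq) * (800 * K) * (1 - (1 / 4) ^ d)) := by
    intro d
    induction d with
    | zero => intro _; simp
    | succ d ih =>
      intro hd
      have h1 := ih (by omega)
      have h2 := hstep (k₀ + d) (by omega) (by omega)
      refine h2.trans ((add_le_add_left h1 _).trans ?_)
      have h14 : ((1 : ℝ) / 4) ^ d ≤ 1 := pow_le_one₀ (by norm_num) (by norm_num)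
      rw [add_assoc, ← ENNReal.ofReal_add
        (mul_nonneg (by positivity) (by linarith)) (by positivity)]
      refine add_le_add_right (ENNReal.ofReal_le_ofReal ?_) _
      rw [← mul_add]
      refine mul_le_mul_of_nonneg_left ?_ (by positivity)
      have h3 : ((1 : ℝ) / 4) ^ (k₀ + d + 1) ≤ (1 / 4) ^ (d + 1) :=
        pow_le_pow_of_le_one (by norm_num) (by norm_num) (by omega)
      have h4 : ((1 : ℝ) / 4) ^ (d + 1) = (1 / 4) ^ d * (1 / 4) := pow_succ _ _
      have h5 : (0 : ℝ) ≤ (1 / 4) ^ d := by positivity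
      linarith
  have hfin := hsum (J - k₀) (by omega)
  rw [Nat.add_sub_cancel' hJk] at hfin
  rw [haJ, ENNReal.ofReal_add (by positivity) (by positivity)]
  refine hfin.trans (add_le_add ha0 (ENNReal.ofReal_le_ofReal ?_))
  refine mul_le_of_le_one_right (by positivity) ?_
  have : (0 : ℝ) ≤ (1 / 4) ^ (J - k₀) := by positivity
  linarith

/-! ### Convergence of the truncations in L²(μ). -/

theorem ofReal_sq_integral_le {α : Type*} [MeasurableSpace α] {μ : Measure α}
    [IsProbabilityMeasure μ] {g : α → ℝ} (hg : Integrable g μ) :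
    ENNReal.ofReal ((∫ x, g x ∂μ) ^ 2) ≤ ∫⁻ x, ENNReal.ofReal (g x ^ 2) ∂μ := by
  set m := ∫ x, g x ∂μ with hm
  have h1 : Integrable (fun x => 2 * m * g x - m ^ 2) μ :=
    (hg.const_mul _).sub (integrable_const _)
  have h2 : ∫ x, (2 * m * g x - m ^ 2) ∂μ = m ^ 2 := by
    rw [integral_sub (hg.const_mul _) (integrable_const _), integral_const_mul, ← hm]
    simp only [integral_const, probReal_univ, smul_eq_mul, one_mul]
    ring
  rw [← h2]
  refine (ofReal_integral_le_lintegral_ofReal h1).trans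
    (lintegral_mono fun x => ENNReal.ofReal_le_ofReal ?_)
  nlinarith [sq_nonneg (g x - m)]

/-- The correction 4/(N + 1) makes the induction close: it decreases by more than the two new terms.
-/
theorem sum_inv_bracketSq_box_le (N : ℕ) : ∑ n ∈ box N, 1 / bracketSq n ≤ 5 - 4 / (N + 1) := by
  induction N with
  | zero => simp [box, bracketSq]; norm_num
  | succ N ih =>
    have h : box (N + 1) = insert (-((N : ℤ) + 1)) (insert ((N : ℤ) + 1) (box N)) := by
      ext n
      simp only [box, Finset.mem_Icc, Finset.mem_insert]
      push_cast
      omega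
    rw [h, Finset.sum_insert (by
      simp only [box, Finset.mem_Icc, Finset.mem_insert]; omega), Finset.sum_insert (by
      simp only [box, Finset.mem_Icc]; omega), bracketSq_neg]
    have hb : bracketSq ((N : ℤ) + 1) = 1 + ((N : ℝ) + 1) ^ 2 := by simp [bracketSq]
    rw [hb]
    push_cast
    have e : 2 * (1 / (1 + ((N : ℝ) + 1) ^ 2)) + 4 / ((N : ℝ) + 1 + 1) ≤ 4 / ((N : ℝ) + 1) := by
      have h0 : (0 : ℝ) ≤ N := by positivity
      rw [← sub_nonneg]
      have : 4 / ((N : ℝ) + 1) - (2 * (1 / (1 + ((N : ℝ) + 1) ^ 2)) + 4 / ((N : ℝ) + 1 + 1)) =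
          (4 * (1 + ((N : ℝ) + 1) ^ 2) - 2 * ((N + 1) * (N + 1 + 1))) /
            ((N + 1) * (N + 1 + 1) * (1 + ((N : ℝ) + 1) ^ 2)) := by
        field_simp; ring
      rw [this]
      refine div_nonneg ?_ (by positivity)
      nlinarith
    linarith

theorem sum_inv_bracketSq_box_le_five (N : ℕ) : ∑ n ∈ box N, 1 / bracketSq n ≤ 5 := by
  refine (sum_inv_bracketSq_box_le N).trans ?_
  have : (0 : ℝ) ≤ 4 / (N + 1) := by positivity
  linarith

theorem card_box (N : ℕ) : ((box N).card : ℝ) = 2 * N + 1 := by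
  have : (box N).card = 2 * N + 1 := by
    simp only [box, Int.card_Icc]; omega
  rw [this]; push_cast; ring

/-- Pointwise, u has bounded variance and u_x has variance at most 2N + 1. Exponential moments at
these two scales bound the mixed moment, so it grows only linearly in N. -/
theorem lintegral_norm_pow_trigPoly_le (N : ℕ) (x : ℝ) :
    ∫⁻ c, ENNReal.ofReal (‖trigPoly (box N) c x‖ ^ 4 *
      ‖trigPoly (box N) (derivSeq c) x‖ ^ 2) ∂seqLaw ≤ ENNReal.ofReal (6400 * (2 * N + 1)) := by
  have hN : (0 : ℝ) < 2 * N + 1 := by positivity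
  have hσ := sum_inv_bracketSq_box_le_five N
  have h1 := lintegral_exp_norm_sq_trigPoly_le (box N) (l := 1 / 10) (by norm_num)
    (by linarith) x
  have h2 : ∫⁻ c, ENNReal.ofReal (Real.exp (1 / (2 * (2 * N + 1)) *
      ‖trigPoly (box N) (derivSeq c) x‖ ^ 2)) ∂seqLaw ≤ 2 := by
    have h3 := lintegral_exp_norm_sq_sum_seqLaw (box N)
      (fun n => Complex.I * n * Complex.exp (Complex.I * n * x)) (l := 1 / (2 * (2 * N + 1)))
      (by positivity)
    have h4 : ∀ a : ℤ → ℂ, trigPoly (box N) (derivSeq a) x =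
        ∑ n ∈ box N, Complex.I * n * Complex.exp (Complex.I * n * x) * a n :=
      fun a => Finset.sum_congr rfl fun n _ => by rw [derivSeq]; ring
    have h5 : ∑ n ∈ box N, ‖Complex.I * n * Complex.exp (Complex.I * n * x)‖ ^ 2 /
        bracketSq n ≤ 2 * N + 1 := by
      rw [← card_box, ← nsmul_one]
      refine Finset.sum_le_card_nsmul _ _ _ fun n _ => ?_
      rw [norm_mul, norm_exp_freq, norm_mul, Complex.norm_I, one_mul, mul_one,
        Complex.norm_intCast, sq_abs, div_le_one (bracketSq_pos n), bracketSq]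
      linarith
    have h6 : 1 / (2 * (2 * (N : ℝ) + 1)) * ∑ n ∈ box N,
        ‖Complex.I * n * Complex.exp (Complex.I * n * x)‖ ^ 2 / bracketSq n ≤ 1 / 2 := by
      refine (mul_le_mul_of_nonneg_left h5 (by positivity)).trans (le_of_eq ?_)
      field_simp
    simp only [h4]
    rw [h3 (by linarith), ← ENNReal.ofReal_ofNat]
    refine ENNReal.ofReal_le_ofReal ?_
    refine inv_le_of_inv_le₀ (by norm_num) ?_
    linarith
  have c1 : Continuous fun a => trigPoly (box N) a x :=
    (continuous_trigPoly_prod (box N)).comp (f := fun a => (a, x)) (by fun_prop)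
  calc _ ≤ ∫⁻ c, ENNReal.ofReal (1600 * (2 * N + 1)) *
        (ENNReal.ofReal (Real.exp (1 / 10 * ‖trigPoly (box N) c x‖ ^ 2)) +
        ENNReal.ofReal (Real.exp (1 / (2 * (2 * N + 1)) *
          ‖trigPoly (box N) (derivSeq c) x‖ ^ 2))) ∂seqLaw := by
        refine lintegral_mono fun c => ?_
        rw [← ENNReal.ofReal_add (Real.exp_pos _).le (Real.exp_pos _).le,
          ← ENNReal.ofReal_mul (by positivity)]
        refine ENNReal.ofReal_le_ofReal ?_
        set a := 1 / 20 * ‖trigPoly (box N) c x‖ ^ 2 with ha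
        set b := 1 / (4 * (2 * (N : ℝ) + 1)) * ‖trigPoly (box N) (derivSeq c) x‖ ^ 2 with hb
        have ha0 : 0 ≤ a := by positivity
        have hb0 : 0 ≤ b := by positivity
        have e1 : ‖trigPoly (box N) c x‖ ^ 4 * ‖trigPoly (box N) (derivSeq c) x‖ ^ 2 =
            1600 * (2 * N + 1) * (a ^ 2 * b) := by
          rw [ha, hb]; field_simp; ring
        have e2 : 1 / 10 * ‖trigPoly (box N) c x‖ ^ 2 = 2 * a := by rw [ha]; ring
        have e3 : 1 / (2 * (2 * (N : ℝ) + 1)) * ‖trigPoly (box N) (derivSeq c) x‖ ^ 2 = 2 * b := by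
          rw [hb]; field_simp; ring
        rw [e1, e2, e3]
        refine mul_le_mul_of_nonneg_left ?_ (by positivity)
        have f1 := Real.quadratic_le_exp_of_nonneg ha0
        have f2 := Real.add_one_le_exp b
        have f3 : a ^ 2 * b ≤ (2 * Real.exp a) * Real.exp b :=
          mul_le_mul (by nlinarith) (by linarith) hb0 (by positivity)
        rw [two_mul a, two_mul b, Real.exp_add, Real.exp_add]
        nlinarith [sq_nonneg (Real.exp a - Real.exp b)]
    _ ≤ ENNReal.ofReal (1600 * (2 * N + 1)) * (2 + 2) := by
        rw [lintegral_const_mul' _ _ ENNReal.ofReal_ne_top, lintegral_add_left (by fun_prop)]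
        gcongr
    _ = _ := by
        rw [show (2 : ℝ≥0∞) + 2 = ENNReal.ofReal 4 by
          rw [show (4 : ℝ) = 2 + 2 by norm_num, ENNReal.ofReal_add (by norm_num) (by norm_num)]
          simp, ← ENNReal.ofReal_mul (by positivity)]
        congr 1; ring

theorem lintegral_norm_pow_four_le (n : ℤ) :
    ∫⁻ c, ENNReal.ofReal (‖c n‖ ^ 4) ∂seqLaw ≤ ENNReal.ofReal (16 / bracketSq n ^ 2) := by
  have hk := bracketSq_pos n
  have h := lintegral_coord_seqLaw n
    (f := fun z => ENNReal.ofReal (Real.exp (bracketSq n / 2 * ‖z‖ ^ 2))) (by fun_prop)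
  rw [lintegral_exp_norm_sq_modeLaw n (by linarith),
    show (1 - bracketSq n / 2 / bracketSq n)⁻¹ = 2 by field_simp; norm_num] at h
  calc ∫⁻ c, ENNReal.ofReal (‖c n‖ ^ 4) ∂seqLaw
      ≤ ∫⁻ c, ENNReal.ofReal (8 / bracketSq n ^ 2) *
        ENNReal.ofReal (Real.exp (bracketSq n / 2 * ‖c n‖ ^ 2)) ∂seqLaw := by
        refine lintegral_mono fun c => ?_
        rw [← ENNReal.ofReal_mul (by positivity)]
        refine ENNReal.ofReal_le_ofReal ?_
        set a := bracketSq n / 2 * ‖c n‖ ^ 2 with ha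
        have ha0 : 0 ≤ a := by positivity
        have e1 : ‖c n‖ ^ 4 = 8 / bracketSq n ^ 2 * (a ^ 2 / 2) := by
          rw [ha]; field_simp; norm_num
        rw [e1]
        refine mul_le_mul_of_nonneg_left ?_ (by positivity)
        have f1 := Real.quadratic_le_exp_of_nonneg ha0
        nlinarith
    _ = _ := by
        rw [lintegral_const_mul' _ _ ENNReal.ofReal_ne_top, h, ← ENNReal.ofReal_mul (by positivity)]
        congr 1; ring

/-- Plain Cauchy–Schwarz with the number of modes. The linear growth is affordable, because the
momentum enters multiplied by a block mass of order 1/N. -/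
theorem lintegral_momentum_sq_le (N : ℕ) :
    ∫⁻ c, ENNReal.ofReal (momentum (box N) c ^ 2) ∂seqLaw ≤ ENNReal.ofReal (80 * (2 * N + 1)) := by
  calc ∫⁻ c, ENNReal.ofReal (momentum (box N) c ^ 2) ∂seqLaw
      ≤ ∫⁻ c, ENNReal.ofReal (2 * N + 1) *
        ∑ n ∈ box N, ENNReal.ofReal ((n : ℝ) ^ 2) * ENNReal.ofReal (‖c n‖ ^ 4) ∂seqLaw := by
        refine lintegral_mono fun c => ?_
        simp only [← ENNReal.ofReal_mul (sq_nonneg _)]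
        rw [← ENNReal.ofReal_sum_of_nonneg fun n _ => by positivity,
          ← ENNReal.ofReal_mul (by positivity)]
        refine ENNReal.ofReal_le_ofReal ?_
        rw [← card_box]
        refine (sq_sum_le_card_mul_sum_sq).trans (le_of_eq ?_)
        congr 1
        exact Finset.sum_congr rfl fun n _ => by ring
    _ ≤ ENNReal.ofReal (2 * N + 1) * ∑ n ∈ box N, ENNReal.ofReal (16 * (1 / bracketSq n)) := by
        rw [lintegral_const_mul' _ _ ENNReal.ofReal_ne_top,
          lintegral_finsetSum _ (fun n _ => by fun_prop)]
        gcongr with n hn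
        rw [lintegral_const_mul' _ _ ENNReal.ofReal_ne_top]
        refine (mul_le_mul_right (lintegral_norm_pow_four_le n) _).trans ?_
        rw [← ENNReal.ofReal_mul (sq_nonneg _)]
        refine ENNReal.ofReal_le_ofReal ?_
        have hk := bracketSq_pos n
        have : (n : ℝ) ^ 2 ≤ bracketSq n := by rw [bracketSq]; linarith
        rw [mul_one_div, mul_div_assoc', div_le_div_iff₀ (by positivity) hk]
        nlinarith [mul_pos hk hk]
    _ ≤ _ := by
        have hk : ∀ n ∈ box N, 0 ≤ 16 * (1 / bracketSq n) := fun n _ => by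
          have := bracketSq_pos n
          positivity
        rw [← ENNReal.ofReal_sum_of_nonneg hk, ← ENNReal.ofReal_mul (by positivity),
          ← Finset.mul_sum]
        refine ENNReal.ofReal_le_ofReal ?_
        have := sum_inv_bracketSq_box_le_five N
        have hN : (0 : ℝ) ≤ 2 * N + 1 := by positivity
        nlinarith

theorem blockInvariant_univ : BlockInvariant Set.univ where
  measurableSet := MeasurableSet.univ
  translate _ _ := by simp
  mul_I _ := by simp
  reflect _ := by simp

/-- Second moment of the change of `quartic` when a block of frequencies is added. -/
theorem lintegral_quartic_splice_sub_sq_le {S B : Finset ℤ} (hB : B ⊆ S)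
    (hBs : ∀ n, n ∈ B ↔ -n ∈ B) {κ : ℝ} (hκ : 0 < κ) (hκB : ∀ n ∈ B, κ ≤ bracketSq n)
    (c : ℤ → ℂ) :
    ∫⁻ a, ENNReal.ofReal ((quartic S (splice B c a) - quartic (S \ B) c) ^ 2) ∂seqLaw ≤
      ENNReal.ofReal (540 / κ) * ∫⁻ a, ∫⁻ x, ENNReal.ofReal (‖trigPoly S (splice B c a) x‖ ^ 4 *
        ‖trigPoly S (derivSeq (splice B c a)) x‖ ^ 2) ∂circLaw ∂seqLaw +
      ENNReal.ofReal (18 * (∑ n ∈ B, 2 / bracketSq n) ^ 2 * momentum (S \ B) c ^ 2) := by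
  have hm := measurable_quartic_splice S B c
  have h_int := integrable_quartic_splice hB c
  have hmean := setIntegral_quartic_splice hB hBs blockInvariant_univ c
  simp only [Measure.restrict_univ, probReal_univ, one_mul] at hmean
  set m := ∫ a, quartic S (splice B c a) ∂seqLaw with hmdef
  -- The mean is the average over an independent copy; by Jensen's inequality the variance is at
  -- most the mean square difference of two copies, to which interpolation with x² applies.
  have hvar : ∫⁻ b, ENNReal.ofReal ((quartic S (splice B c b) - m) ^ 2) ∂seqLaw ≤
      ∫⁻ a, ∫⁻ b, ENNReal.ofReal
        ((quartic S (splice B c b) - quartic S (splice B c a)) ^ 2) ∂seqLaw ∂seqLaw := by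
    have hmm : Measurable fun p : (ℤ → ℂ) × (ℤ → ℂ) => ENNReal.ofReal
        ((quartic S (splice B c p.2) - quartic S (splice B c p.1)) ^ 2) :=
      ENNReal.measurable_ofReal.comp
        (((hm.comp measurable_snd).sub (hm.comp measurable_fst)).pow_const 2)
    rw [lintegral_lintegral_swap hmm.aemeasurable]
    refine lintegral_mono fun b => ?_
    have h1 : Integrable (fun a => quartic S (splice B c b) - quartic S (splice B c a)) seqLaw :=
      (integrable_const _).sub h_int
    have h2 := ofReal_sq_integral_le h1
    rw [integral_sub (integrable_const _) h_int] at h2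
    simpa using h2
  have hpis := lintegral_convex_quartic_sub_le (E := Set.univ) (E' := Set.univ) hB c
    (Φ := fun x => x ^ 2) (even_two.convexOn_pow) (by fun_prop) (fun x => sq_nonneg x)
    MeasurableSet.univ (fun _ _ _ _ _ => Set.mem_univ _)
  simp only [Set.indicator_univ, Pi.one_apply, one_mul] at hpis
  have hgrad : ∀ a, ∫⁻ b, ENNReal.ofReal ((Real.pi / 2 * dirDeriv S B (splice B c a) b) ^ 2)
      ∂seqLaw ≤ ENNReal.ofReal (270 / κ) * ∫⁻ x, ENNReal.ofReal
        (‖trigPoly S (splice B c a) x‖ ^ 4 *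
        ‖trigPoly S (derivSeq (splice B c a)) x‖ ^ 2) ∂circLaw := by
    intro a
    have h1 := lintegral_dirDeriv_sq_le S B (splice B c a)
    have h2 := sum_gradSeq_div_le (S := S) hκ hκB (splice B c a)
    have cu := continuous_trigPoly S (splice B c a)
    have cu' := continuous_trigPoly S (derivSeq (splice B c a))
    rw [← ofReal_integral_eq_lintegral_ofReal (integrable_circLaw (by fun_prop))
      (ae_of_all _ fun x => by positivity), ← ENNReal.ofReal_mul (by positivity)]
    simp only [mul_pow (Real.pi / 2), ENNReal.ofReal_mul (sq_nonneg (Real.pi / 2))]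
    rw [lintegral_const_mul' _ _ ENNReal.ofReal_ne_top]
    refine (mul_le_mul_right h1 _).trans ?_
    rw [← ENNReal.ofReal_mul (by positivity)]
    refine ENNReal.ofReal_le_ofReal ?_
    have hpi : (Real.pi / 2) ^ 2 ≤ 5 / 2 := by nlinarith [Real.pi_lt_d2, Real.pi_pos]
    set I := ∫ x, ‖trigPoly S (splice B c a) x‖ ^ 4 *
        ‖trigPoly S (derivSeq (splice B c a)) x‖ ^ 2 ∂circLaw with hI
    have hI0 : 0 ≤ I := integral_nonneg fun x => by positivity
    calc (Real.pi / 2) ^ 2 * (12 * ∑ n ∈ B, ‖gradSeq S (splice B c a) n‖ ^ 2 / (4 * bracketSq n))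
        ≤ 5 / 2 * (12 * (9 / κ * I)) := by
          have : 0 ≤ ∑ n ∈ B, ‖gradSeq S (splice B c a) n‖ ^ 2 / (4 * bracketSq n) :=
            Finset.sum_nonneg fun n _ => by have := bracketSq_pos n; positivity
          gcongr
      _ = _ := by ring
  have hσ : ∑ n ∈ B, ∫ a, ‖a n‖ ^ 2 ∂seqLaw ≤ ∑ n ∈ B, 2 / bracketSq n :=
    Finset.sum_le_sum fun n _ => integral_norm_sq_seqLaw_le n
  have hσ0 : 0 ≤ ∑ n ∈ B, ∫ a, ‖a n‖ ^ 2 ∂seqLaw :=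
    Finset.sum_nonneg fun n _ => integral_nonneg fun a => by positivity
  calc ∫⁻ a, ENNReal.ofReal ((quartic S (splice B c a) - quartic (S \ B) c) ^ 2) ∂seqLaw
      ≤ ∫⁻ a, (2 * ENNReal.ofReal ((quartic S (splice B c a) - m) ^ 2) + ENNReal.ofReal
          (18 * (∑ n ∈ B, 2 / bracketSq n) ^ 2 * momentum (S \ B) c ^ 2)) ∂seqLaw := by
        refine lintegral_mono fun a => ?_
        rw [← ENNReal.ofReal_ofNat, ← ENNReal.ofReal_mul (by norm_num),
          ← ENNReal.ofReal_add (by positivity) (by positivity)]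
        refine ENNReal.ofReal_le_ofReal ?_
        have h2 : (m - quartic (S \ B) c) ^ 2 ≤
            9 * (∑ n ∈ B, 2 / bracketSq n) ^ 2 * momentum (S \ B) c ^ 2 := by
          rw [hmean, add_sub_cancel_left, mul_pow, mul_pow]
          have := pow_le_pow_left₀ hσ0 hσ 2
          calc _ ≤ 3 ^ 2 * momentum (S \ B) c ^ 2 * (∑ n ∈ B, 2 / bracketSq n) ^ 2 := by gcongr
            _ = _ := by ring
        nlinarith [sq_nonneg ((quartic S (splice B c a) - m) - (m - quartic (S \ B) c))]
    _ ≤ _ := by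
        rw [lintegral_add_right _ measurable_const, lintegral_const, measure_univ, mul_one,
          lintegral_const_mul _ (by fun_prop)]
        refine add_le_add_left ?_ _
        refine (mul_le_mul_right (hvar.trans (hpis.trans (lintegral_mono hgrad))) _).trans
          (le_of_eq ?_)
        rw [lintegral_const_mul' _ _ ENNReal.ofReal_ne_top, ← mul_assoc, ← ENNReal.ofReal_ofNat,
          ← ENNReal.ofReal_mul (by norm_num)]
        congr 2
        ring

theorem box_subset {N₁ N₂ : ℕ} (h : N₁ ≤ N₂) : box N₁ ⊆ box N₂ := fun n hn => by
  simp only [box, Finset.mem_Icc] at *; omega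

theorem quartic_congr {S : Finset ℤ} {c c' : ℤ → ℂ} (h : ∀ n ∈ S, c n = c' n) :
    quartic S c = quartic S c' := by
  have h1 : ∀ x, trigPoly S c x = trigPoly S c' x := fun x =>
    Finset.sum_congr rfl fun n hn => by rw [h n hn]
  have h2 : ∀ x, trigPoly S (derivSeq c) x = trigPoly S (derivSeq c') x := fun x =>
    Finset.sum_congr rfl fun n hn => by rw [derivSeq, derivSeq, h n hn]
  simp only [quartic, h1, h2]

/-- The added modes satisfy ⟨n⟩² ≥ N₁². The fluctuation is of order N₁^{-2} · N₂ and the squared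
drift of order (1/N₁)² · N₁; for N₂ ≤ 2N₁ both are O(1/N₁). -/
theorem lintegral_quartic_box_sub_sq_le {N₁ N₂ : ℕ} (h1 : 1 ≤ N₁) (h12 : N₁ ≤ N₂)
    (h2 : N₂ ≤ 2 * N₁) :
    ∫⁻ c, ENNReal.ofReal ((quartic (box N₂) c - quartic (box N₁) c) ^ 2) ∂seqLaw ≤
      ENNReal.ofReal (20000000 / N₁) := by
  obtain ⟨B, hBdef⟩ : ∃ B, B = box N₂ \ box N₁ := ⟨_, rfl⟩
  have hB : B ⊆ box N₂ := by rw [hBdef]; exact Finset.sdiff_subset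
  have hSB : box N₂ \ B = box N₁ := by rw [hBdef]; exact Finset.sdiff_sdiff_eq_self (box_subset h12)
  have hBs : ∀ n, n ∈ B ↔ -n ∈ B := fun n => by
    rw [hBdef, Finset.mem_sdiff, Finset.mem_sdiff, ← mem_box_neg, ← mem_box_neg]
  have hN1 : (1 : ℝ) ≤ N₁ := by exact_mod_cast h1
  have hκB : ∀ n ∈ B, (N₁ : ℝ) ^ 2 ≤ bracketSq n := fun n hn => by
    rw [hBdef, Finset.mem_sdiff] at hn
    have : (N₁ : ℤ) ≤ |n| := by
      have := hn.2
      simp only [box, Finset.mem_Icc] at this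
      rcases abs_cases n with h | h <;> omega
    have h3 : (N₁ : ℝ) ≤ |(n : ℝ)| := by exact_mod_cast this
    have h4 := pow_le_pow_left₀ (by positivity) h3 2
    rw [sq_abs] at h4
    rw [bracketSq]; linarith
  have hm2 := (continuous_quartic (box N₂)).measurable
  have hm1 := (continuous_quartic (box N₁)).measurable
  rw [lintegral_splice B (by fun_prop)]
  have hc : ∀ c, ∫⁻ a, ENNReal.ofReal ((quartic (box N₂) (splice B c a) -
      quartic (box N₁) (splice B c a)) ^ 2) ∂seqLaw ≤
      ENNReal.ofReal (540 / N₁ ^ 2) * ∫⁻ a, ∫⁻ x, ENNReal.ofReal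
        (‖trigPoly (box N₂) (splice B c a) x‖ ^ 4 *
        ‖trigPoly (box N₂) (derivSeq (splice B c a)) x‖ ^ 2) ∂circLaw ∂seqLaw +
      ENNReal.ofReal (18 * (∑ n ∈ B, 2 / bracketSq n) ^ 2 * momentum (box N₁) c ^ 2) := by
    intro c
    have h := lintegral_quartic_splice_sub_sq_le hB hBs (κ := (N₁ : ℝ) ^ 2) (by positivity) hκB c
    rw [hSB] at h
    refine le_trans (le_of_eq (lintegral_congr fun a => ?_)) h
    rw [quartic_congr (S := box N₁) fun n hn => splice_of_notMem (A := B) (c := c) (c' := a) ?_]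
    rw [← hSB, Finset.mem_sdiff] at hn
    simpa using hn.2
  refine (lintegral_mono hc).trans ?_
  obtain ⟨G, hG⟩ : ∃ G : (ℤ → ℂ) → ℝ≥0∞, G = fun c => ∫⁻ x, ENNReal.ofReal
        (‖trigPoly (box N₂) c x‖ ^ 4 *
        ‖trigPoly (box N₂) (derivSeq c) x‖ ^ 2) ∂circLaw := ⟨_, rfl⟩
  have c1 := continuous_trigPoly_prod (box N₂)
  have c2 := continuous_trigPoly_derivSeq_prod (box N₂)
  have hgm : Measurable fun p : (ℤ → ℂ) × ℝ => ENNReal.ofReal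
        (‖trigPoly (box N₂) p.1 p.2‖ ^ 4 * ‖trigPoly (box N₂) (derivSeq p.1) p.2‖ ^ 2) :=
    (ENNReal.continuous_ofReal.comp ((c1.norm.pow 4).mul (c2.norm.pow 2))).measurable
  have hGm : Measurable G := by rw [hG]; exact hgm.lintegral_prod_right'
  have hGint : ∫⁻ c, G c ∂seqLaw ≤ ENNReal.ofReal (6400 * (2 * N₂ + 1)) := by
    rw [hG, lintegral_lintegral_swap hgm.aemeasurable]
    refine (lintegral_mono fun x => lintegral_norm_pow_trigPoly_le N₂ x).trans ?_
    simp
  rw [lintegral_add_right _ (by unfold momentum; fun_prop),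
    lintegral_const_mul' _ _ ENNReal.ofReal_ne_top]
  have e1 : ∫⁻ c, ∫⁻ a, ∫⁻ x, ENNReal.ofReal
        (‖trigPoly (box N₂) (splice B c a) x‖ ^ 4 *
        ‖trigPoly (box N₂) (derivSeq (splice B c a)) x‖ ^ 2) ∂circLaw ∂seqLaw ∂seqLaw ≤
      ENNReal.ofReal (6400 * (2 * N₂ + 1)) := by
    rw [lintegral_splice B hGm, hG] at hGint
    exact hGint
  have hσ0 : 0 ≤ ∑ n ∈ B, 2 / bracketSq n := Finset.sum_nonneg fun n _ => by
    have := bracketSq_pos n; positivity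
  have hσ : ∑ n ∈ B, 2 / bracketSq n ≤ 10 / N₁ := by
    have hcard : (B.card : ℝ) ≤ 5 * N₁ := by
      have h3 : (B.card : ℝ) ≤ (box N₂).card := by exact_mod_cast Finset.card_le_card hB
      rw [card_box] at h3
      have h4 : (N₂ : ℝ) ≤ 2 * N₁ := by exact_mod_cast h2
      linarith
    calc ∑ n ∈ B, 2 / bracketSq n ≤ ∑ _n ∈ B, 2 / (N₁ : ℝ) ^ 2 :=
          Finset.sum_le_sum fun n hn => div_le_div_of_nonneg_left (by norm_num) (by positivity)
            (hκB n hn)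
      _ = B.card * (2 / (N₁ : ℝ) ^ 2) := by rw [Finset.sum_const, nsmul_eq_mul]
      _ ≤ (5 * N₁) * (2 / (N₁ : ℝ) ^ 2) := by gcongr
      _ = _ := by field_simp; norm_num
  have e2 : ∫⁻ c, ENNReal.ofReal (18 * (∑ n ∈ B, 2 / bracketSq n) ^ 2 * momentum (box N₁) c ^ 2)
      ∂seqLaw ≤ ENNReal.ofReal (18 * (10 / N₁) ^ 2) * ENNReal.ofReal (80 * (2 * N₁ + 1)) := by
    calc _ ≤ ∫⁻ c, ENNReal.ofReal (18 * (10 / N₁) ^ 2) *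
          ENNReal.ofReal (momentum (box N₁) c ^ 2) ∂seqLaw := by
          refine lintegral_mono fun c => ?_
          rw [← ENNReal.ofReal_mul (by positivity)]
          exact ENNReal.ofReal_le_ofReal (by gcongr)
      _ ≤ _ := by
          rw [lintegral_const_mul' _ _ ENNReal.ofReal_ne_top]
          gcongr
          exact lintegral_momentum_sq_le N₁
  refine (add_le_add (mul_le_mul_right e1 _) e2).trans ?_
  rw [← ENNReal.ofReal_mul (by positivity), ← ENNReal.ofReal_mul (by positivity),
    ← ENNReal.ofReal_add (by positivity) (by positivity)]
  refine ENNReal.ofReal_le_ofReal ?_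
  have h4 : (N₂ : ℝ) ≤ 2 * N₁ := by exact_mod_cast h2
  calc 540 / (N₁ : ℝ) ^ 2 * (6400 * (2 * N₂ + 1)) + 18 * (10 / (N₁ : ℝ)) ^ 2 * (80 * (2 * N₁ + 1))
      ≤ 540 / (N₁ : ℝ) ^ 2 * (6400 * (5 * N₁)) + 18 * (10 / (N₁ : ℝ)) ^ 2 * (80 * (3 * N₁)) := by
        gcongr <;> linarith
    _ = 17712000 / (N₁ : ℝ) := by field_simp; norm_num
    _ ≤ _ := by gcongr; norm_num

/-! ### Dependence on the zero mode. -/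

/-- The coefficient of the zero mode in the expansion of `quartic`. -/
def cubic (V : Finset ℤ) (c : ℤ → ℂ) : ℂ :=
  ∫ x, conj (trigPoly V c x) ^ 2 * trigPoly V (derivSeq c) x ∂circLaw

theorem integral_trigPoly_derivSeq (V : Finset ℤ) (c : ℤ → ℂ) :
    ∫ x, trigPoly V (derivSeq c) x ∂circLaw = 0 :=
  integral_deriv_circLaw (hasDerivAt_trigPoly V c) (continuous_trigPoly V _)
    (trigPoly_periodic V c)

theorem integral_mul_trigPoly_derivSeq (V : Finset ℤ) (c : ℤ → ℂ) :
    ∫ x, trigPoly V c x * trigPoly V (derivSeq c) x ∂circLaw = 0 := by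
  have cu := continuous_trigPoly V c
  have cu' := continuous_trigPoly V (derivSeq c)
  have h := integral_deriv_circLaw (w := fun x => trigPoly V c x ^ 2)
    (w' := fun x => 2 * (trigPoly V c x * trigPoly V (derivSeq c) x))
    (fun x => ((hasDerivAt_trigPoly V c x).fun_pow 2).congr_deriv (by push_cast; ring))
    (by fun_prop) (fun x => by simp only [trigPoly_periodic V c x])
  rw [integral_const_mul] at h
  simpa using h

/-- The derivative of v² v̄ has mean zero. Thus both terms linear in the zero mode are expressed
through the single coefficient `cubic`. -/
theorem integral_norm_sq_mul_trigPoly_derivSeq (V : Finset ℤ) (c : ℤ → ℂ) :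
    2 * ∫ x, trigPoly V c x * conj (trigPoly V c x) * trigPoly V (derivSeq c) x ∂circLaw =
      -conj (cubic V c) := by
  have cu := continuous_trigPoly V c
  have cu' := continuous_trigPoly V (derivSeq c)
  have h := integral_deriv_circLaw (w := fun x => trigPoly V c x ^ 2 * conj (trigPoly V c x))
    (w' := fun x => 2 * (trigPoly V c x * conj (trigPoly V c x) * trigPoly V (derivSeq c) x) +
      trigPoly V c x ^ 2 * conj (trigPoly V (derivSeq c) x))
    (fun x => (((hasDerivAt_trigPoly V c x).fun_pow 2).fun_mul
      (hasDerivAt_trigPoly V c x).star).congr_deriv (by simp; ring))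
    (by fun_prop) (fun x => by simp only [trigPoly_periodic V c x])
  rw [integral_add (integrable_circLaw (by fun_prop)) (integrable_circLaw (by fun_prop)),
    integral_const_mul] at h
  have h2 : conj (cubic V c) =
      ∫ x, trigPoly V c x ^ 2 * conj (trigPoly V (derivSeq c) x) ∂circLaw := by
    rw [cubic, ← integral_conj]
    refine integral_congr_ae (ae_of_all _ fun x => ?_)
    simp
  rw [h2]
  exact eq_neg_of_add_eq_zero_left h

theorem trigPoly_update_zero {S : Finset ℤ} (h0 : (0 : ℤ) ∈ S) (c : ℤ → ℂ) (z : ℂ) (x : ℝ) :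
    trigPoly S (Function.update c 0 z) x = z + trigPoly (S.erase 0) c x := by
  rw [trigPoly, ← Finset.add_sum_erase S _ h0]
  congr 1
  · simp
  · refine Finset.sum_congr rfl fun n hn => ?_
    rw [Function.update_of_ne (Finset.ne_of_mem_erase hn)]

theorem trigPoly_derivSeq_update_zero {S : Finset ℤ} (h0 : (0 : ℤ) ∈ S) (c : ℤ → ℂ) (z : ℂ)
    (x : ℝ) : trigPoly S (derivSeq (Function.update c 0 z)) x =
      trigPoly (S.erase 0) (derivSeq c) x := by
  have h : derivSeq (Function.update c 0 z) = Function.update (derivSeq c) 0 0 := by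
    funext n
    by_cases hn : n = 0
    · subst hn; simp [derivSeq]
    · simp [derivSeq, Function.update_of_ne hn]
  rw [h, trigPoly_update_zero h0, zero_add]

/-- Expansion of the form at z + v. Since z is constant in x, only v is differentiated, and the
terms with v_x and v v_x are total derivatives. The term with |z|² gives the momentum, and the
linear ones combine into an imaginary part. -/
theorem quartic_update_zero {S : Finset ℤ} (h0 : (0 : ℤ) ∈ S) (c : ℤ → ℂ) (z : ℂ) :
    quartic S (Function.update c 0 z) = quartic (S.erase 0) c +
      3 * (z * cubic (S.erase 0) c).im + 3 * ‖z‖ ^ 2 * momentum (S.erase 0) c := by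
  obtain ⟨V, hV⟩ : ∃ V, V = S.erase 0 := ⟨_, rfl⟩
  have cu := continuous_trigPoly V c
  have cu' := continuous_trigPoly V (derivSeq c)
  have hexp : ∀ x, (z + trigPoly V c x) * conj (z + trigPoly V c x) ^ 2 *
      trigPoly V (derivSeq c) x =
      z * conj z ^ 2 * trigPoly V (derivSeq c) x +
      (conj z ^ 2 * (trigPoly V c x * trigPoly V (derivSeq c) x) +
      (2 * (z * conj z) * (trigPoly V (derivSeq c) x * conj (trigPoly V c x)) +
      (z * (conj (trigPoly V c x) ^ 2 * trigPoly V (derivSeq c) x) +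
      (conj z * (2 * (trigPoly V c x * conj (trigPoly V c x) * trigPoly V (derivSeq c) x)) +
      trigPoly V c x * conj (trigPoly V c x) ^ 2 * trigPoly V (derivSeq c) x)))) := fun x => by
    simp only [map_add]; ring
  simp only [quartic, trigPoly_update_zero h0, trigPoly_derivSeq_update_zero h0, ← hV]
  simp only [hexp]
  rw [integral_add (integrable_circLaw (by fun_prop)) (integrable_circLaw (by fun_prop)),
    integral_add (integrable_circLaw (by fun_prop)) (integrable_circLaw (by fun_prop)),
    integral_add (integrable_circLaw (by fun_prop)) (integrable_circLaw (by fun_prop)),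
    integral_add (integrable_circLaw (by fun_prop)) (integrable_circLaw (by fun_prop)),
    integral_add (integrable_circLaw (by fun_prop)) (integrable_circLaw (by fun_prop)),
    integral_const_mul, integral_const_mul, integral_const_mul, integral_const_mul,
    integral_const_mul, integral_const_mul,
    integral_norm_sq_mul_trigPoly_derivSeq, integral_trigPoly_derivSeq,
    integral_mul_trigPoly_derivSeq, integral_deriv_mul_conj, ← cubic, Complex.mul_conj,
    Complex.normSq_eq_norm_sq]
  set T := cubic V c
  set J := ∫ x, trigPoly V c x * conj (trigPoly V c x) ^ 2 * trigPoly V (derivSeq c) x ∂circLaw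
  simp only [Complex.mul_re, Complex.mul_im, Complex.add_re, Complex.add_im, Complex.neg_re,
    Complex.neg_im, Complex.conj_re, Complex.conj_im, Complex.I_re, Complex.I_im,
    Complex.ofReal_re, Complex.ofReal_im, Complex.div_ofNat_re, Complex.div_ofNat_im,
    Complex.re_ofNat, Complex.im_ofNat, Complex.zero_re, Complex.zero_im]
  ring

theorem continuous_momentum (V : Finset ℤ) : Continuous (momentum V) := by
  unfold momentum; fun_prop

/-! ### Slices of fixed mass and their continuity in the mass. -/

/-- The total mass `∑ₙ |c_n|²`. -/
def totalMass (c : ℤ → ℂ) : ℝ≥0∞ := ∑' n : ℤ, ENNReal.ofReal (‖c n‖ ^ 2)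

/-- The mass `∑_{n ≠ 0} |c_n|²` outside the zero mode. -/
def restMass (c : ℤ → ℂ) : ℝ≥0∞ := totalMass (Function.update c 0 0)

theorem measurable_totalMass : Measurable totalMass :=
  Measurable.tsum fun n => by fun_prop

theorem measurable_update_prod (k : ℤ) :
    Measurable fun p : (ℤ → ℂ) × ℂ => Function.update p.1 k p.2 := by
  refine measurable_pi_iff.2 fun n => ?_
  by_cases h : n = k
  · subst h; simpa using measurable_snd
  · simp only [Function.update_of_ne h]; fun_prop

theorem measurable_restMass : Measurable restMass :=
  measurable_totalMass.comp
    ((measurable_update_prod 0).comp (f := fun c => (c, (0 : ℂ))) (by fun_prop))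

theorem totalMass_update (c : ℤ → ℂ) (k : ℤ) (z : ℂ) :
    totalMass (Function.update c k z) =
      totalMass (Function.update c k 0) + ENNReal.ofReal (‖z‖ ^ 2) := by
  have h : ∀ w : ℂ, totalMass (Function.update c k w) = ENNReal.ofReal (‖w‖ ^ 2) +
      ∑' n : ℤ, if n = k then 0 else ENNReal.ofReal (‖c n‖ ^ 2) := by
    intro w
    rw [totalMass, ENNReal.tsum_eq_add_tsum_ite k]
    congr 1
    · simp
    · refine tsum_congr fun n => ?_
      by_cases hn : n = k
      · simp [hn]
      · simp [hn]
  rw [h z, h 0]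
  simp [add_comm]

theorem totalMass_eq_restMass_add (c : ℤ → ℂ) (z : ℂ) :
    totalMass (Function.update c 0 z) = restMass c + ENNReal.ofReal (‖z‖ ^ 2) :=
  totalMass_update c 0 z

theorem restMass_update {k : ℤ} (hk : k ≠ 0) (c : ℤ → ℂ) (z : ℂ) :
    restMass (Function.update c k z) =
      restMass (Function.update c k 0) + ENNReal.ofReal (‖z‖ ^ 2) := by
  simp only [restMass]
  rw [Function.update_comm hk, totalMass_update, Function.update_comm hk]

theorem lintegral_norm_sq_le (n : ℤ) :
    ∫⁻ c, ENNReal.ofReal (‖c n‖ ^ 2) ∂seqLaw ≤ ENNReal.ofReal (2 * (1 / bracketSq n)) := by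
  rw [← ofReal_integral_eq_lintegral_ofReal (integrable_norm_sq n)
    (ae_of_all _ fun c => by positivity), mul_one_div]
  exact ENNReal.ofReal_le_ofReal (integral_norm_sq_seqLaw_le n)

theorem exists_subset_box (S : Finset ℤ) : ∃ N, S ⊆ box N := by
  refine ⟨∑ n ∈ S, n.natAbs, fun n hn => ?_⟩
  have h : n.natAbs ≤ ∑ n ∈ S, n.natAbs :=
    Finset.single_le_sum (f := fun n : ℤ => n.natAbs) (fun _ _ => Nat.zero_le _) hn
  simp only [box, Finset.mem_Icc]
  omega

theorem tsum_inv_bracketSq_le : ∑' n : ℤ, ENNReal.ofReal (2 * (1 / bracketSq n)) ≤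
    ENNReal.ofReal 10 := by
  rw [ENNReal.tsum_eq_iSup_sum]
  refine iSup_le fun S => ?_
  obtain ⟨N, hN⟩ := exists_subset_box S
  have h0 : ∀ n : ℤ, 0 ≤ 2 * (1 / bracketSq n) := fun n => by
    have := bracketSq_pos n; positivity
  refine (Finset.sum_le_sum_of_subset hN).trans ?_
  rw [← ENNReal.ofReal_sum_of_nonneg fun n _ => h0 n, ← Finset.mul_sum]
  exact ENNReal.ofReal_le_ofReal (by linarith [sum_inv_bracketSq_box_le_five N])

theorem lintegral_totalMass_le : ∫⁻ c, totalMass c ∂seqLaw ≤ ENNReal.ofReal 10 := by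
  unfold totalMass
  rw [lintegral_tsum fun n => Measurable.aemeasurable (by fun_prop)]
  exact (ENNReal.tsum_le_tsum lintegral_norm_sq_le).trans tsum_inv_bracketSq_le

theorem ae_totalMass_lt_top : ∀ᵐ c ∂seqLaw, totalMass c < ⊤ :=
  ae_lt_top measurable_totalMass (lintegral_totalMass_le.trans_lt ENNReal.ofReal_lt_top).ne

theorem totalMass_update_zero_le (c : ℤ → ℂ) (k : ℤ) :
    totalMass (Function.update c k 0) ≤ totalMass c := by
  have h := totalMass_update c k (c k)
  rw [Function.update_eq_self] at h
  rw [h]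
  exact le_self_add

theorem ae_restMass_lt_top : ∀ᵐ c ∂seqLaw, restMass c < ⊤ :=
  ae_totalMass_lt_top.mono fun c hc => (totalMass_update_zero_le c 0).trans_lt hc

theorem ae_restMass_update_lt_top (k : ℤ) :
    ∀ᵐ c ∂seqLaw, restMass (Function.update c k 0) < ⊤ :=
  ae_totalMass_lt_top.mono fun c hc => (totalMass_update_zero_le _ 0).trans_lt
    ((totalMass_update_zero_le c k).trans_lt hc)

/-- The density of the sequences that can be completed to mass `t` by the zero mode. -/
def sliceDensity (t : ℝ) (c : ℤ → ℂ) : ℝ≥0∞ :=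
  if restMass c < ENNReal.ofReal t then
    ENNReal.ofReal (Real.exp (-(t - (restMass c).toReal))) else 0

theorem measurable_sliceDensity :
    Measurable fun p : ℝ × (ℤ → ℂ) => sliceDensity p.1 p.2 := by
  have h := measurable_restMass
  unfold sliceDensity
  refine Measurable.ite ?_ (by fun_prop) measurable_const
  exact measurableSet_lt (by fun_prop) (by fun_prop)

/-- The point of mass `t` with the given modes outside zero and the given phase of the zero
mode. -/
def slicePoint (t : ℝ) (c : ℤ → ℂ) (θ : ℝ) : ℤ → ℂ :=
  Function.update c 0 (polarPoint (t - (restMass c).toReal) θ)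

theorem measurable_slicePoint :
    Measurable fun p : ℝ × (ℤ → ℂ) × ℝ => slicePoint p.1 p.2.1 p.2.2 := by
  have h := measurable_restMass
  refine (measurable_update_prod 0).comp (f := fun p : ℝ × (ℤ → ℂ) × ℝ =>
    (p.2.1, polarPoint (p.1 - (restMass p.2.1).toReal) p.2.2)) ?_
  refine Measurable.prodMk (by fun_prop) ?_
  exact measurable_polarPoint.comp (f := fun p : ℝ × (ℤ → ℂ) × ℝ =>
    (p.1 - (restMass p.2.1).toReal, p.2.2)) (by fun_prop)

/-- The density at `t` of the total mass, as a measure on the sequences of mass `t`. -/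
def sliceLaw (t : ℝ) : Measure (ℤ → ℂ) :=
  ((seqLaw.prod angleLaw).withDensity fun p => sliceDensity t p.1).map
    fun p => slicePoint t p.1 p.2

theorem measurable_angle_slicePoint {G : (ℤ → ℂ) → ℝ≥0∞} (hG : Measurable G) :
    Measurable fun p : ℝ × (ℤ → ℂ) => ∫⁻ θ, G (slicePoint p.1 p.2 θ) ∂angleLaw := by
  have h : Measurable fun p : (ℝ × (ℤ → ℂ)) × ℝ => G (slicePoint p.1.1 p.1.2 p.2) :=
    hG.comp (measurable_slicePoint.comp (f := fun p : (ℝ × (ℤ → ℂ)) × ℝ =>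
      (p.1.1, p.1.2, p.2)) (by fun_prop))
  exact h.lintegral_prod_right'

theorem lintegral_sliceLaw (t : ℝ) {G : (ℤ → ℂ) → ℝ≥0∞} (hG : Measurable G) :
    ∫⁻ c, G c ∂sliceLaw t =
      ∫⁻ c, sliceDensity t c * ∫⁻ θ, G (slicePoint t c θ) ∂angleLaw ∂seqLaw := by
  have h1 : Measurable fun p : (ℤ → ℂ) × ℝ => slicePoint t p.1 p.2 :=
    measurable_slicePoint.comp (f := fun p : (ℤ → ℂ) × ℝ => (t, p.1, p.2)) (by fun_prop)
  have h2 : Measurable (sliceDensity t) :=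
    measurable_sliceDensity.comp (f := fun c => (t, c)) (by fun_prop)
  have h3 : Measurable fun p : (ℤ → ℂ) × ℝ => G (slicePoint t p.1 p.2) := hG.comp h1
  have h4 : Measurable fun p : (ℤ → ℂ) × ℝ => sliceDensity t p.1 := h2.comp measurable_fst
  rw [sliceLaw, lintegral_map hG h1, lintegral_withDensity_eq_lintegral_mul _ h4 h3,
    lintegral_prod _ (h4.mul h3).aemeasurable]
  refine lintegral_congr fun c => ?_
  have h5 : Measurable fun θ => G (slicePoint t c θ) :=
    h3.comp (f := fun θ => (c, θ)) (by fun_prop)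
  simp only [Pi.mul_apply]
  rw [lintegral_const_mul _ h5]

theorem bracketSq_zero : bracketSq 0 = 1 := by simp [bracketSq]

theorem measurable_angle_polar {G : (ℤ → ℂ) → ℝ≥0∞} (hG : Measurable G) (c : ℤ → ℂ) :
    Measurable fun s => ∫⁻ θ, G (Function.update c 0 (polarPoint s θ)) ∂angleLaw := by
  have h : Measurable fun p : ℝ × ℝ => G (Function.update c 0 (polarPoint p.1 p.2)) :=
    hG.comp ((measurable_update_prod 0).comp (f := fun p : ℝ × ℝ => (c, polarPoint p.1 p.2))
      (measurable_const.prodMk measurable_polarPoint))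
  exact h.lintegral_prod_right'

/-- Disintegration of the law along the total mass. -/
theorem lintegral_mass_slice {φ : ℝ → ℝ≥0∞} (hφ : Measurable φ) {G : (ℤ → ℂ) → ℝ≥0∞}
    (hG : Measurable G) :
    ∫⁻ c, φ (totalMass c).toReal * G c ∂seqLaw =
      ∫⁻ t in Set.Ioi (0 : ℝ), φ t * ∫⁻ c, G c ∂sliceLaw t := by
  have hm := measurable_totalMass
  have hr := measurable_restMass
  have hmeas : Measurable fun p : ℝ × (ℤ → ℂ) => φ p.1 * (sliceDensity p.1 p.2 *
      ∫⁻ θ, G (slicePoint p.1 p.2 θ) ∂angleLaw) :=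
    (hφ.comp measurable_fst).mul
      (measurable_sliceDensity.mul (measurable_angle_slicePoint hG))
  have hR : ∫⁻ t in Set.Ioi (0 : ℝ), φ t * ∫⁻ c, G c ∂sliceLaw t =
      ∫⁻ c, (∫⁻ t in Set.Ioi (0 : ℝ), φ t * (sliceDensity t c *
        ∫⁻ θ, G (slicePoint t c θ) ∂angleLaw)) ∂seqLaw := by
    have hsw : Measurable (Function.uncurry fun (c : ℤ → ℂ) (t : ℝ) => φ t * (sliceDensity t c *
        ∫⁻ θ, G (slicePoint t c θ) ∂angleLaw)) := hmeas.comp measurable_swap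
    rw [lintegral_lintegral_swap hsw.aemeasurable]
    refine lintegral_congr fun t => ?_
    rw [lintegral_sliceLaw t hG, lintegral_const_mul]
    exact (measurable_sliceDensity.mul (measurable_angle_slicePoint hG)).comp
      (f := fun c => (t, c)) (by fun_prop)
  rw [hR, lintegral_update 0 (by fun_prop)]
  refine lintegral_congr_ae (ae_restMass_lt_top.mono fun c hc => ?_)
  beta_reduce
  obtain ⟨r, hrdef⟩ : ∃ r, r = (restMass c).toReal := ⟨_, rfl⟩
  have hr0 : 0 ≤ r := by rw [hrdef]; exact ENNReal.toReal_nonneg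
  have hrc : restMass c = ENNReal.ofReal r := by rw [hrdef, ENNReal.ofReal_toReal hc.ne]
  have hg := measurable_angle_polar hG c
  rw [lintegral_modeLaw_polar 0 (by
    have := (measurable_update_prod 0).comp (f := fun z : ℂ => (c, z)) (by fun_prop)
    have h2 : Measurable fun z : ℂ => Function.update c 0 z := this
    fun_prop)]
  simp only [totalMass_eq_restMass_add, bracketSq_zero, one_mul]
  have hL : ∀ s ∈ Set.Ioi (0 : ℝ), ENNReal.ofReal (Real.exp (-s)) *
      ∫⁻ θ, φ (restMass c + ENNReal.ofReal (‖polarPoint s θ‖ ^ 2)).toReal *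
        G (Function.update c 0 (polarPoint s θ)) ∂angleLaw =
      ENNReal.ofReal (Real.exp (-s)) * (φ (s + r) *
        ∫⁻ θ, G (Function.update c 0 (polarPoint s θ)) ∂angleLaw) := by
    intro s hs
    have hs0 : 0 ≤ s := (Set.mem_Ioi.1 hs).le
    congr 1
    have hGs : Measurable fun θ => G (Function.update c 0 (polarPoint s θ)) :=
      hG.comp ((measurable_update_prod 0).comp (f := fun θ => (c, polarPoint s θ))
        (measurable_const.prodMk (measurable_polarPoint.comp (f := fun θ => (s, θ)) (by fun_prop))))
    rw [← lintegral_const_mul _ hGs]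
    refine lintegral_congr fun θ => ?_
    rw [norm_sq_polarPoint hs0, hrc, ← ENNReal.ofReal_add hr0 hs0,
      ENNReal.toReal_ofReal (by linarith), add_comm]
  -- The substitution s = t - r replaces the squared modulus of the zero mode by the total mass; the
  -- positivity of s becomes the condition r < t in `sliceDensity`.
  rw [setLIntegral_congr_fun measurableSet_Ioi hL, ← lintegral_indicator measurableSet_Ioi,
    ← lintegral_indicator measurableSet_Ioi, ← lintegral_sub_right_eq_self _ r]
  refine lintegral_congr fun t => ?_
  have hrr : (ENNReal.ofReal r).toReal = r := ENNReal.toReal_ofReal hr0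
  simp only [sliceDensity, slicePoint, hrc, hrr]
  by_cases ht : r < t
  · have h1 : t - r ∈ Set.Ioi (0 : ℝ) := by simp [ht]
    have h2 : t ∈ Set.Ioi (0 : ℝ) := by simp; linarith
    rw [Set.indicator_of_mem h1, Set.indicator_of_mem h2, sub_add_cancel,
      if_pos ((ENNReal.ofReal_lt_ofReal_iff (by linarith)).2 ht)]
    ring
  · have h1 : t - r ∉ Set.Ioi (0 : ℝ) := by simp; linarith
    rw [Set.indicator_of_notMem h1]
    by_cases h2 : t ∈ Set.Ioi (0 : ℝ)
    · rw [Set.indicator_of_mem h2, if_neg (fun h => ht (ENNReal.ofReal_lt_ofReal_iff'.1 h).1)]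
      simp
    · rw [Set.indicator_of_notMem h2]

/-- The slice measures of functions that do not depend on the mode `k`, with the integration over
the radius of the mode `k` moved to the zero mode. -/
theorem lintegral_sliceLaw_of_update {k : ℤ} (hk : k ≠ 0) {G : (ℤ → ℂ) → ℝ≥0∞}
    (hG : Measurable G) (hGk : ∀ c z, G (Function.update c k z) = G c) (t : ℝ) :
    ∫⁻ c, G c ∂sliceLaw t = ∫⁻ c, (∫⁻ w in Set.Ioi (0 : ℝ),
      (if w + (restMass (Function.update c k 0)).toReal < t then ENNReal.ofReal (bracketSq k *
        Real.exp (-(bracketSq k * (t - (restMass (Function.update c k 0)).toReal - w)))) else 0) *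
      (ENNReal.ofReal (Real.exp (-w)) *
        ∫⁻ θ, G (Function.update c 0 (polarPoint w θ)) ∂angleLaw)) ∂seqLaw := by
  have hJ : Measurable fun c => sliceDensity t c * ∫⁻ θ, G (slicePoint t c θ) ∂angleLaw :=
    (measurable_sliceDensity.mul (measurable_angle_slicePoint hG)).comp
      (f := fun c => (t, c)) (by fun_prop)
  rw [lintegral_sliceLaw t hG, lintegral_update k hJ]
  refine lintegral_congr_ae ((ae_restMass_update_lt_top k).mono fun c hc => ?_)
  beta_reduce
  obtain ⟨r, hrdef⟩ : ∃ r, r = (restMass (Function.update c k 0)).toReal := ⟨_, rfl⟩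
  have hr0 : 0 ≤ r := by rw [hrdef]; exact ENNReal.toReal_nonneg
  have hrc : restMass (Function.update c k 0) = ENNReal.ofReal r := by
    rw [hrdef, ENNReal.ofReal_toReal hc.ne]
  have hJk : Measurable fun z => sliceDensity t (Function.update c k z) *
      ∫⁻ θ, G (slicePoint t (Function.update c k z) θ) ∂angleLaw :=
    hJ.comp ((measurable_update_prod k).comp (f := fun z : ℂ => (c, z)) (by fun_prop))
  rw [lintegral_modeLaw_polar k hJk, ← hrdef]
  have hL : ∀ s ∈ Set.Ioi (0 : ℝ), ENNReal.ofReal (bracketSq k * Real.exp (-(bracketSq k * s))) *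
      ∫⁻ θ, sliceDensity t (Function.update c k (polarPoint s θ)) *
        ∫⁻ θ', G (slicePoint t (Function.update c k (polarPoint s θ)) θ') ∂angleLaw ∂angleLaw =
      ENNReal.ofReal (bracketSq k * Real.exp (-(bracketSq k * s))) *
        ((if r + s < t then ENNReal.ofReal (Real.exp (-(t - r - s))) else 0) *
        ∫⁻ θ, G (Function.update c 0 (polarPoint (t - r - s) θ)) ∂angleLaw) := by
    intro s hs
    have hs0 : 0 < s := Set.mem_Ioi.1 hs
    congr 1
    have hθ : ∀ θ, restMass (Function.update c k (polarPoint s θ)) = ENNReal.ofReal (r + s) := by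
      intro θ
      rw [restMass_update hk, hrc, norm_sq_polarPoint hs0.le, ENNReal.ofReal_add hr0 hs0.le]
    simp only [sliceDensity, slicePoint, hθ, ENNReal.toReal_ofReal (by linarith : 0 ≤ r + s),
      Function.update_comm hk, hGk]
    rw [lintegral_const, measure_univ, mul_one, ← sub_sub]
    congr 1
    have hiff : ENNReal.ofReal (r + s) < ENNReal.ofReal t ↔ r + s < t := by
      rw [ENNReal.ofReal_lt_ofReal_iff']
      exact ⟨fun h => h.1, fun h => ⟨h, by linarith⟩⟩
    simp only [hiff]
  -- The substitution s = t - r - w exchanges the free radius of mode k for that of the zero mode.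
  -- The integrand G is then evaluated at a point that does not involve t.
  rw [setLIntegral_congr_fun measurableSet_Ioi hL, ← lintegral_indicator measurableSet_Ioi,
    ← lintegral_indicator measurableSet_Ioi, ← lintegral_sub_left_eq_self _ (t - r)]
  refine lintegral_congr fun w => ?_
  by_cases hw : 0 < w
  swap
  · have h1 : w ∉ Set.Ioi (0 : ℝ) := by simpa using hw
    rw [Set.indicator_of_notMem h1]
    by_cases h2 : t - r - w ∈ Set.Ioi (0 : ℝ)
    · rw [Set.indicator_of_mem h2, if_neg (by linarith)]; simp
    · rw [Set.indicator_of_notMem h2]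
  · have h1 : w ∈ Set.Ioi (0 : ℝ) := hw
    rw [Set.indicator_of_mem h1]
    by_cases h2 : w + r < t
    · have h3 : t - r - w ∈ Set.Ioi (0 : ℝ) := by simp; linarith
      rw [Set.indicator_of_mem h3, if_pos h2, if_pos (by linarith),
        show t - r - (t - r - w) = w by ring]
    · have h3 : t - r - w ∉ Set.Ioi (0 : ℝ) := by simp; linarith
      rw [Set.indicator_of_notMem h3, if_neg h2, zero_mul]

/-- After the radius of mode k has absorbed the mass constraint, t appears only in an explicit
density, which is continuous in t off one point. Dominated convergence applies with no continuity of
G. -/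
theorem tendsto_lintegral_sliceLaw {k : ℤ} (hk : k ≠ 0) {G : (ℤ → ℂ) → ℝ≥0∞}
    (hG : Measurable G) (hG1 : ∀ c, G c ≤ 1) (hGk : ∀ c z, G (Function.update c k z) = G c)
    (m : ℝ) :
    Tendsto (fun t => ∫⁻ c, G c ∂sliceLaw t) (𝓝 m) (𝓝 (∫⁻ c, G c ∂sliceLaw m)) := by
  have hκ := bracketSq_pos k
  simp only [lintegral_sliceLaw_of_update hk hG hGk]
  obtain ⟨R, hR⟩ : ∃ R : (ℤ → ℂ) → ℝ, R = fun c => (restMass (Function.update c k 0)).toReal :=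
    ⟨_, rfl⟩
  obtain ⟨g, hg⟩ : ∃ g : (ℤ → ℂ) → ℝ → ℝ≥0∞, g = fun c w =>
    ∫⁻ θ, G (Function.update c 0 (polarPoint w θ)) ∂angleLaw := ⟨_, rfl⟩
  obtain ⟨H, hH⟩ : ∃ H : ℝ → (ℤ → ℂ) → ℝ → ℝ≥0∞, H = fun t c w =>
    (if w + R c < t then ENNReal.ofReal (bracketSq k *
        Real.exp (-(bracketSq k * (t - R c - w)))) else 0) *
      (ENNReal.ofReal (Real.exp (-w)) * g c w) := ⟨_, rfl⟩
  have hRm : Measurable R := by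
    rw [hR]
    exact (measurable_restMass.comp ((measurable_update_prod k).comp
      (f := fun c => (c, (0 : ℂ))) (by fun_prop))).ennreal_toReal
  have hgm : Measurable fun p : (ℤ → ℂ) × ℝ => g p.1 p.2 := by
    rw [hg]
    have h : Measurable fun p : ((ℤ → ℂ) × ℝ) × ℝ =>
        G (Function.update p.1.1 0 (polarPoint p.1.2 p.2)) :=
      hG.comp ((measurable_update_prod 0).comp (f := fun p : ((ℤ → ℂ) × ℝ) × ℝ =>
        (p.1.1, polarPoint p.1.2 p.2)) (Measurable.prodMk (by fun_prop)
          (measurable_polarPoint.comp (f := fun p : ((ℤ → ℂ) × ℝ) × ℝ => (p.1.2, p.2))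
            (by fun_prop))))
    exact h.lintegral_prod_right'
  have hHm : ∀ t, Measurable fun p : (ℤ → ℂ) × ℝ => H t p.1 p.2 := by
    intro t
    rw [hH]
    refine Measurable.mul (Measurable.ite ?_ (by fun_prop) measurable_const)
      (Measurable.mul (by fun_prop) hgm)
    exact measurableSet_lt (by fun_prop) measurable_const
  have hg1 : ∀ c w, g c w ≤ 1 := fun c w => by
    rw [hg]
    refine (lintegral_mono fun θ => hG1 _).trans ?_
    simp
  have hHb : ∀ t c w, H t c w ≤ ENNReal.ofReal (bracketSq k) * ENNReal.ofReal (Real.exp (-w)) := by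
    intro t c w
    rw [hH]
    refine mul_le_mul' ?_ ((mul_le_mul_right (hg1 c w) _).trans (by rw [mul_one]))
    split_ifs with h
    · refine ENNReal.ofReal_le_ofReal (mul_le_of_le_one_right hκ.le (Real.exp_le_one_iff.2 ?_))
      have : 0 < t - R c - w := by linarith
      have := mul_pos hκ this
      linarith
    · exact zero_le
  have hexp : ∫⁻ w in Set.Ioi (0 : ℝ), ENNReal.ofReal (Real.exp (-w)) = 1 := by
    have := lintegral_exp_neg_mul_Ioi (a := 1) one_pos
    simpa using this
  have hbound : ∫⁻ w in Set.Ioi (0 : ℝ), ENNReal.ofReal (bracketSq k) *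
      ENNReal.ofReal (Real.exp (-w)) = ENNReal.ofReal (bracketSq k) := by
    rw [lintegral_const_mul _ (by fun_prop), hexp, mul_one]
  have hinner : ∀ c, Tendsto (fun t => ∫⁻ w in Set.Ioi (0 : ℝ), H t c w) (𝓝 m)
      (𝓝 (∫⁻ w in Set.Ioi (0 : ℝ), H m c w)) := by
    intro c
    refine tendsto_lintegral_filter_of_dominated_convergence
      (fun w => ENNReal.ofReal (bracketSq k) * ENNReal.ofReal (Real.exp (-w)))
      (Eventually.of_forall fun t => (hHm t).comp (f := fun w => (c, w)) (by fun_prop))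
      (Eventually.of_forall fun t => ae_of_all _ fun w => hHb t c w)
      (by rw [hbound]; exact ENNReal.ofReal_ne_top) ?_
    -- The density jumps only where the remaining mass of mode k is zero, a null set of w.
    have hne : ∀ᵐ w ∂(volume.restrict (Set.Ioi (0 : ℝ))), w ≠ m - R c :=
      ae_restrict_of_ae (Measure.ae_ne volume _)
    refine hne.mono fun w hw => ?_
    rw [hH]
    refine ENNReal.Tendsto.mul_const ?_ (Or.inr (ENNReal.mul_ne_top ENNReal.ofReal_ne_top
      ((hg1 c w).trans_lt ENNReal.one_lt_top).ne))
    by_cases hlt : w + R c < m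
    · have hev : ∀ᶠ t in 𝓝 m, w + R c < t := lt_mem_nhds hlt
      rw [if_pos hlt]
      refine Tendsto.congr' (hev.mono fun t ht => (if_pos ht).symm) ?_
      refine ENNReal.tendsto_ofReal ?_
      exact Continuous.tendsto (f := fun t => bracketSq k *
        Real.exp (-(bracketSq k * (t - R c - w)))) (by fun_prop) m
    · have hgt : m < w + R c := lt_of_le_of_ne (not_lt.1 hlt) fun h => hw (by linarith)
      have hev : ∀ᶠ t in 𝓝 m, t < w + R c := gt_mem_nhds hgt
      rw [if_neg hlt]
      exact Tendsto.congr' (hev.mono fun t ht => (if_neg (not_lt.2 ht.le)).symm) tendsto_const_nhds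
  have houter : Tendsto (fun t => ∫⁻ c, (∫⁻ w in Set.Ioi (0 : ℝ), H t c w) ∂seqLaw) (𝓝 m)
      (𝓝 (∫⁻ c, (∫⁻ w in Set.Ioi (0 : ℝ), H m c w) ∂seqLaw)) := by
    refine tendsto_lintegral_filter_of_dominated_convergence
      (fun _ => ENNReal.ofReal (bracketSq k))
      (Eventually.of_forall fun t => (hHm t).lintegral_prod_right')
      (Eventually.of_forall fun t => ae_of_all _ fun c => ?_)
      (by simp) (ae_of_all _ fun c => hinner c)
    rw [← hbound]
    exact lintegral_mono fun w => hHb t c w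
  rw [hH, hR, hg] at houter
  exact houter

/-! ### Positivity of the slices and limits of conditional measures. -/

theorem modeLaw_ball_pos (n : ℤ) {δ : ℝ} (hδ : 0 < δ) :
    0 < ∫⁻ z, ({z : ℂ | ‖z‖ ^ 2 < δ}.indicator 1 z : ℝ≥0∞) ∂modeLaw n := by
  have hκ := bracketSq_pos n
  have hm : MeasurableSet {z : ℂ | ‖z‖ ^ 2 < δ} := measurableSet_lt (by fun_prop) measurable_const
  rw [lintegral_modeLaw_polar n (measurable_one.indicator hm)]
  have h1 : ∫⁻ s in Set.Ioo 0 δ, ENNReal.ofReal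
      (bracketSq n * Real.exp (-(bracketSq n * δ))) ≤
      ∫⁻ s in Set.Ioi (0 : ℝ), ENNReal.ofReal (bracketSq n * Real.exp (-(bracketSq n * s))) *
        ∫⁻ θ, ({z : ℂ | ‖z‖ ^ 2 < δ}.indicator 1 (polarPoint s θ) : ℝ≥0∞) ∂angleLaw := by
    refine le_trans ?_ (lintegral_mono_set (s := Set.Ioo 0 δ) fun s hs => hs.1)
    refine setLIntegral_mono' measurableSet_Ioo fun s hs => ?_
    have h2 : ∀ θ, ({z : ℂ | ‖z‖ ^ 2 < δ}.indicator 1 (polarPoint s θ) : ℝ≥0∞) = 1 := fun θ => by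
      rw [Set.indicator_of_mem]
      · rfl
      · simp only [Set.mem_ofPred_eq, norm_sq_polarPoint hs.1.le]; exact hs.2
    simp only [h2, lintegral_one, measure_univ, mul_one]
    refine ENNReal.ofReal_le_ofReal (mul_le_mul_of_nonneg_left (Real.exp_le_exp.2 ?_) hκ.le)
    nlinarith [hs.2]
  refine lt_of_lt_of_le ?_ h1
  rw [lintegral_const, Measure.restrict_apply_univ, Real.volume_Ioo, sub_zero]
  refine ENNReal.mul_pos ?_ ?_
  · simp only [ne_eq, ENNReal.ofReal_eq_zero, not_le]; positivity
  · simpa using hδ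

theorem totalMass_eq_sum_add (S : Finset ℤ) (c : ℤ → ℂ) :
    totalMass c = ∑ n ∈ S, ENNReal.ofReal (‖c n‖ ^ 2) +
      ∑' n : {n : ℤ // n ∉ S}, ENNReal.ofReal (‖c n‖ ^ 2) := by
  have h := Summable.tsum_add_tsum_compl (f := fun n : ℤ => ENNReal.ofReal (‖c n‖ ^ 2))
    (s := (S : Set ℤ)) ENNReal.summable ENNReal.summable
  rw [totalMass, ← h]
  congr 1
  exact Finset.tsum_subtype S fun n : ℤ => ENNReal.ofReal (‖c n‖ ^ 2)

/-- Outside a large finite set the expected mass is small, so the tail is below a/2 with positive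
probability. The finitely many remaining modes are independent of it and lie in small discs with
positive probability. This makes every slice of positive mass nontrivial, so that it can be
normalized. -/
theorem seqLaw_totalMass_lt_pos {a : ℝ} (ha : 0 < a) :
    0 < seqLaw {c | totalMass c < ENNReal.ofReal a} := by
  have hfin : ∑' n : ℤ, ENNReal.ofReal (2 * (1 / bracketSq n)) ≠ ⊤ :=
    (tsum_inv_bracketSq_le.trans_lt ENNReal.ofReal_lt_top).ne
  have ha4 : (0 : ℝ≥0∞) < ENNReal.ofReal (a / 4) := ENNReal.ofReal_pos.2 (by linarith)
  obtain ⟨S, hS⟩ := ((ENNReal.tendsto_tsum_compl_atTop_zero hfin).eventually_lt_const ha4).exists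
  obtain ⟨T, hT⟩ : ∃ T : (ℤ → ℂ) → ℝ≥0∞, T = fun c =>
    ∑' n : {n : ℤ // n ∉ S}, ENNReal.ofReal (‖c n‖ ^ 2) := ⟨_, rfl⟩
  have hTm : Measurable T := by
    rw [hT]; exact Measurable.tsum fun n => by fun_prop
  have hTint : ∫⁻ c, T c ∂seqLaw ≤ ENNReal.ofReal (a / 4) := by
    have hmn : ∀ n : {n : ℤ // n ∉ S},
        AEMeasurable (fun c : ℤ → ℂ => ENNReal.ofReal (‖c n‖ ^ 2)) seqLaw :=
      fun n => Measurable.aemeasurable (by fun_prop)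
    rw [hT, lintegral_tsum hmn]
    refine le_trans (ENNReal.tsum_le_tsum fun n => ?_) hS.le
    exact lintegral_norm_sq_le n.1
  have hU : 0 < seqLaw {c | T c < ENNReal.ofReal (a / 2)} := by
    by_contra h0
    have h0' := nonpos_iff_eq_zero.1 (not_lt.1 h0)
    have h1 : ∀ᵐ c ∂seqLaw, ENNReal.ofReal (a / 2) ≤ T c := by
      rw [ae_iff]; simpa using h0'
    have h2 := lintegral_mono_ae h1
    rw [lintegral_const, measure_univ, mul_one] at h2
    have h3 := h2.trans hTint
    rw [ENNReal.ofReal_le_ofReal_iff (by linarith)] at h3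
    linarith
  obtain ⟨δ, hδ⟩ : ∃ δ : ℝ, δ = a / (2 * (S.card + 1)) := ⟨_, rfl⟩
  have hδ0 : 0 < δ := by rw [hδ]; positivity
  obtain ⟨D, hD⟩ : ∃ D : Set ℂ, D = {z | ‖z‖ ^ 2 < δ} := ⟨_, rfl⟩
  have hDm : MeasurableSet D := by
    rw [hD]; exact measurableSet_lt (by fun_prop) measurable_const
  have hV : 0 < ∫⁻ c, ∏ n ∈ S, (D.indicator 1 (c n) : ℝ≥0∞) ∂seqLaw := by
    rw [lintegral_prod_coord_seqLaw S (f := fun _ => D.indicator 1)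
      fun n => measurable_one.indicator hDm]
    refine pos_iff_ne_zero.2 (Finset.prod_ne_zero_iff.2 fun n _ => ?_)
    rw [hD]
    exact (modeLaw_ball_pos n hδ0).ne'
  have hAm : MeasurableSet {c | totalMass c < ENNReal.ofReal a} :=
    measurableSet_lt measurable_totalMass measurable_const
  have hUm : MeasurableSet {c | T c < ENNReal.ofReal (a / 2)} :=
    measurableSet_lt hTm measurable_const
  rw [← lintegral_indicator_one hAm, lintegral_splice S (measurable_one.indicator hAm)]
  calc (0 : ℝ≥0∞) < seqLaw {c | T c < ENNReal.ofReal (a / 2)} *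
        ∫⁻ c, ∏ n ∈ S, (D.indicator 1 (c n) : ℝ≥0∞) ∂seqLaw := ENNReal.mul_pos hU.ne' hV.ne'
    _ = ∫⁻ c, {c | T c < ENNReal.ofReal (a / 2)}.indicator 1 c *
        ∫⁻ c', ∏ n ∈ S, (D.indicator 1 (c' n) : ℝ≥0∞) ∂seqLaw ∂seqLaw := by
        rw [lintegral_mul_const _ (measurable_one.indicator hUm), lintegral_indicator_one hUm]
    _ ≤ _ := by
        refine lintegral_mono fun c => ?_
        by_cases hc : c ∈ {c | T c < ENNReal.ofReal (a / 2)}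
        swap
        · rw [Set.indicator_of_notMem hc, zero_mul]; exact zero_le
        rw [Set.indicator_of_mem hc, Pi.one_apply, one_mul]
        refine lintegral_mono fun c' => ?_
        by_cases hc' : ∀ n ∈ S, c' n ∈ D
        swap
        · push Not at hc'
          obtain ⟨n, hn, hn'⟩ := hc'
          rw [Finset.prod_eq_zero hn (Set.indicator_of_notMem hn' _)]
          exact zero_le
        rw [Finset.prod_eq_one fun n hn => by rw [Set.indicator_of_mem (hc' n hn)]; rfl,
          Set.indicator_of_mem]
        · rfl
        simp only [Set.mem_ofPred_eq] at hc ⊢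
        rw [totalMass_eq_sum_add S]
        have h1 : ∑' n : {n : ℤ // n ∉ S}, ENNReal.ofReal (‖splice S c c' n‖ ^ 2) = T c := by
          rw [hT]
          refine tsum_congr fun n => ?_
          rw [splice_of_notMem (by simpa using n.2)]
        have h2 : ∑ n ∈ S, ENNReal.ofReal (‖splice S c c' n‖ ^ 2) ≤ ENNReal.ofReal (a / 2) := by
          rw [← ENNReal.ofReal_sum_of_nonneg fun n _ => by positivity]
          refine ENNReal.ofReal_le_ofReal ?_
          calc ∑ n ∈ S, ‖splice S c c' n‖ ^ 2 ≤ ∑ _n ∈ S, δ := by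
                refine Finset.sum_le_sum fun n hn => ?_
                rw [splice_of_mem (by simpa using hn)]
                have := hc' n hn
                rw [hD, Set.mem_ofPred_eq] at this
                exact this.le
            _ = S.card * δ := by rw [Finset.sum_const, nsmul_eq_mul]
            _ ≤ (S.card + 1) * δ := by nlinarith
            _ = a / 2 := by rw [hδ]; field_simp
        rw [h1]
        calc _ ≤ ENNReal.ofReal (a / 2) + T c := by gcongr
          _ < ENNReal.ofReal (a / 2) + ENNReal.ofReal (a / 2) :=
            ENNReal.add_lt_add_left ENNReal.ofReal_ne_top hc
          _ = ENNReal.ofReal a := by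
            rw [← ENNReal.ofReal_add (by linarith) (by linarith)]; congr 1; ring

theorem sliceDensity_le_one (t : ℝ) (c : ℤ → ℂ) : sliceDensity t c ≤ 1 := by
  rw [sliceDensity]
  split_ifs with h
  · rw [← ENNReal.ofReal_one]
    refine ENNReal.ofReal_le_ofReal (Real.exp_le_one_iff.2 ?_)
    have h1 := (ENNReal.lt_ofReal_iff_toReal_lt (h.trans ENNReal.ofReal_lt_top).ne).1 h
    linarith
  · exact zero_le

instance (t : ℝ) : IsFiniteMeasure (sliceLaw t) := by
  refine ⟨?_⟩
  rw [← lintegral_one, lintegral_sliceLaw t measurable_const]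
  refine lt_of_le_of_lt (b := 1) ?_ ENNReal.one_lt_top
  calc _ ≤ ∫⁻ _, (1 : ℝ≥0∞) ∂seqLaw := lintegral_mono fun c => by
        simpa using sliceDensity_le_one t c
    _ = 1 := by simp

theorem sliceLaw_univ_pos {t : ℝ} (ht : 0 < t) : 0 < sliceLaw t Set.univ := by
  have hm : Measurable (sliceDensity t) :=
    measurable_sliceDensity.comp (f := fun c => (t, c)) (by fun_prop)
  rw [← lintegral_one, lintegral_sliceLaw t measurable_const]
  simp only [lintegral_one, measure_univ, mul_one]
  rw [lintegral_pos_iff_support hm]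
  refine lt_of_lt_of_le (seqLaw_totalMass_lt_pos ht) (measure_mono fun c hc => ?_)
  simp only [Set.mem_ofPred_eq] at hc
  rw [Function.mem_support, sliceDensity,
    if_pos (show restMass c < _ from (totalMass_update_zero_le c 0).trans_lt hc)]
  simpa using Real.exp_pos _

/-- The sequences with total mass in `(m - ε, m + ε)`. -/
def seqShell (m ε : ℝ) : Set (ℤ → ℂ) := {c | (totalMass c).toReal ∈ Set.Ioo (m - ε) (m + ε)}

theorem measurableSet_seqShell (m ε : ℝ) : MeasurableSet (seqShell m ε) :=
  measurable_totalMass.ennreal_toReal measurableSet_Ioo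

theorem setLIntegral_seqShell {m ε : ℝ} (hε : ε ≤ m) {G : (ℤ → ℂ) → ℝ≥0∞} (hG : Measurable G) :
    ∫⁻ c in seqShell m ε, G c ∂seqLaw =
      ∫⁻ t in Set.Ioo (m - ε) (m + ε), ∫⁻ c, G c ∂sliceLaw t := by
  have h := lintegral_mass_slice (φ := (Set.Ioo (m - ε) (m + ε)).indicator 1)
    (measurable_one.indicator measurableSet_Ioo) hG
  have h1 : ∀ c, (Set.Ioo (m - ε) (m + ε)).indicator 1 (totalMass c).toReal * G c =
      (seqShell m ε).indicator G c := by
    intro c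
    by_cases hc : (totalMass c).toReal ∈ Set.Ioo (m - ε) (m + ε)
    · rw [Set.indicator_of_mem hc, Set.indicator_of_mem (by simpa [seqShell] using hc)]; simp
    · rw [Set.indicator_of_notMem hc, Set.indicator_of_notMem (by simpa [seqShell] using hc)]; simp
  simp only [h1] at h
  rw [← lintegral_indicator (measurableSet_seqShell m ε), h, ← lintegral_indicator measurableSet_Ioi,
    ← lintegral_indicator measurableSet_Ioo]
  refine lintegral_congr fun t => ?_
  by_cases ht : t ∈ Set.Ioo (m - ε) (m + ε)
  · have h2 : t ∈ Set.Ioi (0 : ℝ) := by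
      have := ht.1
      rw [Set.mem_Ioi]; linarith
    rw [Set.indicator_of_mem h2, Set.indicator_of_mem ht, Set.indicator_of_mem ht]; simp
  · rw [Set.indicator_of_notMem ht]
    by_cases h2 : t ∈ Set.Ioi (0 : ℝ)
    · rw [Set.indicator_of_mem h2, Set.indicator_of_notMem ht, zero_mul]
    · rw [Set.indicator_of_notMem h2]

theorem tendsto_average_Ioo {F : ℝ → ℝ≥0∞} {m : ℝ}
    (hF : Tendsto F (𝓝 m) (𝓝 (F m))) :
    Tendsto (fun ε : ℝ => (ENNReal.ofReal (2 * ε))⁻¹ * ∫⁻ t in Set.Ioo (m - ε) (m + ε), F t)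
      (𝓝[>] 0) (𝓝 (F m)) := by
  have hball : ∀ {U : Set ℝ}, U ∈ 𝓝 m →
      ∀ᶠ ε : ℝ in 𝓝[>] 0, 0 < ε ∧ Set.Ioo (m - ε) (m + ε) ⊆ U := by
    intro U hU
    obtain ⟨r, hr, hrU⟩ := Metric.mem_nhds_iff.1 hU
    filter_upwards [Ioo_mem_nhdsGT hr] with ε hε
    refine ⟨hε.1, fun t ht => hrU ?_⟩
    rw [Real.ball_eq_Ioo]
    exact ⟨by linarith [ht.1, hε.2], by linarith [ht.2, hε.2]⟩
  have hvol : ∀ {ε : ℝ} (a : ℝ≥0∞), 0 < ε →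
      (ENNReal.ofReal (2 * ε))⁻¹ * ∫⁻ _ in Set.Ioo (m - ε) (m + ε), a = a := by
    intro ε a hε
    rw [lintegral_const, Measure.restrict_apply_univ, Real.volume_Ioo,
      show m + ε - (m - ε) = 2 * ε by ring, mul_left_comm,
      ENNReal.inv_mul_cancel (by simpa using hε) ENNReal.ofReal_ne_top, mul_one]
  refine tendsto_order.2 ⟨fun a ha => ?_, fun a ha => ?_⟩
  · obtain ⟨b, hab, hb⟩ := exists_between ha
    have hU : {t | b < F t} ∈ 𝓝 m := hF.eventually_const_lt hb
    filter_upwards [hball hU] with ε hε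
    refine lt_of_lt_of_le hab ?_
    rw [← hvol b hε.1]
    refine mul_le_mul_right ?_ _
    refine setLIntegral_mono' measurableSet_Ioo fun t ht => ?_
    have := hε.2 ht
    rw [Set.mem_ofPred_eq] at this
    exact this.le
  · obtain ⟨b, hb, hba⟩ := exists_between ha
    have hU : {t | F t < b} ∈ 𝓝 m := hF.eventually_lt_const hb
    filter_upwards [hball hU] with ε hε
    refine lt_of_le_of_lt ?_ hba
    rw [← hvol b hε.1]
    refine mul_le_mul_right ?_ _
    refine setLIntegral_mono' measurableSet_Ioo fun t ht => ?_
    have := hε.2 ht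
    rw [Set.mem_ofPred_eq] at this
    exact this.le

theorem tendsto_sliceLaw {k : ℤ} (hk : k ≠ 0) {E : Set (ℤ → ℂ)} (hE : MeasurableSet E)
    (hEk : ∀ c z, Function.update c k z ∈ E ↔ c ∈ E) (m : ℝ) :
    Tendsto (fun t => sliceLaw t E) (𝓝 m) (𝓝 (sliceLaw m E)) := by
  have h := tendsto_lintegral_sliceLaw hk (G := E.indicator 1) (measurable_one.indicator hE)
    (fun c => Set.indicator_apply_le fun _ => le_rfl) (fun c z => by
      by_cases hc : c ∈ E
      · rw [Set.indicator_of_mem hc, Set.indicator_of_mem ((hEk c z).2 hc)]; rfl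
      · rw [Set.indicator_of_notMem hc, Set.indicator_of_notMem (fun h => hc ((hEk c z).1 h))]) m
  simpa only [lintegral_indicator_one hE] using h

theorem seqLaw_inter_seqShell {m ε : ℝ} (hε : ε ≤ m) {E : Set (ℤ → ℂ)} (hE : MeasurableSet E) :
    seqLaw (seqShell m ε ∩ E) = ∫⁻ t in Set.Ioo (m - ε) (m + ε), sliceLaw t E := by
  have h := setLIntegral_seqShell hε (G := E.indicator 1) (measurable_one.indicator hE)
  simp only [lintegral_indicator_one hE] at h
  rw [← h, Measure.restrict_apply hE, Set.inter_comm]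

/-- The conditional measures of sets that do not depend on the mode `k` converge to the normalized
slice measure. -/
theorem tendsto_cond_seqShell {m : ℝ} (hm : 0 < m) {k : ℤ} (hk : k ≠ 0) {E : Set (ℤ → ℂ)}
    (hE : MeasurableSet E) (hEk : ∀ c z, Function.update c k z ∈ E ↔ c ∈ E) :
    Tendsto (fun ε : ℝ => (seqLaw (seqShell m ε))⁻¹ * seqLaw (seqShell m ε ∩ E)) (𝓝[>] 0)
      (𝓝 ((sliceLaw m Set.univ)⁻¹ * sliceLaw m E)) := by
  have h1 := tendsto_average_Ioo (tendsto_sliceLaw hk hE hEk m)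
  have h2 := tendsto_average_Ioo (tendsto_sliceLaw hk MeasurableSet.univ (by simp) m)
  have h3 := ENNReal.Tendsto.mul (tendsto_inv_iff.2 h2)
    (Or.inr (measure_ne_top _ _)) h1 (Or.inr (ENNReal.inv_ne_top.2 (sliceLaw_univ_pos hm).ne'))
  refine Tendsto.congr' ?_ h3
  filter_upwards [Ioo_mem_nhdsGT hm] with ε hε
  rw [seqLaw_inter_seqShell hε.2.le hE]
  have h4 := seqLaw_inter_seqShell hε.2.le (E := Set.univ) MeasurableSet.univ
  rw [Set.inter_univ] at h4
  rw [h4]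
  have h5 : ENNReal.ofReal (2 * ε) ≠ 0 := by simpa using hε.1
  rw [ENNReal.mul_inv (Or.inl (ENNReal.inv_ne_zero.2 ENNReal.ofReal_ne_top))
    (Or.inl (ENNReal.inv_ne_top.2 h5)), inv_inv]
  generalize (∫⁻ t in Set.Ioo (m - ε) (m + ε), sliceLaw t Set.univ)⁻¹ = a
  rw [mul_comm _ a, mul_assoc, ← mul_assoc (ENNReal.ofReal (2 * ε)),
    ENNReal.mul_inv_cancel h5 ENNReal.ofReal_ne_top, one_mul]

/-! ### Second moments on slices. -/

theorem lintegral_modeLaw_phase (n : ℤ) {e : ℂ} (he : ‖e‖ = 1) {g : ℂ → ℝ≥0∞} (hg : Measurable g) :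
    ∫⁻ z, g (e * z) ∂modeLaw n = ∫⁻ z, g z ∂modeLaw n := by
  conv_rhs => rw [← modeLaw_map_phase n he]
  rw [lintegral_map hg (by fun_prop)]

/-- The mean square over the phase of the zero mode. -/
def radialSq (A Y : ℝ) (T : ℂ) (s : ℝ) : ℝ := (A + 3 * s * Y) ^ 2 + 9 / 2 * s * ‖T‖ ^ 2

/-- Averaging over the quarter turns 1, i, -1, -i kills the cross term and replaces Im(zT)² by
|zT|²/2, so four phases already give the full angular mean. -/
theorem lintegral_sq_modeLaw_zero (A Y : ℝ) (T : ℂ) :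
    ∫⁻ z, ENNReal.ofReal ((A + 3 * (z * T).im + 3 * ‖z‖ ^ 2 * Y) ^ 2) ∂modeLaw 0 =
      ∫⁻ s in Set.Ioi (0 : ℝ), ENNReal.ofReal (Real.exp (-s)) * ENNReal.ofReal (radialSq A Y T s) := by
  obtain ⟨g, hg⟩ : ∃ g : ℂ → ℝ≥0∞, g = fun z =>
    ENNReal.ofReal ((A + 3 * (z * T).im + 3 * ‖z‖ ^ 2 * Y) ^ 2) := ⟨_, rfl⟩
  have hgm : Measurable g := by rw [hg]; fun_prop
  have h4 : 4 * ∫⁻ z, g z ∂modeLaw 0 =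
      4 * ∫⁻ z, ENNReal.ofReal (radialSq A Y T (‖z‖ ^ 2)) ∂modeLaw 0 := by
    calc 4 * ∫⁻ z, g z ∂modeLaw 0 = ∫⁻ z, g z ∂modeLaw 0 + ∫⁻ z, g (Complex.I * z) ∂modeLaw 0 +
          ∫⁻ z, g (-1 * z) ∂modeLaw 0 + ∫⁻ z, g (-Complex.I * z) ∂modeLaw 0 := by
          rw [lintegral_modeLaw_phase 0 (by simp) hgm, lintegral_modeLaw_phase 0 (by simp) hgm,
            lintegral_modeLaw_phase 0 (by simp) hgm]
          ring
      _ = ∫⁻ z, (g z + g (Complex.I * z) + g (-1 * z) + g (-Complex.I * z)) ∂modeLaw 0 := by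
          rw [lintegral_add_left (by fun_prop), lintegral_add_left (by fun_prop),
            lintegral_add_left (by fun_prop)]
      _ = ∫⁻ z, 4 * ENNReal.ofReal (radialSq A Y T (‖z‖ ^ 2)) ∂modeLaw 0 := by
          refine lintegral_congr fun z => ?_
          rw [hg]
          beta_reduce
          have h0 : 0 ≤ radialSq A Y T (‖z‖ ^ 2) := by rw [radialSq]; positivity
          rw [← ENNReal.ofReal_add (by positivity) (by positivity),
            ← ENNReal.ofReal_add (by positivity) (by positivity),
            ← ENNReal.ofReal_add (by positivity) (by positivity),
            show (4 : ℝ≥0∞) = ENNReal.ofReal 4 by simp, ← ENNReal.ofReal_mul (by norm_num)]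
          congr 1
          have hn : ‖z‖ ^ 2 * ‖T‖ ^ 2 = (z * T).re ^ 2 + (z * T).im ^ 2 := by
            rw [← mul_pow, ← norm_mul, ← Complex.normSq_eq_norm_sq, Complex.normSq_apply]; ring
          have e1 : (Complex.I * z * T).im = (z * T).re := by
            rw [mul_assoc]; simp
          have e2 : (-1 * z * T).im = -(z * T).im := by
            rw [mul_assoc]; simp
          have e3 : (-Complex.I * z * T).im = -(z * T).re := by
            rw [mul_assoc]; simp
          rw [radialSq, mul_assoc (9 / 2 : ℝ), hn, e1, e2, e3]
          simp only [norm_mul, norm_neg, Complex.norm_I, norm_one, one_mul]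
          ring
      _ = _ := by
          rw [lintegral_const_mul _ (by unfold radialSq; fun_prop)]
  have h5 : ∫⁻ z, g z ∂modeLaw 0 = ∫⁻ z, ENNReal.ofReal (radialSq A Y T (‖z‖ ^ 2)) ∂modeLaw 0 :=
    (ENNReal.mul_right_inj (by norm_num) (by norm_num)).1 h4
  rw [hg] at h5
  rw [h5, lintegral_modeLaw_polar 0 (by unfold radialSq; fun_prop)]
  refine setLIntegral_congr_fun measurableSet_Ioi fun s hs => ?_
  have hs0 : 0 ≤ s := (Set.mem_Ioi.1 hs).le
  simp only [norm_sq_polarPoint hs0, bracketSq_zero, one_mul, lintegral_const, measure_univ,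
    mul_one]

theorem radialSq_nonneg (A Y : ℝ) (T : ℂ) {s : ℝ} (hs : 0 ≤ s) : 0 ≤ radialSq A Y T s := by
  rw [radialSq]; positivity

/-- A + 3s₀Y is affine in s₀ and so is recovered from its values at s and s + 1, with coefficients
at most m + 2 in absolute value. -/
theorem radialSq_le (A Y : ℝ) (T : ℂ) {m s₀ s : ℝ} (h0 : 0 ≤ s₀) (hm : s₀ ≤ m) (hs0 : 0 ≤ s)
    (hs1 : s ≤ 1) :
    radialSq A Y T s₀ ≤ 2 * (m + 2) ^ 2 * (radialSq A Y T s + radialSq A Y T (s + 1)) := by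
  simp only [radialSq]
  have hd1 : (1 - (s₀ - s)) ^ 2 ≤ (m + 2) ^ 2 := by
    refine sq_le_sq' ?_ ?_ <;> linarith
  have hd2 : (s₀ - s) ^ 2 ≤ (m + 2) ^ 2 := by
    refine sq_le_sq' ?_ ?_ <;> linarith
  have e1 : (A + 3 * s₀ * Y) ^ 2 ≤ 2 * (m + 2) ^ 2 *
      ((A + 3 * s * Y) ^ 2 + (A + 3 * (s + 1) * Y) ^ 2) := by
    have : A + 3 * s₀ * Y = (1 - (s₀ - s)) * (A + 3 * s * Y) + (s₀ - s) * (A + 3 * (s + 1) * Y) := by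
      ring
    rw [this]
    calc _ ≤ 2 * ((1 - (s₀ - s)) ^ 2 * (A + 3 * s * Y) ^ 2 +
          (s₀ - s) ^ 2 * (A + 3 * (s + 1) * Y) ^ 2) := by
          nlinarith [sq_nonneg ((1 - (s₀ - s)) * (A + 3 * s * Y) -
            (s₀ - s) * (A + 3 * (s + 1) * Y))]
      _ ≤ 2 * ((m + 2) ^ 2 * (A + 3 * s * Y) ^ 2 + (m + 2) ^ 2 * (A + 3 * (s + 1) * Y) ^ 2) := by
          gcongr
      _ = _ := by ring
  have e2 : 9 / 2 * s₀ * ‖T‖ ^ 2 ≤ 2 * (m + 2) ^ 2 *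
      (9 / 2 * s * ‖T‖ ^ 2 + 9 / 2 * (s + 1) * ‖T‖ ^ 2) := by
    have h1 : s₀ ≤ 2 * (m + 2) ^ 2 * (s + (s + 1)) := by nlinarith
    calc 9 / 2 * s₀ * ‖T‖ ^ 2 ≤ 9 / 2 * (2 * (m + 2) ^ 2 * (s + (s + 1))) * ‖T‖ ^ 2 := by gcongr
      _ = _ := by ring
  linarith

/-- The two-point bound is averaged over 0 < s < 1. There the weights e^{-s} and e^{-(s+1)} are at
least e^{-2}, whence the factor e². -/
theorem ofReal_radialSq_le (A Y : ℝ) (T : ℂ) {m s₀ : ℝ} (h0 : 0 ≤ s₀) (hm : s₀ ≤ m) :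
    ENNReal.ofReal (radialSq A Y T s₀) ≤ ENNReal.ofReal (4 * (m + 2) ^ 2 * Real.exp 2) *
      ∫⁻ s in Set.Ioi (0 : ℝ), ENNReal.ofReal (Real.exp (-s)) *
        ENNReal.ofReal (radialSq A Y T s) := by
  obtain ⟨h, hh⟩ : ∃ h : ℝ → ℝ≥0∞, h = fun s => ENNReal.ofReal (Real.exp (-s)) *
        ENNReal.ofReal (radialSq A Y T s) := ⟨_, rfl⟩
  have hhm : Measurable h := by rw [hh]; unfold radialSq; fun_prop
  have hshift : ∫⁻ s in Set.Ioi (0 : ℝ), h (s + 1) ≤ ∫⁻ s in Set.Ioi (0 : ℝ), h s := by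
    rw [← lintegral_indicator measurableSet_Ioi, ← lintegral_indicator measurableSet_Ioi,
      ← lintegral_add_right_eq_self ((Set.Ioi (0 : ℝ)).indicator h) 1]
    refine lintegral_mono fun s => ?_
    by_cases hs : s ∈ Set.Ioi (0 : ℝ)
    · have hs' : s + 1 ∈ Set.Ioi (0 : ℝ) := by
        rw [Set.mem_Ioi] at *; linarith
      rw [Set.indicator_of_mem hs, Set.indicator_of_mem hs']
    · rw [Set.indicator_of_notMem hs]; exact zero_le
  have hlow : ENNReal.ofReal (radialSq A Y T s₀) ≤
      ENNReal.ofReal (2 * (m + 2) ^ 2 * Real.exp 2) *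
        ∫⁻ s in Set.Ioi (0 : ℝ), (h s + h (s + 1)) := by
    calc ENNReal.ofReal (radialSq A Y T s₀)
        = ∫⁻ _ in Set.Ioo (0 : ℝ) 1, ENNReal.ofReal (radialSq A Y T s₀) := by simp
      _ ≤ ∫⁻ s in Set.Ioo (0 : ℝ) 1, ENNReal.ofReal (2 * (m + 2) ^ 2 * Real.exp 2) *
            (h s + h (s + 1)) := by
          refine setLIntegral_mono' measurableSet_Ioo fun s hs => ?_
          have hr1 := radialSq_nonneg A Y T hs.1.le
          have hr2 := radialSq_nonneg A Y T (s := s + 1) (by linarith [hs.1])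
          rw [hh]
          beta_reduce
          rw [← ENNReal.ofReal_mul (Real.exp_pos _).le, ← ENNReal.ofReal_mul (Real.exp_pos _).le,
            ← ENNReal.ofReal_add (by positivity) (by positivity),
            ← ENNReal.ofReal_mul (by positivity)]
          refine ENNReal.ofReal_le_ofReal ((radialSq_le A Y T h0 hm hs.1.le hs.2.le).trans ?_)
          rw [mul_assoc]
          rw [mul_assoc (2 : ℝ), mul_assoc (2 : ℝ), mul_assoc]
          refine mul_le_mul_of_nonneg_left ?_ (by norm_num)
          refine mul_le_mul_of_nonneg_left ?_ (by positivity)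
          rw [mul_add, ← mul_assoc, ← mul_assoc, ← Real.exp_add, ← Real.exp_add]
          have e1 : 1 ≤ Real.exp (2 + -s) := Real.one_le_exp (by linarith [hs.2])
          have e2 : 1 ≤ Real.exp (2 + -(s + 1)) := Real.one_le_exp (by linarith [hs.2])
          nlinarith
      _ ≤ _ := by
          rw [lintegral_const_mul _ (by fun_prop)]
          gcongr
          exact Set.Ioo_subset_Ioi_self
  refine hlow.trans ?_
  rw [lintegral_add_left hhm]
  have h2 : (∫⁻ s in Set.Ioi (0 : ℝ), h s) + (∫⁻ s in Set.Ioi (0 : ℝ), h (s + 1)) ≤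
      ENNReal.ofReal 2 * ∫⁻ s in Set.Ioi (0 : ℝ), h s := by
    rw [show ENNReal.ofReal 2 = 2 by simp, two_mul]
    exact add_le_add_right hshift _
  refine (mul_le_mul_right h2 _).trans (le_of_eq ?_)
  rw [← mul_assoc, ← ENNReal.ofReal_mul (by positivity), hh]
  congr 2
  ring

/-- The second moment on a slice is controlled by the second moment under the Gaussian law. -/
theorem lintegral_sq_sliceLaw_le {F A Y : (ℤ → ℂ) → ℝ} {T : (ℤ → ℂ) → ℂ} (hF : Measurable F)
    (hform : ∀ c z, F (Function.update c 0 z) = A c + 3 * (z * T c).im + 3 * ‖z‖ ^ 2 * Y c)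
    (m : ℝ) :
    ∫⁻ c, ENNReal.ofReal (F c ^ 2) ∂sliceLaw m ≤
      ENNReal.ofReal (16 * (m + 2) ^ 2 * Real.exp 2) * ∫⁻ c, ENNReal.ofReal (F c ^ 2) ∂seqLaw := by
  rw [lintegral_sliceLaw m (by fun_prop), lintegral_update 0 (G := fun c => ENNReal.ofReal (F c ^ 2)) (by fun_prop)]
  simp only [hform, lintegral_sq_modeLaw_zero]
  rw [← lintegral_const_mul' _ _ ENNReal.ofReal_ne_top]
  refine lintegral_mono fun c => ?_
  by_cases hc : restMass c < ENNReal.ofReal m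
  swap
  · rw [sliceDensity, if_neg hc, zero_mul]; exact zero_le
  have hr := (ENNReal.lt_ofReal_iff_toReal_lt (hc.trans ENNReal.ofReal_lt_top).ne).1 hc
  have hr0 : 0 ≤ (restMass c).toReal := ENNReal.toReal_nonneg
  obtain ⟨s₀, hs₀⟩ : ∃ s₀, s₀ = m - (restMass c).toReal := ⟨_, rfl⟩
  have hs0 : 0 ≤ s₀ := by linarith
  have h1 : ∀ θ, ENNReal.ofReal (F (slicePoint m c θ) ^ 2) ≤
      ENNReal.ofReal (4 * radialSq (A c) (Y c) (T c) s₀) := by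
    intro θ
    rw [slicePoint, hform, ← hs₀, norm_sq_polarPoint hs0]
    refine ENNReal.ofReal_le_ofReal ?_
    have h2 : (polarPoint s₀ θ * T c).im ^ 2 ≤ s₀ * ‖T c‖ ^ 2 := by
      have e : s₀ * ‖T c‖ ^ 2 = ‖polarPoint s₀ θ * T c‖ ^ 2 := by
        rw [norm_mul, mul_pow, norm_sq_polarPoint hs0]
      rw [e]
      exact sq_le_sq' (by linarith [neg_abs_le (polarPoint s₀ θ * T c).im,
        Complex.abs_im_le_norm (polarPoint s₀ θ * T c)])
        ((le_abs_self _).trans (Complex.abs_im_le_norm _))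
    rw [radialSq]
    nlinarith [sq_nonneg (A c + 3 * s₀ * Y c - 3 * (polarPoint s₀ θ * T c).im),
      sq_nonneg (A c + 3 * s₀ * Y c)]
  calc _ ≤ 1 * ENNReal.ofReal (4 * radialSq (A c) (Y c) (T c) s₀) := by
        refine mul_le_mul' (sliceDensity_le_one m c) ((lintegral_mono h1).trans ?_)
        simp
    _ ≤ ENNReal.ofReal 4 * (ENNReal.ofReal (4 * (m + 2) ^ 2 * Real.exp 2) *
      ∫⁻ s in Set.Ioi (0 : ℝ), ENNReal.ofReal (Real.exp (-s)) *
        ENNReal.ofReal (radialSq (A c) (Y c) (T c) s)) := by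
        rw [one_mul, ENNReal.ofReal_mul (by norm_num)]
        gcongr
        exact ofReal_radialSq_le _ _ _ hs0 (by linarith)
    _ = _ := by
        rw [← mul_assoc, ← ENNReal.ofReal_mul (by norm_num)]
        congr 2
        ring

theorem lintegral_quartic_sub_sq_sliceLaw_le (m : ℝ) {N₁ N₂ : ℕ} (h1 : 1 ≤ N₁)
    (h12 : N₁ ≤ N₂) (h2 : N₂ ≤ 2 * N₁) :
    ∫⁻ c, ENNReal.ofReal ((quartic (box N₂) c - quartic (box N₁) c) ^ 2) ∂sliceLaw m ≤
      ENNReal.ofReal (16 * (m + 2) ^ 2 * Real.exp 2 * 20000000 / N₁) := by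
  have hz : ∀ N, (0 : ℤ) ∈ box N := fun N => by simp [box]
  have hm2 := (continuous_quartic (box N₂)).measurable
  have hm1 := (continuous_quartic (box N₁)).measurable
  have h := lintegral_sq_sliceLaw_le (F := fun c => quartic (box N₂) c - quartic (box N₁) c)
    (A := fun c => quartic ((box N₂).erase 0) c - quartic ((box N₁).erase 0) c)
    (Y := fun c => momentum ((box N₂).erase 0) c - momentum ((box N₁).erase 0) c)
    (T := fun c => cubic ((box N₂).erase 0) c - cubic ((box N₁).erase 0) c) (hm2.sub hm1)
    (fun c z => by
      rw [quartic_update_zero (hz N₂), quartic_update_zero (hz N₁), mul_sub, Complex.sub_im]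
      ring) m
  refine h.trans ((mul_le_mul_right (lintegral_quartic_box_sub_sq_le h1 h12 h2) _).trans
    (le_of_eq ?_))
  rw [← ENNReal.ofReal_mul (by positivity)]
  congr 1
  ring

/-! ### From dyadic Cauchy estimates to a limit function. -/

theorem eLpNorm_two_le_of_lintegral_sq_le {X : Type*} [MeasurableSpace X] {ν : Measure X}
    {g : X → ℝ} {b : ℝ} (hb : 0 ≤ b) (h : ∫⁻ x, ENNReal.ofReal (g x ^ 2) ∂ν ≤ ENNReal.ofReal (b ^ 2)) :
    eLpNorm g 2 ν ≤ ENNReal.ofReal b := by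
  rw [eLpNorm_eq_lintegral_rpow_enorm_toReal (by norm_num) (by norm_num)]
  have h1 : ∀ x, ‖g x‖ₑ ^ (2 : ℝ≥0∞).toReal = ENNReal.ofReal (g x ^ 2) := fun x => by
    rw [← ofReal_norm, ENNReal.toReal_ofNat, ENNReal.rpow_ofNat,
      ← ENNReal.ofReal_pow (norm_nonneg _), Real.norm_eq_abs, sq_abs]
  simp only [h1]
  calc _ ≤ ENNReal.ofReal (b ^ 2) ^ (1 / (2 : ℝ≥0∞).toReal) := by gcongr
    _ = _ := by
      rw [ENNReal.toReal_ofNat, ENNReal.ofReal_rpow_of_nonneg (by positivity) (by norm_num),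
        ← Real.sqrt_eq_rpow, Real.sqrt_sq hb]

/-- The limit along the dyadic subsequence. -/
def dyadicLim {X : Type*} (F : ℕ → X → ℝ) (x : X) : ℝ := limUnder atTop fun k : ℕ => F (2 ^ k) x

/-- Dyadic Cauchy estimates in `L²` imply convergence to the dyadic limit. -/
theorem tendsto_eLpNorm_sub_dyadicLim {X : Type*} [MeasurableSpace X] {ν : Measure X}
    {F : ℕ → X → ℝ} (hF : ∀ N, Measurable (F N)) {C : ℝ} (hC : 0 ≤ C)
    (h : ∀ N₁ N₂, 1 ≤ N₁ → N₁ ≤ N₂ → N₂ ≤ 2 * N₁ →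
      ∫⁻ x, ENNReal.ofReal ((F N₂ x - F N₁ x) ^ 2) ∂ν ≤ ENNReal.ofReal (C / N₁)) :
    AEStronglyMeasurable (dyadicLim F) ν ∧
      Tendsto (fun N => eLpNorm (fun x => F N x - dyadicLim F x) 2 ν) atTop (𝓝 0) := by
  have hsm : ∀ N, AEStronglyMeasurable (F N) ν := fun N => (hF N).aestronglyMeasurable
  set K := Real.sqrt C with hK
  have hK0 : 0 ≤ K := Real.sqrt_nonneg _
  have hstep : ∀ j N : ℕ, 2 ^ j ≤ N → N ≤ 2 * 2 ^ j →
      -- The rate is 2^{-j/2}, replaced by the rational ratio 3/4 through 1/2 ≤ (3/4)².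
      eLpNorm (F N - F (2 ^ j)) 2 ν ≤ ENNReal.ofReal (K * (3 / 4) ^ j) := by
    intro j N h1 h2
    refine eLpNorm_two_le_of_lintegral_sq_le (by positivity)
      ((h (2 ^ j) N Nat.one_le_two_pow h1 h2).trans (ENNReal.ofReal_le_ofReal ?_))
    rw [mul_pow, hK, Real.sq_sqrt hC, div_eq_mul_inv]
    refine mul_le_mul_of_nonneg_left ?_ hC
    push_cast
    rw [← pow_mul, mul_comm j 2, pow_mul, ← inv_pow]
    exact pow_le_pow_left₀ (by norm_num) (by norm_num) j
  have htail : ∀ i j N : ℕ, 2 ^ j ≤ N → N ≤ 2 ^ (j + i) →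
      eLpNorm (F N - F (2 ^ j)) 2 ν ≤ ENNReal.ofReal (4 * K * (3 / 4) ^ j) := by
    intro i
    induction i with
    | zero =>
      intro j N h1 h2
      rw [show N = 2 ^ j from le_antisymm h2 h1]
      simp
    | succ i ih =>
      intro j N h1 h2
      by_cases h3 : N ≤ 2 ^ (j + 1)
      · refine (hstep j N h1 (by rw [pow_succ] at h3; omega)).trans (ENNReal.ofReal_le_ofReal ?_)
        have : 0 ≤ K * (3 / 4) ^ j := by positivity
        linarith
      · have e1 := ih (j + 1) N (by omega) (by rw [show j + 1 + i = j + (i + 1) by ring]; exact h2)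
        have e2 := hstep j (2 ^ (j + 1)) (Nat.pow_le_pow_right (by norm_num) (by omega))
          (by rw [pow_succ]; omega)
        calc eLpNorm (F N - F (2 ^ j)) 2 ν
            = eLpNorm ((F N - F (2 ^ (j + 1))) + (F (2 ^ (j + 1)) - F (2 ^ j))) 2 ν := by
              rw [sub_add_sub_cancel]
          _ ≤ _ := (eLpNorm_add_le ((hsm _).sub (hsm _)) ((hsm _).sub (hsm _)) (by norm_num)).trans
              (add_le_add e1 e2)
          _ = _ := by
              rw [← ENNReal.ofReal_add (by positivity) (by positivity)]
              congr 1
              rw [pow_succ]; ring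
  have htail' : ∀ j N : ℕ, 2 ^ j ≤ N →
      eLpNorm (F N - F (2 ^ j)) 2 ν ≤ ENNReal.ofReal (4 * K * (3 / 4) ^ j) := fun j N hN =>
    htail N j N hN (Nat.lt_two_pow_self.le.trans (Nat.pow_le_pow_right (by norm_num) (by omega)))
  have hpair : ∀ j N N' : ℕ, 2 ^ j ≤ N → 2 ^ j ≤ N' →
      eLpNorm (F N - F N') 2 ν ≤ ENNReal.ofReal (8 * K * (3 / 4) ^ j) := by
    intro j N N' hN hN'
    have e2 := htail' j N' hN'
    rw [eLpNorm_sub_comm] at e2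
    calc eLpNorm (F N - F N') 2 ν = eLpNorm ((F N - F (2 ^ j)) + (F (2 ^ j) - F N')) 2 ν := by
          rw [sub_add_sub_cancel]
      _ ≤ _ := (eLpNorm_add_le ((hsm _).sub (hsm _)) ((hsm _).sub (hsm _)) (by norm_num)).trans
          (add_le_add (htail' j N hN) e2)
      _ = _ := by
          rw [← ENNReal.ofReal_add (by positivity) (by positivity)]
          congr 1; ring
  -- The added 1 provides the strict inequality required of the summable bounds, also when K = 0.
  have hsum : ∑' j : ℕ, ENNReal.ofReal ((8 * K + 1) * (3 / 4) ^ j) ≠ ⊤ := by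
    have hs : Summable fun j : ℕ => (8 * K + 1) * ((3 : ℝ) / 4) ^ j :=
      (summable_geometric_of_lt_one (by norm_num) (by norm_num)).mul_left _
    exact hs.tsum_ofReal_ne_top
  have hae : ∀ᵐ x ∂ν, ∃ l, Tendsto (fun k : ℕ => F (2 ^ k) x) atTop (𝓝 l) := by
    refine Lp.ae_tendsto_of_cauchy_eLpNorm (f := fun k : ℕ => F (2 ^ k)) (fun k => hsm _)
      (p := 2) (by norm_num) hsum fun j n k hn hk => ?_
    refine (hpair j _ _ (Nat.pow_le_pow_right (by norm_num) hn)
      (Nat.pow_le_pow_right (by norm_num) hk)).trans_lt ?_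
    have : (0 : ℝ) < (3 / 4) ^ j := by positivity
    exact (ENNReal.ofReal_lt_ofReal_iff (by positivity)).2 (by linarith)
  have hlim : ∀ᵐ x ∂ν, Tendsto (fun k : ℕ => F (2 ^ k) x) atTop (𝓝 (dyadicLim F x)) :=
    hae.mono fun x hx => tendsto_nhds_limUnder hx
  have hfin : ∀ j N : ℕ, 2 ^ j ≤ N →
      eLpNorm (fun x => F N x - dyadicLim F x) 2 ν ≤ ENNReal.ofReal (8 * K * (3 / 4) ^ j) := by
    intro j N hN
    refine (Lp.eLpNorm_lim_le_liminf_eLpNorm (f := fun k : ℕ => F N - F (2 ^ k))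
      (fun k => (hsm _).sub (hsm _)) _ (hlim.mono fun x hx => hx.const_sub (F N x))).trans ?_
    refine (liminf_le_limsup).trans (limsup_le_of_le (by isBoundedDefault) ?_)
    filter_upwards [eventually_ge_atTop j] with k hk
    exact hpair j N _ hN (Nat.pow_le_pow_right (by norm_num) hk)
  have hto : Tendsto (fun j : ℕ => ENNReal.ofReal (8 * K * (3 / 4) ^ j)) atTop (𝓝 0) := by
    rw [← ENNReal.ofReal_zero]
    refine ENNReal.tendsto_ofReal ?_
    have := (tendsto_pow_atTop_nhds_zero_of_lt_one (r := (3 : ℝ) / 4) (by norm_num)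
      (by norm_num)).const_mul (8 * K)
    simpa using this
  refine ⟨aestronglyMeasurable_of_tendsto_ae atTop (fun k : ℕ => hsm (2 ^ k)) hlim,
    ENNReal.tendsto_nhds_zero.2 fun ε hε => ?_⟩
  obtain ⟨j, hj⟩ := (ENNReal.tendsto_nhds_zero.1 hto ε hε).exists
  filter_upwards [eventually_ge_atTop (2 ^ j)] with N hN
  exact (hfin j N hN).trans hj

/-! ### Exponential moments of the momentum below a mass cutoff. -/

theorem inv_one_sub_le_exp_quadratic {x : ℝ} (hx : x ≤ 1 / 2) : (1 - x)⁻¹ ≤ Real.exp (x + 2 * x ^ 2) := by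
  have h1 : 0 < 1 - x := by linarith
  rw [inv_le_iff_one_le_mul₀ h1]
  have h2 := Real.add_one_le_exp (x + 2 * x ^ 2)
  nlinarith [mul_nonneg (sq_nonneg x) (by linarith : (0 : ℝ) ≤ 1 - 2 * x)]

theorem sum_box_odd (N : ℕ) {g : ℤ → ℝ} (hg : ∀ n, g (-n) = -g n) : ∑ n ∈ box N, g n = 0 := by
  have h : ∑ n ∈ box N, g n = ∑ n ∈ box N, g (-n) :=
    Finset.sum_bij' (fun n _ => -n) (fun n _ => -n) (fun n hn => (mem_box_neg N n).1 hn)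
      (fun n hn => (mem_box_neg N n).1 hn) (by simp) (by simp) fun n _ => by simp
  simp only [hg, Finset.sum_neg_distrib] at h
  linarith

/-- The odd high-frequency weights `K n`, for `|n| > L`. -/
def highWeight (K : ℝ) (L : ℕ) (n : ℤ) : ℝ := if (L : ℝ) < |(n : ℝ)| then K * n else 0

theorem highWeight_neg (K : ℝ) (L : ℕ) (n : ℤ) : highWeight K L (-n) = -highWeight K L n := by
  simp only [highWeight, Int.cast_neg, abs_neg]
  split_ifs <;> simp

theorem highWeight_le {K : ℝ} {L : ℕ} (hL : 2 * |K| ≤ L) (n : ℤ) :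
    highWeight K L n ≤ bracketSq n / 2 := by
  rw [highWeight]
  split_ifs with h
  · have h1 : K * n ≤ |K| * |(n : ℝ)| := by rw [← abs_mul]; exact le_abs_self _
    have h2 := sq_abs (n : ℝ)
    rw [bracketSq]
    nlinarith [abs_nonneg (n : ℝ)]
  · linarith [bracketSq_pos n]

theorem highWeight_div_sq_le (K : ℝ) (L : ℕ) (n : ℤ) :
    (highWeight K L n / bracketSq n) ^ 2 ≤ K ^ 2 * (1 / bracketSq n) := by
  have hp := bracketSq_pos n
  have h1 : highWeight K L n ^ 2 ≤ K ^ 2 * bracketSq n := by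
    rw [highWeight]
    split_ifs
    · rw [mul_pow, bracketSq]; nlinarith [sq_nonneg K]
    · have := sq_nonneg K; rw [zero_pow two_ne_zero]; positivity
  rw [div_pow, mul_one_div, div_le_div_iff₀ (by positivity) hp]
  nlinarith

/-- The exponential moment is a product of factors 1/(1 - x_n) with x_n odd in n. The first-order
terms, whose absolute values have a divergent sum, cancel between n and -n; the squares are
summable, being at most K²/⟨n⟩². -/
theorem lintegral_exp_highWeight_le {K : ℝ} {L : ℕ} (hL : 2 * |K| ≤ L) (N : ℕ) :
    ∫⁻ c, ENNReal.ofReal (Real.exp (∑ n ∈ box N, highWeight K L n * ‖c n‖ ^ 2)) ∂seqLaw ≤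
      ENNReal.ofReal (Real.exp (10 * K ^ 2)) := by
  have hw := highWeight_le hL
  rw [lintegral_exp_sum_norm_sq_seqLaw _ fun n _ => by linarith [hw n, bracketSq_pos n]]
  refine ENNReal.ofReal_le_ofReal ?_
  have hx : ∀ n, highWeight K L n / bracketSq n ≤ 1 / 2 := fun n => by
    rw [div_le_iff₀ (bracketSq_pos n)]; linarith [hw n]
  calc ∏ n ∈ box N, (1 - highWeight K L n / bracketSq n)⁻¹
      ≤ ∏ n ∈ box N, Real.exp (highWeight K L n / bracketSq n +
          2 * (highWeight K L n / bracketSq n) ^ 2) :=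
        Finset.prod_le_prod (fun n _ => inv_nonneg.2 (by linarith [hx n]))
          fun n _ => inv_one_sub_le_exp_quadratic (hx n)
    _ = Real.exp (2 * ∑ n ∈ box N, (highWeight K L n / bracketSq n) ^ 2) := by
        rw [← Real.exp_sum, Finset.sum_add_distrib, sum_box_odd N, zero_add, Finset.mul_sum]
        intro n
        rw [highWeight_neg, bracketSq_neg, neg_div]
    _ ≤ Real.exp (10 * K ^ 2) := by
        rw [Real.exp_le_exp]
        have h1 : ∑ n ∈ box N, (highWeight K L n / bracketSq n) ^ 2 ≤
            ∑ n ∈ box N, K ^ 2 * (1 / bracketSq n) :=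
          Finset.sum_le_sum fun n _ => highWeight_div_sq_le K L n
        rw [← Finset.mul_sum] at h1
        nlinarith [sum_inv_bracketSq_box_le_five N, sq_nonneg K]

theorem momentum_erase_zero (S : Finset ℤ) (c : ℤ → ℂ) :
    momentum (S.erase 0) c = momentum S c :=
  Finset.sum_erase _ (by simp)

/-- Frequencies up to L are paid for by the mass, and only the others need Gaussian integration. The
zero mode has weight zero, so its mass does not enter. -/
theorem mul_momentum_le {K : ℝ} (L N : ℕ) (c : ℤ → ℂ) :
    K * momentum (box N) c ≤ |K| * L * ∑ n ∈ (box N).erase 0, ‖c n‖ ^ 2 +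
      ∑ n ∈ box N, highWeight K L n * ‖c n‖ ^ 2 := by
  have h0 : ∑ n ∈ (box N).erase 0, highWeight K L n * ‖c n‖ ^ 2 =
      ∑ n ∈ box N, highWeight K L n * ‖c n‖ ^ 2 := Finset.sum_erase _ (by simp [highWeight])
  rw [← momentum_erase_zero, ← h0, momentum, Finset.mul_sum, Finset.mul_sum,
    ← Finset.sum_add_distrib]
  refine Finset.sum_le_sum fun n _ => ?_
  rw [highWeight]
  split_ifs with h
  · have : 0 ≤ |K| * L * ‖c n‖ ^ 2 := by positivity
    linarith
  · have h1 : K * n ≤ |K| * |(n : ℝ)| := by rw [← abs_mul]; exact le_abs_self _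
    have h2 : K * n ≤ |K| * L := h1.trans (by gcongr; exact not_lt.1 h)
    nlinarith [sq_nonneg ‖c n‖]

/-- Below a mass cutoff, the momentum has exponential moments uniformly in the truncation. -/
theorem exists_lintegral_exp_momentum_le (K R : ℝ) : ∃ D : ℝ, 0 ≤ D ∧ ∀ N : ℕ,
    ∫⁻ c in {c | ∑ n ∈ (box N).erase 0, ‖c n‖ ^ 2 < R},
      ENNReal.ofReal (Real.exp (K * momentum (box N) c)) ∂seqLaw ≤ ENNReal.ofReal D := by
  -- Beyond 2|K| the weight Kn is at most ⟨n⟩²/2, so every Gaussian exponential moment is finite.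
  obtain ⟨L, hL⟩ := exists_nat_ge (2 * |K|)
  refine ⟨Real.exp (|K| * L * R) * Real.exp (10 * K ^ 2), by positivity, fun N => ?_⟩
  have hmeas : MeasurableSet {c : ℤ → ℂ | ∑ n ∈ (box N).erase 0, ‖c n‖ ^ 2 < R} :=
    measurableSet_lt (by fun_prop) measurable_const
  calc _ ≤ ∫⁻ c in {c | ∑ n ∈ (box N).erase 0, ‖c n‖ ^ 2 < R},
        ENNReal.ofReal (Real.exp (|K| * L * R)) *
          ENNReal.ofReal (Real.exp (∑ n ∈ box N, highWeight K L n * ‖c n‖ ^ 2)) ∂seqLaw := by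
        refine setLIntegral_mono' hmeas fun c hc => ?_
        rw [Set.mem_ofPred_eq] at hc
        rw [← ENNReal.ofReal_mul (Real.exp_pos _).le, ← Real.exp_add]
        refine ENNReal.ofReal_le_ofReal (Real.exp_le_exp.2 ((mul_momentum_le L N c).trans ?_))
        gcongr
    _ ≤ ∫⁻ c, ENNReal.ofReal (Real.exp (|K| * L * R)) *
          ENNReal.ofReal (Real.exp (∑ n ∈ box N, highWeight K L n * ‖c n‖ ^ 2)) ∂seqLaw :=
        setLIntegral_le_lintegral _ _
    _ ≤ _ := by
        rw [lintegral_const_mul' _ _ ENNReal.ofReal_ne_top, ENNReal.ofReal_mul (Real.exp_pos _).le]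
        gcongr
        exact lintegral_exp_highWeight_le hL N

/-! ### Passing exponential bounds from μ to the slices. -/

/-- The zero mode enters the quartic form as `A + 3 Im (zT) + 3|z|² Y`. -/
def zeroModeForm (A Y : ℝ) (T z : ℂ) : ℝ := A + 3 * (z * T).im + 3 * ‖z‖ ^ 2 * Y

theorem exp_le_two_add_exp {a q x : ℝ} (h : |a| ≤ q) :
    Real.exp (a * x) ≤ Real.exp (q * x) + Real.exp (-q * x) := by
  have h1 : a * x ≤ q * |x| := (le_abs_self _).trans (by rw [abs_mul]; gcongr)
  rcases abs_cases x with ⟨hx, _⟩ | ⟨hx, _⟩ <;> rw [hx] at h1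
  · linarith [Real.exp_le_exp.2 h1, Real.exp_pos (-q * x)]
  · have := Real.exp_le_exp.2 (show a * x ≤ -q * x by linarith)
    linarith [Real.exp_pos (q * x)]

theorem exp_add_add_le (x y v : ℝ) :
    Real.exp (x + y + v) ≤ Real.exp (3 * x) + Real.exp (3 * y) + Real.exp (3 * v) := by
  have hx := Real.exp_pos (3 * x)
  have hy := Real.exp_pos (3 * y)
  have hv := Real.exp_pos (3 * v)
  rcases le_total x y with h1 | h1 <;> rcases le_total y v with h2 | h2 <;>
    rcases le_total x v with h3 | h3
  all_goals first
    | linarith [Real.exp_le_exp.2 (show x + y + v ≤ 3 * v by linarith)]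
    | linarith [Real.exp_le_exp.2 (show x + y + v ≤ 3 * y by linarith)]
    | linarith [Real.exp_le_exp.2 (show x + y + v ≤ 3 * x by linarith)]

theorem exp_sub_le (x y : ℝ) : Real.exp (x - y) ≤ Real.exp (2 * x) + Real.exp (-(2 * y)) := by
  rcases le_total x (-y) with h | h
  · linarith [Real.exp_le_exp.2 (show x - y ≤ -(2 * y) by linarith), Real.exp_pos (2 * x)]
  · linarith [Real.exp_le_exp.2 (show x - y ≤ 2 * x by linarith), Real.exp_pos (-(2 * y))]

/-- `e^{qx} + e^{-qx}`. -/
def twoSidedExp (q x : ℝ) : ℝ := Real.exp (q * x) + Real.exp (-q * x)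

theorem twoSidedExp_pos (q x : ℝ) : 0 < twoSidedExp q x := by unfold twoSidedExp; positivity

/-- Averaging over the four phases `1, i, -1, -i` controls both the radial and the angular part. -/
theorem exp_zeroMode_le {p q : ℝ} (hp : 0 ≤ p) (hq : 6 * p ≤ q) (A Y : ℝ) (T z : ℂ) {s R : ℝ}
    (hs0 : 0 ≤ s) (hsR : s ≤ R) (hz : ‖z‖ ^ 2 ≤ R) (hsz : s ≤ 2 * ‖z‖ ^ 2) :
    Real.exp (p * (A + 3 * s * Y + 3 * (Real.sqrt s * ‖T‖))) ≤
      Real.exp (9 * p * R * |Y|) +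
        3 * (twoSidedExp q (zeroModeForm A Y T z) +
          twoSidedExp q (zeroModeForm A Y T (Complex.I * z)) +
          twoSidedExp q (zeroModeForm A Y T (-1 * z)) +
          twoSidedExp q (zeroModeForm A Y T (-Complex.I * z))) := by
  obtain ⟨F1, hF1⟩ : ∃ F1, F1 = zeroModeForm A Y T z := ⟨_, rfl⟩
  obtain ⟨F2, hF2⟩ : ∃ F2, F2 = zeroModeForm A Y T (Complex.I * z) := ⟨_, rfl⟩
  obtain ⟨F3, hF3⟩ : ∃ F3, F3 = zeroModeForm A Y T (-1 * z) := ⟨_, rfl⟩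
  obtain ⟨F4, hF4⟩ : ∃ F4, F4 = zeroModeForm A Y T (-Complex.I * z) := ⟨_, rfl⟩
  rw [← hF1, ← hF2, ← hF3, ← hF4]
  have hsum : F1 + F3 = 2 * (A + 3 * ‖z‖ ^ 2 * Y) := by
    rw [hF1, hF3, zeroModeForm, zeroModeForm, neg_one_mul, norm_neg, neg_mul, Complex.neg_im]
    ring
  have hd1 : F1 - F3 = 6 * (z * T).im := by
    rw [hF1, hF3, zeroModeForm, zeroModeForm, neg_one_mul, norm_neg, neg_mul, Complex.neg_im]
    ring
  have hd2 : F2 - F4 = 6 * (z * T).re := by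
    rw [hF2, hF4, zeroModeForm, zeroModeForm, neg_mul, norm_neg, neg_mul, Complex.neg_im,
      mul_assoc, Complex.I_mul_im]
    ring
  have h6 : |6 * p| ≤ q := by rwa [abs_of_nonneg (by positivity)]
  have h6' : |-(6 * p)| ≤ q := by rwa [abs_neg]
  have h3 : |3 * p| ≤ q := by rw [abs_of_nonneg (by positivity)]; linarith
  have hbd : ∀ x y : ℝ, Real.exp (3 * p * (x - y)) ≤ twoSidedExp q x + twoSidedExp q y := by
    intro x y
    have e1 := exp_sub_le (3 * p * x) (3 * p * y)
    have e2 := exp_le_two_add_exp (x := x) h6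
    have e3 := exp_le_two_add_exp (x := y) h6'
    rw [← mul_sub] at e1
    rw [show 2 * (3 * p * x) = 6 * p * x by ring,
      show -(2 * (3 * p * y)) = -(6 * p) * y by ring] at e1
    unfold twoSidedExp
    linarith
  -- The radial part is the half-sum of the values at z and -z. The factor 3 in the exponent pays
  -- for splitting a product of three exponentials into a sum.
  have hrad : Real.exp (3 * (p * (A + 3 * ‖z‖ ^ 2 * Y))) ≤ twoSidedExp q F1 + twoSidedExp q F3 := by
    have e : 3 * (p * (A + 3 * ‖z‖ ^ 2 * Y)) = (3 * p * F1 + 3 * p * F3) / 2 := by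
      linear_combination -(3 * p / 2) * hsum
    have e2 := exp_le_two_add_exp (x := F1) h3
    have e3 := exp_le_two_add_exp (x := F3) h3
    have e4 := Real.exp_pos (3 * p * F1)
    have e5 := Real.exp_pos (3 * p * F3)
    rw [e]
    unfold twoSidedExp
    rcases le_total (3 * p * F1) (3 * p * F3) with h | h
    · linarith [Real.exp_le_exp.2 (show (3 * p * F1 + 3 * p * F3) / 2 ≤ 3 * p * F3 by linarith)]
    · linarith [Real.exp_le_exp.2 (show (3 * p * F1 + 3 * p * F3) / 2 ≤ 3 * p * F1 by linarith)]
  -- The angular part is recovered from differences: opposite values differ by 6 Im(zT) or 6 Re(zT),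
  -- and one of these dominates √s |T| because s ≤ 2|z|². Splitting a difference doubles the
  -- exponent 3p to 6p.
  have hang : Real.exp (3 * (p * (3 * (Real.sqrt s * ‖T‖)))) ≤ 2 * (twoSidedExp q F1 +
      twoSidedExp q F2 + twoSidedExp q F3 + twoSidedExp q F4) := by
    have hst : (Real.sqrt s * ‖T‖) ^ 2 ≤ 2 * ((z * T).re ^ 2 + (z * T).im ^ 2) := by
      have : ‖z * T‖ ^ 2 = (z * T).re ^ 2 + (z * T).im ^ 2 := by
        rw [← Complex.normSq_eq_norm_sq, Complex.normSq_apply]; ring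
      rw [← this, norm_mul, mul_pow, mul_pow, Real.sq_sqrt hs0]
      nlinarith [sq_nonneg ‖T‖]
    have hw : Real.sqrt s * ‖T‖ ≤ 2 * max |(z * T).re| |(z * T).im| := by
      refine abs_le_of_sq_le_sq' ?_ (by positivity) |>.2
      have h1 : (z * T).re ^ 2 ≤ max |(z * T).re| |(z * T).im| ^ 2 := by
        rw [← sq_abs]; gcongr; exact le_max_left _ _
      have h2 : (z * T).im ^ 2 ≤ max |(z * T).re| |(z * T).im| ^ 2 := by
        rw [← sq_abs (z * T).im]; gcongr; exact le_max_right _ _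
      nlinarith
    have hcase : ∀ y : ℝ, Real.sqrt s * ‖T‖ ≤ 2 * y →
        Real.exp (3 * (p * (3 * (Real.sqrt s * ‖T‖)))) ≤ Real.exp (3 * p * (6 * y)) := by
      intro y hy
      refine Real.exp_le_exp.2 ?_
      nlinarith
    have p1 := twoSidedExp_pos q F1
    have p2 := twoSidedExp_pos q F2
    have p3 := twoSidedExp_pos q F3
    have p4 := twoSidedExp_pos q F4
    rcases max_cases |(z * T).re| |(z * T).im| with ⟨hm, _⟩ | ⟨hm, _⟩ <;> rw [hm] at hw
    · rcases abs_cases (z * T).re with ⟨ha, _⟩ | ⟨ha, _⟩ <;> rw [ha] at hw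
      · have := hcase _ hw
        rw [← hd2] at this
        linarith [hbd F2 F4]
      · have := hcase _ hw
        rw [show 6 * -(z * T).re = F4 - F2 by linarith] at this
        linarith [hbd F4 F2]
    · rcases abs_cases (z * T).im with ⟨ha, _⟩ | ⟨ha, _⟩ <;> rw [ha] at hw
      · have := hcase _ hw
        rw [← hd1] at this
        linarith [hbd F1 F3]
      · have := hcase _ hw
        rw [show 6 * -(z * T).im = F3 - F1 by linarith] at this
        linarith [hbd F3 F1]
  -- The change of radius from |z|² to s costs a multiple of the momentum.
  have hmom : Real.exp (3 * (p * (3 * (s - ‖z‖ ^ 2) * Y))) ≤ Real.exp (9 * p * R * |Y|) := by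
    refine Real.exp_le_exp.2 ?_
    have h1 : (s - ‖z‖ ^ 2) * Y ≤ R * |Y| := by
      refine (le_abs_self _).trans ?_
      rw [abs_mul]
      gcongr
      rw [abs_le]; constructor <;> nlinarith [sq_nonneg ‖z‖]
    nlinarith
  have hsplit := exp_add_add_le (p * (A + 3 * ‖z‖ ^ 2 * Y)) (p * (3 * (s - ‖z‖ ^ 2) * Y))
    (p * (3 * (Real.sqrt s * ‖T‖)))
  rw [← mul_add, ← mul_add] at hsplit
  rw [show A + 3 * s * Y + 3 * (Real.sqrt s * ‖T‖) = A + 3 * ‖z‖ ^ 2 * Y +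
    3 * (s - ‖z‖ ^ 2) * Y + 3 * (Real.sqrt s * ‖T‖) by ring]
  linarith [twoSidedExp_pos q F2, twoSidedExp_pos q F4]

theorem lintegral_reflect {G : (ℤ → ℂ) → ℝ≥0∞} (hG : Measurable G) :
    ∫⁻ c, G (fun n => c (-n)) ∂seqLaw = ∫⁻ c, G c ∂seqLaw := by
  conv_rhs => rw [← seqLaw_map_reflect]
  rw [lintegral_map hG (by fun_prop)]

theorem quartic_box_zeroMode (N : ℕ) (c : ℤ → ℂ) (z : ℂ) :
    quartic (box N) (Function.update c 0 z) = zeroModeForm (quartic ((box N).erase 0) c)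
      (momentum ((box N).erase 0) c) (cubic ((box N).erase 0) c) z :=
  quartic_update_zero (by simp [box]) c z

theorem continuous_twoSidedExp (q : ℝ) : Continuous (twoSidedExp q) := by
  unfold twoSidedExp; fun_prop

theorem continuous_zeroModeForm (A Y : ℝ) (T : ℂ) : Continuous (zeroModeForm A Y T) := by
  unfold zeroModeForm
  fun_prop

theorem measurableSet_massCutoff (S : Finset ℤ) (M : ℝ) :
    MeasurableSet {c : ℤ → ℂ | ∑ n ∈ S, ‖c n‖ ^ 2 < M} :=
  measurableSet_lt (by fun_prop) measurable_const

/-- The functional is odd and the mass cutoff even under reflection, so the two signs have the same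
exponential moment. -/
theorem setLIntegral_twoSidedExp_le {q M C : ℝ} {N : ℕ}
    (h : ∫⁻ c in {c | ∑ n ∈ box N, ‖c n‖ ^ 2 < M},
      ENNReal.ofReal (Real.exp (q * quartic (box N) c)) ∂seqLaw ≤ ENNReal.ofReal C) :
    ∫⁻ c in {c | ∑ n ∈ box N, ‖c n‖ ^ 2 < M},
      ENNReal.ofReal (twoSidedExp q (quartic (box N) c)) ∂seqLaw ≤ 2 * ENNReal.ofReal C := by
  have hm := measurableSet_massCutoff (box N) M
  have hq := (continuous_quartic (box N)).measurable
  have h2 : ∫⁻ c in {c | ∑ n ∈ box N, ‖c n‖ ^ 2 < M},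
      ENNReal.ofReal (Real.exp (-q * quartic (box N) c)) ∂seqLaw =
      ∫⁻ c in {c | ∑ n ∈ box N, ‖c n‖ ^ 2 < M},
      ENNReal.ofReal (Real.exp (q * quartic (box N) c)) ∂seqLaw := by
    rw [← lintegral_indicator hm, ← lintegral_indicator hm]
    rw [← lintegral_reflect (G := ({c : ℤ → ℂ | ∑ n ∈ box N, ‖c n‖ ^ 2 < M}.indicator
      fun c => ENNReal.ofReal (Real.exp (q * quartic (box N) c))))
      (Measurable.indicator (by fun_prop) hm)]
    refine lintegral_congr fun c => ?_
    simp only [Set.indicator, Set.mem_ofPred_eq, sum_norm_sq_reflect (mem_box_neg N),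
      quartic_reflect (mem_box_neg N), mul_neg, neg_mul]
  have h3 : ∀ c, ENNReal.ofReal (twoSidedExp q (quartic (box N) c)) =
      ENNReal.ofReal (Real.exp (q * quartic (box N) c)) +
        ENNReal.ofReal (Real.exp (-q * quartic (box N) c)) := fun c => by
    rw [twoSidedExp, ENNReal.ofReal_add (by positivity) (by positivity)]
  simp only [h3]
  rw [lintegral_add_left (by fun_prop), h2, two_mul]
  exact add_le_add h h

/-- The annulus `{a < |z|² < b}`. -/
def annulus (a b : ℝ) : Set ℂ := (fun z => ‖z‖ ^ 2) ⁻¹' Set.Ioo a b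

theorem measurableSet_annulus (a b : ℝ) : MeasurableSet (annulus a b) :=
  measurableSet_Ioo.preimage (by fun_prop)

theorem phase_mem_annulus {e : ℂ} (he : ‖e‖ = 1) (a b : ℝ) (z : ℂ) :
    e * z ∈ annulus a b ↔ z ∈ annulus a b := by
  simp [annulus, he]

theorem modeLaw_annulus_pos {a b : ℝ} (ha : 0 ≤ a) (hab : a < b) : 0 < modeLaw 0 (annulus a b) := by
  have hmeas := measurableSet_annulus a b
  rw [← lintegral_indicator_one hmeas,
    lintegral_modeLaw_polar 0 (measurable_one.indicator hmeas), bracketSq_zero]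
  have h1 : ENNReal.ofReal (Real.exp (-b) * (b - a)) ≤ ∫⁻ s in Set.Ioi (0 : ℝ),
      ENNReal.ofReal (1 * Real.exp (-(1 * s))) *
        ∫⁻ θ, (annulus a b).indicator 1 (polarPoint s θ) ∂angleLaw := by
    calc ENNReal.ofReal (Real.exp (-b) * (b - a))
        = ∫⁻ _ in Set.Ioo a b, ENNReal.ofReal (Real.exp (-b)) := by
          rw [ENNReal.ofReal_mul (Real.exp_pos _).le]; simp
      _ ≤ ∫⁻ s in Set.Ioo a b, ENNReal.ofReal (1 * Real.exp (-(1 * s))) *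
            ∫⁻ θ, (annulus a b).indicator 1 (polarPoint s θ) ∂angleLaw := by
          refine setLIntegral_mono' measurableSet_Ioo fun s hs => ?_
          have e : ∀ θ, (annulus a b).indicator (1 : ℂ → ℝ≥0∞) (polarPoint s θ) = 1 := fun θ => by
            have : polarPoint s θ ∈ annulus a b := by
              rw [annulus, Set.mem_preimage, norm_sq_polarPoint (ha.trans hs.1.le)]
              exact hs
            rw [Set.indicator_of_mem this]; rfl
          simp only [e, lintegral_const, measure_univ, mul_one, one_mul]
          gcongr
          exact hs.2.le
      _ ≤ _ := lintegral_mono_set (Set.Ioo_subset_Ioi_self.trans (Set.Ioi_subset_Ioi ha))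
  refine lt_of_lt_of_le ?_ h1
  have : 0 < b - a := by linarith
  exact ENNReal.ofReal_pos.2 (by positivity)

theorem setLIntegral_annulus_phase {e : ℂ} (he : ‖e‖ = 1) (a b : ℝ) {g : ℂ → ℝ≥0∞}
    (hg : Measurable g) :
    ∫⁻ z in annulus a b, g (e * z) ∂modeLaw 0 = ∫⁻ z in annulus a b, g z ∂modeLaw 0 := by
  have hm := measurableSet_annulus a b
  rw [← lintegral_indicator hm, ← lintegral_indicator hm,
    ← lintegral_modeLaw_phase 0 he (hg.indicator hm)]
  refine lintegral_congr fun z => ?_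
  by_cases hz : z ∈ annulus a b
  · rw [Set.indicator_of_mem hz, Set.indicator_of_mem ((phase_mem_annulus he a b z).2 hz)]
  · rw [Set.indicator_of_notMem hz,
      Set.indicator_of_notMem (mt (phase_mem_annulus he a b z).1 hz)]

/-- Averaging the zero mode over an annulus. -/
theorem modeLaw_annulus_mul_exp_le {p q : ℝ} (hp : 0 ≤ p) (hq : 6 * p ≤ q) (A Y : ℝ) (T : ℂ)
    {s R : ℝ} (hs0 : 0 ≤ s) (hsR : s ≤ R) :
    modeLaw 0 (annulus (R / 2) R) *
        ENNReal.ofReal (Real.exp (p * (A + 3 * s * Y + 3 * (Real.sqrt s * ‖T‖)))) ≤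
      ENNReal.ofReal (Real.exp (9 * p * R * |Y|)) +
        12 * ∫⁻ z in annulus (R / 2) R, ENNReal.ofReal (twoSidedExp q (zeroModeForm A Y T z))
          ∂modeLaw 0 := by
  obtain ⟨g, hg⟩ : ∃ g : ℂ → ℝ≥0∞, g = fun z =>
    ENNReal.ofReal (twoSidedExp q (zeroModeForm A Y T z)) := ⟨_, rfl⟩
  have hgm : Measurable g := by
    rw [hg]
    exact (((continuous_twoSidedExp q).comp (continuous_zeroModeForm A Y T)).measurable).ennreal_ofReal
  have hpt : ∀ z ∈ annulus (R / 2) R,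
      ENNReal.ofReal (Real.exp (p * (A + 3 * s * Y + 3 * (Real.sqrt s * ‖T‖)))) ≤
      ENNReal.ofReal (Real.exp (9 * p * R * |Y|)) +
        3 * (g z + g (Complex.I * z) + g (-1 * z) + g (-Complex.I * z)) := by
    intro z hz
    have := exp_zeroMode_le hp hq A Y T z hs0 hsR hz.2.le (by linarith [hz.1])
    refine (ENNReal.ofReal_le_ofReal this).trans (le_of_eq ?_)
    have h1 := (twoSidedExp_pos q (zeroModeForm A Y T z)).le
    have h2 := (twoSidedExp_pos q (zeroModeForm A Y T (Complex.I * z))).le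
    have h3 := (twoSidedExp_pos q (zeroModeForm A Y T (-1 * z))).le
    have h4 := (twoSidedExp_pos q (zeroModeForm A Y T (-Complex.I * z))).le
    rw [ENNReal.ofReal_add (by positivity) (by positivity), ENNReal.ofReal_mul (by norm_num),
      ENNReal.ofReal_add (by positivity) h4, ENNReal.ofReal_add (by positivity) h3,
      ENNReal.ofReal_add h1 h2, hg]
    simp
  have hI : ‖Complex.I‖ = 1 := by simp
  have hn : ‖(-1 : ℂ)‖ = 1 := by simp
  have hnI : ‖-Complex.I‖ = 1 := by simp
  have m2 : Measurable fun z => g (Complex.I * z) := by fun_prop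
  have m3 : Measurable fun z => g (-1 * z) := by fun_prop
  have m4 : Measurable fun z => g (-Complex.I * z) := by fun_prop
  rw [mul_comm, ← setLIntegral_const]
  refine (setLIntegral_mono' (measurableSet_annulus _ _) hpt).trans ?_
  rw [lintegral_add_left measurable_const, lintegral_const_mul _ (by fun_prop),
    lintegral_add_left (by fun_prop), lintegral_add_left (by fun_prop), lintegral_add_left hgm,
    setLIntegral_annulus_phase hI _ _ hgm, setLIntegral_annulus_phase hn _ _ hgm,
    setLIntegral_annulus_phase hnI _ _ hgm, setLIntegral_const, ← hg]
  refine add_le_add ?_ (le_of_eq ?_)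
  · calc _ ≤ ENNReal.ofReal (Real.exp (9 * p * R * |Y|)) * 1 := by gcongr; exact prob_le_one
      _ = _ := mul_one _
  · ring

theorem sum_erase_zero_le_restMass (N : ℕ) (c : ℤ → ℂ) :
    ENNReal.ofReal (∑ n ∈ (box N).erase 0, ‖c n‖ ^ 2) ≤ restMass c := by
  rw [ENNReal.ofReal_sum_of_nonneg fun n _ => by positivity, restMass, totalMass]
  calc ∑ n ∈ (box N).erase 0, ENNReal.ofReal (‖c n‖ ^ 2)
      = ∑ n ∈ (box N).erase 0, ENNReal.ofReal (‖Function.update c 0 0 n‖ ^ 2) :=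
        Finset.sum_congr rfl fun n hn => by
          rw [Function.update_of_ne (Finset.ne_of_mem_erase hn)]
    _ ≤ _ := ENNReal.sum_le_tsum _

/-- On a slice the radius of the zero mode is dictated by all the other modes, including those
beyond N. The supremum over s removes this dependence and makes the bound uniform in t. -/
theorem lintegral_exp_quartic_sliceLaw_le {p t R : ℝ} (hp : 0 ≤ p) (ht : t ≤ R) (N : ℕ) :
    ∫⁻ c, ENNReal.ofReal (Real.exp (p * quartic (box N) c)) ∂sliceLaw t ≤
      ∫⁻ c in {c | ∑ n ∈ (box N).erase 0, ‖c n‖ ^ 2 < R}, (⨆ s ∈ Set.Icc 0 R,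
        ENNReal.ofReal (Real.exp (p * (quartic ((box N).erase 0) c +
          3 * s * momentum ((box N).erase 0) c +
          3 * (Real.sqrt s * ‖cubic ((box N).erase 0) c‖))))) ∂seqLaw := by
  have hqm := (continuous_quartic (box N)).measurable
  have hm := measurableSet_massCutoff ((box N).erase 0) R
  rw [lintegral_sliceLaw t (by fun_prop), ← lintegral_indicator hm]
  refine lintegral_mono fun c => ?_
  beta_reduce
  by_cases hc : restMass c < ENNReal.ofReal t
  swap
  · rw [sliceDensity, if_neg hc, zero_mul]; exact zero_le
  have hr := (ENNReal.lt_ofReal_iff_toReal_lt (hc.trans ENNReal.ofReal_lt_top).ne).1 hc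
  have hr0 : 0 ≤ (restMass c).toReal := ENNReal.toReal_nonneg
  have hmem : c ∈ {c : ℤ → ℂ | ∑ n ∈ (box N).erase 0, ‖c n‖ ^ 2 < R} := by
    have h1 := (sum_erase_zero_le_restMass N c).trans_lt hc
    rw [ENNReal.ofReal_lt_ofReal_iff (by linarith)] at h1
    exact h1.trans_le ht
  rw [Set.indicator_of_mem hmem]
  obtain ⟨s, hs⟩ : ∃ s, s = t - (restMass c).toReal := ⟨_, rfl⟩
  have hs0 : 0 ≤ s := by linarith
  refine le_trans ?_ (le_iSup₂ (f := fun (s : ℝ) (_ : s ∈ Set.Icc 0 R) =>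
    ENNReal.ofReal (Real.exp (p * (quartic ((box N).erase 0) c +
          3 * s * momentum ((box N).erase 0) c +
          3 * (Real.sqrt s * ‖cubic ((box N).erase 0) c‖))))) s ⟨hs0, by linarith⟩)
  calc _ ≤ 1 * ∫⁻ _, ENNReal.ofReal (Real.exp (p * (quartic ((box N).erase 0) c +
          3 * s * momentum ((box N).erase 0) c +
          3 * (Real.sqrt s * ‖cubic ((box N).erase 0) c‖)))) ∂angleLaw := by
        refine mul_le_mul' (sliceDensity_le_one t c) (lintegral_mono fun θ => ?_)
        beta_reduce
        rw [slicePoint, quartic_box_zeroMode, ← hs, zeroModeForm, norm_sq_polarPoint hs0]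
        refine ENNReal.ofReal_le_ofReal (Real.exp_le_exp.2 (mul_le_mul_of_nonneg_left ?_ hp))
        have h1 : (polarPoint s θ * cubic ((box N).erase 0) c).im ≤
            Real.sqrt s * ‖cubic ((box N).erase 0) c‖ := by
          refine (le_abs_self _).trans ((Complex.abs_im_le_norm _).trans (le_of_eq ?_))
          rw [norm_mul, ← Real.sqrt_sq (norm_nonneg (polarPoint s θ)), norm_sq_polarPoint hs0]
        linarith
    _ = _ := by simp

/-- Exponential integrability below the mass threshold passes to the fixed-mass slices. -/
theorem exists_lintegral_exp_sliceLaw_le {p q M C : ℝ} (hp : 0 ≤ p) (hq : 6 * p ≤ q) (hM : 0 < M)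
    (h : ∀ N, ∫⁻ c in {c | ∑ n ∈ box N, ‖c n‖ ^ 2 < M},
      ENNReal.ofReal (Real.exp (q * quartic (box N) c)) ∂seqLaw ≤ ENNReal.ofReal C) :
    ∃ D : ℝ, 0 ≤ D ∧ ∀ (N : ℕ) (t : ℝ), t ≤ M / 2 →
      ∫⁻ c, ENNReal.ofReal (Real.exp (p * quartic (box N) c)) ∂sliceLaw t ≤ ENNReal.ofReal D := by
  obtain ⟨R, hR⟩ : ∃ R, R = M / 2 := ⟨_, rfl⟩
  obtain ⟨D₁, hD₁, h1⟩ := exists_lintegral_exp_momentum_le (9 * p * R) R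
  obtain ⟨D₂, hD₂, h2⟩ := exists_lintegral_exp_momentum_le (-(9 * p * R)) R
  obtain ⟨κ, hκ⟩ : ∃ κ, κ = modeLaw 0 (annulus (R / 2) R) := ⟨_, rfl⟩
  have hκ0 : κ ≠ 0 := by
    rw [hκ]; exact (modeLaw_annulus_pos (by linarith) (by linarith)).ne'
  have hκt : κ ≠ ⊤ := by rw [hκ]; exact measure_ne_top _ _
  obtain ⟨B, hB⟩ : ∃ B : ℝ≥0∞, B = κ⁻¹ * (ENNReal.ofReal D₁ + ENNReal.ofReal D₂ +
    12 * (2 * ENNReal.ofReal C)) := ⟨_, rfl⟩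
  have hBt : B ≠ ⊤ := by
    rw [hB]
    exact ENNReal.mul_ne_top (ENNReal.inv_ne_top.2 hκ0) (by finiteness)
  refine ⟨B.toReal, ENNReal.toReal_nonneg, fun N t ht => ?_⟩
  rw [ENNReal.ofReal_toReal hBt]
  refine (lintegral_exp_quartic_sliceLaw_le hp (ht.trans hR.ge) N).trans ?_
  have hm := measurableSet_massCutoff ((box N).erase 0) R
  have hmM := measurableSet_massCutoff (box N) M
  have hma := measurableSet_annulus (R / 2) R
  obtain ⟨V, hV⟩ : ∃ V, V = (box N).erase 0 := ⟨_, rfl⟩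
  rw [← hV] at hm ⊢
  obtain ⟨g, hg⟩ : ∃ g : (ℤ → ℂ) → ℝ≥0∞, g = fun c =>
    ENNReal.ofReal (twoSidedExp q (quartic (box N) c)) := ⟨_, rfl⟩
  have hgm : Measurable g := by
    rw [hg]
    exact ((continuous_twoSidedExp q).comp (continuous_quartic (box N))).measurable.ennreal_ofReal
  have hpt : ∀ c, (⨆ s ∈ Set.Icc 0 R, ENNReal.ofReal (Real.exp (p * (quartic V c +
          3 * s * momentum V c + 3 * (Real.sqrt s * ‖cubic V c‖))))) ≤
      κ⁻¹ * (ENNReal.ofReal (Real.exp (9 * p * R * momentum (box N) c)) +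
        ENNReal.ofReal (Real.exp (-(9 * p * R) * momentum (box N) c)) +
        12 * ∫⁻ z in annulus (R / 2) R, g (Function.update c 0 z) ∂modeLaw 0) := by
    intro c
    refine iSup₂_le fun s hs => ?_
    have h3 := modeLaw_annulus_mul_exp_le hp hq (quartic V c) (momentum V c) (cubic V c) hs.1 hs.2
    rw [← hκ] at h3
    rw [mul_comm κ⁻¹, ← div_eq_mul_inv, ENNReal.le_div_iff_mul_le (Or.inl hκ0) (Or.inl hκt),
      mul_comm]
    refine h3.trans (add_le_add ?_ (le_of_eq ?_))
    · rw [← ENNReal.ofReal_add (by positivity) (by positivity), hV, momentum_erase_zero]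
      refine ENNReal.ofReal_le_ofReal ?_
      rcases abs_cases (momentum (box N) c) with ⟨ha, _⟩ | ⟨ha, _⟩ <;> rw [ha]
      · linarith [Real.exp_pos (-(9 * p * R) * momentum (box N) c)]
      · rw [mul_neg, ← neg_mul]
        linarith [Real.exp_pos (9 * p * R * momentum (box N) c)]
    · congr 1
      refine lintegral_congr fun z => ?_
      rw [hg]
      beta_reduce
      rw [quartic_box_zeroMode, hV]
  have hmm := (continuous_momentum (box N)).measurable
  have hinner : Measurable fun c : ℤ → ℂ =>
      ∫⁻ z in annulus (R / 2) R, g (Function.update c 0 z) ∂modeLaw 0 :=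
    Measurable.lintegral_prod_right' (f := fun x : (ℤ → ℂ) × ℂ => g (Function.update x.1 0 x.2))
      (hgm.comp (measurable_update_prod 0))
  refine (lintegral_mono hpt).trans ?_
  rw [lintegral_const_mul _ (by fun_prop), lintegral_add_left (by fun_prop),
    lintegral_add_left (by fun_prop), lintegral_const_mul _ hinner, hB]
  have h1' := h1 N
  have h2' := h2 N
  rw [← hV] at h1' h2'
  refine mul_le_mul_right (add_le_add (add_le_add h1' h2') (mul_le_mul_right ?_ _)) _
  refine le_trans ?_ (setLIntegral_twoSidedExp_le (h N))
  rw [← lintegral_indicator hmM, ← lintegral_indicator hm,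
    lintegral_update 0 (Measurable.indicator (by rw [← hg]; exact hgm) hmM)]
  refine lintegral_mono fun c => ?_
  by_cases hc : c ∈ {c : ℤ → ℂ | ∑ n ∈ V, ‖c n‖ ^ 2 < R}
  swap
  · rw [Set.indicator_of_notMem hc]; exact zero_le
  rw [Set.indicator_of_mem hc, ← lintegral_indicator hma]
  refine lintegral_mono fun z => ?_
  by_cases hz : z ∈ annulus (R / 2) R
  swap
  · rw [Set.indicator_of_notMem hz]; exact zero_le
  -- Both the zero mode and the rest of the truncation have mass below R = M/2, so the sum is below
  -- the threshold M.
  have hmem : Function.update c 0 z ∈ {c : ℤ → ℂ | ∑ n ∈ box N, ‖c n‖ ^ 2 < M} := by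
    rw [Set.mem_ofPred_eq, ← Finset.add_sum_erase (box N) _ (show (0 : ℤ) ∈ box N by simp [box]),
      Function.update_self, ← hV]
    have e : ∑ n ∈ V, ‖Function.update c 0 z n‖ ^ 2 = ∑ n ∈ V, ‖c n‖ ^ 2 :=
      Finset.sum_congr rfl fun n hn => by
        rw [hV] at hn
        rw [Function.update_of_ne (Finset.ne_of_mem_erase hn)]
    rw [e]
    rw [Set.mem_ofPred_eq] at hc
    linarith [hz.2]
  rw [Set.indicator_of_mem hz, Set.indicator_of_mem hmem, hg]

/-- Uniform bounds on the slices near `m` pass to the normalized slice and to thin shells. -/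
theorem exists_shell_bound {ι : Type*} {G : ι → (ℤ → ℂ) → ℝ≥0∞} (hG : ∀ i, Measurable (G i))
    {m R D : ℝ} (hm : 0 < m) (hmR : m < R)
    (h : ∀ i t, t ≤ R → ∫⁻ c, G i c ∂sliceLaw t ≤ ENNReal.ofReal D) :
    ∃ C : ℝ, 0 ≤ C ∧
      (∀ i, (sliceLaw m Set.univ)⁻¹ * ∫⁻ c, G i c ∂sliceLaw m ≤ ENNReal.ofReal C) ∧
      ∃ δ : ℝ, 0 < δ ∧ ∀ ε : ℝ, 0 < ε → ε < δ → ∀ i,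
        (seqLaw (seqShell m ε))⁻¹ * ∫⁻ c in seqShell m ε, G i c ∂seqLaw ≤ ENNReal.ofReal C := by
  obtain ⟨a, ha⟩ : ∃ a, a = sliceLaw m Set.univ := ⟨_, rfl⟩
  have ha0 : a ≠ 0 := by rw [ha]; exact (sliceLaw_univ_pos hm).ne'
  have hat : a ≠ ⊤ := by rw [ha]; exact measure_ne_top _ _
  -- For small ε the average slice mass over the shell exceeds half its value at m, so normalization
  -- is uniformly bounded; the other constraints on δ keep the shell inside (0, R).
  have ha2 : a / 2 ≠ 0 := ENNReal.div_ne_zero.2 ⟨ha0, by norm_num⟩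
  obtain ⟨B, hB⟩ : ∃ B : ℝ≥0∞, B = (a / 2)⁻¹ * ENNReal.ofReal D := ⟨_, rfl⟩
  have hBt : B ≠ ⊤ := by
    rw [hB]; exact ENNReal.mul_ne_top (ENNReal.inv_ne_top.2 ha2) ENNReal.ofReal_ne_top
  have hlim := tendsto_average_Ioo (tendsto_sliceLaw one_ne_zero MeasurableSet.univ
    (fun c z => by simp) m)
  rw [← ha] at hlim
  have hev := (hlim.eventually (lt_mem_nhds (ENNReal.half_lt_self ha0 hat)))
  rw [eventually_nhdsWithin_iff, Metric.eventually_nhds_iff] at hev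
  obtain ⟨δ, hδ, hev⟩ := hev
  refine ⟨B.toReal, ENNReal.toReal_nonneg, fun i => ?_, min δ (min m (R - m)),
    by have : 0 < R - m := by linarith
       positivity, fun ε hε hεδ i => ?_⟩
  · rw [ENNReal.ofReal_toReal hBt, hB, ← ha]
    refine mul_le_mul' (ENNReal.inv_le_inv.2 ENNReal.half_le_self) (h i m hmR.le)
  · rw [ENNReal.ofReal_toReal hBt, hB]
    have h1 : ε < δ := hεδ.trans_le (min_le_left _ _)
    have h2 : ε < m := hεδ.trans_le ((min_le_right _ _).trans (min_le_left _ _))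
    have h3 : ε < R - m := hεδ.trans_le ((min_le_right _ _).trans (min_le_right _ _))
    have h4 := @hev ε (by rwa [Real.dist_eq, sub_zero, abs_of_pos hε]) hε
    have hε2 : ENNReal.ofReal (2 * ε) ≠ 0 := (ENNReal.ofReal_pos.2 (by positivity)).ne'
    have hvol : seqLaw (seqShell m ε) = ∫⁻ t in Set.Ioo (m - ε) (m + ε), sliceLaw t Set.univ := by
      rw [← seqLaw_inter_seqShell h2.le MeasurableSet.univ, Set.inter_univ]
    rw [← hvol] at h4
    have hnum : ∫⁻ c in seqShell m ε, G i c ∂seqLaw ≤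
        ENNReal.ofReal (2 * ε) * ENNReal.ofReal D := by
      rw [setLIntegral_seqShell h2.le (hG i)]
      calc _ ≤ ∫⁻ _ in Set.Ioo (m - ε) (m + ε), ENNReal.ofReal D :=
            setLIntegral_mono' measurableSet_Ioo fun t ht => h i t (by linarith [ht.2])
        _ = _ := by
            rw [setLIntegral_const, Real.volume_Ioo, mul_comm]
            congr 2; ring
    calc _ ≤ (seqLaw (seqShell m ε))⁻¹ * (ENNReal.ofReal (2 * ε) * ENNReal.ofReal D) :=
          mul_le_mul_right hnum _
      _ = ((ENNReal.ofReal (2 * ε))⁻¹ * seqLaw (seqShell m ε))⁻¹ * ENNReal.ofReal D := by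
          rw [ENNReal.mul_inv (Or.inr (measure_ne_top _ _)) (Or.inl (by simpa using hε)), inv_inv]
          ring
      _ ≤ _ := by gcongr

/-! ### Identification of `H^{1/2-}` with coefficient sequences. -/

/-- The coefficient sequences of elements of `H^{1/2-}`. -/
def Regular (c : ℤ → ℂ) : Prop :=
  ∀ s : ℝ, s < 1 / 2 → Summable fun n : ℤ => bracket n ^ (2 * s) * ‖c n‖ ^ 2

theorem one_le_bracket (n : ℤ) : 1 ≤ bracket n :=
  Real.one_le_sqrt.2 (by nlinarith [sq_nonneg (n : ℝ)])

theorem summable_iff_tsum_ofReal_ne_top {ι : Type*} {f : ι → ℝ} (hf : ∀ i, 0 ≤ f i) :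
    Summable f ↔ ∑' i, ENNReal.ofReal (f i) ≠ ⊤ := by
  refine ⟨Summable.tsum_ofReal_ne_top, fun h => ?_⟩
  refine (ENNReal.summable_toReal h).congr fun i => ?_
  rw [ENNReal.toReal_ofReal (hf i)]

/-- A sequence of regularity exponents increasing to `1/2`. -/
def regExp (k : ℕ) : ℝ := 1 / 2 - 1 / (k + 1)

/-- Countably many exponents suffice because ⟨n⟩ ≥ 1. This gives measurability and reduces the
almost sure statement to single exponents. -/
theorem regular_iff (c : ℤ → ℂ) : Regular c ↔ ∀ k : ℕ,
    ∑' n : ℤ, ENNReal.ofReal (bracket n ^ (2 * regExp k) * ‖c n‖ ^ 2) ≠ ⊤ := by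
  have hnn : ∀ s : ℝ, ∀ n : ℤ, 0 ≤ bracket n ^ (2 * s) * ‖c n‖ ^ 2 := fun s n =>
    mul_nonneg (Real.rpow_nonneg (bracket_pos n).le _) (by positivity)
  constructor
  · intro h k
    refine (summable_iff_tsum_ofReal_ne_top (hnn _)).1 (h _ ?_)
    have : (0 : ℝ) < 1 / (k + 1) := by positivity
    rw [regExp]; linarith
  · intro h s hs
    obtain ⟨k, hk⟩ := exists_nat_one_div_lt (show (0 : ℝ) < 1 / 2 - s by linarith)
    refine ((summable_iff_tsum_ofReal_ne_top (hnn _)).2 (h k)).of_nonneg_of_le (hnn s) fun n => ?_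
    refine mul_le_mul_of_nonneg_right ?_ (by positivity)
    refine Real.rpow_le_rpow_of_exponent_le (one_le_bracket n) ?_
    rw [regExp]; linarith

theorem measurableSet_regular : MeasurableSet {c : ℤ → ℂ | Regular c} := by
  have : {c : ℤ → ℂ | Regular c} = ⋂ k : ℕ, {c : ℤ → ℂ |
      ∑' n : ℤ, ENNReal.ofReal (bracket n ^ (2 * regExp k) * ‖c n‖ ^ 2) ≠ ⊤} := by
    ext c
    simp only [Set.mem_iInter, Set.mem_ofPred_eq, regular_iff]
  rw [this]
  refine MeasurableSet.iInter fun k => ?_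
  have hm : Measurable fun c : ℤ → ℂ =>
      ∑' n : ℤ, ENNReal.ofReal (bracket n ^ (2 * regExp k) * ‖c n‖ ^ 2) :=
    Measurable.tsum fun n => by fun_prop
  exact (hm (measurableSet_singleton ⊤)).compl

theorem Regular.update {c : ℤ → ℂ} (h : Regular c) (k : ℤ) (z : ℂ) :
    Regular (Function.update c k z) := by
  intro s hs
  refine (h s hs).congr_cofinite ?_
  filter_upwards [(Set.finite_singleton k).compl_mem_cofinite] with n hn
  rw [Function.update_of_ne (by simpa using hn)]

theorem summable_bracket_rpow {b : ℝ} (hb : 1 < b) : Summable fun n : ℤ => bracket n ^ (-b) := by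
  refine (Real.summable_abs_int_rpow hb).of_norm_bounded_eventually ?_
  filter_upwards [(Set.finite_singleton (0 : ℤ)).compl_mem_cofinite] with n hn
  have hn0 : (n : ℝ) ≠ 0 := by simpa using hn
  rw [Real.norm_of_nonneg (Real.rpow_nonneg (bracket_pos n).le _)]
  refine Real.rpow_le_rpow_of_nonpos (abs_pos.2 hn0) ?_ (by linarith)
  rw [bracket]
  exact Real.abs_le_sqrt (by linarith)

/-- The expected H^s norm squared is at most 2 Σ ⟨n⟩^{2s-2}, finite for s < 1/2. -/
theorem ae_regular : ∀ᵐ c ∂seqLaw, Regular c := by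
  simp only [regular_iff]
  rw [ae_all_iff]
  intro k
  have hm : ∀ n : ℤ, Measurable fun c : ℤ → ℂ =>
      ENNReal.ofReal (bracket n ^ (2 * regExp k) * ‖c n‖ ^ 2) := fun n => by fun_prop
  have hb : 1 < 2 - 2 * regExp k := by
    have : (0 : ℝ) < 1 / (k + 1) := by positivity
    rw [regExp]; linarith
  have hle : ∀ n : ℤ, ∫⁻ c, ENNReal.ofReal (bracket n ^ (2 * regExp k) * ‖c n‖ ^ 2) ∂seqLaw ≤
      ENNReal.ofReal (2 * bracket n ^ (-(2 - 2 * regExp k))) := by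
    intro n
    have hbp := bracket_pos n
    have h0 : 0 ≤ bracket n ^ (2 * regExp k) := Real.rpow_nonneg hbp.le _
    simp only [ENNReal.ofReal_mul h0]
    rw [lintegral_const_mul _ (by fun_prop)]
    refine (mul_le_mul_right (lintegral_norm_sq_le n) _).trans (le_of_eq ?_)
    rw [← ENNReal.ofReal_mul h0]
    congr 1
    rw [← bracket_sq, neg_sub, Real.rpow_sub hbp, Real.rpow_two]
    ring
  have h_int : ∫⁻ c, ∑' n : ℤ, ENNReal.ofReal (bracket n ^ (2 * regExp k) * ‖c n‖ ^ 2) ∂seqLaw ≠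
      ⊤ := by
    rw [lintegral_tsum fun n => (hm n).aemeasurable]
    exact ne_top_of_le_ne_top ((summable_bracket_rpow hb).mul_left 2).tsum_ofReal_ne_top
      (ENNReal.tsum_le_tsum hle)
  filter_upwards [ae_lt_top (Measurable.tsum hm) h_int] with c hc using hc.ne

/-- A slice changes only the zero mode of a Gaussian sequence, and regularity ignores single modes.
-/
theorem ae_regular_sliceLaw (t : ℝ) : ∀ᵐ c ∂sliceLaw t, Regular c := by
  have hm := measurableSet_regular.compl
  rw [ae_iff]
  have e : {c : ℤ → ℂ | ¬Regular c} = {c : ℤ → ℂ | Regular c}ᶜ := rfl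
  rw [e, ← lintegral_indicator_one hm,
    lintegral_sliceLaw t (measurable_one.indicator hm)]
  rw [← lintegral_zero (μ := seqLaw)]
  refine lintegral_congr_ae ?_
  filter_upwards [ae_regular] with c hc
  have : ∀ θ, ({c : ℤ → ℂ | Regular c}ᶜ.indicator 1 (slicePoint t c θ) : ℝ≥0∞) = 0 := fun θ =>
    Set.indicator_of_notMem (Set.notMem_compl_iff.2 (hc.update 0 _)) _
  simp only [this, lintegral_zero, mul_zero]

/-- The `L²` function with Fourier coefficients `c`. -/
def seriesL2 (c : ℤ → ℂ) : L2T := ∑' n : ℤ, c n • (fourierLp 2 n : L2T)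

theorem Regular.summable_sq {c : ℤ → ℂ} (h : Regular c) : Summable fun n => ‖c n‖ ^ 2 := by
  simpa using h 0 (by norm_num)

theorem fourierCoeff_seriesL2 {c : ℤ → ℂ} (h : Summable fun n => ‖c n‖ ^ 2) (n : ℤ) :
    fourierCoeff (seriesL2 c : Torus → ℂ) n = c n := by
  have hmem : Memℓp c 2 := memℓp_gen (by simpa using h)
  have hs := (fourierBasis (T := 2 * Real.pi)).hasSum_repr_symm ⟨c, hmem⟩
  rw [coe_fourierBasis] at hs
  have : seriesL2 c = fourierBasis.repr.symm ⟨c, hmem⟩ := hs.tsum_eq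
  rw [this, ← fourierBasis_repr, LinearIsometryEquiv.apply_symm_apply]

theorem Regular.memHHalfMinus {c : ℤ → ℂ} (h : Regular c) : MemHHalfMinus (seriesL2 c) := by
  intro s hs
  simp only [fourierCoeff_seriesL2 h.summable_sq]
  exact h s hs

open Classical in
/-- The element of `H^{1/2-}` with Fourier coefficients `c`, or `0` if there is none. -/
def ofSeq (c : ℤ → ℂ) : HHalfMinus := if h : Regular c then ⟨seriesL2 c, h.memHHalfMinus⟩ else 0

theorem ofSeq_of_regular {c : ℤ → ℂ} (h : Regular c) :
    ofSeq c = (⟨seriesL2 c, h.memHHalfMinus⟩ : {u : L2T // MemHHalfMinus u}) := dif_pos h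

theorem ofSeq_of_not_regular {c : ℤ → ℂ} (h : ¬Regular c) : ofSeq c = 0 := dif_neg h

theorem coeff_ofSeq {c : ℤ → ℂ} (h : Regular c) : coeff (ofSeq c) = c := by
  ext n
  rw [ofSeq_of_regular h]
  exact fourierCoeff_seriesL2 h.summable_sq n

theorem coeff_zero : coeff 0 = 0 := by
  ext n
  change fourierCoeff ((0 : L2T) : Torus → ℂ) n = 0
  rw [← fourierBasis_repr]
  simp

theorem measurable_coeff : Measurable coeff := comap_measurable coeff

theorem measurable_ofSeq : Measurable ofSeq := by
  classical
  refine measurable_comap_iff.2 ?_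
  have : coeff ∘ ofSeq = fun c => if c ∈ {c : ℤ → ℂ | Regular c} then c else 0 := by
    ext1 c
    by_cases h : Regular c
    · rw [Function.comp_apply, coeff_ofSeq h, if_pos (show c ∈ {c : ℤ → ℂ | Regular c} from h)]
    · rw [Function.comp_apply, ofSeq_of_not_regular h, coeff_zero,
        if_neg (show c ∉ {c : ℤ → ℂ | Regular c} from h)]
  rw [this]
  exact Measurable.ite measurableSet_regular measurable_id measurable_const

theorem wienerMeasure_eq : wienerMeasure = seqLaw.map ofSeq := by
  have hsc : Measurable fun (g : ℤ → ℂ) (n : ℤ) => g n / (bracket n : ℂ) := by fun_prop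
  rw [← gaussianSequence_map_scale, Measure.map_map measurable_ofSeq hsc, wienerMeasure]
  refine Measure.map_congr ?_
  have h : ∀ᵐ g ∂gaussianSequence, Regular fun n => g n / (bracket n : ℂ) := by
    have := ae_regular
    rw [← gaussianSequence_map_scale] at this
    exact ae_of_ae_map hsc.aemeasurable this
  filter_upwards [h] with g hg
  have hm : MemHHalfMinus (randomSeries g) := hg.memHHalfMinus
  rw [Function.comp_apply, ofSeq_of_regular hg]
  exact dif_pos hm

theorem map_coeff_map_ofSeq {ν : Measure (ℤ → ℂ)} (h : ∀ᵐ c ∂ν, Regular c) :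
    (ν.map ofSeq).map coeff = ν := by
  rw [Measure.map_map measurable_coeff measurable_ofSeq]
  conv_rhs => rw [← Measure.map_id (μ := ν)]
  refine Measure.map_congr ?_
  filter_upwards [h] with c hc using coeff_ofSeq hc

theorem map_coeff_wienerMeasure : wienerMeasure.map coeff = seqLaw := by
  rw [wienerMeasure_eq, map_coeff_map_ofSeq ae_regular]

theorem ext_of_map_coeff {ν ν' : Measure HHalfMinus} (h : ν.map coeff = ν'.map coeff) : ν = ν' := by
  ext E hE
  obtain ⟨E', hE', rfl⟩ := hE
  rw [← Measure.map_apply measurable_coeff hE', h, Measure.map_apply measurable_coeff hE']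

theorem mass_eq (u : HHalfMinus) : mass u = (totalMass (coeff u)).toReal := by
  have h := lp.hasSum_norm (p := 2) (by norm_num) (fourierBasis.repr u.1)
  simp only [fourierBasis_repr, ENNReal.toReal_ofNat, Real.rpow_ofNat,
    LinearIsometryEquiv.norm_map] at h
  have h2 : totalMass (coeff u) = ENNReal.ofReal (∑' n, ‖coeff u n‖ ^ 2) :=
    (ENNReal.ofReal_tsum_of_nonneg (fun n => by positivity) h.summable).symm
  rw [h2, ENNReal.toReal_ofReal (tsum_nonneg fun n => by positivity), mass]
  exact h.tsum_eq.symm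

theorem massShell_eq (m ε : ℝ) : massShell m ε = coeff ⁻¹' seqShell m ε := by
  ext u
  rw [massShell, seqShell, Set.mem_preimage, Set.mem_ofPred_eq, Set.mem_ofPred_eq, mass_eq]

theorem map_coeff_shellMeasure (m ε : ℝ) :
    (shellMeasure m ε).map coeff = (seqLaw (seqShell m ε))⁻¹ • seqLaw.restrict (seqShell m ε) := by
  have hm := measurableSet_seqShell m ε
  rw [shellMeasure, ProbabilityTheory.cond, massShell_eq, Measure.map_smul, ← Measure.restrict_map measurable_coeff hm,
    map_coeff_wienerMeasure, ← Measure.map_apply measurable_coeff hm, map_coeff_wienerMeasure]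

/-- The normalized slice of mass `m`, as a measure on `H^{1/2-}`. -/
def sliceMeasure (m : ℝ) : Measure HHalfMinus :=
  ((sliceLaw m Set.univ)⁻¹ • sliceLaw m).map ofSeq

theorem map_coeff_sliceMeasure (m : ℝ) :
    (sliceMeasure m).map coeff = (sliceLaw m Set.univ)⁻¹ • sliceLaw m :=
  map_coeff_map_ofSeq (Measure.ae_smul_measure (ae_regular_sliceLaw m) _)

theorem isFixedMassMeasure_sliceMeasure {m : ℝ} (hm : 0 < m) :
    IsFixedMassMeasure m (sliceMeasure m) := by
  intro N B hB
  obtain ⟨E, hE⟩ : ∃ E : Set (ℤ → ℂ), E = (fun (c : ℤ → ℂ)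
    (n : Finset.Icc (-(N : ℤ)) (N : ℤ)) => c n.1) ⁻¹' B := ⟨_, rfl⟩
  have hEm : MeasurableSet E := by rw [hE]; exact hB.preimage (by fun_prop)
  have e : {u : HHalfMinus | (fun n : Finset.Icc (-(N : ℤ)) (N : ℤ) => coeff u n.1) ∈ B} =
      coeff ⁻¹' E := by rw [hE]; rfl
  have hupd : ∀ c z, Function.update c ((N : ℤ) + 1) z ∈ E ↔ c ∈ E := by
    intro c z
    rw [hE, Set.mem_preimage, Set.mem_preimage]
    have : (fun n : Finset.Icc (-(N : ℤ)) (N : ℤ) => Function.update c ((N : ℤ) + 1) z n.1) =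
        fun n : Finset.Icc (-(N : ℤ)) (N : ℤ) => c n.1 := by
      ext n
      have := Finset.mem_Icc.1 n.2
      rw [Function.update_of_ne (by omega)]
    rw [this]
  -- The mode N + 1 is nonzero and outside the cylinder, so it is free to absorb the mass
  -- constraint.
  have h := tendsto_cond_seqShell hm (k := (N : ℤ) + 1) (by omega) hEm hupd
  rw [e, ← Measure.map_apply measurable_coeff hEm, map_coeff_sliceMeasure]
  refine h.congr fun ε => ?_
  rw [← Measure.map_apply measurable_coeff hEm, map_coeff_shellMeasure, Measure.smul_apply,
    Measure.restrict_apply hEm, Set.inter_comm, smul_eq_mul]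

/-- Limits are unique, so the measures agree on cylinders, a generating π-system. It identifies the
measure obtained by choice with the normalized slice. -/
theorem IsFixedMassMeasure.eq {m : ℝ} {ν ν' : Measure HHalfMinus} [IsFiniteMeasure ν]
    (h : IsFixedMassMeasure m ν) (h' : IsFixedMassMeasure m ν') : ν = ν' := by
  have hcyl : ∀ (N : ℕ) (B : Set (Finset.Icc (-(N : ℤ)) (N : ℤ) → ℂ)), MeasurableSet B →
      ν {u | (fun n => coeff u n.1) ∈ B} = ν' {u | (fun n => coeff u n.1) ∈ B} :=
    fun N B hB => tendsto_nhds_unique (h N B hB) (h' N B hB)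
  have huniv : ν Set.univ = ν' Set.univ := by
    simpa using hcyl 0 Set.univ MeasurableSet.univ
  refine ext_of_map_coeff (ext_of_generate_finite (measurableCylinders fun _ : ℤ => ℂ)
    generateFrom_measurableCylinders.symm isPiSystem_measurableCylinders ?_ ?_)
  · intro E hE
    have hEm : MeasurableSet E := MeasurableSet.of_mem_measurableCylinders hE
    obtain ⟨s, S, hS, rfl⟩ := (mem_measurableCylinders E).1 hE
    obtain ⟨N, hN⟩ := exists_subset_box s
    rw [Measure.map_apply measurable_coeff hEm, Measure.map_apply measurable_coeff hEm]
    exact hcyl N ((fun (x : Finset.Icc (-(N : ℤ)) (N : ℤ) → ℂ) (n : s) => x ⟨n.1, hN n.2⟩) ⁻¹' S)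
      (hS.preimage (by fun_prop))
  · rw [Measure.map_apply measurable_coeff MeasurableSet.univ,
      Measure.map_apply measurable_coeff MeasurableSet.univ]
    exact huniv

instance (m : ℝ) : IsFiniteMeasure (sliceMeasure m) := by
  refine ⟨?_⟩
  rw [sliceMeasure, Measure.map_apply measurable_ofSeq MeasurableSet.univ, Set.preimage_univ,
    Measure.smul_apply, smul_eq_mul]
  exact (ENNReal.inv_mul_le_one _).trans_lt ENNReal.one_lt_top

theorem isFixedMassMeasure_fixedMassMeasure {m : ℝ} (hm : 0 < m) :
    IsFixedMassMeasure m (fixedMassMeasure m) := by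
  have h : ∃ ν, IsFixedMassMeasure m ν := ⟨_, isFixedMassMeasure_sliceMeasure hm⟩
  rw [fixedMassMeasure, dif_pos h]
  exact h.choose_spec

theorem map_coeff_fixedMassMeasure {m : ℝ} (hm : 0 < m) :
    (fixedMassMeasure m).map coeff = (sliceLaw m Set.univ)⁻¹ • sliceLaw m := by
  rw [← (isFixedMassMeasure_sliceMeasure hm).eq (isFixedMassMeasure_fixedMassMeasure hm),
    map_coeff_sliceMeasure]

/-! ### Assembly of the statements on `H^{1/2-}`. -/

theorem integrable_and_integral_le {X : Type*} [MeasurableSpace X] {ν : Measure X} {g : X → ℝ}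
    (hg : AEStronglyMeasurable g ν) (h0 : ∀ x, 0 ≤ g x) {C : ℝ} (hC : 0 ≤ C)
    (h : ∫⁻ x, ENNReal.ofReal (g x) ∂ν ≤ ENNReal.ofReal C) :
    Integrable g ν ∧ ∫ x, g x ∂ν ≤ C := by
  have h0' : 0 ≤ᵐ[ν] g := Eventually.of_forall h0
  refine ⟨⟨hg, (hasFiniteIntegral_iff_ofReal h0').2 (h.trans_lt ENNReal.ofReal_lt_top)⟩, ?_⟩
  rw [integral_eq_lintegral_of_nonneg_ae h0' hg]
  exact ENNReal.toReal_le_of_le_ofReal hC h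

theorem fN_eq (N : ℕ) : fN N = fun u => quartic (box N) (coeff u) :=
  funext fun u => fN_eq_quartic N u

theorem measurable_quartic (S : Finset ℤ) : Measurable (quartic S) :=
  (continuous_quartic S).measurable

theorem measurable_fN (N : ℕ) : Measurable (fN N) := by
  rw [fN_eq]
  exact (measurable_quartic _).comp measurable_coeff

theorem lintegral_comp_coeff (ν : Measure HHalfMinus) {G : (ℤ → ℂ) → ℝ≥0∞} (hG : Measurable G) :
    ∫⁻ u, G (coeff u) ∂ν = ∫⁻ c, G c ∂ν.map coeff :=
  (lintegral_map hG measurable_coeff).symm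

theorem setOf_truncMass_lt (N : ℕ) (M : ℝ) :
    {u | truncMass N u < M} = coeff ⁻¹' {c | ∑ n ∈ box N, ‖c n‖ ^ 2 < M} := by
  ext u
  rw [Set.mem_preimage, Set.mem_ofPred_eq, Set.mem_ofPred_eq, truncMass_eq_sum, box]

theorem setLIntegral_exp_fN (q M : ℝ) (N : ℕ) :
    ∫⁻ u in {u | truncMass N u < M}, ENNReal.ofReal (Real.exp (q * fN N u)) ∂wienerMeasure =
      ∫⁻ c in {c | ∑ n ∈ box N, ‖c n‖ ^ 2 < M},
        ENNReal.ofReal (Real.exp (q * quartic (box N) c)) ∂seqLaw := by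
  have hq := measurable_quartic (box N)
  rw [← map_coeff_wienerMeasure, setLIntegral_map (measurableSet_massCutoff _ _) (by fun_prop)
    measurable_coeff, setOf_truncMass_lt, fN_eq]

theorem exists_isMassThreshold {q : ℝ} (hq : 1 ≤ q) : ∃ M : ℝ, IsMassThreshold q M := by
  obtain ⟨M, hM, C, h⟩ := exists_lintegral_exp_quartic_le hq
  refine ⟨M, hM, max C 0, fun N => ?_⟩
  have hm := measurable_fN N
  refine integrable_and_integral_le (by fun_prop : Measurable fun u =>
    Real.exp (q * fN N u)).aestronglyMeasurable (fun u => (Real.exp_pos _).le) (le_max_right _ _) ?_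
  rw [setLIntegral_exp_fN]
  exact (h N).trans (ENNReal.ofReal_le_ofReal (le_max_left _ _))

theorem IsMassThreshold.exists_lintegral_le {q M : ℝ} (h : IsMassThreshold q M) :
    ∃ C : ℝ, ∀ N, ∫⁻ c in {c | ∑ n ∈ box N, ‖c n‖ ^ 2 < M},
      ENNReal.ofReal (Real.exp (q * quartic (box N) c)) ∂seqLaw ≤ ENNReal.ofReal C := by
  obtain ⟨-, C, h⟩ := h
  refine ⟨C, fun N => ?_⟩
  rw [← setLIntegral_exp_fN, ← ofReal_integral_eq_lintegral_ofReal (h N).1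
    (Eventually.of_forall fun u => (Real.exp_pos _).le)]
  exact ENNReal.ofReal_le_ofReal (h N).2

/-- Dyadic bounds for the law of the Fourier coefficients give the `L²` convergence of `f_N`. -/
theorem isL2Limit_dyadicLim {ν : Measure HHalfMinus} {C : ℝ} (hC : 0 ≤ C)
    (h : ∀ N₁ N₂, 1 ≤ N₁ → N₁ ≤ N₂ → N₂ ≤ 2 * N₁ →
      ∫⁻ c, ENNReal.ofReal ((quartic (box N₂) c - quartic (box N₁) c) ^ 2) ∂ν.map coeff ≤
        ENNReal.ofReal (C / N₁)) : IsL2Limit ν (dyadicLim fN) := by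
  refine tendsto_eLpNorm_sub_dyadicLim measurable_fN hC fun N₁ N₂ h1 h12 h2 => ?_
  refine le_trans (le_of_eq ?_) (h N₁ N₂ h1 h12 h2)
  have hq1 := measurable_quartic (box N₁)
  have hq2 := measurable_quartic (box N₂)
  rw [← lintegral_comp_coeff ν (by fun_prop), fN_eq, fN_eq]

theorem isL2Limit_wienerMeasure : IsL2Limit wienerMeasure (dyadicLim fN) :=
  isL2Limit_dyadicLim (C := 20000000) (by norm_num) fun N₁ N₂ h1 h12 h2 => by
    rw [map_coeff_wienerMeasure]
    exact lintegral_quartic_box_sub_sq_le h1 h12 h2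

/-- `dyadicLim fN` is defined pointwise, without reference to a measure, so the same function is the
limit under μ and under every μ_m. -/
theorem isL2Limit_fixedMassMeasure {m : ℝ} (hm : 0 < m) :
    IsL2Limit (fixedMassMeasure m) (dyadicLim fN) := by
  have ht : (sliceLaw m Set.univ)⁻¹ ≠ ⊤ := ENNReal.inv_ne_top.2 (sliceLaw_univ_pos hm).ne'
  refine isL2Limit_dyadicLim (C := ((sliceLaw m Set.univ)⁻¹).toReal *
    (16 * (m + 2) ^ 2 * Real.exp 2 * 20000000)) (by positivity) fun N₁ N₂ h1 h12 h2 => ?_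
  rw [map_coeff_fixedMassMeasure hm, lintegral_smul_measure, smul_eq_mul, mul_div_assoc,
    ENNReal.ofReal_mul ENNReal.toReal_nonneg, ENNReal.ofReal_toReal ht]
  exact mul_le_mul_right (lintegral_quartic_sub_sq_sliceLaw_le m h1 h12 h2) _

/-- Convergence in L² gives an almost everywhere convergent subsequence, and Fatou's lemma applies
along it. -/
theorem lintegral_exp_le_of_isL2Limit {ν : Measure HHalfMinus} {f : HHalfMinus → ℝ}
    (hf : IsL2Limit ν f) {p : ℝ} {B : ℝ≥0∞}
    (h : ∀ N, ∫⁻ u, ENNReal.ofReal (Real.exp (p * fN N u)) ∂ν ≤ B) :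
    ∫⁻ u, ENNReal.ofReal (Real.exp (p * f u)) ∂ν ≤ B := by
  have hmeas := tendstoInMeasure_of_tendsto_eLpNorm two_ne_zero
    (fun N => (measurable_fN N).aestronglyMeasurable) hf.1 hf.2
  obtain ⟨ns, -, hns⟩ := hmeas.exists_seq_tendsto_ae
  have hm := measurable_fN
  calc _ = ∫⁻ u, liminf (fun i => ENNReal.ofReal (Real.exp (p * fN (ns i) u))) atTop ∂ν := by
        refine lintegral_congr_ae ?_
        filter_upwards [hns] with u hu
        refine (Tendsto.liminf_eq ?_).symm
        exact ENNReal.tendsto_ofReal ((Real.continuous_exp.tendsto _).comp (hu.const_mul p))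
    _ ≤ liminf (fun i => ∫⁻ u, ENNReal.ofReal (Real.exp (p * fN (ns i) u)) ∂ν) atTop :=
        lintegral_liminf_le fun i => by
          have := hm (ns i)
          fun_prop
    _ ≤ B := by
        refine (liminf_le_liminf (v := fun _ => B) (Eventually.of_forall fun i => h _)).trans ?_
        rw [liminf_const]

/-- The transfer to slices needs only the exponent 6p ≤ 480p. The strict inequality m < M/2 leaves
room for a thin shell around m inside the range t ≤ M/2 where the slices are bounded. -/
theorem exists_bounds {p m : ℝ} (hp : 1 ≤ p) (hm : 0 < m) {M : ℝ}
    (hM : IsMassThreshold (480 * p) M) (hmM : m < 1 / 2 * M) :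
    ∃ C : ℝ,
      (∀ N : ℕ, Integrable (fun u => Real.exp (p * fN N u)) (fixedMassMeasure m) ∧
        ∫ u, Real.exp (p * fN N u) ∂fixedMassMeasure m ≤ C) ∧
      (∃ δ : ℝ, 0 < δ ∧ ∀ ε : ℝ, 0 < ε → ε < δ → ∀ N : ℕ,
        Integrable (fun u => Real.exp (p * fN N u)) (shellMeasure m ε) ∧
        ∫ u, Real.exp (p * fN N u) ∂shellMeasure m ε ≤ C) ∧
      (∀ f : HHalfMinus → ℝ, IsL2Limit (fixedMassMeasure m) f →
        Integrable (fun u => Real.exp (p * f u)) (fixedMassMeasure m) ∧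
        ∫ u, Real.exp (p * f u) ∂fixedMassMeasure m ≤ C) := by
  obtain ⟨C₀, h₀⟩ := hM.exists_lintegral_le
  obtain ⟨D, -, hD⟩ := exists_lintegral_exp_sliceLaw_le (p := p) (by linarith) (by linarith) hM.1 h₀
  have hGm : ∀ N : ℕ, Measurable fun c => ENNReal.ofReal (Real.exp (p * quartic (box N) c)) :=
    fun N => by
      have := measurable_quartic (box N)
      fun_prop
  obtain ⟨C, hC, hfix, δ, hδ, hshell⟩ := exists_shell_bound hGm hm (R := M / 2) (by linarith) hD
  have hsm : ∀ (ν : Measure HHalfMinus) (N : ℕ),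
      AEStronglyMeasurable (fun u => Real.exp (p * fN N u)) ν := fun ν N => by
    have := measurable_fN N
    exact (by fun_prop : Measurable fun u => Real.exp (p * fN N u)).aestronglyMeasurable
  have hpos : ∀ x : ℝ, 0 ≤ Real.exp x := fun x => (Real.exp_pos x).le
  have hl : ∀ N, ∫⁻ u, ENNReal.ofReal (Real.exp (p * fN N u)) ∂fixedMassMeasure m ≤
      ENNReal.ofReal C := fun N => by
    rw [fN_eq, lintegral_comp_coeff _ (hGm N), map_coeff_fixedMassMeasure hm,
      lintegral_smul_measure]
    exact hfix N
  refine ⟨C, fun N => integrable_and_integral_le (hsm _ N) (fun u => hpos _) hC (hl N),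
    ⟨δ, hδ, fun ε hε hεδ N => integrable_and_integral_le (hsm _ N) (fun u => hpos _) hC ?_⟩,
    fun f hf => integrable_and_integral_le ?_ (fun u => hpos _) hC
      (lintegral_exp_le_of_isL2Limit hf hl)⟩
  · rw [fN_eq, lintegral_comp_coeff _ (hGm N), map_coeff_shellMeasure, lintegral_smul_measure]
    exact hshell ε hε hεδ N
  · exact Real.continuous_exp.comp_aestronglyMeasurable (hf.1.const_mul p)

end

end DNLS

theorem theorem1010 :
    -- the constants `m_q` exist
    (∀ q : ℝ, 1 ≤ q → ∃ M : ℝ, DNLS.IsMassThreshold q M) ∧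
    -- the measures `μ_m` exist
    (∀ m : ℝ, 0 < m → DNLS.IsFixedMassMeasure m (DNLS.fixedMassMeasure m)) ∧
    -- the limit `f` of the `f_N` exists
    (∃ f : DNLS.HHalfMinus → ℝ, DNLS.IsL2Limit DNLS.wienerMeasure f ∧
      ∀ m : ℝ, 0 < m → DNLS.IsL2Limit (DNLS.fixedMassMeasure m) f) ∧
    -- the bounds
    (∀ p m : ℝ, 1 ≤ p → 0 < m →
      (∃ M : ℝ, DNLS.IsMassThreshold (480 * p) M ∧ m < 1 / 2 * M) →
      ∃ C : ℝ,
        (∀ N : ℕ,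
          MeasureTheory.Integrable (fun u => Real.exp (p * DNLS.fN N u))
            (DNLS.fixedMassMeasure m) ∧
          ∫ u, Real.exp (p * DNLS.fN N u) ∂DNLS.fixedMassMeasure m ≤ C) ∧
        (∃ δ : ℝ, 0 < δ ∧ ∀ ε : ℝ, 0 < ε → ε < δ → ∀ N : ℕ,
          MeasureTheory.Integrable (fun u => Real.exp (p * DNLS.fN N u))
            (DNLS.shellMeasure m ε) ∧
          ∫ u, Real.exp (p * DNLS.fN N u) ∂DNLS.shellMeasure m ε ≤ C) ∧
        (∀ f : DNLS.HHalfMinus → ℝ, DNLS.IsL2Limit (DNLS.fixedMassMeasure m) f →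
          MeasureTheory.Integrable (fun u => Real.exp (p * f u)) (DNLS.fixedMassMeasure m) ∧
          ∫ u, Real.exp (p * f u) ∂DNLS.fixedMassMeasure m ≤ C)) :=
  ⟨fun _ hq => DNLS.exists_isMassThreshold hq,
    fun _ hm => DNLS.isFixedMassMeasure_fixedMassMeasure hm,
    ⟨DNLS.dyadicLim DNLS.fN, DNLS.isL2Limit_wienerMeasure,
      fun _ hm => DNLS.isL2Limit_fixedMassMeasure hm⟩,
    fun _ _ hp hm ⟨_, hM, hmM⟩ => DNLS.exists_bounds hp hm hM hmM⟩
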